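/- **Conventions.** A hypergraph $H=(V,E)$ has a finite nonempty vertex set $V$ and a finite set $E$ of hyperedges $e\subseteq V$; $\|H\|=\sum_{e\in E}|e|$. For an integer $\alpha\ge 0$ let $H_{>\alpha}=(V,\{e\in E:|e|>\alpha\})$; $H$ is $(\alpha,\beta)$-nice if every vertex lies in at most $\beta$ hyperedges of $H_{>\alpha}$. For $U\subseteq V$, $H[U]$ is the hypergraph with vertex set $U$ and hyperedges $\{e\cap U: e\in E,\ |e\cap U|\ge 2\}$. A $k$-hypergraphlet of $H$ is an $H[U]$ with $|U|=k$ that is connected (the graph on $U$ joining two distinct vertices that share a hyperedge is connected). Given a coloring $c:V\to\{1,\dots,k\}$, it is colorful if $c$ is injective on $U$. The model of computation is the randomized word RAM with zero-initialized memory: arithmetic operations and comparisons on words, array accesses, and the drawing of a uniformly random integer below a given word take unit time. A word has at least $C(\beta+k\log_2(\alpha+|V|+|E|+2))$ bits, for a constant $C$ (so that numbers up to a fixed power of $2^\beta(\alpha+|V|+|E|+2)^k$ fit in one word). The input consists of $k$, $\alpha$, $|V|$, $|E|$ and a list of the hyperedges, each given as a list of its vertices, in any order; $\beta$ is not part of the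 input. **Theorem.** There are a two-phase randomized algorithm (a fixed program for each phase) and an absolute constant $C$ such that the following holds for all integers $k\ge 2$, $\alpha\ge 0$, $\beta\ge 0$ and every $(\alpha,\beta)$-nice hypergraph $H=(V,E)$, on the above machine for every such word length. 1. The build-up phase, on input $k,\alpha,H$, always halts within $$2^{Ck}\cdot\left(2^\beta|V|+\alpha^k|E|+\alpha^2\beta\|H\|\right)$$ steps. Among other things it draws and stores a uniformly random coloring $c:V\to\{1,\dots,k\}$. 2. If $H$ has at least one colorful $k$-hypergraphlet with respect to the stored coloring $c$, then each call of the sampling phase (after the build-up phase and any number of earlier calls, and whatever their random outcomes) takes expected time at most $$k^{Ck}\cdot\left(\beta^2+\ln|V|\right)$$ and outputs (its vertex list and its list of hyperedges) a colorful $k$-hypergraphlet $H[U]$ of $H$ with respect to $c$, uniformly at random: each vertex set $U$ of a colorful $k$-hypergraphlet is returned with probability $1/N$, where $N$ is the number of these sets. -/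

import Mathlib

open Set
open scoped ENNReal

namespace HyperMotivo

/-! ## Hypergraphs -/

section Hypergraphs

variable {V : Type*}

/-- The upper part `H_{> a}` of the `a`-split of `H`: same vertices, the hyperedges of size more
than `a`. -/
def upperPart (H : Hypergraph V) (a : ℕ) : Hypergraph V where
  vertexSet := H.vertexSet
  edgeSet := {e | e ∈ H.edgeSet ∧ a < e.ncard}
  subset_vertexSet_of_mem_edgeSet' := fun _ he => H.subset_vertexSet_of_mem_edgeSet' he.1

/-- The number of hyperedges that contain `v`. -/
noncomputable def degree (H : Hypergraph V) (v : V) : ℕ :=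
  {e | e ∈ H.edgeSet ∧ v ∈ e}.ncard

/-- The maximum degree `Δ(H)` (for hypergraphs on finitely many vertices). -/
noncomputable def maxDegree (H : Hypergraph V) : ℕ :=
  sSup (degree H '' H.vertexSet)

/-- `H` is `(a, b)`-nice: `Δ(H_{> a}) ≤ b`. -/
def IsNice (H : Hypergraph V) (a b : ℕ) : Prop :=
  maxDegree (upperPart H a) ≤ b

/-- `‖H‖`, the sum of the sizes of the hyperedges (for hypergraphs on finitely many vertices). -/
noncomputable def size (H : Hypergraph V) : ℕ :=
  ∑ᶠ e ∈ H.edgeSet, e.ncard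

/-- The induced hypergraph `H[U]`, for `U ⊆ V(H)`: its hyperedges are the sets `e ∩ U` with at
least two elements, `e` a hyperedge of `H`. -/
def induced (H : Hypergraph V) (U : Set V) : Hypergraph V where
  vertexSet := U
  edgeSet := {X | 2 ≤ X.ncard ∧ ∃ e ∈ H.edgeSet, X = e ∩ U}
  subset_vertexSet_of_mem_edgeSet' := by
    rintro _ ⟨-, e, -, rfl⟩
    exact inter_subset_right

/-- The Gaifman graph: distinct vertices are adjacent if they lie in a common hyperedge. -/
def gaifman (H : Hypergraph V) : SimpleGraph V where
  Adj u v := u ≠ v ∧ H.Adj u v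
  symm := ⟨fun _ _ h => ⟨h.1.symm, h.2.symm⟩⟩
  loopless := ⟨fun _ h => h.1 rfl⟩

/-- `H` is connected: its Gaifman graph, on the vertex set of `H`, is connected. -/
def IsConnectedHypergraph (H : Hypergraph V) : Prop :=
  ((gaifman H).induce H.vertexSet).Connected

/-- The vertex sets `U` of the `c`-colorful `k`-hypergraphlets `H[U]` of `H`: `U` has `k` vertices,
`H[U]` is connected, and the `k` vertices of `U` have distinct colors. -/
def colorfulSets (H : Hypergraph V) (k : ℕ) (c : V → Fin k) : Set (Set V) :=
  {U | U ⊆ H.vertexSet ∧ U.ncard = k ∧ IsConnectedHypergraph (induced H U) ∧ InjOn c U}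

/-- The list of lists `es` lists the members of the family `F` of sets: each member is listed
once, and each list enumerates its elements without repetition (in any order). -/
def Lists (es : List (List V)) (F : Set (Set V)) : Prop :=
  (∀ l ∈ es, l.Nodup) ∧ (es.map fun l => {v | v ∈ l}).Nodup ∧
    ∀ e : Set V, e ∈ F ↔ e ∈ es.map fun l => {v | v ∈ l}

end Hypergraphs

/-! ## The machine: a randomized word RAM

Memory cells hold words, that is, natural numbers below `2 ^ w`. A program is a fixed finite piece
of code; it uses finitely many registers and finitely many arrays of `2 ^ w` cells each, arithmetic
on words, tests, loops, and uniformly random integers. Every elementary command takes one step (the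
expressions in a program have constant size, since the program does not depend on the input). -/

/-- The contents of the registers and of the arrays. -/
structure Store where
  reg : ℕ → ℕ
  arr : ℕ → ℕ → ℕ

/-- Expressions. `load a i` is the cell of array number `a` at the address `i`. -/
inductive Expr where
  | const (m : ℕ)
  | reg (x : ℕ)
  | load (a : ℕ) (i : Expr)
  | add (d e : Expr)
  | sub (d e : Expr)
  | mul (d e : Expr)
  | div (d e : Expr)
  | mod (d e : Expr)
  | lt (d e : Expr)

/-- The value of an expression with words of `w` bits. Constants, sums and products are reduced
modulo `2 ^ w`, subtraction is truncated at `0`, and `lt` has value `1` or `0`. -/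
def Expr.eval (w : ℕ) (s : Store) : Expr → ℕ
  | .const m => m % 2 ^ w
  | .reg x => s.reg x
  | .load a i => s.arr a (i.eval w s)
  | .add d e => (d.eval w s + e.eval w s) % 2 ^ w
  | .sub d e => d.eval w s - e.eval w s
  | .mul d e => (d.eval w s * e.eval w s) % 2 ^ w
  | .div d e => d.eval w s / e.eval w s
  | .mod d e => d.eval w s % e.eval w s
  | .lt d e => if d.eval w s < e.eval w s then 1 else 0

/-- Commands. A program is a command. -/
inductive Cmd where
  | skip
  /-- register `x` := `e` -/
  | assign (x : ℕ) (e : Expr)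
  /-- cell `i` of array `a` := `e` -/
  | store (a : ℕ) (i e : Expr)
  /-- register `x` := a uniformly random integer in `{0, …, e - 1}` (`0` if `e = 0`) -/
  | rand (x : ℕ) (e : Expr)
  | seq (p q : Cmd)
  /-- if `e ≠ 0` then `p` else `q` -/
  | branch (e : Expr) (p q : Cmd)
  /-- while `e ≠ 0` do `p` -/
  | loop (e : Expr) (p : Cmd)

/-- `s` with register `x` set to `m`. -/
def Store.setReg (s : Store) (x m : ℕ) : Store :=
  { s with reg := Function.update s.reg x m }

/-- `s` with cell `i` of array `a` set to `m`. -/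
def Store.setArr (s : Store) (a i m : ℕ) : Store :=
  { s with arr := Function.update s.arr a (Function.update (s.arr a) i m) }

/-- The uniform distribution on `{0, …, m - 1}`; the point mass at `0` if `m = 0`. -/
noncomputable def uniformBelow : ℕ → PMF ℕ
  | 0 => PMF.pure 0
  | m + 1 => (PMF.uniformOfFintype (Fin (m + 1))).map fun i => (i : ℕ)

/-- A configuration: the commands that remain to be executed, and the store. The machine has halted
when no command remains. -/
abbrev Config : Type := List Cmd × Store

/-- One step of the machine. -/
noncomputable def step (w : ℕ) : Config → PMF Config
  | ([], s) => PMF.pure ([], s)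
  | (.skip :: K, s) => PMF.pure (K, s)
  | (.assign x e :: K, s) => PMF.pure (K, s.setReg x (e.eval w s))
  | (.store a i e :: K, s) => PMF.pure (K, s.setArr a (i.eval w s) (e.eval w s))
  | (.rand x e :: K, s) => (uniformBelow (e.eval w s)).map fun m => (K, s.setReg x m)
  | (.seq p q :: K, s) => PMF.pure (p :: q :: K, s)
  | (.branch e p q :: K, s) => PMF.pure ((if e.eval w s ≠ 0 then p else q) :: K, s)
  | (.loop e p :: K, s) => PMF.pure (if e.eval w s ≠ 0 then p :: .loop e p :: K else K, s)

/-- The distribution of the configuration after `t` steps of program `P` from the store `s`. -/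
noncomputable def run (w : ℕ) (P : Cmd) (s : Store) : ℕ → PMF Config
  | 0 => PMF.pure ([P], s)
  | t + 1 => (run w P s t).bind (step w)

/-- `P`, started in `s`, halts after at most `T` steps, whatever the random choices. -/
def HaltsWithin (w : ℕ) (P : Cmd) (s : Store) (T : ℕ) : Prop :=
  ∀ x ∈ (run w P s T).support, x.1 = []

/-- The stores in which `P`, started in `s`, halts with positive probability. -/
def finalStores (w : ℕ) (P : Cmd) (s : Store) : Set Store :=
  {s' | ∃ t, ([], s') ∈ (run w P s t).support}

/-- The probability that `P`, started in `s`, halts, and does so in a store that belongs to `A`. -/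
noncomputable def haltProb (w : ℕ) (P : Cmd) (s : Store) (A : Set Store) : ℝ≥0∞ :=
  ⨆ t, (run w P s t).toOuterMeasure {x | x.1 = [] ∧ x.2 ∈ A}

/-- The expected number of steps of `P` started in `s`, as the sum over `t` of the probability that
more than `t` steps are made. -/
noncomputable def expectedTime (w : ℕ) (P : Cmd) (s : Store) : ℝ≥0∞ :=
  ∑' t, (run w P s t).toOuterMeasure {x | x.1 ≠ []}

/-- `AfterCalls w P s s'`: the store `s'` can arise from `s` by some finite number (possibly zero)
of successive complete executions of `P`. -/
def AfterCalls (w : ℕ) (P : Cmd) : Store → Store → Prop :=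
  Relation.ReflTransGen fun s s' => s' ∈ finalStores w P s

/-! ## Input and output format -/

/-- The offsets of a list of lists inside its concatenation: `0, |l₀|, |l₀| + |l₁|, …`. -/
def offsets {V : Type*} (es : List (List V)) : List ℕ :=
  (List.range (es.length + 1)).map fun i => ((es.take i).map List.length).sum

/-- The input: `k`, `a`, the number of vertices and the number of hyperedges in registers `0`, `1`,
`2`, `3`, and the listed hyperedges, concatenated, in array `1`, with their offsets in array `0`.
Everything else is zero. -/
def inputStore (k a n : ℕ) (es : List (List (Fin n))) : Store where
  reg x := if x = 0 then k else if x = 1 then a else if x = 2 then n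
    else if x = 3 then es.length else 0
  arr b i := if b = 0 then (offsets es).getD i 0
    else if b = 1 then (es.flatten.map fun v => (v : ℕ)).getD i 0 else 0

/-- The coloring `c` is stored in array `2`. -/
def HasColoring {k n : ℕ} (s : Store) (c : Fin n → Fin k) : Prop :=
  ∀ v : Fin n, s.arr 2 v = c v

/-- The cells `f 0, f 1, …` begin with the list `L`. -/
def Holds (f : ℕ → ℕ) (L : List ℕ) : Prop :=
  ∀ (i : ℕ) (h : i < L.length), f i = L[i]

/-- The hypergraph `G` is written out in `s`: the number of its vertices and the number of its
hyperedges are in registers `4` and `5`, its vertices are listed in array `3`, and its hyperedges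
are listed in arrays `4` (offsets) and `5` (concatenation). -/
def Outputs {n : ℕ} (s : Store) (G : Hypergraph (Fin n)) : Prop :=
  ∃ (us : List (Fin n)) (es : List (List (Fin n))),
    us.Nodup ∧ {v | v ∈ us} = G.vertexSet ∧ Lists es G.edgeSet ∧
    s.reg 4 = us.length ∧ s.reg 5 = es.length ∧
    Holds (s.arr 3) (us.map fun v => (v : ℕ)) ∧
    Holds (s.arr 4) (offsets es) ∧
    Holds (s.arr 5) (es.flatten.map fun v => (v : ℕ))

end HyperMotivo

open HyperMotivo

namespace HyperMotivo

open Finset (card_eq_sum_ones card_eq_zero card_filter card_filter_le card_pos card_range mem_coe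
  mem_filter mul_sum range_subset_range sum_add_distrib sum_comm sum_congr sum_const sum_eq_zero
  sum_filter sum_ite sum_le_card_nsmul sum_le_sum sum_le_sum_of_subset sum_mul sum_range_succ)
open Function (update update_apply update_of_ne update_self)
open ENNReal (div_le_div_right natCast_ne_top)
open Nat (div_eq_of_lt lt_succ_iff_lt_or_eq lt_two_pow_self mod_eq_of_lt mod_lt pow_le_pow_left
  pow_le_pow_right two_pow_pos)
open List (getD_eq_getElem getElem_mem mem_append mem_cons toFinset_card_of_nodup)
open _root_.Finset renaming range → rng, mem_range → mem_rng

/-! ## Ideal evaluation -/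

/-! The sampler draws spanning trees of colourful connected sets and keeps only one distinguished
tree per set.

Trees and counting. A tree is built by attaching a tree `b` to the root of a tree `a`. The colour
sets are disjoint, and the part attached last must contain the largest colour other than the root's,
so the order of attachment carries no freedom (`Valid`). Colour sets are bit masks, and for disjoint
masks comparing the largest colours is comparing numbers. The number of trees with root `u` and
colours `C` obeys the recurrence `cnt_rec`: sum over the colours `X` of `a` the number of trees at
`u` with colours `X` times the total number of trees with colours `C - X` over the neighbours of
`u`.

Neighbour sums. The vertices that share a large hyperedge with `v` are handled by inclusion and
exclusion over the at most `2 ^ β` sets of large hyperedges at `v`; a trie has one node for each set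
that occurs at some vertex. The neighbours that share only small hyperedges with `v` are listed
explicitly. `adjCnt_eq` is the resulting formula.

Sampling. To draw a neighbour of `v` in proportion to its number of trees, each vertex list gets a
table of slots of equal capacity whose total capacity is at most twice the total weight. A draw is
kept if it hits the filled part of a slot and if the list is the first one at `v` that contains the
vertex. As `v` has at most `β + 1` lists, `2 * (β + 1)` tries suffice on average (`chooseC_le`).
Choosing split, neighbour and subtrees recursively yields a uniformly random tree (`exT_split`,
`exA_eq`, `growC_le`); its root is chosen as a neighbour of an artificial vertex `n` whose only list
consists of the vertices of colour `0`.

Uniformity. A tree is canonical if every attached part is a whole connected component of what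
remains without the root, and is attached through the neighbour of least colour. Each colourful
connected set has exactly one canonical tree rooted at its vertex of colour `0` (`canon_exists`,
`canon_unique`). Rejecting the other trees therefore gives a uniform set, and since a set carries at
most `(k + 1) ^ (2 * k)` trees (`card_trees_le`), the expected number of attempts is bounded in
terms of `k` (`attemptC_le`).

Output. The traces of the large hyperedges on the sampled set are found through its vertices. For
the small ones the build-up phase stores, for every colourful set, how many small hyperedges contain
it; inverting these sums over supersets tells which traces occur (`lowDeg_eq`).

Programs. `ic` assigns to a program the expected or worst-case value of a multiple of its running
time plus a function of the final store, and is infinite if a large number is written. It decreases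
along runs (`icc_step`, `run_potential`), so each upper bound for it is a statement about the
machine, and loops only require a supersolution. Time bounds arise from the factor `1`,
probabilities from the factor `0` and an indicator. Only upper bounds for probabilities come out; as
the program halts almost surely, upper bounds for an event and its complement that add up to `1` are
equalities (`eq_inv_of_le`). -/

instance : Add Expr := ⟨.add⟩
instance : Sub Expr := ⟨.sub⟩
instance : Mul Expr := ⟨.mul⟩
instance : Div Expr := ⟨.div⟩
instance : Mod Expr := ⟨.mod⟩
instance (m : ℕ) : OfNat Expr m := ⟨.const m⟩

/-- The value of an expression on a machine with words of unbounded length. -/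
def Expr.ival (s : Store) : Expr → ℕ
  | .const m => m
  | .reg x => s.reg x
  | .load a i => s.arr a (i.ival s)
  | .add d e => d.ival s + e.ival s
  | .sub d e => d.ival s - e.ival s
  | .mul d e => d.ival s * e.ival s
  | .div d e => d.ival s / e.ival s
  | .mod d e => d.ival s % e.ival s
  | .lt d e => if d.ival s < e.ival s then 1 else 0

/-- A bound for the exponent of the values of the subexpressions. -/
def Expr.size : Expr → ℕ
  | .const m => m + 1
  | .reg _ => 1
  | .load _ i => i.size + 1
  | .add d e | .sub d e | .mul d e | .div d e | .mod d e | .lt d e => d.size + e.size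

section ival
variable (s : Store) (d e : Expr)
@[simp] theorem ival_reg (x : ℕ) : (Expr.reg x).ival s = s.reg x := rfl
@[simp] theorem ival_load (a : ℕ) : (Expr.load a e).ival s = s.arr a (e.ival s) := rfl
@[simp] theorem ival_add : (d + e).ival s = d.ival s + e.ival s := rfl
@[simp] theorem ival_sub : (d - e).ival s = d.ival s - e.ival s := rfl
@[simp] theorem ival_mul : (d * e).ival s = d.ival s * e.ival s := rfl
@[simp] theorem ival_div : (d / e).ival s = d.ival s / e.ival s := rfl
@[simp] theorem ival_mod : (d % e).ival s = d.ival s % e.ival s := rfl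
@[simp] theorem ival_lt : (Expr.lt d e).ival s = if d.ival s < e.ival s then 1 else 0 := rfl
@[simp] theorem ival_zero : (0 : Expr).ival s = 0 := rfl
@[simp] theorem ival_one : (1 : Expr).ival s = 1 := rfl
@[simp] theorem ival_two : (2 : Expr).ival s = 2 := rfl
end ival

/-- All cells and registers hold values of at most `M`. -/
def Bounded (M : ℕ) (s : Store) : Prop := (∀ x, s.reg x ≤ M) ∧ ∀ a i, s.arr a i ≤ M

theorem Expr.size_pos (e : Expr) : 1 ≤ e.size := by
  induction e <;> simp only [Expr.size] <;> omega

/-- The sizes serve as exponents: a product adds them, and a sum is at most the product of the two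
bounds because both are at least `2`. A constant `m` has size `m + 1`, as `m < 2 ^ m`. -/
theorem Expr.ival_le {M : ℕ} (hM : 2 ≤ M) {s : Store} (hs : Bounded M s) (e : Expr) :
    e.ival s ≤ M ^ e.size := by
  have h2 : ∀ e : Expr, 2 ≤ M ^ e.size := fun e =>
    hM.trans (Nat.le_self_pow (by have := e.size_pos; omega) M)
  have up : ∀ {x : ℕ} {d e : Expr}, x ≤ M ^ d.size → x ≤ M ^ (d.size + e.size) := fun h =>
    h.trans (pow_le_pow_right (by omega) (by omega))
  induction e with
  | const m =>
    exact (lt_two_pow_self.le.trans (pow_le_pow_left hM m)).trans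
      (pow_le_pow_right (by omega) (by simp [Expr.size]))
  | reg x => simpa [Expr.size] using hs.1 x
  | load a i => exact (hs.2 a _).trans (Nat.le_self_pow (by simp [Expr.size]) M)
  | add d e hd he =>
    have := h2 d; have := h2 e; simp only [Expr.ival, Expr.size, pow_add]; nlinarith
  | mul d e hd he => simp only [Expr.ival, Expr.size, pow_add]; exact Nat.mul_le_mul hd he
  | sub d e hd he => exact (Nat.sub_le _ _).trans (up hd)
  | div d e hd he => exact (Nat.div_le_self _ _).trans (up hd)
  | mod d e hd he => exact (Nat.mod_le _ _).trans (up hd)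
  | lt d e hd he =>
    have : (Expr.lt d e).ival s ≤ 1 := by simp only [Expr.ival]; split_ifs <;> simp
    grind

/-- All subexpressions stay below `2 ^ w`, so no reduction modulo `2 ^ w` ever takes effect and the
rest of the proof can work with ideal arithmetic. -/
theorem Expr.eval_eq {M w : ℕ} (hM : 2 ≤ M) {s : Store} (hs : Bounded M s) (e : Expr)
    (h : M ^ e.size < 2 ^ w) : e.eval w s = e.ival s := by
  have hlt : ∀ e : Expr, M ^ e.size < 2 ^ w → e.ival s < 2 ^ w := fun e h =>
    (e.ival_le hM hs).trans_lt h
  have l : ∀ {d e : Expr}, M ^ (d.size + e.size) < 2 ^ w → M ^ d.size < 2 ^ w := fun h =>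
    (pow_le_pow_right (by omega) (by omega)).trans_lt h
  have r : ∀ {d e : Expr}, M ^ (d.size + e.size) < 2 ^ w → M ^ e.size < 2 ^ w := fun h =>
    (pow_le_pow_right (by omega) (by omega)).trans_lt h
  induction e with
  | const m => exact mod_eq_of_lt (hlt _ h)
  | reg x => rfl
  | load a i ih =>
    simp only [Expr.eval, Expr.ival]
    rw [ih ((pow_le_pow_right (by omega) (by simp [Expr.size])).trans_lt h)]
  | add d e hd he =>
    simp only [Expr.eval, hd (l h), he (r h)]; exact mod_eq_of_lt (hlt (.add d e) h)
  | mul d e hd he =>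
    simp only [Expr.eval, hd (l h), he (r h)]; exact mod_eq_of_lt (hlt (.mul d e) h)
  | sub d e hd he | div d e hd he | mod d e hd he | lt d e hd he =>
    simp only [Expr.eval, Expr.ival, hd (l h), he (r h)]

@[simp] theorem setReg_reg (s : Store) (x m y : ℕ) :
    (s.setReg x m).reg y = if y = x then m else s.reg y := by
  simp [Store.setReg, update_apply]
@[simp] theorem setReg_arr (s : Store) (x m : ℕ) : (s.setReg x m).arr = s.arr := rfl
@[simp] theorem setArr_reg (s : Store) (a i m : ℕ) : (s.setArr a i m).reg = s.reg := rfl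
theorem setArr_arr (s : Store) (a i m b j : ℕ) :
    (s.setArr a i m).arr b j = if b = a then (if j = i then m else s.arr b j) else s.arr b j := by
  simp only [Store.setArr, update_apply]; grind
theorem setArr_arr' (s : Store) (a i m b : ℕ) :
    (s.setArr a i m).arr b = if b = a then update (s.arr b) i m else s.arr b := by
  simp only [Store.setArr, update_apply]; simp_all

theorem Bounded.setReg {M : ℕ} {s : Store} (hs : Bounded M s) {m : ℕ} (hm : m ≤ M) (x : ℕ) :
    Bounded M (s.setReg x m) := by
  refine ⟨fun y => ?_, hs.2⟩; grind [setReg_reg, Bounded]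

theorem Bounded.setArr {M : ℕ} {s : Store} (hs : Bounded M s) {m : ℕ} (hm : m ≤ M) (a i : ℕ) :
    Bounded M (s.setArr a i m) := by
  refine ⟨hs.1, fun b j => ?_⟩; grind [setArr_arr, Bounded]

/-! ## The cost functional -/

/-- Aggregation over the `m` outcomes of a draw: the average or the supremum. -/
noncomputable def agg (b : Bool) (m : ℕ) (g : ℕ → ℝ≥0∞) : ℝ≥0∞ :=
  if b then (if m = 0 then g 0 else (∑ i ∈ rng m, g i) / m)
  else ⨆ i, ⨆ (_ : i < max m 1), g i

theorem agg_mono (b : Bool) (m : ℕ) {g g' : ℕ → ℝ≥0∞} (h : ∀ i < max m 1, g i ≤ g' i) :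
    agg b m g ≤ agg b m g' := by
  unfold agg; split_ifs with hb hm
  · simp_all
  · refine div_le_div_right (sum_le_sum fun i hi => h i ?_) _; simp_all
  · exact iSup_mono fun i => iSup_mono fun hi => h i hi

theorem agg_le (b : Bool) (m : ℕ) {g : ℕ → ℝ≥0∞} {x : ℝ≥0∞} (h : ∀ i < max m 1, g i ≤ x) :
    agg b m g ≤ x := by
  unfold agg; split_ifs with hb hm
  · simp_all
  · refine ENNReal.div_le_of_le_mul ?_
    calc _ ≤ ∑ i ∈ rng m, x :=
          sum_le_sum fun i hi => h i (lt_max_of_lt_left (mem_rng.1 hi))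
      _ = _ := by simp [mul_comm]
  · simp_all

/-- The expected (`b = true`) or worst-case (`b = false`) value of `τ` times the number of steps
plus the value of `f` in the final store; `⊤` if a value above `M` is written. -/
noncomputable def ic (M : ℕ) (b : Bool) (τ : ℝ≥0∞) : Cmd → (Store → ℝ≥0∞) → Store → ℝ≥0∞
  | .skip, f => fun s => τ + f s
  | .assign x e, f => fun s => if e.ival s ≤ M then τ + f (s.setReg x (e.ival s)) else ⊤
  | .store a i e, f => fun s => if e.ival s ≤ M then τ + f (s.setArr a (i.ival s) (e.ival s)) else ⊤
  | .rand x e, f => fun s =>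
    if e.ival s ≤ M then τ + agg b (e.ival s) (fun m => f (s.setReg x m)) else ⊤
  | .seq p q, f => fun s => τ + ic M b τ p (ic M b τ q f) s
  | .branch e p q, f => fun s => τ + if e.ival s ≠ 0 then ic M b τ p f s else ic M b τ q f s
  | .loop e p, f => sInf {X | ∀ s, τ + (if e.ival s ≠ 0 then ic M b τ p X s else f s) ≤ X s}

section
variable {M : ℕ} {b : Bool} {τ : ℝ≥0∞}

/-- Loops are valued by the least supersolution, so it suffices to guess a bound `X` and to check
one iteration. All loop rules rest on this. -/
theorem ic_loop_le {e : Expr} {p : Cmd} {f X : Store → ℝ≥0∞}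
    (h : ∀ s, τ + (if e.ival s ≠ 0 then ic M b τ p X s else f s) ≤ X s) (s : Store) :
    ic M b τ (.loop e p) f s ≤ X s :=
  (sInf_le (show X ∈ {X | ∀ s, τ + (if e.ival s ≠ 0 then ic M b τ p X s else f s) ≤ X s} from h)) s

/-- `s'` agrees with `s` on what `P` does not modify. -/
def Cmd.modR : Cmd → ℕ → Bool
  | .assign x _, y | .rand x _, y => x == y
  | .seq p q, y | .branch _ p q, y => p.modR y || q.modR y
  | .loop _ p, y => p.modR y
  | _, _ => false

def Cmd.modA : Cmd → ℕ → Bool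
  | .store a _ _, y => a == y
  | .seq p q, y | .branch _ p q, y => p.modA y || q.modA y
  | .loop _ p, y => p.modA y
  | _, _ => false

structure Fr (P : Cmd) (s s' : Store) : Prop where
  reg : ∀ x, P.modR x = false → s'.reg x = s.reg x
  arr : ∀ a, P.modA a = false → s'.arr a = s.arr a

theorem Fr.refl (P : Cmd) (s : Store) : Fr P s s := ⟨fun _ _ => rfl, fun _ _ => rfl⟩

theorem Fr.rg {P : Cmd} {s s' : Store} (h : Fr P s s') {x v : ℕ} (hv : s.reg x = v)
    (hx : P.modR x = false := by rfl) : s'.reg x = v := (h.reg x hx).trans hv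

theorem Fr.ar {P : Cmd} {s s' : Store} (h : Fr P s s') {x : ℕ} {v : ℕ → ℕ} (hv : s.arr x = v)
    (hx : P.modA x = false := by rfl) : s'.arr x = v := (h.arr x hx).trans hv

theorem Fr.trans {P : Cmd} {s s' s'' : Store} (h : Fr P s s') (h' : Fr P s' s'') : Fr P s s'' :=
  ⟨fun x hx => (h'.reg x hx).trans (h.reg x hx), fun x hx => (h'.arr x hx).trans (h.arr x hx)⟩

theorem Fr.of_le {P P' : Cmd} {s s' : Store} (h : Fr P s s')
    (hr : ∀ x, P'.modR x = false → P.modR x = false)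
    (ha : ∀ x, P'.modA x = false → P.modA x = false) : Fr P' s s' :=
  ⟨fun x hx => h.reg x (hr x hx), fun x hx => h.arr x (ha x hx)⟩

theorem Fr.left {p q : Cmd} {s s' : Store} (h : Fr p s s') : Fr (.seq p q) s s' :=
  h.of_le (fun x hx => by simp_all [Cmd.modR]) (fun x hx => by simp_all [Cmd.modA])
theorem Fr.right {p q : Cmd} {s s' : Store} (h : Fr q s s') : Fr (.seq p q) s s' :=
  h.of_le (fun x hx => by simp_all [Cmd.modR]) (fun x hx => by simp_all [Cmd.modA])

/-- Only those stores are reached that differ from `s` in what `P` writes. This spares every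
specification the list of what it leaves unchanged. -/
theorem ic_frame (P : Cmd) : ∀ {f g : Store → ℝ≥0∞} {s : Store},
    (∀ s', Fr P s s' → f s' ≤ g s') → ic M b τ P f s ≤ ic M b τ P g s := by
  induction P with
  | skip => intro f g s h; exact add_le_add_right (h s (Fr.refl _ s)) τ
  | assign x e =>
    intro f g s h; simp only [ic]; split_ifs
    · refine add_le_add_right (h (s.setReg x (e.ival s)) ⟨fun y hy => ?_, fun _ _ => rfl⟩) τ
      simp only [Cmd.modR, beq_eq_false_iff_ne] at hy; simp [hy.symm]
    · simp
  | store a i e =>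
    intro f g s h; simp only [ic]; split_ifs
    · refine add_le_add_right
        (h (s.setArr a (i.ival s) (e.ival s)) ⟨fun y hy => rfl, fun y hy => ?_⟩) τ
      simp only [Cmd.modA, beq_eq_false_iff_ne] at hy; simp [setArr_arr', hy.symm]
    · simp
  | rand x e =>
    intro f g s h; simp only [ic]; split_ifs
    · refine add_le_add_right (agg_mono _ _ fun m _ =>
        h (s.setReg x m) ⟨fun y hy => ?_, fun _ _ => rfl⟩) τ
      simp only [Cmd.modR, beq_eq_false_iff_ne] at hy; simp [hy.symm]
    · simp
  | seq p q hp hq =>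
    intro f g s h
    exact add_le_add_right (hp fun s' hs' => hq fun s'' hs'' => h _ (hs'.left.trans hs''.right)) τ
  | branch e p q hp hq =>
    intro f g s h; simp only [ic]; refine add_le_add_right ?_ τ; split_ifs
    · exact hp fun s' hs' => h _ ⟨hs'.left.1, hs'.left.2⟩
    · exact hq fun s' hs' => h _ ⟨hs'.right.1, hs'.right.2⟩
  | loop e p hp =>
    intro f g s h; simp only [ic, sInf_apply]; refine le_iInf fun X => ?_; have hX := X.2
    simp only [mem_ofPred_eq] at hX
    classical
    -- A supersolution for `g` becomes one for `f` when it is raised to `⊤` at the stores outside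
    -- the frame, which an iteration started inside never reaches.
    have hmem : ∀ s', τ + (if e.ival s' ≠ 0 then
        ic M b τ p (fun s' => if Fr (.loop e p) s s' then X.1 s' else ⊤) s' else f s') ≤
        if Fr (.loop e p) s s' then X.1 s' else ⊤ := by
      intro s'; by_cases hs : Fr (.loop e p) s s'
      · simp only [if_pos hs]; refine le_trans (add_le_add_right ?_ τ) (hX s'); split_ifs
        · refine hp fun s'' hs'' => ?_; rw [if_pos (hs.trans ⟨hs''.1, hs''.2⟩)]
        · simp_all
      · simp_all
    refine (iInf_le _ ⟨fun s' => if Fr (.loop e p) s s' then X.1 s' else ⊤, hmem⟩).trans ?_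
    simp [Fr.refl]

theorem ic_mono (P : Cmd) {f g : Store → ℝ≥0∞} (s : Store) (h : ∀ s, f s ≤ g s) :
    ic M b τ P f s ≤ ic M b τ P g s := ic_frame P fun s' _ => h s'

/-- Each supersolution dominates the unrolling of the infimum. This is the half of the fixed-point
equation that soundness needs. -/
theorem ic_loop_unfold (e : Expr) (p : Cmd) (f : Store → ℝ≥0∞) (s : Store) :
    τ + (if e.ival s ≠ 0 then ic M b τ p (ic M b τ (.loop e p) f) s else f s) ≤
      ic M b τ (.loop e p) f s := by
  conv_rhs => rw [ic]
  rw [sInf_apply]; refine le_iInf fun X => le_trans (add_le_add_right ?_ τ) (X.2 s); split_ifs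
  · exact ic_mono p s fun s' => ic_loop_le X.2 s'
  · simp

end

/-! ## Soundness -/

/-- The expectation of `Φ`. -/
noncomputable def ex {α : Type*} (p : PMF α) (Φ : α → ℝ≥0∞) : ℝ≥0∞ := ∑' y, p y * Φ y

theorem ex_pure {α : Type*} (a : α) (Φ : α → ℝ≥0∞) : ex (PMF.pure a) Φ = Φ a := by unfold ex; simp

theorem ex_bind {α β : Type*} (p : PMF α) (q : α → PMF β) (Φ : β → ℝ≥0∞) :
    ex (p.bind q) Φ = ex p fun a => ex (q a) Φ := by
  unfold ex; simp only [PMF.bind_apply, ← ENNReal.tsum_mul_right, ← ENNReal.tsum_mul_left]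
  rw [ENNReal.tsum_comm]; grind

theorem ex_map {α β : Type*} (p : PMF α) (q : α → β) (Φ : β → ℝ≥0∞) :
    ex (p.map q) Φ = ex p fun a => Φ (q a) := by
  rw [PMF.map, ex_bind]; simp [ex_pure]

theorem ex_mono {α : Type*} (p : PMF α) {Φ Ψ : α → ℝ≥0∞} (h : ∀ a ∈ p.support, Φ a ≤ Ψ a) :
    ex p Φ ≤ ex p Ψ := by
  refine ENNReal.tsum_le_tsum fun a => ?_; by_cases ha : p a = 0
  · simp [ha]
  · exact mul_le_mul_right (h a ((PMF.mem_support_iff _ _).2 ha)) _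

theorem ex_add {α : Type*} (p : PMF α) (Φ Ψ : α → ℝ≥0∞) :
    ex p (fun a => Φ a + Ψ a) = ex p Φ + ex p Ψ := by
  simp [ex, mul_add, ENNReal.tsum_add]

theorem ex_indicator {α : Type*} (p : PMF α) (A : Set α) :
    p.toOuterMeasure A = ex p (A.indicator 1) := by
  rw [PMF.toOuterMeasure_apply, ex]; refine tsum_congr fun a => ?_; by_cases h : a ∈ A <;> simp [h]

theorem ex_mul {α : Type*} (p : PMF α) (c : ℝ≥0∞) (Φ : α → ℝ≥0∞) :
    ex p (fun a => c * Φ a) = c * ex p Φ := by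
  simp only [ex, ← ENNReal.tsum_mul_left]; grind

theorem uniformBelow_succ (m : ℕ) :
    uniformBelow (m + 1) = (PMF.uniformOfFintype (Fin (m + 1))).map Fin.val := by
  first
  | rfl
  | exact PMF.map_id _

theorem ex_uniformBelow (m : ℕ) (Φ : ℕ → ℝ≥0∞) : ex (uniformBelow m) Φ = agg true m Φ := by
  cases m with
  | zero => simp [uniformBelow, ex_pure, agg]
  | succ m =>
    rw [uniformBelow_succ, ex_map, ex, tsum_fintype, agg]
    simp only [PMF.uniformOfFintype_apply, Fintype.card_fin, if_true, Nat.succ_ne_zero, if_false]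
    rw [← mul_sum, Fin.sum_univ_eq_sum_range (fun i => Φ i) (m + 1), ENNReal.div_eq_inv_mul]

/-- The maximum with `1` accounts for draws below `0`, whose outcome is `0`. -/
theorem mem_support_uniformBelow {m i : ℕ} (h : i ∈ (uniformBelow m).support) : i < max m 1 := by
  cases m with
  | zero => simp [uniformBelow] at h; simp [h]
  | succ m => simp only [uniformBelow_succ, PMF.support_map, mem_image] at h; omega

/-- The largest size of an expression of `P`. -/
def Cmd.size : Cmd → ℕ
  | .skip => 0
  | .assign _ e => e.size
  | .store _ i e => max i.size e.size
  | .rand _ e => e.size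
  | .seq p q => max p.size q.size
  | .branch e p q => max e.size (max p.size q.size)
  | .loop e p => max e.size p.size

section
variable {M w : ℕ}

open Classical in
/-- The cost functional of a configuration. -/
noncomputable def icc (M : ℕ) (b : Bool) (τ : ℝ≥0∞) (f : Store → ℝ≥0∞) (x : Config) : ℝ≥0∞ :=
  if Bounded M x.2 then (x.1.foldr (ic M b τ) f) x.2 else ⊤

/-- Every command of the configuration fits into the words. -/
def Fits (M w : ℕ) (K : List Cmd) : Prop := ∀ P ∈ K, M ^ P.size < 2 ^ w

/-- The commands still to be executed are parts of the program, so the size bound for the program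
persists during a run. -/
theorem size_step {x y : Config} (hy : y ∈ (step w x).support) :
    ∀ Q ∈ y.1, ∃ P ∈ x.1, Q.size ≤ P.size := by
  intro Q hQ; obtain ⟨_ | ⟨P, K⟩, s⟩ := x
  · simp_all [step]
  · have : Q ∈ K ∨ Q.size ≤ P.size := by cases P <;> simp [step] at hy <;> grind [Cmd.size]
    grind

theorem fits_run (hM : 2 ≤ M) {P : Cmd} (hP : M ^ P.size < 2 ^ w) (s : Store) (t : ℕ) :
    ∀ x ∈ (run w P s t).support, Fits M w x.1 := by
  induction t with
  | zero => simpa [run, Fits] using hP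
  | succ t ih =>
    intro y hy Q hQ; obtain ⟨x, hx, hy⟩ := (PMF.mem_support_bind_iff _ _ _).1 hy
    obtain ⟨P, hP, h⟩ := size_step hy Q hQ
    exact (pow_le_pow_right (by omega) h).trans_lt (ih x hx P hP)

/-- The clauses of `ic` mirror the machine steps, so one step lowers the value by at least `τ`, on
average or for every outcome. A store with a number above `M` has value `⊤`; in all others the
machine computes the ideal values. -/
theorem icc_step (hM : 2 ≤ M) (b : Bool) (τ : ℝ≥0∞) (f : Store → ℝ≥0∞) (x : Config)
    (hx : x.1 ≠ []) (hf : Fits M w x.1) :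
    (b = true → τ + ex (step w x) (icc M b τ f) ≤ icc M b τ f x) ∧
    ∀ y ∈ (step w x).support, b = false → τ + icc M b τ f y ≤ icc M b τ f x := by
  obtain ⟨K, s⟩ := x; have key : ∀ y : Config, step w (K, s) = PMF.pure y →
      (τ + icc M b τ f y ≤ icc M b τ f (K, s)) →
      (b = true → τ + ex (step w (K, s)) (icc M b τ f) ≤ icc M b τ f (K, s)) ∧
      ∀ y ∈ (step w (K, s)).support, b = false → τ + icc M b τ f y ≤ icc M b τ f (K, s) := by
    intro y hy h'; rw [hy]; simp only [PMF.support_pure, mem_singleton_iff, forall_eq, ex_pure]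
    grind
  by_cases hs : Bounded M s
  swap
  · have htop : icc M b τ f (K, s) = ⊤ := if_neg hs
    exact ⟨fun _ => htop ▸ le_top, fun _ _ _ => htop ▸ le_top⟩
  have hicc : ∀ K, icc M b τ f (K, s) = (K.foldr (ic M b τ) f) s := fun K => if_pos hs
  cases K with
  | nil => exact absurd rfl hx
  | cons P K =>
    have ev : ∀ e : Expr, e.size ≤ P.size → e.eval w s = e.ival s := fun e he =>
      e.eval_eq hM hs ((pow_le_pow_right (by omega) he).trans_lt (hf P List.mem_cons_self))
    have hicc' : icc M b τ f (P :: K, s) = ic M b τ P (K.foldr (ic M b τ) f) s := hicc _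
    cases P with
    | skip | seq p q => refine key _ rfl ?_; rw [hicc', hicc]; exact le_rfl
    | assign x e =>
      refine key _ rfl ?_; rw [hicc']; simp only [ic]; rw [ev e le_rfl]; split_ifs with h
      · rw [icc, if_pos (hs.setReg h x)]
      · simp
    | store a i e =>
      refine key _ rfl ?_
      rw [hicc']; simp only [ic]; rw [ev e (le_max_right _ _), ev i (le_max_left _ _)]
      split_ifs with h
      · rw [icc, if_pos (hs.setArr h _ _)]
      · simp
    | rand x e =>
      rw [hicc']
      simp only [step, ev e le_rfl, PMF.support_map, mem_image, ex_map, ex_uniformBelow, ic]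
      split_ifs with h
      swap
      · simp
      have hb : ∀ m < max (e.ival s) 1, icc M b τ f (K, s.setReg x m) =
          (K.foldr (ic M b τ) f) (s.setReg x m) := fun m hm =>
        if_pos (hs.setReg (by omega) x)
      refine ⟨?_, ?_⟩
      · rintro rfl; exact add_le_add_right (agg_mono _ _ fun m hm => (hb m hm).le) τ
      · rintro y ⟨m, hm, rfl⟩ rfl; have hm' := mem_support_uniformBelow hm; rw [hb m hm']
        refine add_le_add_right ?_ τ; rw [agg, if_neg (by simp)]; exact le_iSup₂_of_le m hm' le_rfl
    | branch e p q =>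
      refine key _ rfl ?_; rw [hicc', hicc]; simp only [ic]; rw [ev e (le_max_left _ _)]
      refine add_le_add_right ?_ τ; split_ifs <;> exact le_rfl
    | loop e p =>
      refine key _ rfl ?_; rw [hicc', hicc, ev e (le_max_left _ _)]
      refine le_trans (add_le_add_right ?_ τ) (ic_loop_unfold e p _ s); split_ifs <;> exact le_rfl

theorem step_nil (s : Store) : step w ([], s) = PMF.pure ([], s) := rfl

/-- The potential decreases along a run. -/
theorem run_potential (hM : 2 ≤ M) {P : Cmd} (hP : M ^ P.size < 2 ^ w) {s : Store}
    (hs : Bounded M s) (τ : ℝ≥0∞) (f : Store → ℝ≥0∞) (T : ℕ) :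
    τ * ∑ t ∈ rng T, (run w P s t).toOuterMeasure {x | x.1 ≠ []} +
      ex (run w P s T) (icc M true τ f) ≤ ic M true τ P f s := by
  induction T with
  | zero =>
    simp only [Finset.range_zero, Finset.sum_empty, mul_zero, zero_add, run, ex_pure]
    rw [icc, if_pos hs]; exact le_rfl
  | succ T ih =>
    refine le_trans ?_ ih; rw [sum_range_succ, mul_add, add_assoc]; refine add_le_add_right ?_ _
    rw [run, ex_bind, ex_indicator, ← ex_mul, ← ex_add]; refine ex_mono _ fun x hx => ?_
    by_cases h : x.1 = []
    · obtain ⟨K, s'⟩ := x; simp only at h; subst h; simp [step_nil, ex_pure]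
    · simpa [h] using (icc_step hM true τ f x h (fits_run hM hP s T x hx)).1 rfl

/-- The potential with `τ = 1` and `f = 0`, for every finite horizon. -/
theorem expectedTime_le (hM : 2 ≤ M) {P : Cmd} (hP : M ^ P.size < 2 ^ w) {s : Store}
    (hs : Bounded M s) : expectedTime w P s ≤ ic M true 1 P 0 s := by
  refine ENNReal.tsum_le_of_sum_range_le fun T => ?_
  exact le_trans (by rw [one_mul]; exact le_self_add) (run_potential hM hP hs 1 0 T)

/-- The potential with `τ = 0` and the indicator of the event: what has halted in `A` by time `T`
contributes its probability. -/
theorem haltProb_le (hM : 2 ≤ M) {P : Cmd} (hP : M ^ P.size < 2 ^ w) {s : Store}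
    (hs : Bounded M s) (A : Set Store) :
    haltProb w P s A ≤ ic M true 0 P (A.indicator 1) s := by
  refine iSup_le fun T => le_trans ?_ (run_potential hM hP hs 0 _ T)
  rw [zero_mul, zero_add, ex_indicator]; refine ex_mono _ fun x _ => ?_; obtain ⟨K, s'⟩ := x
  by_cases h : K = [] ∧ s' ∈ A
  · obtain ⟨rfl, h⟩ := h; rw [icc]; split_ifs
    · simp [h]
    · simp
  · simp_all

/-- Turns expectations into certainty. With `f` equal to `0` on a property and `⊤` off it, a finite
value means that every store reached with positive probability has the property. -/
theorem finalStores_lt_top (hM : 2 ≤ M) {P : Cmd} (hP : M ^ P.size < 2 ^ w) {s : Store}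
    (hs : Bounded M s) {f : Store → ℝ≥0∞} (hf : ic M true 0 P f s < ⊤) {s' : Store}
    (hs' : s' ∈ finalStores w P s) : Bounded M s' ∧ f s' < ⊤ := by
  obtain ⟨T, hT⟩ := hs'; have h := (run_potential hM hP hs 0 f T).trans_lt hf
  rw [zero_mul, zero_add] at h; have h1 : (run w P s T) ([], s') * icc M true 0 f ([], s') < ⊤ := 
    (ENNReal.le_tsum (f := fun y => run w P s T y * icc M true 0 f y) _).trans_lt h
  have h2 : icc M true 0 f ([], s') < ⊤ := by
    by_contra hc
    simp_all
  rw [icc] at h2; split_ifs at h2 with hb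
  · simp_all
  · simp_all

/-- In the worst-case mode, after `t` steps without halting, `t` plus the remaining value is at most
`T`, and the remaining value is at least `1`. -/
theorem haltsWithin_of_le (hM : 2 ≤ M) {P : Cmd} (hP : M ^ P.size < 2 ^ w) {s : Store}
    (hs : Bounded M s) {T : ℕ} (h : ic M false 1 P 0 s ≤ T) : HaltsWithin w P s T := by
  have key : ∀ t : ℕ, ∀ x ∈ (run w P s t).support,
      x.1 = [] ∨ (t : ℝ≥0∞) + icc M false 1 0 x ≤ T := by
    intro t
    induction t with
    | zero =>
      intro x hx; simp only [run, PMF.support_pure, mem_singleton_iff] at hx; subst hx; right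
      rw [icc, if_pos hs]; simp_all
    | succ t ih =>
      intro y hy; simp only [run, PMF.mem_support_bind_iff] at hy; obtain ⟨x, hx, hy⟩ := hy
      by_cases hxe : x.1 = []
      · obtain ⟨K, s'⟩ := x; simp only at hxe; subst hxe
        simp only [step_nil, PMF.support_pure, mem_singleton_iff] at hy; simp_all
      · right; have h1 := (icc_step hM false 1 0 x hxe (fits_run hM hP s t x hx)).2 y hy rfl
        have h2 := (ih x hx).resolve_left hxe; refine le_trans ?_ h2; push_cast; rw [add_assoc]
        simp_all
  intro x hx
  by_contra hxe
  obtain ⟨y, hy⟩ := (step w x).support_nonempty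
  have h1 : 1 ≤ icc M false 1 0 x := le_trans le_self_add
    ((icc_step hM false 1 0 x hxe (fits_run hM hP s T x hx)).2 y hy rfl)
  have h2 := (add_le_add_right h1 (T : ℝ≥0∞)).trans ((key T x hx).resolve_left hxe)
  have h3 : ((T + 1 : ℕ) : ℝ≥0∞) ≤ T := by simpa using h2
  have := Nat.cast_le.1 h3; omega

/-- A finite expected time makes the probability of still running tend to `0`. Together with upper
bounds for both events this gives exact probabilities. -/
theorem one_le_haltProb_add (P : Cmd) (s : Store) (h : expectedTime w P s < ⊤) (A : Set Store) :
    1 ≤ haltProb w P s A + haltProb w P s Aᶜ := by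
  have h0 := ENNReal.tendsto_atTop_zero_of_tsum_ne_top h.ne
  have h1 : ∀ t, 1 ≤ (run w P s t).toOuterMeasure {x | x.1 ≠ []} +
      (haltProb w P s A + haltProb w P s Aᶜ) := by
    intro t; have hc : (1 : ℝ≥0∞) = ex (run w P s t) 1 := by simp [ex, PMF.tsum_coe]
    rw [hc]; refine le_trans ?_ (add_le_add_right (add_le_add
      (le_iSup (fun t => (run w P s t).toOuterMeasure {x | x.1 = [] ∧ x.2 ∈ A}) t)
      (le_iSup (fun t => (run w P s t).toOuterMeasure {x | x.1 = [] ∧ x.2 ∈ Aᶜ}) t)) _)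
    simp only [ex_indicator, ← ex_add]; refine ex_mono _ fun x _ => ?_
    by_cases h : x.1 = [] <;> by_cases h' : x.2 ∈ A <;> simp [h, h']
  refine le_of_tendsto_of_tendsto' tendsto_const_nhds (h0.add_const _) h1 |>.trans ?_; simp

end

/-! ## Total correctness with time bounds -/

/-- `P`, started in `s`, halts within `T` steps in a store that satisfies `Q`, whatever the random
choices, and writes no value above `M`. -/
def Tri (M : ℕ) (P : Cmd) (s : Store) (T : ℕ) (Q : Store → Prop) : Prop :=
  ∀ (b : Bool) (τ : ℝ≥0∞) (f : Store → ℝ≥0∞) (X : ℝ≥0∞), (∀ s', Q s' → f s' ≤ X) →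
    ic M b τ P f s ≤ τ * T + X

/-- The sequential composition of a list of commands. -/
def blk : List Cmd → Cmd
  | [] => .skip
  | c :: l => .seq c (blk l)

/-- `for i := 0, …, bnd - 1 do body` -/
def forC (i : ℕ) (bnd : Expr) (body : Cmd) : Cmd :=
  .seq (.assign i 0) (.loop (.lt (.reg i) bnd) (.seq body (.assign i (.reg i + 1))))

section
variable {M : ℕ} {s : Store} {T T₁ T₂ : ℕ} {Q Q₁ : Store → Prop}

theorem Tri.conseq {P : Cmd} (h : Tri M P s T₁ Q₁) (hT : T₁ ≤ T) (hQ : ∀ s', Q₁ s' → Q s') :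
    Tri M P s T Q := fun b τ f X hX =>
  (h b τ f X fun s' hs' => hX s' (hQ s' hs')).trans
    (add_le_add_left (mul_le_mul_right (Nat.cast_le.2 hT) τ) X)

theorem Tri.time {P : Cmd} (h : Tri M P s T₁ Q) (hT : T₁ ≤ T) : Tri M P s T Q :=
  h.conseq hT fun _ => id

theorem Tri.fr {P : Cmd} (h : Tri M P s T Q) : Tri M P s T (fun s' => Q s' ∧ Fr P s s') := by
  classical
  intro b τ f X hX
  refine le_trans (ic_frame (g := fun s' => if Fr P s s' then f s' else 0) P fun s' hs' => ?_)
    (h b τ _ X fun s' hs' => ?_)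
  · simp_all
  · split_ifs with hf
    · simp_all
    · simp

theorem Tri.skip (h : Q s) : Tri M .skip s 1 Q := fun b τ f X hX => by
  simpa [ic] using add_le_add_right (hX s h) τ

theorem Tri.assign {x : ℕ} {e : Expr} (he : e.ival s ≤ M) (h : Q (s.setReg x (e.ival s))) :
    Tri M (.assign x e) s 1 Q := fun b τ f X hX => by
  simpa [ic, he] using add_le_add_right (hX _ h) τ

theorem Tri.store {a : ℕ} {i e : Expr} (he : e.ival s ≤ M)
    (h : Q (s.setArr a (i.ival s) (e.ival s))) : Tri M (.store a i e) s 1 Q := fun b τ f X hX => by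
  simpa [ic, he] using add_le_add_right (hX _ h) τ

theorem Tri.rand {x : ℕ} {e : Expr} (he : e.ival s ≤ M)
    (h : ∀ m < max (e.ival s) 1, Q (s.setReg x m)) : Tri M (.rand x e) s 1 Q := fun b τ f X hX => by
  simp only [ic, he, if_true, Nat.cast_one, mul_one]
  exact add_le_add_right (agg_le _ _ fun m hm => hX _ (h m hm)) τ

theorem Tri.seq {p q : Cmd} (h : Tri M p s T₁ Q₁)
    (h' : ∀ s', Q₁ s' → Fr p s s' → Tri M q s' T₂ Q) : Tri M (.seq p q) s (T₁ + T₂ + 1) Q :=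
  fun b τ f X hX => by
    have := h.fr b τ (ic M b τ q f) (τ * T₂ + X) fun s' hs' => h' s' hs'.1 hs'.2 b τ f X hX
    refine le_trans (add_le_add_right this τ) (le_of_eq ?_); grind

theorem Tri.ite {e : Expr} {p q : Cmd} (h : e.ival s ≠ 0 → Tri M p s T Q)
    (h' : e.ival s = 0 → Tri M q s T Q) : Tri M (.branch e p q) s (T + 1) Q :=
  fun b τ f X hX => by
    have key : (if e.ival s ≠ 0 then ic M b τ p f s else ic M b τ q f s) ≤ τ * T + X := by
      split_ifs with hc
      · exact h hc b τ f X hX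
      · exact h' (not_not.1 hc) b τ f X hX
    refine le_trans (add_le_add_right key τ) (le_of_eq ?_); grind

theorem Tri.nil (h : Q s) : Tri M (blk []) s 1 Q := Tri.skip h

theorem Tri.cons {c : Cmd} {l : List Cmd} (h : Tri M c s T₁ Q₁)
    (h' : ∀ s', Q₁ s' → Fr c s s' → Tri M (blk l) s' T₂ Q) :
    Tri M (blk (c :: l)) s (T₁ + T₂ + 1) Q := Tri.seq h h'

theorem Tri.asg {x : ℕ} {e : Expr} {l : List Cmd} (he : e.ival s ≤ M)
    (h : Tri M (blk l) (s.setReg x (e.ival s)) T Q) : Tri M (blk (.assign x e :: l)) s (T + 2) Q :=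
  (Tri.seq (Q₁ := fun s' => s' = s.setReg x (e.ival s)) (Tri.assign he rfl)
    fun s' hs' _ => hs' ▸ h).time (by omega)

theorem Tri.sto {a : ℕ} {i e : Expr} {l : List Cmd} (he : e.ival s ≤ M)
    (h : Tri M (blk l) (s.setArr a (i.ival s) (e.ival s)) T Q) :
    Tri M (blk (.store a i e :: l)) s (T + 2) Q :=
  (Tri.seq (Q₁ := fun s' => s' = s.setArr a (i.ival s) (e.ival s)) (Tri.store he rfl)
    fun s' hs' _ => hs' ▸ h).time (by omega)

theorem Tri.asgv {x v : ℕ} {e : Expr} {l : List Cmd} (he : e.ival s = v) (hv : v ≤ M)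
    (h : Tri M (blk l) (s.setReg x v) T Q) : Tri M (blk (.assign x e :: l)) s (T + 2) Q :=
  Tri.asg (he ▸ hv) (he ▸ h)

theorem Tri.stov {a j v : ℕ} {i e : Expr} {l : List Cmd} (hi : i.ival s = j) (he : e.ival s = v)
    (hv : v ≤ M) (h : Tri M (blk l) (s.setArr a j v) T Q) :
    Tri M (blk (.store a i e :: l)) s (T + 2) Q :=
  Tri.sto (he ▸ hv) (hi ▸ he ▸ h)

/-- Loops with a known number of iterations. -/
theorem Tri.loop {e : Expr} {p : Cmd} (N : ℕ) (t : ℕ → ℕ) (Inv : ℕ → Store → Prop)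
    (h0 : Inv 0 s)
    (hbody : ∀ j < N, ∀ s', Fr (.loop e p) s s' → Inv j s' →
      e.ival s' ≠ 0 ∧ Tri M p s' (t j) (Inv (j + 1)))
    (hend : ∀ s', Fr (.loop e p) s s' → Inv N s' → e.ival s' = 0) :
    Tri M (.loop e p) s (∑ j ∈ rng N, (t j + 1) + 1) (Inv N) := by
  -- Induction on the number `j` of iterations still to come; `N - j` have been made.
  intro b τ f X hX; have key : ∀ j ≤ N, ∀ s', Fr (.loop e p) s s' → Inv (N - j) s' →
      ic M b τ (.loop e p) f s' ≤
        τ * ((∑ i ∈ rng j, (t (N - 1 - i) + 1) + 1 : ℕ) : ℝ≥0∞) + X := by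
    have unf : ∀ s', ic M b τ (.loop e p) f s' ≤
        τ + (if e.ival s' ≠ 0 then ic M b τ p (ic M b τ (.loop e p) f) s' else f s') := by
      refine fun s' => ic_loop_le (X := fun s' => τ + (if e.ival s' ≠ 0 then
        ic M b τ p (ic M b τ (.loop e p) f) s' else f s')) (fun s'' => ?_) s'
      refine add_le_add_right ?_ τ; split_ifs
      · exact ic_mono p s'' fun s3 => ic_loop_unfold e p f s3
      · simp
    intro j
    induction j with
    | zero =>
      intro _ s' hf hI; refine (unf s').trans ?_
      rw [if_neg (by rw [hend s' hf (by simpa using hI)]; simp)]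
      simpa using add_le_add_right (hX s' (by simpa using hI)) τ
    | succ j ih =>
      intro hj s' hf hI; obtain ⟨h1, h2⟩ := hbody (N - (j + 1)) (by omega) s' hf hI
      refine (unf s').trans ?_; rw [if_pos h1]
      have h3 := h2.fr b τ (ic M b τ (.loop e p) f) _ fun s'' hs'' =>
        ih (by omega) s'' (hf.trans (hs''.2.of_le (fun x hx => by simpa [Cmd.modR] using hx)
            (fun x hx => by simpa [Cmd.modA] using hx)))
          (by rw [show N - j = N - (j + 1) + 1 by omega]; exact hs''.1)
      refine le_trans (add_le_add_right h3 τ) (le_of_eq ?_)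
      rw [sum_range_succ, show N - 1 - j = N - (j + 1) by omega]; grind
  have h := key N le_rfl s (Fr.refl _ _) (by simpa using h0)
  rwa [Finset.sum_range_reflect (fun i => t i + 1)] at h

/-- An iteration pays three extra steps for the test, the sequencing and the increment; the last
three pay for the initial assignment, its sequencing and the failing test. -/
theorem Tri.for_ {i : ℕ} {bnd : Expr} {body : Cmd} (N : ℕ) (t : ℕ → ℕ) (Inv : ℕ → Store → Prop)
    (hN : N ≤ M) (hmod : body.modR i = false)
    (hbnd : ∀ j s', Fr (forC i bnd body) s s' → Inv j s' → bnd.ival s' = N)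
    (h0 : Inv 0 (s.setReg i 0))
    (hbody : ∀ j < N, ∀ s', Fr (forC i bnd body) s s' → s'.reg i = j → Inv j s' →
      Tri M body s' (t j) (fun s'' => Inv (j + 1) (s''.setReg i (j + 1)))) :
    Tri M (forC i bnd body) s (∑ j ∈ rng N, (t j + 3) + 3)
      (fun s' => Inv N s' ∧ s'.reg i = N) := by
  have hfr0 : Fr (.assign i 0) s (s.setReg i 0) := ⟨fun x hx => by
    simp only [Cmd.modR, beq_eq_false_iff_ne] at hx; simp [hx.symm], fun _ _ => rfl⟩
  refine (Tri.seq (Q₁ := fun s' => s' = s.setReg i 0) (Tri.assign (Nat.zero_le _) rfl)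
    fun s' hs' _ => ?_).time (T₁ := 1 + (∑ j ∈ rng N, (t j + 1 + 1 + 1) + 1) + 1) ?_
  · subst hs'; refine Tri.loop N (fun j => t j + 1 + 1) (fun j s' => Inv j s' ∧ s'.reg i = j)
      ⟨h0, by simp⟩ ?_ ?_
    · rintro j hj s' hf ⟨hI, hij⟩; have hf' : Fr (forC i bnd body) s s' := hfr0.left.trans hf.right
      refine ⟨by simp [hij, hbnd j s' hf' hI, hj], ?_⟩
      refine Tri.seq (hbody j hj s' hf' hij hI) fun s'' hs'' hfr => ?_
      have hi : s''.reg i = j := (hfr.reg i hmod).trans hij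
      refine Tri.assign (by simp [hi]; omega) ⟨?_, by simp [hi]⟩; simp_all
    · rintro s' hf ⟨hI, hij⟩; simp [hij, hbnd N s' (hfr0.left.trans hf.right) hI]
  · grind

theorem Tri.for_const {i : ℕ} {bnd : Expr} {body : Cmd} (N t : ℕ) (Inv : ℕ → Store → Prop)
    (hN : N ≤ M) (hmod : body.modR i = false)
    (hbnd : ∀ j s', Fr (forC i bnd body) s s' → Inv j s' → bnd.ival s' = N)
    (h0 : Inv 0 (s.setReg i 0))
    (hbody : ∀ j < N, ∀ s', Fr (forC i bnd body) s s' → s'.reg i = j → Inv j s' →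
      Tri M body s' t (fun s'' => Inv (j + 1) (s''.setReg i (j + 1)))) :
    Tri M (forC i bnd body) s (N * (t + 3) + 3) (fun s' => Inv N s' ∧ s'.reg i = N) := by
  refine (Tri.for_ N (fun _ => t) Inv hN hmod hbnd h0 hbody).time ?_; simp

end

/-- Equality test. -/
def eqE (d e : Expr) : Expr := 1 - (.lt d e + .lt e d)

@[simp] theorem ival_eqE (s : Store) (d e : Expr) :
    (eqE d e).ival s = if d.ival s = e.ival s then 1 else 0 := by
  simp only [eqE, ival_sub, ival_one, ival_add, ival_lt]; grind

open _root_.HyperMotivo.Tri (asg asgv assign cons conseq for_ for_const loop nil sto store stov time)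

/-! ## Bit masks -/

theorem land_eq_zero_iff {X Y : ℕ} : X &&& Y = 0 ↔ ∀ i, X.testBit i → Y.testBit i → False := by
  constructor
  · intro h i hx hy; have := congrArg (fun Z => Nat.testBit Z i) h; grind
  · intro h; refine Nat.zero_of_testBit_eq_false fun i => ?_; simp_all

/-- Peels off the lowest bit. The disjointness table is filled by this recursion. -/
theorem land_half (X Y : ℕ) :
    X &&& Y = 0 ↔ X / 2 &&& Y / 2 = 0 ∧ ¬ (X % 2 = 1 ∧ Y % 2 = 1) := by
  rw [← Nat.and_div_two]; have := Nat.and_mod_two_eq_one (a := X) (b := Y); omega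

/-- Disjoint masks add without carries, so addition on the machine is the union of colour sets, and
subtraction is the difference. -/
theorem add_eq_lor : ∀ X Y : ℕ, X &&& Y = 0 → X + Y = X ||| Y := by
  intro X
  induction X using Nat.strong_induction_on with
  | _ X ih =>
    intro Y h; rcases Nat.eq_zero_or_pos X with rfl | hX
    · simp
    · obtain ⟨h1, h2⟩ := (land_half X Y).1 h; have h3 := ih (X / 2) (by omega) (Y / 2) h1
      rw [← Nat.or_div_two] at h3; have h4 := Nat.or_mod_two_eq_one (a := X) (b := Y); omega

theorem testBit_add {X Y : ℕ} (h : X &&& Y = 0) (i : ℕ) :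
    (X + Y).testBit i = (X.testBit i || Y.testBit i) := by
  rw [add_eq_lor X Y h, Nat.testBit_lor]

theorem testBit_sub_pow {Z c : ℕ} (h : Z.testBit c) (i : ℕ) :
    (Z - 2 ^ c).testBit i = (Z.testBit i && decide (i ≠ c)) := by
  have h0 : Nat.ldiff Z (2 ^ c) &&& 2 ^ c = 0 := by rw [land_eq_zero_iff]; simp
  have h1 : Nat.ldiff Z (2 ^ c) + 2 ^ c = Z := by
    rw [add_eq_lor _ _ h0]; refine Nat.eq_of_testBit_eq fun i => ?_
    rw [Nat.testBit_lor, Nat.testBit_ldiff, Nat.testBit_two_pow]; grind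
  rw [show Z - 2 ^ c = Nat.ldiff Z (2 ^ c) by omega, Nat.testBit_ldiff, Nat.testBit_two_pow]; grind

/-- With its converse for disjoint masks below, this makes one comparison of numbers decide which of
two colour sets holds the larger maximum. -/
theorem lt_of_max {P Q y : ℕ} (hQ : Q.testBit y) (hP : ∀ z, P.testBit z → z < y) : P < Q := by
  refine lt_of_lt_of_le (Nat.lt_pow_two_of_testBit P fun i hi => ?_) (Nat.ge_two_pow_of_testBit hQ)
  by_contra h
  grind

theorem exists_max {P Q : ℕ} (h : P < Q) (hd : P &&& Q = 0) :
    ∃ y, Q.testBit y ∧ (∀ z, P.testBit z → z < y) ∧ ∀ z, Q.testBit z → z ≤ y := by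
  obtain ⟨y, hy, hmax⟩ : ∃ y, (Q.testBit y = true) ∧ ∀ z, Q.testBit z → z ≤ y := by
    refine ⟨Q.log2, ?_, fun z hz => ?_⟩
    · exact Nat.testBit_log2 (by omega)
    · exact (Nat.le_log2 (by omega)).2 (Nat.ge_two_pow_of_testBit hz)
  refine ⟨y, hy, fun z hz => ?_, hmax⟩
  by_contra hc
  rcases Nat.lt_or_ge y z with h' | h'
  · exact absurd (lt_of_max hz fun x hx => (hmax x hx).trans_lt h') (by omega)
  · have : z = y := by omega
    subst this; exact land_eq_zero_iff.1 hd _ hz hy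

/-! ## Binary derivation trees -/

/-- Rooted trees, built by attaching a tree `b` to the root of a tree `a`. -/
inductive BT where
  | leaf (u : ℕ)
  | node (a b : BT)

namespace BT

def root : BT → ℕ
  | leaf u => u
  | node a _ => a.root

def leaves : BT → List ℕ
  | leaf u => [u]
  | node a b => a.leaves ++ b.leaves

def mask (col : ℕ → ℕ) : BT → ℕ
  | leaf u => 2 ^ col u
  | node a b => a.mask col + b.mask col

/-- The prefix code of a tree with labelled leaves. -/
def enc (φ : ℕ → ℕ) : BT → List ℕ
  | leaf u => [φ u + 1]
  | node a b => 0 :: (a.enc φ ++ b.enc φ)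

theorem root_mem (t : BT) : t.root ∈ t.leaves := by
  induction t with
  | leaf u => simp [root, leaves]
  | node a b iha _ => simp [root, leaves, iha]

theorem length_enc (φ : ℕ → ℕ) (t : BT) : (t.enc φ).length + 1 = 2 * t.leaves.length := by
  induction t with
  | leaf u => simp [enc, leaves]
  | node a b iha ihb => simp [enc, leaves]; omega

theorem enc_le {φ : ℕ → ℕ} {N : ℕ} (t : BT) (h : ∀ u ∈ t.leaves, φ u < N) :
    ∀ x ∈ t.enc φ, x ≤ N := by
  induction t with
  | leaf u => simpa [enc, leaves, Nat.succ_le_iff] using h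
  | node a b iha ihb =>
    intro x hx; simp only [enc, mem_cons, mem_append] at hx; rcases hx with rfl | hx | hx
    · omega
    · exact iha (fun u hu => h u (by simp [leaves, hu])) x hx
    · exact ihb (fun u hu => h u (by simp [leaves, hu])) x hx

/-- The code is prefix-free: `0` announces an inner node, a positive number a leaf. The remainders
`r` and `r'` are there for the induction; later they absorb the padding to equal length. -/
theorem enc_inj {φ : ℕ → ℕ} (t : BT) : ∀ (t' : BT) (r r' : List ℕ),
    (∀ u ∈ t.leaves, ∀ u' ∈ t'.leaves, φ u = φ u' → u = u') →
    t.enc φ ++ r = t'.enc φ ++ r' → t = t' ∧ r = r' := by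
  induction t with
  | leaf u =>
    intro t' r r' h he
    cases t' with
    | leaf u' =>
      simp only [enc, List.cons_append, List.nil_append, List.cons.injEq, add_left_inj] at he
      exact ⟨by rw [h u (by simp [leaves]) u' (by simp [leaves]) he.1], he.2⟩
    | node a b => simp [enc] at he
  | node a b iha ihb =>
    intro t' r r' h he
    cases t' with
    | leaf u' => simp [enc] at he
    | node a' b' =>
      simp only [enc, List.cons_append, List.append_assoc, List.cons.injEq, true_and] at he
      obtain ⟨rfl, h2⟩ := iha a' _ _
        (fun u hu u' hu' => h u (by simp [leaves, hu]) u' (by simp [leaves, hu'])) he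
      obtain ⟨rfl, h3⟩ := ihb b' _ _
        (fun u hu u' hu' => h u (by simp [leaves, hu]) u' (by simp [leaves, hu'])) h2
      grind

/-- Used twice: with vertices as labels it bounds the numbers in the tables, and with colours as
labels it bounds the number of trees on one vertex set. -/
theorem card_le_of_code (S : Finset BT) (φ : ℕ → ℕ) (N K : ℕ)
    (hφ : ∀ t ∈ S, ∀ u ∈ t.leaves, φ u < N)
    (hinj : ∀ t ∈ S, ∀ t' ∈ S, ∀ u ∈ t.leaves, ∀ u' ∈ t'.leaves, φ u = φ u' → u = u')
    (hlen : ∀ t ∈ S, t.leaves.length ≤ K) : S.card ≤ (N + 1) ^ (2 * K) := by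
  have hlen' : ∀ t ∈ S, (t.enc φ).length ≤ 2 * K := fun t ht => by
    have := length_enc φ t; have := hlen t ht; omega
  have hle : ∀ t ∈ S, ∀ i, (t.enc φ).getD i 0 < N + 1 := by
    intro t ht i; rw [List.getD_eq_getElem?_getD]; rcases Nat.lt_or_ge i (t.enc φ).length with h | h
    · rw [List.getElem?_eq_getElem h]
      exact Nat.lt_succ_of_le (enc_le t (hφ t ht) _ (getElem_mem h))
    · simp_all
  let F : S → (Fin (2 * K) → Fin (N + 1)) := fun t i => ⟨(t.1.enc φ).getD i 0, hle t.1 t.2 i⟩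
  have hF : Function.Injective F := by
    rintro ⟨t, ht⟩ ⟨t', ht'⟩ h; have pad : t.enc φ ++ List.replicate (2 * K - (t.enc φ).length) 0 =
        t'.enc φ ++ List.replicate (2 * K - (t'.enc φ).length) 0 := by
      have h1 := hlen' t ht; have h2 := hlen' t' ht'
      refine List.ext_getElem (by simp; omega) fun i hi hi' => ?_
      have hi2 : i < 2 * K := by simp at hi; omega
      have h3 := congrArg Fin.val (congrFun h ⟨i, hi2⟩); grind
    exact Subtype.ext (enc_inj t t' _ _ (hinj t ht t' ht') pad).1
  have := Fintype.card_le_of_injective F hF; simp_all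

end BT

/-! ## Valid derivation trees -/

section trees

variable (n : ℕ) (col : ℕ → ℕ) (Nb : ℕ → Finset ℕ)

open BT

/-- `t` derives a colourful tree; the subtree that is attached last contains the largest colour
among the colours other than that of the root. -/
def Valid : BT → Prop
  | leaf u => u < n
  | node a b => Valid a ∧ Valid b ∧ b.root ∈ Nb a.root ∧ a.mask col &&& b.mask col = 0 ∧
      a.mask col - 2 ^ col a.root < b.mask col

variable {n col Nb}

theorem Valid.leaves_lt {t : BT} (h : Valid n col Nb t) : ∀ u ∈ t.leaves, u < n := by
  induction t with
  | leaf u => simpa [leaves, Valid] using h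
  | node a b iha ihb =>
    intro u hu; simp only [leaves, mem_append] at hu; exact hu.elim (iha h.1 u) (ihb h.2.1 u)

theorem Valid.testBit {t : BT} (h : Valid n col Nb t) (x : ℕ) :
    (t.mask col).testBit x = true ↔ ∃ u ∈ t.leaves, col u = x := by
  induction t with
  | leaf u => simp [mask, leaves, Nat.testBit_two_pow]
  | node a b iha ihb =>
    rw [mask, testBit_add h.2.2.2.1, Bool.or_eq_true, iha h.1, ihb h.2.1]
    simp [leaves, or_and_right, exists_or]

theorem Valid.nodup {t : BT} (h : Valid n col Nb t) : (t.leaves.map col).Nodup := by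
  induction t with
  | leaf u => simp [leaves]
  | node a b iha ihb =>
    rw [leaves, List.map_append, List.nodup_append]; refine ⟨iha h.1, ihb h.2.1, ?_⟩
    rintro x hx y hy rfl; simp only [List.mem_map] at hx hy
    exact land_eq_zero_iff.1 h.2.2.2.1 x ((h.1.testBit x).2 hx) ((h.2.1.testBit x).2 hy)

theorem Valid.inj {t : BT} (h : Valid n col Nb t) {u v : ℕ} (hu : u ∈ t.leaves)
    (hv : v ∈ t.leaves) (huv : col u = col v) : u = v :=
  List.inj_on_of_nodup_map h.nodup hu hv huv

theorem mask_pos (t : BT) : 0 < t.mask col := by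
  induction t with
  | leaf u => simp [mask]
  | node a b iha ihb => simp only [mask]; omega

theorem Valid.length_le {t : BT} (h : Valid n col Nb t) {K : ℕ} (hK : t.mask col < 2 ^ K) :
    t.leaves.length ≤ K := by
  have h1 : (t.leaves.map col).toFinset ⊆ rng K := by
    intro x hx; simp only [List.mem_toFinset, List.mem_map] at hx
    have h2 := Nat.ge_two_pow_of_testBit ((h.testBit x).2 hx)
    exact mem_rng.2 ((Nat.pow_lt_pow_iff_right (by omega)).1 (h2.trans_lt hK))
  have h2 := Finset.card_le_card h1
  rwa [toFinset_card_of_nodup h.nodup, List.length_map, card_range] at h2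

/-- The colours in a valid tree are distinct and `C < 2 ^ C`, so there are at most `C` leaves, and
the code leaves finitely many trees. -/
theorem finite_trees (n C u : ℕ) (col : ℕ → ℕ) (Nb : ℕ → Finset ℕ) :
    {t : BT | Valid n col Nb t ∧ t.mask col = C ∧ t.root = u}.Finite := by
  by_contra hinf
  obtain ⟨S, hS, hcard⟩ := Set.Infinite.exists_subset_card_eq hinf ((n + 1) ^ (2 * C) + 1)
  have := card_le_of_code S id n C (fun t ht u hu => (hS ht).1.leaves_lt u hu)
    (fun _ _ _ _ _ _ _ _ h => h)
    (fun t ht => (hS ht).1.length_le ((hS ht).2.1 ▸ lt_two_pow_self))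
  omega

variable (n col Nb) in
/-- The valid trees with colour set `C` and root `u`. -/
noncomputable def TS (C u : ℕ) : Finset BT := (finite_trees n C u col Nb).toFinset

theorem mem_TS {C u : ℕ} {t : BT} :
    t ∈ TS n col Nb C u ↔ Valid n col Nb t ∧ t.mask col = C ∧ t.root = u := by
  simp [TS]

variable (n col Nb) in
noncomputable def cnt (C u : ℕ) : ℕ := (TS n col Nb C u).card

variable (n col Nb) in
noncomputable def adjCnt (C v : ℕ) : ℕ := ∑ u ∈ Nb v, cnt n col Nb C u

theorem cnt_le {C u k : ℕ} (hC : C < 2 ^ k) : cnt n col Nb C u ≤ (n + 1) ^ (2 * k) :=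
  card_le_of_code _ id n k (fun _ ht u hu => (mem_TS.1 ht).1.leaves_lt u hu)
    (fun _ _ _ _ _ _ _ _ h => h)
    (fun _ ht => (mem_TS.1 ht).1.length_le ((mem_TS.1 ht).2.1 ▸ hC))

theorem Valid.col_root {t : BT} (h : Valid n col Nb t) : (t.mask col).testBit (col t.root) :=
  (h.testBit _).2 ⟨_, t.root_mem, rfl⟩

theorem cnt_eq_zero {C u : ℕ} (h : C.testBit (col u) = false) : cnt n col Nb C u = 0 := by
  rw [cnt, card_eq_zero, Finset.eq_empty_iff_forall_notMem]; intro t ht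
  obtain ⟨h1, h2, h3⟩ := mem_TS.1 ht; have := h1.col_root; simp_all

/-- The splittings `C = X + (C - X)` that are allowed at a root with colour `x`. -/
def SplitOK (x C X : ℕ) : Prop := X &&& (C - X) = 0 ∧ X - 2 ^ x < C - X

instance (x C X : ℕ) : Decidable (SplitOK x C X) := inferInstanceAs (Decidable (_ ∧ _))

/-- A tree that is not a leaf splits uniquely into `a` and `b`; it is classified by the colours `X`
of `a` and the root of `b`. The summand is arbitrary because the same decomposition yields both the
recurrence for the counts and the law of the sampled trees. -/
theorem sum_TS {A : Type*} [AddCommMonoid A] (C u : ℕ) (hu : u < n) (f : BT → A) :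
    ∑ t ∈ TS n col Nb C u, f t = (if C = 2 ^ col u then f (leaf u) else 0) +
      ∑ X ∈ rng C, if SplitOK (col u) C X then
        ∑ a ∈ TS n col Nb X u, ∑ v ∈ Nb u, ∑ b ∈ TS n col Nb (C - X) v, f (node a b) else 0 := by
  classical
  let isLeaf : BT → Prop := fun t => ∃ u, t = leaf u
  rw [← Finset.sum_filter_add_sum_filter_not _ isLeaf]; congr 1
  · split_ifs with h
    · have : (TS n col Nb C u).filter isLeaf = {leaf u} := by
        ext t; simp only [mem_filter, mem_TS, Finset.mem_singleton]; constructor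
        · rintro ⟨⟨-, -, h3⟩, v, rfl⟩; simp only [root] at h3; rw [h3]
        · rintro rfl; exact ⟨⟨hu, h.symm, rfl⟩, u, rfl⟩
      simp_all
    · refine sum_eq_zero fun t ht => ?_; simp only [mem_filter, mem_TS] at ht
      obtain ⟨⟨-, h2, h3⟩, v, rfl⟩ := ht; simp only [root, mask] at h2 h3; simp_all
  · have h1 : ∀ X ∈ rng C, (if SplitOK (col u) C X then
        ∑ a ∈ TS n col Nb X u, ∑ v ∈ Nb u, ∑ b ∈ TS n col Nb (C - X) v, f (node a b) else 0) =
        ∑ p ∈ if SplitOK (col u) C X then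
          TS n col Nb X u ×ˢ (Nb u).biUnion (fun v => TS n col Nb (C - X) v) else ∅,
          f (node p.1 p.2) := by
      intro X _; split_ifs
      · rw [Finset.sum_product]; refine sum_congr rfl fun a _ => ?_; rw [Finset.sum_biUnion]
        intro v _ v' _ hvv; refine Finset.disjoint_left.2 fun t ht ht' => hvv ?_
        rw [← (mem_TS.1 ht).2.2, (mem_TS.1 ht').2.2]
      · simp
    -- Leaves have been filtered out, so the value of the map at a leaf is a dummy.
    rw [sum_congr rfl h1, Finset.sum_sigma']; refine Finset.sum_bij' (fun t _ => match t with
        | leaf u => ⟨0, leaf u, leaf u⟩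
        | node a b => ⟨a.mask col, a, b⟩) (fun p _ => node p.2.1 p.2.2) ?_ ?_ ?_ ?_ ?_
    · intro t ht; simp only [mem_filter, mem_TS] at ht; obtain ⟨⟨h2, h3, h4⟩, h5⟩ := ht
      cases t with
      | leaf v => exact absurd ⟨v, rfl⟩ h5
      | node a b =>
        simp only [root, mask] at h3 h4; have hb := mask_pos (col := col) b
        have e : C - a.mask col = b.mask col := by omega
        have ok : SplitOK (col u) C (a.mask col) := by rw [SplitOK, e, ← h4]; exact h2.2.2.2
        simp only [Finset.mem_sigma, mem_rng, if_pos ok, Finset.mem_product, mem_TS,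
          Finset.mem_biUnion, e]
        exact ⟨by omega, ⟨h2.1, trivial, h4⟩, b.root, h4 ▸ h2.2.2.1, h2.2.1, trivial, rfl⟩
    · rintro ⟨X, a, b⟩ hp; simp only [Finset.mem_sigma, mem_rng] at hp; obtain ⟨hX, hp⟩ := hp
      split_ifs at hp with ok
      · simp only [Finset.mem_product, mem_TS, Finset.mem_biUnion] at hp
        obtain ⟨⟨h1, h2, h3⟩, v, hv, h4, h5, h6⟩ := hp; simp only [mem_filter, mem_TS]
        refine ⟨⟨⟨h1, h4, ?_, ?_, ?_⟩, ?_, h3⟩, ?_⟩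
        · simp_all
        · rw [h2, h5]; exact ok.1
        · rw [h2, h5, h3]; exact ok.2
        · simp only [mask]; omega
        · grind
      · simp at hp
    · grind
    · rintro ⟨X, a, b⟩ hp; simp only [Finset.mem_sigma] at hp; obtain ⟨-, hp⟩ := hp
      split_ifs at hp with ok
      · simp only [Finset.mem_product, mem_TS] at hp; simp_all
      · simp at hp
    · grind

/-- Only masks below `C` enter, apart from `X = 0`, whose term vanishes. Hence the tables can be
filled in the order of the numbers `C`. -/
theorem cnt_rec (C u : ℕ) (hu : u < n) :
    cnt n col Nb C u = (if C = 2 ^ col u then 1 else 0) +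
      ∑ X ∈ rng C, if SplitOK (col u) C X then
        cnt n col Nb X u * adjCnt n col Nb (C - X) u else 0 := by
  have := sum_TS (Nb := Nb) (col := col) C u hu (fun _ => 1); simpa [cnt, adjCnt] using this

end trees

/-! ## Canonical trees -/

section canonical
open BT
variable {n : ℕ} {col : ℕ → ℕ} {Nb : ℕ → Finset ℕ}

/-- The leaf set of a tree. -/
def BT.verts (t : BT) : Finset ℕ := t.leaves.toFinset

theorem mem_verts {t : BT} {u : ℕ} : u ∈ t.verts ↔ u ∈ t.leaves := List.mem_toFinset

theorem verts_node (a b : BT) : (node a b).verts = a.verts ∪ b.verts := by simp [verts, leaves]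

variable (col Nb) in
/-- The local condition for canonical trees: an attached tree `b` is a connected component of the
rest, and its root is the neighbour of the root of `a` with the least colour. -/
def Canon : BT → Prop
  | leaf _ => True
  | node a b => Canon a ∧ Canon b ∧ ∀ x ∈ a.verts, ∀ y ∈ b.verts, x ∈ Nb y →
      x = a.root ∧ col b.root ≤ col y

variable (Nb) in
/-- Connectedness of a vertex set, by cuts. -/
def Conn (W : Finset ℕ) : Prop := ∀ S ⊆ W, S.Nonempty → (∀ a ∈ S, ∀ b ∈ W, a ∈ Nb b → b ∈ S) → S = W

/-- Adjacency is symmetric on the vertices. -/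
def SymNb (n : ℕ) (Nb : ℕ → Finset ℕ) : Prop := ∀ u < n, ∀ v < n, u ∈ Nb v → v ∈ Nb u

/-- Within each of the two halves a closed nonempty set is everything by induction, and the edge
between the two roots carries it from one half to the other. -/
theorem Valid.conn (hs : SymNb n Nb) {t : BT} (h : Valid n col Nb t) : Conn Nb t.verts := by
  classical
  induction t with
  | leaf u => intro S hS hne _; have : (leaf u).verts = {u} := rfl; grind
  | node a b iha ihb =>
    intro S hS hne hc; rw [verts_node] at hS hc ⊢; have ra := mem_verts.2 a.root_mem
    have rb := mem_verts.2 b.root_mem; have hab : b.root ∈ Nb a.root := h.2.2.1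
    have hba : a.root ∈ Nb b.root :=
      hs _ (h.2.1.leaves_lt _ b.root_mem) _ (h.1.leaves_lt _ a.root_mem) hab
    have keyA : (S ∩ a.verts).Nonempty → a.verts ⊆ S := fun hn => by
      have := iha h.1 (S ∩ a.verts) Finset.inter_subset_right hn (fun x hx y hy hxy => by grind)
      simp_all
    have keyB : (S ∩ b.verts).Nonempty → b.verts ⊆ S := fun hn => by
      have := ihb h.2.1 (S ∩ b.verts) Finset.inter_subset_right hn (fun x hx y hy hxy => by grind)
      simp_all
    have hA : a.verts ⊆ S → b.verts ⊆ S := fun hA => keyB ⟨b.root, Finset.mem_inter.2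
      ⟨hc _ (hA ra) _ (Finset.mem_union_right _ rb) hba, rb⟩⟩
    have hB : b.verts ⊆ S → a.verts ⊆ S := fun hB => keyA ⟨a.root, Finset.mem_inter.2
      ⟨hc _ (hB rb) _ (Finset.mem_union_left _ ra) hab, ra⟩⟩
    refine Finset.Subset.antisymm hS ?_; obtain ⟨x, hx⟩ := hne
    rcases Finset.mem_union.1 (hS hx) with hx' | hx'
    · have := keyA ⟨x, Finset.mem_inter.2 ⟨hx, hx'⟩⟩; grind
    · have := keyB ⟨x, Finset.mem_inter.2 ⟨hx, hx'⟩⟩; grind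

/-- The vertex with the largest colour among the vertices other than the root lies in the part that
is attached last. -/
theorem Valid.top_mem {a b : BT} (h : Valid n col Nb (node a b)) :
    ∃ y ∈ b.verts, (∀ z ∈ a.verts, z ≠ a.root → col z < col y) ∧
      ∀ z ∈ b.verts, col z ≤ col y := by
  obtain ⟨ha, hb, -, hd, hlt⟩ := h
  have hd' : (a.mask col - 2 ^ col a.root) &&& b.mask col = 0 := by
    rw [land_eq_zero_iff] at hd ⊢; intro i hi hi'; rw [testBit_sub_pow ha.col_root] at hi; simp_all
  obtain ⟨x, hx, h1, h2⟩ := exists_max hlt hd'; obtain ⟨y, hy, rfl⟩ := (hb.testBit x).1 hx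
  refine ⟨y, mem_verts.2 hy, fun z hz hzr => h1 _ ?_, fun z hz => h2 _ ?_⟩
  · rw [testBit_sub_pow ha.col_root]; simp only [Bool.and_eq_true, decide_eq_true_eq]
    exact ⟨(ha.testBit _).2 ⟨z, mem_verts.1 hz, rfl⟩,
      fun hc => hzr (ha.inj (mem_verts.1 hz) a.root_mem hc)⟩
  · exact (hb.testBit _).2 ⟨z, mem_verts.1 hz, rfl⟩

theorem Valid.disjoint {a b : BT} (h : Valid n col Nb (node a b)) : Disjoint a.verts b.verts := by
  refine Finset.disjoint_left.2 fun x hx hy => ?_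
  exact land_eq_zero_iff.1 h.2.2.2.1 (col x) ((h.1.testBit _).2 ⟨x, mem_verts.1 hx, rfl⟩)
    ((h.2.1.testBit _).2 ⟨x, mem_verts.1 hy, rfl⟩)

/-- The vertex of largest colour apart from the root lies in both `b` and `b'`. Now `b'` is
connected and avoids the root, whereas in a canonical tree the edges that leave `b` go only to the
root; so `b'` cannot leave `b`. -/
theorem canon_subset (hs : SymNb n Nb) {a b a' b' : BT} (h : Valid n col Nb (node a b))
    (hc : Canon col Nb (node a b)) (h' : Valid n col Nb (node a' b'))
    (hr : a.root = a'.root) (hv : (node a b).verts = (node a' b').verts) : b'.verts ⊆ b.verts := by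
  classical
  obtain ⟨y, hy, hy1, hy2⟩ := h.top_mem; obtain ⟨y', hy', hy1', hy2'⟩ := h'.top_mem
  have hb'r : a.root ∉ b'.verts := fun hm =>
    Finset.disjoint_left.1 h'.disjoint (mem_verts.2 (hr ▸ a'.root_mem)) hm
  have hbr : a.root ∉ b.verts := fun hm =>
    Finset.disjoint_left.1 h.disjoint (mem_verts.2 a.root_mem) hm
  have hy'b : y' ∈ b.verts := by
    have : y' ∈ (node a b).verts := by rw [hv, verts_node]; exact Finset.mem_union_right _ hy'
    rw [verts_node, Finset.mem_union] at this; refine this.resolve_left fun hm => ?_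
    have h1 := hy1 y' hm (fun e => hb'r (e ▸ hy'))
    have : y ∈ (node a' b').verts := by rw [← hv, verts_node]; exact Finset.mem_union_right _ hy
    rw [verts_node, Finset.mem_union] at this; grind
  have := h'.2.1.conn hs (b'.verts ∩ b.verts) Finset.inter_subset_left
    ⟨y', Finset.mem_inter.2 ⟨hy', hy'b⟩⟩ (fun x hx z hz hxz => by
      simp only [Finset.mem_inter] at hx ⊢; refine ⟨hz, ?_⟩
      have : z ∈ (node a b).verts := by rw [hv, verts_node]; exact Finset.mem_union_right _ hz
      rw [verts_node, Finset.mem_union] at this; refine this.resolve_left fun hm => ?_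
      have hzx := hs x (h.2.1.leaves_lt _ (mem_verts.1 hx.2)) z
        (h.1.leaves_lt _ (mem_verts.1 hm)) hxz
      exact hb'r ((hc.2.2 z hm x hx.2 hzx).1 ▸ hz))
  simp_all

/-- Both inclusions determine the last part as a set, and the condition of least colour determines
its root. Induction does the rest. -/
theorem canon_unique (hs : SymNb n Nb) (t : BT) : ∀ t' : BT, Valid n col Nb t → Canon col Nb t →
    Valid n col Nb t' → Canon col Nb t' → t.root = t'.root → t.verts = t'.verts → t = t' := by
  classical
  have hne : ∀ {a b : BT} {u : ℕ}, Valid n col Nb (node a b) → (leaf u).root = (node a b).root →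
      (leaf u).verts = (node a b).verts → False := fun {a b u} h hr hv => by
    have h1 : b.root ∈ (leaf u).verts := by
      rw [hv, verts_node]; exact Finset.mem_union_right _ (mem_verts.2 b.root_mem)
    have h2 : b.root = a.root := by
      rw [show a.root = u from hr.symm]; simpa [verts, leaves] using h1
    exact Finset.disjoint_left.1 h.disjoint (mem_verts.2 a.root_mem)
      (h2 ▸ mem_verts.2 b.root_mem)
  induction t with
  | leaf u =>
    intro t' h hc h' hc' hr hv
    cases t' with
    | leaf u' => simp only [root] at hr; rw [hr]
    | node a b => exact (hne h' hr hv).elim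
  | node a b iha ihb =>
    intro t' h hc h' hc' hr hv
    cases t' with
    | leaf u' => exact (hne h hr.symm hv.symm).elim
    | node a' b' =>
      have hb : b.verts = b'.verts := Finset.Subset.antisymm
        (canon_subset hs h' hc' h hr.symm hv.symm) (canon_subset hs h hc h' hr hv)
      have ha : a.verts = a'.verts := by
        have e1 := Finset.union_sdiff_cancel_right h.disjoint
        have e2 := Finset.union_sdiff_cancel_right h'.disjoint
        rw [← e1, ← e2, ← verts_node, ← verts_node, hv, hb]
      have hra := iha a' h.1 hc.1 h'.1 hc'.1 hr ha; have hrb : b.root = b'.root := by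
        have m1 := mem_verts.2 b.root_mem; have m2 := mem_verts.2 b'.root_mem
        have adj : ∀ {c d : BT}, Valid n col Nb (node c d) → c.root ∈ Nb d.root := fun h =>
          hs _ (h.2.1.leaves_lt _ (root_mem _)) _ (h.1.leaves_lt _ (root_mem _)) h.2.2.1
        have l1 := (hc.2.2 a.root (mem_verts.2 a.root_mem) b'.root (hb ▸ m2)
          (by have := adj h'; rwa [show a'.root = a.root from hr.symm] at this)).2
        have l2 := (hc'.2.2 a'.root (mem_verts.2 a'.root_mem) b.root (hb ▸ m1)
          (by have := adj h; rwa [show a.root = a'.root from hr] at this)).2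
        exact h.2.1.inj (mem_verts.1 m1) (mem_verts.1 (hb ▸ m2)) (le_antisymm l1 l2)
      rw [hra, ihb b' h.2.1 hc.2.1 h'.2.1 hc'.2.1 hrb hb]

/-- Let `y` have the largest colour in `W` apart from `u`. The last part must be the component `B`
of `y` in `W` without `u`, attached at the neighbour `r` of `u` in `B` with the least colour. Then
recurse into `B` with root `r` and into the rest with root `u`. -/
theorem canon_exists (hs : SymNb n Nb) (N : ℕ) : ∀ (W : Finset ℕ) (u : ℕ), W.card = N →
    (∀ v ∈ W, v < n) → Set.InjOn col W → u ∈ W → Conn Nb W →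
    ∃ t, Valid n col Nb t ∧ Canon col Nb t ∧ t.root = u ∧ t.verts = W := by
  classical
  induction N using Nat.strong_induction_on with
  | _ N ih =>
    intro W u hN hW hcol hu hconn; by_cases hW1 : W = {u}
    · exact ⟨leaf u, hW u hu, trivial, rfl, hW1.symm⟩
    have hne : (W.erase u).Nonempty := by
      rw [Finset.nonempty_iff_ne_empty]; intro h; rw [Finset.erase_eq_empty_iff] at h; simp_all
    obtain ⟨y, hy, hmax⟩ := Finset.exists_max_image (W.erase u) col hne
    let R : ℕ → ℕ → Prop := fun a b => a ∈ Nb b ∧ b ∈ W.erase u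
    let B : Finset ℕ := (W.erase u).filter fun z => Relation.ReflTransGen R y z
    have hBW : ∀ z ∈ B, z ∈ W ∧ z ≠ u := fun z hz => by
      grind
    have hyB : y ∈ B := mem_filter.2 ⟨hy, Relation.ReflTransGen.refl⟩
    have hBstep : ∀ a ∈ B, ∀ b ∈ W, b ≠ u → a ∈ Nb b → b ∈ B := fun a ha b hb hbu hab => by
      grind
    have sym : ∀ a ∈ W, ∀ b ∈ W, a ∈ Nb b → b ∈ Nb a := fun a ha b hb =>
      hs a (hW a ha) b (hW b hb)
    have hBconn : Conn Nb B := by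
      intro S hS hSne hc; have hyS : y ∈ S := by
        obtain ⟨z, hz⟩ := hSne; have hr := (mem_filter.1 (hS hz)).2; have hzB := hS hz
        induction hr with
        | refl => exact hz
        | @tail b c hb hbc ihr => grind
      refine Finset.Subset.antisymm hS fun z hz => ?_; have hr := (mem_filter.1 hz).2; clear hz
      induction hr with
      | refl => exact hyS
      | @tail b c hb hbc ihr => exact hc b ihr c (mem_filter.2 ⟨hbc.2, hb.tail hbc⟩) hbc.1
    -- Otherwise no edge would leave `B`, although `W` is connected and contains `u` outside `B`.
    have hnb : ∃ r ∈ B, u ∈ Nb r := by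
      by_contra hno
      push Not at hno
      have := hconn B (fun z hz => (hBW z hz).1) ⟨y, hyB⟩ (fun a ha b hb hab => by grind); simp_all
    obtain ⟨r, hr, hrmin⟩ := Finset.exists_min_image (B.filter fun r => u ∈ Nb r) col
      (by obtain ⟨r, h1, h2⟩ := hnb; exact ⟨r, mem_filter.2 ⟨h1, h2⟩⟩)
    obtain ⟨hrB, hrN⟩ := mem_filter.1 hr; have huB : u ∉ B := fun h => (hBW u h).2 rfl
    -- The rest stays connected because only `u` is adjacent to `B`: a closed set that contains `u`
    -- is completed by `B` to a closed set in `W`, and one without `u` is itself closed in `W`.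
    have hBsub : B ⊆ W := fun z hz => (hBW z hz).1; have hAconn : Conn Nb (W \ B) := by
      intro S hS hSne hc; by_cases huS : u ∈ S
      · have := hconn (S ∪ B) (Finset.union_subset (hS.trans Finset.sdiff_subset) hBsub)
          ⟨u, Finset.mem_union_left _ huS⟩ (fun a ha b hb hab => by grind)
        refine Finset.Subset.antisymm hS fun z hz => ?_; grind
      · have hS' : S ⊆ W := hS.trans Finset.sdiff_subset
        have := hconn S hS' hSne (fun a ha b hb hab => by grind); simp_all
    have hcA : (W \ B).card < N := hN ▸ Finset.card_lt_card
      ⟨Finset.sdiff_subset, fun h => (Finset.mem_sdiff.1 (h (hBsub hyB))).2 hyB⟩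
    have hcB : B.card < N := hN ▸ Finset.card_lt_card ⟨hBsub, fun h => huB (h hu)⟩
    obtain ⟨a, ha, hca, hra, hva⟩ := ih _ hcA (W \ B) u rfl
      (fun v hv => hW v (Finset.mem_sdiff.1 hv).1)
      (hcol.mono (by intro x hx; exact (Finset.mem_sdiff.1 (mem_coe.1 hx)).1))
      (Finset.mem_sdiff.2 ⟨hu, huB⟩) hAconn
    obtain ⟨b, hb, hcb, hrb, hvb⟩ := ih _ hcB B r rfl (fun v hv => hW v (hBsub hv))
      (hcol.mono (by intro x hx; exact hBsub (mem_coe.1 hx))) hrB hBconn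
    have hAm : ∀ z ∈ a.leaves, z ∈ W ∧ z ∉ B := fun z hz => by
      have := mem_verts.2 hz; rw [hva] at this; exact Finset.mem_sdiff.1 this
    have hBm : ∀ z ∈ b.leaves, z ∈ B := fun z hz => by
      have := mem_verts.2 hz; rwa [hvb] at this
    refine ⟨node a b, ⟨ha, hb, ?_, ?_, ?_⟩, ⟨hca, hcb, ?_⟩, hra, ?_⟩
    · simp_all
    · rw [land_eq_zero_iff]; intro i h1 h2; obtain ⟨p, hp, rfl⟩ := (ha.testBit i).1 h1
      obtain ⟨q, hq, hpq⟩ := (hb.testBit _).1 h2; have := hcol (hBsub (hBm q hq)) (hAm p hp).1 hpq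
      grind
    · refine lt_of_max (y := col y) ?_ fun z hz => ?_
      · exact (hb.testBit _).2 ⟨y, mem_verts.1 (hvb ▸ hyB), rfl⟩
      · rw [testBit_sub_pow ha.col_root] at hz
        simp only [Bool.and_eq_true, decide_eq_true_eq] at hz
        obtain ⟨p, hp, rfl⟩ := (ha.testBit z).1 hz.1
        have hpu : p ≠ u := fun e => hz.2 (by rw [hra, e])
        refine lt_of_le_of_ne (hmax p (Finset.mem_erase.2 ⟨hpu, (hAm p hp).1⟩)) fun e => ?_
        exact (hAm p hp).2 (hcol (hAm p hp).1 (hBsub hyB) e ▸ hyB)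
    · grind
    · rw [verts_node, hva, hvb, Finset.sdiff_union_of_subset hBsub]

end canonical

/-! ## The programs

Registers: `0`-`3` input, `4`, `5` output, `6` is `2 ^ k`, `7` is `n + 1`, `8` is `m + n + 1`, the
number of vertex lists: list `e < m` belongs to the hyperedge `e` with more than `α` vertices, list
`m + v` consists of the vertices that share a hyperedge of size at most `α`, but none of larger
size, with `v`, and list `m + n` of the vertices of colour `0`.

Arrays: `0`, `1` input, `2` colouring, `3`-`5` output, `6` disjointness of masks, `7` powers of `2`,
`8` powers of `n + 1`, `9` number of sets of large hyperedges at a vertex, `10`, `11` lists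
containing a vertex, `12` nodes of a trie for the sets of large hyperedges at a vertex, `13`, `14`
edges and parities of the trie, `15`, `16`, `17` lengths, entries, and incidence of the vertex lists,
`18` numbers of small hyperedges that contain a set, `19`, `20` numbers of trees at a vertex and
at its neighbours, `21` sums of these numbers for the nodes of the trie, `22`-`26` sampling tables,
`27`-`30` the sampled tree, `31`-`33` stack, `34` multiplicities of the output. -/

abbrev rg (x : ℕ) : Expr := .reg x
abbrev ld (a : ℕ) (e : Expr) : Expr := .load a e

/-- The size of the hyperedge in register `10`. -/
def szE : Expr := ld 0 (rg 10 + 1) - ld 0 (rg 10)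

def initC : Cmd := blk [
  .assign 6 1,
  .assign 7 (rg 2 + 1),
  .assign 8 (rg 3 + rg 2 + 1),
  .assign 9 1,
  forC 10 (rg 0) (blk [
    .store 7 (rg 10) (rg 6),
    .store 8 (rg 10) (rg 9),
    .assign 6 (rg 6 * 2),
    .assign 9 (rg 9 * rg 7)])]

def colorC : Cmd := forC 10 (rg 2) (blk [
  .rand 11 (rg 0),
  .store 2 (rg 10) (rg 11)])

/-- The cell for a pair of masks is computed from the cell for their halves, which has a smaller
address, and from the lowest bits. -/
def disC : Cmd := blk [
  .store 6 0 1,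
  forC 10 (rg 6 * rg 6) (.store 6 (rg 10)
    (ld 6 (rg 10 / rg 6 / 2 * rg 6 + rg 10 % rg 6 / 2) *
      (1 - rg 10 / rg 6 % 2 * (rg 10 % rg 6 % 2))))]

/-- Append the vertex `u` to the list `id`. -/
def appendC (id u : Expr) : Cmd := blk [
  .store 17 (u * rg 8 + id) 1,
  .store 16 (ld 15 id * rg 8 + id) u,
  .store 15 id (ld 15 id + 1)]

/-- Besides listing the vertices of colour `0`, this gives every vertex one trie node, namely node
`0`, which stands for the empty set. -/
def rootC : Cmd := forC 10 (rg 2) (blk [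
  .store 9 (rg 10) 1,
  .branch (ld 2 (rg 10)) .skip (appendC (rg 3 + rg 2) (rg 10))])

/-- Follows the edge of the current hyperedge from a node and creates the child if it is missing.
The entry `0` can mean a missing child since the root is a child of no node. -/
def trieStepC : Cmd := blk [
  .assign 15 (ld 12 (rg 14 * rg 7 + rg 12)),
  .branch (ld 13 (rg 15 * rg 3 + rg 10)) .skip (blk [
    .assign 16 (rg 16 + 1),
    .store 13 (rg 15 * rg 3 + rg 10) (rg 16),
    .store 14 (rg 16) (1 - ld 14 (rg 15))]),
  .store 12 ((rg 13 + rg 14) * rg 7 + rg 12) (ld 13 (rg 15 * rg 3 + rg 10))]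

/-- Reading one more hyperedge at a vertex doubles its list of nodes: the second half repeats the
sets of the first half with the hyperedge added. -/
def trieVertexC : Cmd := blk [
  .assign 12 (ld 1 (ld 0 (rg 10) + rg 11)),
  appendC (rg 10) (rg 12),
  .store 11 (ld 10 (rg 12) * rg 7 + rg 12) (rg 10),
  .store 10 (rg 12) (ld 10 (rg 12) + 1),
  .assign 13 (ld 9 (rg 12)),
  forC 14 (rg 13) trieStepC,
  .store 9 (rg 12) (rg 13 * 2)]

def trieC : Cmd := forC 10 (rg 3)
  (.branch (.lt (rg 1) szE) (forC 11 szE trieVertexC) .skip)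

/-- There are `n + 1` rounds: the number `n` is an artificial vertex whose only list is that of
colour `0`. Choosing the root of a tree thus becomes the choice of a neighbour. -/
def sourceC : Cmd := forC 10 (rg 7) (blk [
  .store 11 (ld 10 (rg 10) * rg 7 + rg 10) (rg 3 + rg 10),
  .store 10 (rg 10) (ld 10 (rg 10) + 1)])

/-- The index (register `22`) of the first list at `v` (register `21`) that contains `u` (register
`20`). -/
def firstC : Cmd := blk [
  .assign 22 0,
  .loop (.lt (rg 22) (ld 10 (rg 21)) *
      (1 - ld 17 (rg 20 * rg 8 + ld 11 (rg 22 * rg 7 + rg 21))))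
    (.assign 22 (rg 22 + 1))]

/-- A pair is recorded only if none of the lists at its first vertex contains the second. This
avoids repetitions and keeps out the neighbours that share a large hyperedge. -/
def lowPairC : Cmd := blk [
  .assign 21 (ld 1 (ld 0 (rg 10) + rg 11 / rg 13)),
  .assign 20 (ld 1 (ld 0 (rg 10) + rg 11 % rg 13)),
  firstC,
  .branch (.lt (rg 22) (ld 10 (rg 21))) .skip (appendC (rg 3 + rg 21) (rg 20))]

def lowC : Cmd := forC 10 (rg 3) (.branch (.lt (rg 1) szE) .skip (blk [
  .assign 13 szE,
  forC 11 (rg 13 * rg 13) lowPairC]))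

/-- A number written in base `|e| + 1` selects for each colour either nothing, by the digit `0`, or
a vertex of `e`. Register `17` records whether the colours fit, register `18` accumulates the code
of the set. -/
def codeDigitC : Cmd := blk [
  .assign 19 (rg 15 % rg 13),
  .assign 15 (rg 15 / rg 13),
  .branch (rg 19) (blk [
    .assign 23 (ld 1 (ld 0 (rg 10) + rg 19 - 1)),
    .assign 17 (rg 17 * eqE (ld 2 (rg 23)) (rg 12)),
    .assign 18 (rg 18 + (rg 23 + 1) * ld 8 (rg 12))]) .skip]

def codeC : Cmd := blk [
  .assign 15 (rg 11),
  .assign 17 1,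
  .assign 18 0,
  forC 12 (rg 0) codeDigitC,
  .branch (rg 17) (.store 18 (rg 18) (ld 18 (rg 18) + 1)) .skip]

def degC : Cmd := forC 10 (rg 3) (.branch (.lt (rg 1) szE) .skip (blk [
  .assign 13 (szE + 1),
  .assign 14 1,
  forC 11 (rg 0) (.assign 14 (rg 14 * rg 13)),
  forC 11 (rg 14) codeC]))

/-- The number of trees with root `u`, colour set `C` that split into `X` and `C - X`. -/
def splitE (u C X x : Expr) : Expr :=
  ld 6 (X * rg 6 + (C - X)) * .lt (X - ld 7 x) (C - X) * ld 19 (u * rg 6 + X) *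
    ld 20 (u * rg 6 + (C - X))

def countC : Cmd := forC 11 (rg 2) (blk [
  .assign 12 (ld 2 (rg 11)),
  .assign 13 (eqE (rg 10) (ld 7 (rg 12))),
  forC 14 (rg 10) (.assign 13 (rg 13 + splitE (rg 11) (rg 10) (rg 14) (rg 12))),
  .store 19 (rg 11 * rg 6 + rg 10) (rg 13),
  forC 14 (ld 9 (rg 11)) (blk [
    .assign 15 (ld 12 (rg 14 * rg 7 + rg 11) * rg 6 + rg 10),
    .store 21 (rg 15) (ld 21 (rg 15) + rg 13)])])

def slotSumC : Cmd := forC 14 (ld 15 (rg 11)) (blk [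
  .assign 15 (ld 19 (ld 16 (rg 14 * rg 8 + rg 11) * rg 6 + rg 10)),
  .assign 12 (rg 12 + rg 15),
  .assign 13 (rg 13 + .lt 0 (rg 15))])

/-- The weight of each vertex is cut into portions of at most the capacity in register `17`. With
truncated subtraction, `x - (x - q)` is the minimum of `x` and `q`. -/
def slotFillC : Cmd := forC 14 (ld 15 (rg 11)) (blk [
  .assign 19 (ld 16 (rg 14 * rg 8 + rg 11)),
  .assign 15 (ld 19 (rg 19 * rg 6 + rg 10)),
  .loop (rg 15) (blk [
    .store 25 ((rg 18 * rg 8 + rg 11) * rg 6 + rg 10) (rg 19),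
    .store 26 ((rg 18 * rg 8 + rg 11) * rg 6 + rg 10) (rg 15 - (rg 15 - rg 17)),
    .assign 15 (rg 15 - rg 17),
    .assign 18 (rg 18 + 1)])])

def slotC : Cmd := forC 11 (rg 8) (blk [
  .assign 12 0,
  .assign 13 0,
  slotSumC,
  .assign 17 (rg 12 / rg 13),
  .assign 18 0,
  slotFillC,
  .store 22 (rg 11 * rg 6 + rg 10) (rg 12),
  .store 23 (rg 11 * rg 6 + rg 10) (rg 17),
  .store 24 (rg 11 * rg 6 + rg 10) (rg 18 * rg 17)])

/-- Even sets are collected separately and subtracted at the end, so the truncated subtraction is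
exact. The initial value at node `0` cancels the empty set, which is even. -/
def adjC : Cmd := forC 11 (rg 2) (blk [
  .assign 12 (ld 21 (rg 10)),
  .assign 13 0,
  forC 14 (ld 9 (rg 11)) (blk [
    .assign 15 (ld 12 (rg 14 * rg 7 + rg 11)),
    .branch (ld 14 (rg 15)) (.assign 12 (rg 12 + ld 21 (rg 15 * rg 6 + rg 10)))
      (.assign 13 (rg 13 + ld 21 (rg 15 * rg 6 + rg 10)))]),
  .store 20 (rg 11 * rg 6 + rg 10) (rg 12 + ld 22 ((rg 3 + rg 11) * rg 6 + rg 10) - rg 13)])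

def dpC : Cmd := forC 10 (rg 6) (blk [countC, slotC, adjC])

def prepC : Cmd := blk [disC, rootC, trieC, sourceC, lowC, degC, dpC]

def buildC : Cmd := blk [initC, colorC, prepC]

/-- The sampling weight of the list with index `i` at the vertex in register `21`, for the colours
in register `25`. -/
def weightE (i : Expr) : Expr := ld 24 (ld 11 (i * rg 7 + rg 21) * rg 6 + rg 25)

def chooseTailC : Cmd := blk [
  .assign 30 0,
  .loop (1 - .lt (rg 29) (weightE (rg 30))) (blk [
    .assign 29 (rg 29 - weightE (rg 30)),
    .assign 30 (rg 30 + 1)]),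
  .assign 31 (ld 11 (rg 30 * rg 7 + rg 21)),
  .assign 32 (ld 23 (rg 31 * rg 6 + rg 25)),
  .assign 33 ((rg 29 / rg 32 * rg 8 + rg 31) * rg 6 + rg 25),
  .assign 20 (ld 25 (rg 33)),
  firstC,
  .assign 28 (1 - .lt (rg 29 % rg 32) (ld 26 (rg 33)) * eqE (rg 22) (rg 30))]

/-- Choose a neighbour (register `20`) of the vertex in register `21` with probability proportional
to the number of trees with the colours in register `25` there. -/
def chooseC : Cmd := blk [
  .assign 26 0,
  forC 27 (ld 10 (rg 21)) (.assign 26 (rg 26 + weightE (rg 27))),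
  .assign 28 1,
  .loop (rg 28) (.seq (.rand 29 (rg 26)) chooseTailC)]

def splitTailC : Cmd := blk [
  .assign 30 0,
  .loop (1 - .lt (rg 29) (splitE (rg 20) (rg 25) (rg 30) (rg 34))) (blk [
    .assign 29 (rg 29 - splitE (rg 20) (rg 25) (rg 30) (rg 34)),
    .assign 30 (rg 30 + 1)]),
  .store 31 (rg 24) (rg 20),
  .store 32 (rg 24) (rg 30),
  .store 33 (rg 24) (rg 25 - rg 30),
  .assign 24 (rg 24 + 1),
  .assign 25 (rg 30)]

/-- Splits off the part attached last, puts it on the stack and continues with the remaining colours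
until only the colour of the root is left. -/
def expandC : Cmd := .loop (rg 25 - ld 7 (rg 34))
  (.seq (.rand 29 (ld 19 (rg 20 * rg 6 + rg 25))) splitTailC)

def popC : Cmd := blk [
  .assign 24 (rg 24 - 1),
  .assign 21 (ld 31 (rg 24)),
  .assign 35 (ld 32 (rg 24)),
  .assign 25 (ld 33 (rg 24))]

/-- For the colour of the new vertex this stores the vertex, the colours of the tree it is attached
to, the colours of the attached tree, and the colour of its parent. The test for canonical trees
needs nothing else. -/
def recordC : Cmd := blk [
  .assign 34 (ld 2 (rg 20)),
  .store 27 (rg 34) (rg 20),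
  .store 28 (rg 34) (rg 35),
  .store 29 (rg 34) (rg 25),
  .store 30 (rg 34) (ld 2 (rg 21))]

def startC : Cmd := blk [
  .assign 24 1,
  .store 31 0 (rg 2),
  .store 32 0 0,
  .store 33 0 (rg 6 - 1)]

def growC : Cmd := .seq startC
  (.loop (rg 24) (.seq popC (.seq chooseC (.seq recordC expandC))))

/-- Runs over all triples of colours: an attached tree, named by the colour of its root, a colour on
the side it is attached to, and a colour inside it. An adjacency that a canonical tree forbids sets
register `36`. -/
def checkC : Cmd := blk [
  .assign 36 0,
  forC 37 (rg 0 * rg 0 * rg 0) (blk [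
    .assign 38 (rg 37 / (rg 0 * rg 0)),
    .assign 39 (rg 37 / rg 0 % rg 0),
    .assign 40 (rg 37 % rg 0),
    .assign 20 (ld 27 (rg 39)),
    .assign 21 (ld 27 (rg 40)),
    firstC,
    .branch ((ld 28 (rg 38) / ld 7 (rg 39) % 2) * (ld 29 (rg 38) / ld 7 (rg 40) % 2) *
        .lt (rg 22) (ld 10 (rg 21)) *
        (1 - eqE (rg 39) (ld 30 (rg 38)) * .lt (rg 38) (rg 40 + 1)))
      (.assign 36 1) .skip])]

def attemptC : Cmd := .seq (.assign 36 1) (.loop (rg 36) (.seq growC checkC))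

/-- Inversion over supersets: the masks are treated in decreasing order, so the numbers for all
proper supersets are known and can be subtracted. -/
def zetaC : Cmd := forC 41 (rg 6) (blk [
  .assign 42 (rg 6 - 1 - rg 41),
  .assign 43 0,
  forC 44 (rg 0) (.assign 43 (rg 43 + rg 42 / ld 7 (rg 44) % 2 *
    ((ld 27 (rg 44) + 1) * ld 8 (rg 44)))),
  .assign 45 0,
  forC 44 (rg 6) (.assign 45 (rg 45 + .lt (rg 42) (rg 44) *
    ld 6 (rg 42 * rg 6 + (rg 6 - 1 - rg 44)) * ld 34 (rg 44))),
  .store 34 (rg 42) (ld 18 (rg 43) - rg 45)])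

/-- The bound leaves out the last list at a vertex, which does not come from a large hyperedge. -/
def markC : Cmd := forC 41 (rg 0) (blk [
  .assign 42 (ld 27 (rg 41)),
  forC 43 (ld 10 (rg 42) - 1) (blk [
    .assign 44 (ld 11 (rg 43 * rg 7 + rg 42)),
    .assign 45 0,
    forC 46 (rg 0) (.assign 45 (rg 45 + ld 17 (ld 27 (rg 46) * rg 8 + rg 44) * ld 7 (rg 46))),
    .store 34 (rg 45) 1])])

/-- A trace is written before its size is known. If it has fewer than two vertices, the offset is
not advanced and the next trace overwrites it. -/
def emitC : Cmd := blk [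
  .assign 5 0,
  .store 4 0 0,
  forC 41 (rg 6) (.branch (ld 34 (rg 41)) (blk [
    .assign 42 (ld 4 (rg 5)),
    forC 43 (rg 0) (.branch (rg 41 / ld 7 (rg 43) % 2) (blk [
      .store 5 (rg 42) (ld 27 (rg 43)),
      .assign 42 (rg 42 + 1)]) .skip),
    .branch (.lt (ld 4 (rg 5) + 1) (rg 42)) (blk [
      .assign 5 (rg 5 + 1),
      .store 4 (rg 5) (rg 42)]) .skip]) .skip)]

def outputC : Cmd := blk [
  .assign 4 (rg 0),
  forC 41 (rg 0) (.store 3 (rg 41) (ld 27 (rg 41))),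
  zetaC, markC, emitC]

def sampleC : Cmd := .seq attemptC outputC

theorem size_buildC : buildC.size ≤ 40 := by decide

theorem size_sampleC : sampleC.size ≤ 40 := by decide

/-! ## Instances -/

/-- A hypergraph on `{0, …, n - 1}`, given by a list of its hyperedges. -/
structure Hy where
  k : ℕ
  a : ℕ
  n : ℕ
  E : List (List ℕ)
  two_le_k : 2 ≤ k
  n_pos : 0 < n
  nodup : ∀ l ∈ E, l.Nodup
  lt_n : ∀ l ∈ E, ∀ v ∈ l, v < n

namespace Hy
variable (I : Hy) (col : ℕ → ℕ)

def m : ℕ := I.E.length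
def L : ℕ := I.m + I.n + 1
def ed (e : ℕ) : List ℕ := I.E.getD e []
def sz (e : ℕ) : ℕ := (I.ed e).length
def vt (e i : ℕ) : ℕ := (I.ed e).getD i 0
def off (e : ℕ) : ℕ := ∑ i ∈ rng e, I.sz i
/-- The large hyperedges among the first `j` ones that contain `v`. -/
def hi (v j : ℕ) : List ℕ := (List.range j).filter fun e => I.a < I.sz e ∧ v ∈ I.ed e
/-- The indices of the vertex lists that belong to `v`. -/
def src (v : ℕ) : List ℕ := I.hi v I.m ++ [I.m + v]
/-- `u` and `v` share a large hyperedge. -/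
def HiAdj (v u : ℕ) : Prop := ∃ e, I.a < I.sz e ∧ v ∈ I.ed e ∧ u ∈ I.ed e
/-- `u` and `v` share one of the first `j` small hyperedges. -/
def LowAdj (j v u : ℕ) : Prop := ∃ e < j, ¬ I.a < I.sz e ∧ v ∈ I.ed e ∧ u ∈ I.ed e

open Classical in
/-- The members of the vertex lists. -/
noncomputable def mem (id : ℕ) : Finset ℕ :=
  if id < I.m then (if I.a < I.sz id then (I.ed id).toFinset else ∅)
  else if id = I.m + I.n then (rng I.n).filter fun v => col v = 0
  else (rng I.n).filter fun u => I.LowAdj I.m (id - I.m) u ∧ ¬ I.HiAdj (id - I.m) u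

open Classical in
noncomputable def Nb (v : ℕ) : Finset ℕ :=
  (rng I.n).filter fun u => ∃ id ∈ I.src v, u ∈ I.mem col id

variable {I}

theorem sz_lt {e : ℕ} (h : 0 < I.sz e) : e < I.m := by
  by_contra hc
  simp_all [sz, ed, m]

theorem ed_mem {e : ℕ} (h : e < I.m) : I.ed e ∈ I.E := by
  rw [ed, getD_eq_getElem _ _ h]; exact getElem_mem h

theorem ed_nodup (e : ℕ) : (I.ed e).Nodup := by
  by_cases h : e < I.m
  · exact I.nodup _ (ed_mem h)
  · simp_all [ed, m]

theorem ed_lt {e v : ℕ} (h : v ∈ I.ed e) : v < I.n := by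
  by_cases he : e < I.m
  · exact I.lt_n _ (ed_mem he) v h
  · simp_all [ed, m]

theorem vt_mem {e i : ℕ} (h : i < I.sz e) : I.vt e i ∈ I.ed e := by
  rw [vt, getD_eq_getElem _ _ h]; exact getElem_mem h

theorem vt_lt {e i : ℕ} (h : i < I.sz e) : I.vt e i < I.n := ed_lt (vt_mem h)

theorem _root_.HyperMotivo.length_le_of_lt {l : List ℕ} {n : ℕ} (h : l.Nodup)
    (h' : ∀ v ∈ l, v < n) : l.length ≤ n := by
  simpa using (List.subperm_of_subset h fun v hv => List.mem_range.2 (h' v hv)).length_le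

theorem sz_le (e : ℕ) : I.sz e ≤ I.n := length_le_of_lt (ed_nodup e) fun _ => ed_lt

theorem vt_inj {e i j : ℕ} (hi : i < I.sz e) (hj : j < I.sz e) (h : I.vt e i = I.vt e j) :
    i = j := by
  rw [vt, vt, getD_eq_getElem _ _ hi, getD_eq_getElem _ _ hj] at h
  exact (ed_nodup e).getElem_inj_iff.1 h

theorem mem_ed_iff {e v : ℕ} : v ∈ I.ed e ↔ ∃ i < I.sz e, I.vt e i = v := by
  constructor
  · intro h; obtain ⟨i, hi, rfl⟩ := List.mem_iff_getElem.1 h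
    exact ⟨i, hi, by rw [vt, getD_eq_getElem _ _ hi]⟩
  · rintro ⟨i, hi, rfl⟩; exact vt_mem hi

theorem hi_succ (v j : ℕ) : I.hi v (j + 1) =
    I.hi v j ++ if I.a < I.sz j ∧ v ∈ I.ed j then [j] else [] := by
  rw [hi, List.range_succ, List.filter_append, hi]; grind

theorem mem_hi {v j e : ℕ} : e ∈ I.hi v j ↔ e < j ∧ I.a < I.sz e ∧ v ∈ I.ed e := by simp [hi]

end Hy

/-- `M` bounds the numbers that occur for instances with at most `β` large hyperedges at a vertex. -/
structure Big (I : Hy) (β M : ℕ) : Prop where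
  deg : ∀ v, (I.hi v I.m).length ≤ β
  two : 2 ≤ M
  idx : I.m + I.n + β + 3 ≤ M
  slots : 8 * (I.n + 1) ≤ M
  sq : (I.n + 1) * (I.n + 1) ≤ M
  k3 : I.k * I.k * I.k ≤ M
  k4 : 2 ^ I.k * 2 ^ I.k ≤ M
  pow : (I.n + 1) ^ I.k ≤ M
  trie : I.n * 2 ^ β + 2 ^ β * 2 ≤ M
  node : (I.n * 2 ^ β + 1) * 2 ^ I.k ≤ M
  slot : (4 * I.n + 1) * I.L * 2 ^ I.k ≤ M
  val : 4 * (2 ^ β + β + 2) * ((I.n + 1) * (I.n + 1) ^ (2 * I.k)) ≤ M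

/-- Whether `P` leaves the given registers and arrays unchanged. -/
def keeps (P : Cmd) (rs as : List ℕ) : Bool :=
  rs.all (fun x => !P.modR x) && as.all fun x => !P.modA x

theorem Fr.reg_of {P : Cmd} {s s' : Store} (h : Fr P s s') {rs as : List ℕ}
    (hk : keeps P rs as = true) {x : ℕ} (hx : x ∈ rs) : s'.reg x = s.reg x := by
  simp only [keeps, Bool.and_eq_true, List.all_eq_true, Bool.not_eq_true'] at hk
  exact h.reg x (hk.1 x hx)

theorem Fr.arr_of {P : Cmd} {s s' : Store} (h : Fr P s s') {rs as : List ℕ}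
    (hk : keeps P rs as = true) {x : ℕ} (hx : x ∈ as) : s'.arr x = s.arr x := by
  simp only [keeps, Bool.and_eq_true, List.all_eq_true, Bool.not_eq_true'] at hk
  exact h.arr x (hk.2 x hx)

/-- The input of the instance. -/
structure Input (I : Hy) (s : Store) : Prop where
  r0 : s.reg 0 = I.k
  r1 : s.reg 1 = I.a
  r2 : s.reg 2 = I.n
  r3 : s.reg 3 = I.m
  a0 : ∀ e ≤ I.m, s.arr 0 e = I.off e
  a1 : ∀ e i, i < I.sz e → s.arr 1 (I.off e + i) = I.vt e i

theorem Input.fr {I : Hy} {P : Cmd} {s s' : Store} (h : Input I s) (hf : Fr P s s')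
    (hk : keeps P [0, 1, 2, 3] [0, 1] = true) : Input I s' := by
  have hr := fun {x} hx => hf.reg_of hk (x := x) hx
  have ha := fun {x} hx => hf.arr_of hk (x := x) hx; obtain ⟨_, _, _, _, _, _⟩ := h
  constructor <;> first | (rw [hr (by simp)]; assumption) | (rw [ha (by simp)]; assumption)

/-- The constants computed at the start. -/
structure Consts (I : Hy) (s : Store) : Prop extends Input I s where
  r6 : s.reg 6 = 2 ^ I.k
  r7 : s.reg 7 = I.n + 1
  r8 : s.reg 8 = I.L
  a7 : ∀ x < I.k, s.arr 7 x = 2 ^ x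
  a8 : ∀ x < I.k, s.arr 8 x = (I.n + 1) ^ x

theorem Consts.fr {I : Hy} {P : Cmd} {s s' : Store} (h : Consts I s) (hf : Fr P s s')
    (hk : keeps P [0, 1, 2, 3, 6, 7, 8] [0, 1, 7, 8] = true) : Consts I s' := by
  have hr := fun {x} hx => hf.reg_of hk (x := x) hx
  have ha := fun {x} hx => hf.arr_of hk (x := x) hx; obtain ⟨⟨_, _, _, _, _, _⟩, _, _, _, _, _⟩ := h
  refine ⟨⟨?_, ?_, ?_, ?_, ?_, ?_⟩, ?_, ?_, ?_, ?_, ?_⟩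
  all_goals first | (rw [hr (by simp)]; assumption) | (rw [ha (by simp)]; assumption)

/-! ### Constants and the disjointness table -/

section
variable {I : Hy} {β M : ℕ} {s : Store}

theorem Big.pow_le (hB : Big I β M) {x : ℕ} (hx : x ≤ I.k) : (I.n + 1) ^ x ≤ M :=
  (pow_le_pow_right (by omega) hx).trans hB.pow

theorem Big.two_pow (hB : Big I β M) : 2 ^ I.k ≤ M :=
  (Nat.le_mul_of_pos_left _ (by positivity)).trans hB.k4

theorem Big.two_pow_le (hB : Big I β M) {x : ℕ} (hx : x ≤ I.k) : 2 ^ x ≤ M :=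
  (pow_le_pow_right (by omega) hx).trans hB.two_pow

theorem Big.k_le (hB : Big I β M) : I.k ≤ M := lt_two_pow_self.le.trans hB.two_pow

theorem initC_spec (hB : Big I β M) (h : Input I s) :
    Tri M initC s (20 * I.k + 20) (Consts I) := by
  have hi := hB.idx
  refine (Tri.fr (Q := fun s' => s'.reg 6 = 2 ^ I.k ∧ s'.reg 7 = I.n + 1 ∧ s'.reg 8 = I.L ∧
    ∀ x < I.k, s'.arr 7 x = 2 ^ x ∧ s'.arr 8 x = (I.n + 1) ^ x)
    (asg ?_ (asg ?_ (asg ?_ (asg ?_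
      (cons (for_const I.k 9 (fun j s' => s'.reg 6 = 2 ^ j ∧ s'.reg 9 = (I.n + 1) ^ j ∧
        ∀ x < j, s'.arr 7 x = 2 ^ x ∧ s'.arr 8 x = (I.n + 1) ^ x)
        hB.k_le rfl ?_ ?_ ?_) (T₂ := 1) ?_)))))).conseq ?_ ?_
  · simp; omega
  · simp [h.r2]; omega
  · simp [h.r2, h.r3]; omega
  · simp; omega
  · intro j s' hf _; rw [ival_reg, hf.reg 0 rfl]; simp [h.r0]
  · simp
  · rintro j hj s' hf hj' ⟨h6, h9, ha⟩
    have h7 : s'.reg 7 = I.n + 1 := by rw [hf.reg 7 rfl]; simp [h.r2]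
    have h1 := hB.two_pow_le (x := j) (by omega); have h2 := hB.two_pow_le (x := j + 1) (by omega)
    have h3 := hB.pow_le (x := j) (by omega); have h4 := hB.pow_le (x := j + 1) (by omega)
    refine sto ?_ (sto ?_ (asg ?_ (asg ?_ (nil ?_))))
    · simp_all
    · simp_all
    · simpa [h6, ← pow_succ] using h2
    · simpa [h9, h7, ← pow_succ] using h4
    · refine ⟨by simp [h6, pow_succ], by simp [h9, h7, pow_succ], fun x hx => ?_⟩
      simp only [setReg_arr, setArr_arr]; rcases lt_succ_iff_lt_or_eq.1 hx with hx | rfl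
      · simp_all
      · simp_all
  · rintro s' ⟨⟨h6, h9, ha⟩, -⟩ hf; refine nil ⟨h6, ?_, ?_, ha⟩
    · rw [hf.reg 7 rfl]; simp [h.r2]
    · rw [hf.reg 8 rfl]; simp [h.r2, h.r3, Hy.L]
  · omega
  · rintro s' ⟨⟨h6, h7, h8, ha⟩, hf⟩
    exact ⟨h.fr hf (by decide), h6, h7, h8, fun x hx => (ha x hx).1, fun x hx => (ha x hx).2⟩

theorem disC_spec (hB : Big I β M) (h : Consts I s) :
    Tri M disC s (4 * (2 ^ I.k * 2 ^ I.k) + 10) (fun s' => ∀ X < 2 ^ I.k, ∀ Y < 2 ^ I.k,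
      s'.arr 6 (X * 2 ^ I.k + Y) = if X &&& Y = 0 then 1 else 0) := by
  have h2 := hB.two; set K := 2 ^ I.k with hK; have hKpos : 0 < K := by positivity
  have hd : ∀ X Y, Y < K → (X * K + Y) / K = X ∧ (X * K + Y) % K = Y := fun X Y hY => by
    rw [mul_comm, Nat.mul_add_div hKpos, Nat.mul_add_mod, div_eq_of_lt hY, mod_eq_of_lt hY]; simp
  let D : ℕ → ℕ := fun t => if t / K &&& t % K = 0 then 1 else 0
  refine conseq (sto ?_ (cons (for_const (K * K) 1
    (fun j s' => s'.arr 6 0 = 1 ∧ ∀ t < j, s'.arr 6 t = D t)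
    hB.k4 rfl ?_ ?_ ?_) (T₂ := 1) (Q := fun s' => ∀ t < K * K, s'.arr 6 t = D t) ?_)) ?_ ?_
  · simp; omega
  · intro j s' hf _; rw [ival_mul, ival_reg, hf.reg 6 rfl]; simp [h.r6, ← hK]
  · simp [setArr_arr]
  · rintro j hj s' hf hj' ⟨h0, ha⟩; have h6 : s'.reg 6 = K := by rw [hf.reg 6 rfl]; simp [h.r6, hK]
    have key : (s'.arr 6 (j / K / 2 * K + j % K / 2)) * (1 - j / K % 2 * (j % K % 2)) = D j := by
      have hjm : j % K / 2 < K := by have := mod_lt j hKpos; omega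
      have hjd := Nat.div_add_mod j K
      -- For `j = 0` the cell is its own predecessor, which is why it is set beforehand; otherwise
      -- the address is smaller than `j`.
      have e : s'.arr 6 (j / K / 2 * K + j % K / 2) = D (j / K / 2 * K + j % K / 2) := by
        rcases Nat.eq_zero_or_pos j with rfl | hj0
        · simp [h0, D]
        · refine ha _ ?_; rcases Nat.eq_zero_or_pos (j / K) with h1 | h1
          · grind
          · have : j / K / 2 * K < j / K * K := Nat.mul_lt_mul_of_pos_right (by omega) hKpos; grind
      rw [e]; simp only [D, (hd _ _ hjm).1, (hd _ _ hjm).2, land_half (j / K) (j % K)]; grind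
    have ev : ∀ x, Expr.ival s' (ld 6 (rg 10 / rg 6 / 2 * rg 6 + rg 10 % rg 6 / 2) *
      (1 - rg 10 / rg 6 % 2 * (rg 10 % rg 6 % 2))) = x ↔ D j = x := by
      simp_all
    refine store ?_ ?_
    · rw [(ev _).2 rfl]; simp only [D]; split_ifs <;> omega
    · rw [(ev _).2 rfl]; simp only [setReg_arr, setArr_arr, ival_reg, hj', if_true]
      refine ⟨?_, fun t ht => ?_⟩
      · split_ifs with hc
        · rw [← hc]; simp [D]
        · exact h0
      · grind
  · rintro s' ⟨⟨-, ha⟩, -⟩ hf; exact nil ha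
  · omega
  · intro s' hs' X hX Y hY; rw [hs' _ (by nlinarith)]; grind
end

theorem enc_inj {K v v' C C' : ℕ} (hC : C < K) (hC' : C' < K) (h : v * K + C = v' * K + C') :
    v = v' ∧ C = C' := by
  have hK : 0 < K := by omega
  have h1 := congrArg (· / K) h; have h2 := congrArg (· % K) h
  simp only [mul_comm _ K, Nat.mul_add_div hK, Nat.mul_add_mod, div_eq_of_lt hC,
    div_eq_of_lt hC', mod_eq_of_lt hC, mod_eq_of_lt hC', add_zero] at h1 h2
  omega

/-- A table with rows of length `K`, after the change of one entry. -/
theorem setArr_table (s : Store) (a K v C x : ℕ) (hC : C < K) {v' C' : ℕ} (hC' : C' < K) :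
    (s.setArr a (v * K + C) x).arr a (v' * K + C') =
      if v' = v ∧ C' = C then x else s.arr a (v' * K + C') := by
  rw [setArr_arr, if_pos rfl]; by_cases h : v' = v ∧ C' = C
  · simp_all
  · rw [if_neg h, if_neg fun hc => h (enc_inj hC' hC hc)]

theorem getD_append_single {l : List ℕ} {i x d : ℕ} (hi : i < l.length + 1) :
    (l ++ [x]).getD i d = if i = l.length then x else l.getD i d := by
  grind

/-- The vertex lists are `ℓ id`, for `id < L`. -/
structure ListsOK (I : Hy) (ℓ : ℕ → List ℕ) (s : Store) : Prop where
  len : ∀ id < I.L, s.arr 15 id = (ℓ id).length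
  ent : ∀ id < I.L, ∀ i < (ℓ id).length, s.arr 16 (i * I.L + id) = (ℓ id).getD i 0
  inc : ∀ id < I.L, ∀ u < I.n, s.arr 17 (u * I.L + id) = if u ∈ ℓ id then 1 else 0
  nodup : ∀ id < I.L, (ℓ id).Nodup
  lt_n : ∀ id < I.L, ∀ u ∈ ℓ id, u < I.n

theorem ListsOK.congr {I : Hy} {ℓ : ℕ → List ℕ} {s s' : Store} (h : ListsOK I ℓ s)
    (h15 : s'.arr 15 = s.arr 15) (h16 : s'.arr 16 = s.arr 16) (h17 : s'.arr 17 = s.arr 17) :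
    ListsOK I ℓ s' := by
  obtain ⟨_, _, _, _, _⟩ := h; constructor <;> simpa only [h15, h16, h17]

theorem ListsOK.lists {I : Hy} {ℓ ℓ' : ℕ → List ℕ} {s : Store} (h : ListsOK I ℓ s)
    (h' : ∀ id < I.L, ℓ' id = ℓ id) : ListsOK I ℓ' s := by
  obtain ⟨_, _, _, _, _⟩ := h; constructor <;> intro id hid <;> rw [h' id hid] <;> solve_by_elim

theorem ListsOK.length_le {I : Hy} {ℓ : ℕ → List ℕ} {s : Store} (h : ListsOK I ℓ s) {id : ℕ}
    (hid : id < I.L) : (ℓ id).length ≤ I.n := length_le_of_lt (h.nodup id hid) (h.lt_n id hid)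

/-! ### Vertex lists and the list of possible roots -/

section
variable {I : Hy} {col : ℕ → ℕ} {β M : ℕ} {s : Store}

theorem appendC_spec (hB : Big I β M) (h8 : s.reg 8 = I.L) {ℓ : ℕ → List ℕ} (h : ListsOK I ℓ s)
    {idE uE : Expr} {id u : ℕ} (hidE : ∀ s', s'.reg = s.reg → idE.ival s' = id)
    (huE : ∀ s', s'.reg = s.reg → uE.ival s' = u) (hid : id < I.L) (hu : u < I.n)
    (hn : u ∉ ℓ id) :
    Tri M (appendC idE uE) s 7 (ListsOK I (update ℓ id (ℓ id ++ [u]))) := by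
  have hi := hB.idx; have hlen : (ℓ id).length + 1 ≤ I.n + 1 := by have := h.length_le hid; omega
  refine time (stov (j := u * I.L + id) (v := 1) ?_ rfl (by omega)
    (stov (j := (ℓ id).length * I.L + id) (v := u) ?_ (huE _ rfl) (by omega)
    (stov (j := id) (v := (ℓ id).length + 1) (hidE _ rfl) ?_ (by omega) (nil ?_)))) le_rfl
  · simp_all
  · simp [hidE (s.setArr 17 (u * I.L + id) 1) rfl, h8, setArr_arr, h.len id hid]
  · have e1 := hidE ((s.setArr 17 (u * I.L + id) 1).setArr 16 ((ℓ id).length * I.L + id) u) rfl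
    simp [setArr_arr, h.len id hid, e1]
  · refine ⟨fun j hj => ?_, fun j hj i hi' => ?_, fun j hj v hv => ?_, fun j hj => ?_,
      fun j hj v hv => ?_⟩
    · rw [setArr_arr, if_pos rfl, update_apply]; split_ifs with hc
      · simp
      · simp [setArr_arr, h.len j hj]
    · rw [setArr_arr, if_neg (by simp), setArr_table _ _ _ _ _ _ hid hj]; by_cases hc : j = id
      · subst hc; rw [update_self] at hi' ⊢
        simp only [List.length_append, List.length_singleton] at hi'; rw [getD_append_single hi']
        simp only [and_true]; split_ifs with h1
        · rfl
        · rw [setArr_arr, if_neg (by simp), h.ent j hj i (by omega)]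
      · rw [update_of_ne hc] at hi' ⊢
        rw [if_neg (by tauto), setArr_arr, if_neg (by simp), h.ent j hj i hi']
    · rw [setArr_arr, if_neg (by simp), setArr_arr, if_neg (by simp),
        setArr_table _ _ _ _ _ _ hid hj, h.inc j hj v hv]
      grind
    · rw [update_apply]; split_ifs with hc
      · subst hc; rw [List.nodup_append]
        exact ⟨h.nodup j hj, by simp, fun x hx y hy hxy => by simp at hy; subst hy hxy; exact hn hx⟩
      · exact h.nodup j hj
    · by_cases hc : j = id
      · subst hc; rw [update_self, mem_append, List.mem_singleton] at hv; rcases hv with hv | rfl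
        · exact h.lt_n j hj v hv
        · exact hu
      · rw [update_of_ne hc] at hv; exact h.lt_n j hj v hv

variable (I col) in
/-- The list of the first `j` vertices that have colour `0`. -/
def rootList (j id : ℕ) : List ℕ :=
  if id = I.m + I.n then (List.range j).filter (fun v => col v = 0) else []

theorem rootC_spec (hB : Big I β M) (h : Consts I s) (hc : ∀ v < I.n, s.arr 2 v = col v)
    (hz : s.arr 15 = 0 ∧ s.arr 17 = 0) :
    Tri M rootC s (20 * I.n + 20) (fun s' => (∀ v < I.n, s'.arr 9 v = 1) ∧
      ListsOK I (rootList I col I.n) s') := by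
  have hi := hB.idx; refine (for_const I.n 14 (fun j s' => (∀ v < j, s'.arr 9 v = 1) ∧
      ListsOK I (rootList I col j) s') (by omega) rfl ?_ ?_ ?_).conseq (by omega) (fun s' hs' => hs'.1)
  · intro j s' hf _; rw [ival_reg, hf.reg 2 rfl, h.r2]
  · refine ⟨by simp, ?_, ?_, ?_, ?_, ?_⟩
    all_goals intro id hid
    all_goals simp [hz, rootList]
  · rintro j hj s' hf hj' ⟨h9, hL⟩; have h' := h.fr hf (by decide)
    have hcol : s'.arr 2 j = col j := by rw [hf.arr 2 rfl]; exact hc j hj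
    have e : ∀ id, rootList I col (j + 1) id = if id = I.m + I.n ∧ col j = 0 then
        rootList I col j id ++ [j] else rootList I col j id := by
      intro id; by_cases h1 : id = I.m + I.n <;> by_cases h2 : col j = 0 <;>
        simp [rootList, h1, h2, List.range_succ]
    have hL' : ListsOK I (rootList I col j) (s'.setArr 9 j 1) :=
      hL.congr (by simp [setArr_arr']) (by simp [setArr_arr']) (by simp [setArr_arr'])
    have hv : (ld 2 (rg 10)).ival (s'.setArr 9 j 1) = col j := by simp [hj', setArr_arr, hcol]
    refine time (stov (j := j) (v := 1) hj' rfl (by omega) (cons (Tri.ite (T := 7)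
      (Q := fun s'' => ListsOK I (rootList I col (j + 1)) s'') (fun hcj => ?_) (fun hcj => ?_))
      (T₂ := 1) ?_)) (by omega)
    · refine (Tri.skip ?_).time (by omega); rw [hv] at hcj
      exact hL'.lists fun id _ => by rw [e, if_neg (by tauto)]
    · rw [hv] at hcj
      refine (appendC_spec (s := s'.setArr 9 j 1) (id := I.m + I.n) (u := j) hB h'.r8 hL'
        (fun s1 hs1 => ?_) (fun s1 hs1 => ?_) ?_ hj ?_).conseq le_rfl fun s'' hs'' => ?_
      · simp [hs1, h'.r2, h'.r3]
      · simp [hs1, hj']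
      · simp [Hy.L]
      · simp [rootList]
      · refine hs''.lists fun id _ => ?_; rw [e, update_apply]
        by_cases h1 : id = I.m + I.n <;> simp [h1, hcj]
    · intro s'' hs'' hf''; refine nil ⟨fun v hv => ?_, hs''.congr rfl rfl rfl⟩
      rw [setReg_arr, hf''.arr 9 rfl]; simp only [setArr_arr, if_true]; split_ifs with hc
      · rfl
      · exact h9 v (by omega)

end

/-- The lists at the vertices are `h v`. -/
structure SrcOK (I : Hy) (N : ℕ) (h : ℕ → List ℕ) (s : Store) : Prop where
  len : ∀ v < N, s.arr 10 v = (h v).length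
  ent : ∀ v < N, ∀ i < (h v).length, s.arr 11 (i * (I.n + 1) + v) = (h v).getD i 0

/-- The trie: node `a ≤ ctr` represents the set `σ a` of hyperedges. -/
structure TrieOK (I : Hy) (σ : ℕ → Finset ℕ) (ctr : ℕ) (s : Store) : Prop where
  r16 : s.reg 16 = ctr
  root : σ 0 = ∅
  inj : ∀ a ≤ ctr, ∀ b ≤ ctr, σ a = σ b → a = b
  sg : ∀ a ≤ ctr, s.arr 14 a = (σ a).card % 2
  child : ∀ a ≤ ctr, ∀ e < I.m, s.arr 13 (a * I.m + e) ≠ 0 → s.arr 13 (a * I.m + e) ≤ ctr ∧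
    σ (s.arr 13 (a * I.m + e)) = insert e (σ a) ∧ ∀ x ∈ σ a, x < e
  parent : ∀ b ≤ ctr, b ≠ 0 → ∃ a ≤ ctr, ∃ e < I.m, s.arr 13 (a * I.m + e) = b
  fresh : ∀ a, ctr < a → ∀ e < I.m, s.arr 13 (a * I.m + e) = 0

/-- The nodes of the trie for the subsets of `h v`. -/
structure NodesOK (I : Hy) (σ : ℕ → Finset ℕ) (ctr : ℕ) (h : ℕ → List ℕ) (s : Store) : Prop where
  num : ∀ v < I.n, s.arr 9 v = 2 ^ (h v).length
  le : ∀ v < I.n, ∀ j < 2 ^ (h v).length, s.arr 12 (j * (I.n + 1) + v) ≤ ctr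
  -- Quantifying over `g` says that the nodes at `v` run through the power set, each set once,
  -- without naming a bijection.
  sum : ∀ v < I.n, ∀ g : Finset ℕ → ℕ,
    ∑ j ∈ rng (2 ^ (h v).length), g (σ (s.arr 12 (j * (I.n + 1) + v))) =
      ∑ S ∈ (h v).toFinset.powerset, g S

/-! ### The trie of sets of large hyperedges -/

section
variable {I : Hy} {col : ℕ → ℕ} {β M : ℕ} {s : Store} {σ : ℕ → Finset ℕ} {ctr : ℕ}
  {h : ℕ → List ℕ}

theorem NodesOK.subset (hN : NodesOK I σ ctr h s) {v j : ℕ} (hv : v < I.n)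
    (hj : j < 2 ^ (h v).length) : σ (s.arr 12 (j * (I.n + 1) + v)) ⊆ (h v).toFinset := by
  classical
  -- The sum identity is applied to the indicator of the sets that are not contained.
  have h1 := hN.sum v hv (fun S => if S ⊆ (h v).toFinset then 0 else 1)
  rw [sum_eq_zero (s := (h v).toFinset.powerset) (fun S hS => by
    simp_all), Finset.sum_eq_zero_iff] at h1
  simp_all

theorem TrieOK.congr {s' : Store} (hT : TrieOK I σ ctr s) (h16 : s'.reg 16 = s.reg 16)
    (h13 : s'.arr 13 = s.arr 13) (h14 : s'.arr 14 = s.arr 14) : TrieOK I σ ctr s' := by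
  refine ⟨h16 ▸ hT.r16, hT.root, hT.inj, ?_, ?_, ?_, ?_⟩
  · rw [h14]; exact hT.sg
  · rw [h13]; exact hT.child
  · rw [h13]; exact hT.parent
  · rw [h13]; exact hT.fresh

/-- Edges lead to larger hyperedges, so the last edge to a node is the maximum of its set. If the
new set already had a node, that node would be reached from a node with the set `σ a`, hence from
`a` itself, along `e`; but this child is missing. -/
theorem TrieOK.new (hT : TrieOK I σ ctr s) {a e : ℕ} (ha : a ≤ ctr) (he : e < I.m)
    (h0 : s.arr 13 (a * I.m + e) = 0) (hlt : ∀ x ∈ σ a, x < e) :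
    TrieOK I (update σ (ctr + 1) (insert e (σ a))) (ctr + 1)
      (((s.setReg 16 (ctr + 1)).setArr 13 (a * I.m + e) (ctr + 1)).setArr 14 (ctr + 1)
        (1 - s.arr 14 a)) := by
  have old : ∀ b ≤ ctr, update σ (ctr + 1) (insert e (σ a)) b = σ b := fun b hb =>
    update_of_ne (by omega) _ _
  have new := update_self (ctr + 1) (insert e (σ a)) σ
  have hea : e ∉ σ a := fun hx => lt_irrefl _ (hlt e hx)
  have hno : ∀ c ≤ ctr, σ c ≠ insert e (σ a) := by
    intro c hc heq; have hc0 : c ≠ 0 := by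
      rintro rfl; rw [hT.root] at heq; exact absurd (heq ▸ Finset.mem_insert_self e (σ a)) (by simp)
    obtain ⟨a', ha', e', he', hch⟩ := hT.parent c hc hc0
    obtain ⟨-, h2, h3⟩ := hT.child a' ha' e' he' (hch ▸ hc0); rw [hch, heq] at h2
    have hea' : e' ∉ σ a' := fun hx => lt_irrefl _ (h3 e' hx); have hee : e = e' := by
      have m1 : e ∈ insert e' (σ a') := h2 ▸ Finset.mem_insert_self _ _
      have m2 : e' ∈ insert e (σ a) := h2 ▸ Finset.mem_insert_self _ _; grind
    subst hee
    have haa : σ a = σ a' := by rw [← Finset.erase_insert hea, ← Finset.erase_insert hea', h2]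
    have := hT.inj a ha a' ha' haa; simp_all
  have hA : ∀ a' e', e' < I.m → (((s.setReg 16 (ctr + 1)).setArr 13 (a * I.m + e)
      (ctr + 1)).setArr 14 (ctr + 1) (1 - s.arr 14 a)).arr 13 (a' * I.m + e') =
      if a' = a ∧ e' = e then ctr + 1 else s.arr 13 (a' * I.m + e') := by
    intro a' e' he'; rw [setArr_arr, if_neg (by simp), setArr_table _ _ _ _ _ _ he he', setReg_arr]
  refine ⟨by simp, by rw [old 0 (Nat.zero_le _)]; exact hT.root, ?_, ?_, ?_, ?_, ?_⟩
  · intro b hb c hc hbc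
    rcases Nat.le_succ_iff.1 hb with hb | rfl <;> rcases Nat.le_succ_iff.1 hc with hc | rfl
    · rw [old b hb, old c hc] at hbc; exact hT.inj b hb c hc hbc
    · simp_all
    · grind
    · rfl
  · intro b hb; rw [setArr_arr, if_pos rfl]; rcases Nat.le_succ_iff.1 hb with hb | rfl
    · rw [if_neg (by omega), old b hb, setArr_arr, if_neg (by simp), setReg_arr, hT.sg b hb]
    · rw [if_pos rfl, new, Finset.card_insert_of_notMem hea, hT.sg a ha]; omega
  · intro b hb e' he' hne; rw [hA b e' he'] at hne ⊢; rcases Nat.le_succ_iff.1 hb with hb | rfl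
    · split_ifs at hne ⊢ with hc
      · simp_all
      · obtain ⟨h1, h2, h3⟩ := hT.child b hb e' he' hne; grind
    · rw [if_neg (by omega), hT.fresh _ (by omega) e' he'] at hne; omega
  · intro b hb hb0; rcases Nat.le_succ_iff.1 hb with hb | rfl
    · obtain ⟨a', ha', e', he', hch⟩ := hT.parent b hb hb0; grind
    · grind
  · intro b hb e' he'; rw [hA _ _ he', if_neg (by omega)]; exact hT.fresh b (by omega) e' he'

theorem trieStepC_spec (hT : TrieOK I σ ctr s) (hM : ctr + 1 ≤ M) {e v d j a : ℕ} (h3 : s.reg 3 = I.m)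
    (h7 : s.reg 7 = I.n + 1) (h10 : s.reg 10 = e) (h12 : s.reg 12 = v) (h13 : s.reg 13 = d)
    (h14 : s.reg 14 = j) (ha : s.arr 12 (j * (I.n + 1) + v) = a) (hac : a ≤ ctr)
    (he : e < I.m) (hlt : ∀ x ∈ σ a, x < e) :
    Tri M trieStepC s 14 (fun s' => ∃ σ' ctr' b, TrieOK I σ' ctr' s' ∧ ctr ≤ ctr' ∧ ctr' ≤ ctr + 1 ∧
      (∀ c ≤ ctr, σ' c = σ c) ∧ b ≤ ctr' ∧ σ' b = insert e (σ a) ∧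
      s'.arr 12 = update (s.arr 12) ((d + j) * (I.n + 1) + v) b) := by
  refine time (asgv (v := a) (by simp [h14, h7, h12, ha]) (by omega)
    (cons (Q₁ := fun s1 => ∃ σ' ctr', TrieOK I σ' ctr' s1 ∧ ctr ≤ ctr' ∧ ctr' ≤ ctr + 1 ∧
      (∀ c ≤ ctr, σ' c = σ c) ∧ s1.arr 13 (a * I.m + e) ≤ ctr' ∧
      σ' (s1.arr 13 (a * I.m + e)) = insert e (σ a)) (Tri.ite (T := 7) (fun hc => ?_) (fun hc => ?_))
      (T₂ := 3) ?_)) le_rfl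
  · refine (Tri.skip ⟨σ, ctr, hT.congr (by simp) rfl rfl, le_rfl, by omega, fun _ _ => rfl, ?_⟩).time
      (by omega)
    have hc' : s.arr 13 (a * I.m + e) ≠ 0 := by simpa [h3, h10] using hc
    exact ⟨(hT.child a hac e he hc').1, (hT.child a hac e he hc').2.1⟩
  · have hc' : s.arr 13 (a * I.m + e) = 0 := by simpa [h3, h10] using hc
    have hnew := hT.new hac he hc' hlt; refine (asgv (v := ctr + 1) (by simp [hT.r16]) hM
      (stov (j := a * I.m + e) (v := ctr + 1) (by simp [h3, h10]) (by simp) hM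
      (stov (j := ctr + 1) (v := 1 - s.arr 14 a) (by simp) (by simp [setArr_arr])
        (by omega) (nil ?_))))
    refine ⟨_, _, hnew.congr (by simp) ?_ ?_, by omega, le_rfl,
      fun c hc => update_of_ne (by omega) _ _, ?_⟩
    · simp [setArr_arr']
    · simp [setArr_arr']
    · simp [setArr_arr]
  · rintro s1 ⟨σ', ctr', hT', hl, hu, hold, hb, hσ⟩ hf
    have e12 : s1.arr 12 = s.arr 12 := by rw [hf.arr 12 rfl]; rfl
    have e15 : s1.reg 15 = a := hf.rg rfl; have e3 : s1.reg 3 = I.m := hf.rg h3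
    have e7 : s1.reg 7 = I.n + 1 := hf.rg h7; have e10 : s1.reg 10 = e := hf.rg h10
    have e12r : s1.reg 12 = v := hf.rg h12; have e13 : s1.reg 13 = d := hf.rg h13
    have e14 : s1.reg 14 = j := hf.rg h14
    refine stov (j := (d + j) * (I.n + 1) + v) (v := s1.arr 13 (a * I.m + e))
      (by simp [e13, e14, e7, e12r]) (by simp [e15, e3, e10]) (by omega) (nil ?_)
    refine ⟨σ', ctr', s1.arr 13 (a * I.m + e), hT'.congr rfl (by simp [setArr_arr'])
      (by simp [setArr_arr']), hl, hu, hold, hb, hσ, ?_⟩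
    simp [setArr_arr', e12]

/-- The state while the large hyperedges are read. -/
structure ReadOK (I : Hy) (ℓ h : ℕ → List ℕ) (s : Store) : Prop where
  lists : ListsOK I ℓ s
  src : SrcOK I (I.n + 1) h s
  trie : ∃ σ ctr, TrieOK I σ ctr s ∧ NodesOK I σ ctr h s ∧
    ctr ≤ ∑ v ∈ rng I.n, 2 ^ (h v).length

theorem sum_update_pow (f : ℕ → ℕ) {n v : ℕ} (hv : v < n) :
    ∑ u ∈ rng n, 2 ^ (if u = v then f v + 1 else f u) =
      ∑ u ∈ rng n, 2 ^ f u + 2 ^ f v := by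
  have h1 : ∀ u ∈ rng n, 2 ^ (if u = v then f v + 1 else f u) =
      2 ^ f u + if u = v then 2 ^ f v else 0 := by
    grind
  rw [sum_congr rfl h1, sum_add_distrib, Finset.sum_ite_eq']; simp [hv]

-- The time is proportional to the number of nodes at the vertex. As `e` exceeds all hyperedges read
-- before, it is new to their sets, and the two halves of the node list give the power set of the
-- enlarged set.
set_option maxHeartbeats 400000 in
theorem trieVertexC_spec (hB : Big I β M) (hC : Consts I s) {ℓ : ℕ → List ℕ}
    (hR : ReadOK I ℓ h s) {e i : ℕ} (h10 : s.reg 10 = e) (h11 : s.reg 11 = i) (he : e < I.m)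
    (hi : i < I.sz e) (hn : I.vt e i ∉ ℓ e) (hh : ∀ x ∈ h (I.vt e i), x < e)
    (hlen : ∀ v < I.n, (h v).length ≤ β) :
    Tri M trieVertexC s (17 * 2 ^ (h (I.vt e i)).length + 23)
      (ReadOK I (update ℓ e (ℓ e ++ [I.vt e i]))
        (update h (I.vt e i) (h (I.vt e i) ++ [e]))) := by
  set v := I.vt e i with hvdef; have hv : v < I.n := Hy.vt_lt hi; have hidx := hB.idx
  obtain ⟨σ, ctr, hT, hN, hctr⟩ := hR.trie
  have hsum : ∑ v ∈ rng I.n, 2 ^ (h v).length ≤ I.n * 2 ^ β := by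
    refine (sum_le_sum fun v hv => pow_le_pow_right (by omega)
      (hlen v (mem_rng.1 hv))).trans ?_
    simp
  have htrie := hB.trie
  have hpow : 2 ^ (h v).length ≤ 2 ^ β := pow_le_pow_right (by omega) (hlen v hv)
  have heL : e < I.L := by simp only [Hy.L]; omega
  set d := 2 ^ (h v).length with hd
  -- the stores along the way
  refine time (asgv (v := v) ?_ (by omega) (cons
    (appendC_spec (s := s.setReg 12 v) (id := e) (u := v) (ℓ := ℓ) hB (by simp [hC.r8])
      (hR.lists.congr rfl rfl rfl) (fun s1 hs1 => by simp [hs1, h10])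
      (fun s1 hs1 => by simp [hs1]) heL hv hn) (T₂ := d * (14 + 3) + 3 + 3 + 1 + 2 + 2 + 2) ?_)) (by omega)
  · simp [h10, h11, hC.a0 e he.le, hC.a1 e i hi, hvdef]
  intro s1 hL1 hf1; have r1 : ∀ x, x ≠ 12 → s1.reg x = s.reg x := fun x hx => by
    rw [hf1.reg x rfl]; simp [hx]
  have r12 : s1.reg 12 = v := hf1.rg rfl
  have a10 : s1.arr 10 v = (h v).length := by rw [hf1.arr 10 rfl]; exact hR.src.len v (by omega)
  have a9 : s1.arr 9 = s.arr 9 := hf1.arr 9 rfl; have a12 : s1.arr 12 = s.arr 12 := hf1.arr 12 rfl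
  have hlv := hlen v hv; refine stov (j := (h v).length * (I.n + 1) + v) (v := e) ?_ ?_ (by omega)
    (stov (j := v) (v := (h v).length + 1) ?_ ?_ (by omega)
    (asgv (v := d) ?_ (by omega) ?_))
  · simp [r12, a10, r1 7, hC.r7]
  · simp_all
  · simp [r12]
  · simp [r12, setArr_arr, a10]
  · simp [r12, setArr_arr, a9, hN.num v hv, hd]
  set s2 := ((s1.setArr 11 ((h v).length * (I.n + 1) + v) e).setArr 10 v
    ((h v).length + 1)).setReg 13 d with hs2
  have hT2 : TrieOK I σ ctr s2 := hT.congr (by simp [hs2, r1]) (by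
      simp only [hs2, setReg_arr, setArr_arr']; simp; exact hf1.arr 13 rfl) (by
      simp only [hs2, setReg_arr, setArr_arr']; simp; exact hf1.arr 14 rfl)
  have b12 : s2.arr 12 = s.arr 12 := by simp [hs2, setArr_arr', a12]
  -- The trie may grow by one node per round, but old nodes keep their sets. Position `d + j'`
  -- receives the set of position `j'` with `e` added, and all other entries are kept.
  refine cons (for_const d 14 (fun j s' => ∃ σ' ctr', TrieOK I σ' ctr' s' ∧ ctr ≤ ctr' ∧
      ctr' ≤ ctr + j ∧ (∀ c ≤ ctr, σ' c = σ c) ∧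
      (∀ j' < j, s'.arr 12 ((d + j') * (I.n + 1) + v) ≤ ctr' ∧
        σ' (s'.arr 12 ((d + j') * (I.n + 1) + v)) =
          insert e (σ (s.arr 12 (j' * (I.n + 1) + v)))) ∧
      ∀ j' u, u < I.n + 1 → (u ≠ v ∨ j' < d) →
        s'.arr 12 (j' * (I.n + 1) + u) = s.arr 12 (j' * (I.n + 1) + u))
    (by omega) rfl ?_ ?_ ?_) (T₂ := 3) ?_
  · intro j s' hf _; rw [ival_reg, hf.reg 13 rfl]; simp [hs2]
  · refine ⟨σ, ctr, hT2.congr (by simp) rfl rfl, le_rfl, by omega, fun _ _ => rfl, by simp,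
      fun j' u _ _ => ?_⟩
    simp_all
  · rintro j hj s' hf hj' ⟨σ', ctr', hT', hl, hu, hold, hnew, hrest⟩; have hle := hN.le v hv j hj
    have hsub := hN.subset hv hj
    have rr : ∀ x, x ≠ 12 → x ≠ 13 → (trieStepC).modR x = false → 14 ≠ x →
        s'.reg x = s.reg x := by
      intro x hx hx' hm hx14; rw [hf.reg x (by simp [forC, Cmd.modR, hm, hx14])]
      simp [hs2, hx', r1 x hx]
    refine (trieStepC_spec (a := s.arr 12 (j * (I.n + 1) + v)) (v := v) (d := d) (j := j) hT'
      (by omega) (by rw [rr 3 (by simp) (by simp) rfl (by simp), hC.r3])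
      (by rw [rr 7 (by simp) (by simp) rfl (by simp), hC.r7])
      (by rw [rr 10 (by simp) (by simp) rfl (by simp), h10])
      (by rw [hf.reg 12 rfl]; simp [hs2, r12]) (by rw [hf.reg 13 rfl]; simp [hs2]) hj'
      (hrest j v (by omega) (Or.inr hj)) (by omega) he
      (by rw [hold _ hle]; exact fun x hx => hh x (List.mem_toFinset.1 (hsub hx)))).conseq le_rfl ?_
    rintro s'' ⟨σ'', ctr'', b, hT'', hl', hu', hold', hb, hσb, harr⟩
    have hup : ∀ j' u, u < I.n + 1 → s''.arr 12 (j' * (I.n + 1) + u) =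
        if j' = d + j ∧ u = v then b else s'.arr 12 (j' * (I.n + 1) + u) := by
      intro j' u hu; rw [harr, update_apply]; by_cases hc : j' = d + j ∧ u = v
      · rw [if_pos hc, hc.1, hc.2, if_pos rfl]
      · rw [if_neg hc, if_neg fun h => hc (enc_inj hu (by omega) h)]
    refine ⟨σ'', ctr'', hT''.congr (by simp) rfl rfl, by omega, by omega,
      fun c hc => by rw [hold' c (by omega), hold c hc], fun j' hj' => ?_, fun j' u hun huv => ?_⟩
    · rw [setReg_arr, hup _ _ (by omega)]; rcases lt_succ_iff_lt_or_eq.1 hj' with hlt | rfl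
      · rw [if_neg (by omega)]
        exact ⟨by have := (hnew j' hlt).1; omega, by rw [hold' _ (hnew j' hlt).1, (hnew j' hlt).2]⟩
      · rw [if_pos ⟨rfl, rfl⟩]; exact ⟨hb, by rw [hσb, hold _ hle]⟩
    · rw [setReg_arr, hup _ _ hun, if_neg (by omega), hrest j' u hun huv]
  · rintro s3 ⟨⟨σ', ctr', hT', hl, hu, hold, hnew, hrest⟩, -⟩ hf
    have r3 : s3.reg 12 = v := by rw [hf.reg 12 rfl]; simp [hs2, r12]
    have r13 : s3.reg 13 = d := by rw [hf.reg 13 rfl]; simp [hs2]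
    refine stov (j := v) (v := d * 2) (by simp [r3]) (by simp [r13]) (by omega) (nil ?_)
    have hother : ∀ a, a ≠ 9 → a ≠ 10 → a ≠ 11 → a ≠ 12 → trieStepC.modA a = false →
        (s3.setArr 9 v (d * 2)).arr a = s1.arr a := by
      intro a h9 h10 h11 h12 hm
      rw [setArr_arr', if_neg h9, hf.arr a (by simp [forC, Cmd.modA, hm])]
      simp [hs2, setArr_arr', h10, h11]
    have hlenu : ∀ u, (update h v (h v ++ [e]) u).length =
        if u = v then (h v).length + 1 else (h u).length := by
      intro u; rw [update_apply]; split_ifs with hc <;> simp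
    refine ⟨hL1.congr (hother 15 (by simp) (by simp) (by simp) (by simp) rfl)
      (hother 16 (by simp) (by simp) (by simp) (by simp) rfl)
      (hother 17 (by simp) (by simp) (by simp) (by simp) rfl), ⟨fun u hu => ?_, fun u hu i hi => ?_⟩,
      σ', ctr', hT'.congr rfl (by simp [setArr_arr']) (by simp [setArr_arr']),
      ⟨fun u hu => ?_, fun u hu j hj => ?_, fun u hu g => ?_⟩, ?_⟩
    · rw [hlenu, setArr_arr, if_neg (by simp), hf.arr 10 rfl]
      simp only [hs2, setReg_arr, setArr_arr, if_true, Nat.reduceEqDiff, if_false]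
      split_ifs with hc
      · rfl
      · rw [hf1.arr 10 rfl]; exact hR.src.len u hu
    · rw [hlenu] at hi; rw [setArr_arr, if_neg (by simp), hf.arr 11 rfl]
      simp only [hs2, setReg_arr]
      rw [setArr_arr, if_neg (by simp), setArr_table _ _ _ _ _ _ (by omega) (by omega),
        hf1.arr 11 rfl, setReg_arr]
      by_cases hc : u = v
      · rw [if_pos hc] at hi; subst hc; rw [update_self, getD_append_single hi]
        simp only [and_true]; split_ifs with h1
        · rfl
        · exact hR.src.ent _ hu i (by omega)
      · rw [if_neg hc] at hi; rw [if_neg (by tauto), update_of_ne hc]; exact hR.src.ent u hu i hi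
    · rw [hlenu, setArr_arr, if_pos rfl, hf.arr 9 rfl]; split_ifs with hc
      · rw [pow_succ]
      · simp only [hs2, setReg_arr, setArr_arr, Nat.reduceEqDiff, if_false, a9]; exact hN.num u hu
    · rw [hlenu] at hj; rw [setArr_arr, if_neg (by simp)]; by_cases hc : u = v
      · rw [if_pos hc, pow_succ] at hj; subst hc; rcases Nat.lt_or_ge j d with hjd | hjd
        · rw [hrest j _ (by omega) (Or.inr hjd)]; exact (hN.le _ hu j hjd).trans hl
        · have := (hnew (j - d) (by omega)).1; rwa [show d + (j - d) = j by omega] at this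
      · rw [if_neg hc] at hj; rw [hrest j u (by omega) (Or.inl hc)]
        exact (hN.le u hu j hj).trans hl
    · rw [hlenu]; simp only [setArr_arr, Nat.reduceEqDiff, if_false]; by_cases hc : u = v
      · subst hc; rw [if_pos rfl, update_self, pow_succ, ← hd, mul_two, Finset.sum_range_add]
        have e1 : ∑ x ∈ rng d, g (σ' (s3.arr 12 (x * (I.n + 1) + v))) =
            ∑ S ∈ (h v).toFinset.powerset, g S := by
          rw [← hN.sum v hv g]; refine sum_congr rfl fun x hx => ?_; have hx' := mem_rng.1 hx
          rw [hrest x v (by omega) (Or.inr hx'), hold _ (hN.le v hv x hx')]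
        have e2 : ∑ x ∈ rng d, g (σ' (s3.arr 12 ((d + x) * (I.n + 1) + v))) =
            ∑ S ∈ (h v).toFinset.powerset, g (insert e S) := by
          rw [← hN.sum v hv (fun S => g (insert e S))]; refine sum_congr rfl fun x hx => ?_
          rw [(hnew x (mem_rng.1 hx)).2]
        have hnotin : e ∉ (h v).toFinset := fun hm =>
          lt_irrefl _ (hh e (List.mem_toFinset.1 hm))
        rw [e1, e2, ← Finset.sum_powerset_insert hnotin, List.toFinset_append]; congr 2; ext x; simp
      · rw [if_neg hc, update_of_ne hc, ← hN.sum u hu g]; refine sum_congr rfl fun x hx => ?_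
        have hx' := mem_rng.1 hx; rw [hrest x u (by omega) (Or.inl hc), hold _ (hN.le u hu x hx')]
    · have e1 := sum_update_pow (fun u => (h u).length) hv; simp only [hlenu]; rw [e1]; omega
end

theorem sum_getD {A : Type*} [AddCommMonoid A] (l : List ℕ) (h : l.Nodup) (g : ℕ → A) :
    ∑ i ∈ rng l.length, g (l.getD i 0) = ∑ v ∈ l.toFinset, g v := by
  induction l with
  | nil => simp
  | cons a l ih =>
    rw [List.nodup_cons] at h; rw [List.length_cons, Finset.sum_range_succ', List.toFinset_cons,
      Finset.sum_insert (by simpa using h.1), ← ih h.2, add_comm]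
    simp

/-! ### Reading the hyperedges -/

section
variable {I : Hy} {col : ℕ → ℕ} {β M : ℕ} {s : Store}

theorem Hy.length_hi_le (v : ℕ) {j j' : ℕ} (h : j ≤ j') :
    (I.hi v j).length ≤ (I.hi v j').length := by
  induction h with
  | refl => exact le_rfl
  | step _ ih => exact ih.trans (by rw [Hy.hi_succ]; simp)

theorem Input.szE (h : Input I s) {e : ℕ} (h10 : s.reg 10 = e) (he : e < I.m) :
    szE.ival s = I.sz e := by
  simp [HyperMotivo.szE, h10, h.a0 e he.le, h.a0 (e + 1) he, Hy.off, sum_range_succ]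

variable (I col) in
/-- The vertex lists when the first `e` hyperedges and `i` vertices of the next one are read. -/
def readList (e i id : ℕ) : List ℕ :=
  if id < e then (if I.a < I.sz id then I.ed id else [])
  else if id = e then (I.ed e).take i else rootList I col I.n id

variable (I) in
/-- The large hyperedges at `v` among the first `e`, and `e` if `v` is one of its first `i`
vertices. -/
def readHi (e i v : ℕ) : List ℕ := I.hi v e ++ if v ∈ (I.ed e).take i then [e] else []

theorem vt_notMem_take {e i : ℕ} (hi : i < I.sz e) : I.vt e i ∉ (I.ed e).take i := by
  intro h; obtain ⟨j, hj, hji⟩ := List.mem_iff_getElem.1 h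
  simp only [List.length_take, lt_min_iff] at hj; rw [List.getElem_take] at hji
  have := I.vt_inj (e := e) (i := j) (j := i) hj.2 hi
    (by rw [← hji, Hy.vt, getD_eq_getElem _ _ hj.2])
  omega

theorem take_succ_vt {e i : ℕ} (hi : i < I.sz e) :
    (I.ed e).take (i + 1) = (I.ed e).take i ++ [I.vt e i] := by
  have : i < (I.ed e).length := hi
  rw [List.take_add_one, Hy.vt, List.getElem?_eq_getElem this, getD_eq_getElem _ _ this]
  rfl

theorem readList_succ {e i : ℕ} (hi : i < I.sz e) : update (readList I col e i) e
    (readList I col e i e ++ [I.vt e i]) = readList I col e (i + 1) := by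
  funext id; rw [update_apply]; by_cases h : id = e
  · simp [readList, h, take_succ_vt hi]
  · simp [readList, h]

theorem readHi_succ {e i : ℕ} (hi : i < I.sz e) : update (readHi I e i) (I.vt e i)
    (readHi I e i (I.vt e i) ++ [e]) = readHi I e (i + 1) := by
  funext v; rw [update_apply]; by_cases h : v = I.vt e i
  · subst h; simp [readHi, take_succ_vt hi, vt_notMem_take hi]
  · simp [readHi, take_succ_vt hi, h]

theorem readList_next {e : ℕ} (he : e < I.m) :
    readList I col e (if I.a < I.sz e then I.sz e else 0) = readList I col (e + 1) 0 := by
  funext id; have := I.n_pos; have h0 : rootList I col I.n (e + 1) = [] := by simp [rootList]; omega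
  rcases lt_trichotomy id e with h | rfl | h
  · simp [readList, h, h.trans (Nat.lt_succ_self e)]
  · by_cases hc : I.a < I.sz id
    · simp only [readList, hc, if_true]; simp [Hy.sz]
    · simp [readList, hc]
  · by_cases hc : id = e + 1
    · subst hc; simp [readList, h0]
    · simp [readList, h.not_gt, h.ne', show ¬ id < e + 1 by omega, hc]

theorem readHi_next (e : ℕ) :
    readHi I e (if I.a < I.sz e then I.sz e else 0) = readHi I (e + 1) 0 := by
  funext v; simp only [readHi, Hy.hi_succ]; by_cases hc : I.a < I.sz e
  · simp only [hc, if_true]; simp [Hy.sz]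
  · grind

theorem length_readHi_le (e i v : ℕ) (h : I.a < I.sz e) :
    (readHi I e i v).length ≤ (I.hi v (e + 1)).length := by
  rw [Hy.hi_succ, readHi]; grind

/-- A large hyperedge doubles the number of sets at each of its vertices. The increase is the work
spent on it, so the total work for the trie telescopes. -/
theorem sum_two_pow_hi (e : ℕ) (h : I.a < I.sz e) :
    ∑ v ∈ rng I.n, 2 ^ (I.hi v (e + 1)).length =
      ∑ v ∈ rng I.n, 2 ^ (I.hi v e).length +
        ∑ i ∈ rng (I.sz e), 2 ^ (I.hi (I.vt e i) e).length := by
  have h1 := sum_getD (I.ed e) (Hy.ed_nodup e) (fun v => 2 ^ (I.hi v e).length)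
  rw [show ∑ i ∈ rng (I.sz e), 2 ^ (I.hi (I.vt e i) e).length = _ from h1]
  have h2 : (I.ed e).toFinset = (rng I.n).filter (· ∈ I.ed e) := by
    ext v; simp only [List.mem_toFinset, mem_filter, mem_rng]
    exact ⟨fun h => ⟨Hy.ed_lt h, h⟩, fun h => h.2⟩
  rw [h2, sum_filter, ← sum_add_distrib]; refine sum_congr rfl fun v _ => ?_; rw [Hy.hi_succ]; grind

theorem trieC_spec (hB : Big I β M) (hC : Consts I s)
    (hR : ReadOK I (readList I col 0 0) (readHi I 0 0) s) :
    Tri M trieC s (43 * ∑ v ∈ rng I.n, 2 ^ (I.hi v I.m).length + 10 * I.m + 10)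
      (ReadOK I (readList I col I.m 0) (readHi I I.m 0)) := by
  have hidx := hB.idx; let t : ℕ → ℕ := fun e => if I.a < I.sz e then
    ∑ i ∈ rng (I.sz e), (17 * 2 ^ (I.hi (I.vt e i) e).length + 23 + 3) + 3 else 1
  refine (for_ I.m (fun e => t e + 1) (fun e s' => ReadOK I (readList I col e 0) (readHi I e 0) s')
    (by omega) rfl ?_ ⟨hR.lists.congr rfl rfl rfl, ⟨hR.src.len, hR.src.ent⟩, ?_⟩ ?_).conseq ?_
    fun s' hs' => hs'.1
  · intro e s' hf _; rw [ival_reg, hf.reg 3 rfl, hC.r3]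
  · obtain ⟨σ, ctr, hT, hN, hc⟩ := hR.trie
    exact ⟨σ, ctr, hT.congr (by simp) rfl rfl, ⟨hN.num, hN.le, hN.sum⟩, hc⟩
  · intro e he s' hf h10 hR'; have hC' := hC.fr hf (by decide); have hszE := hC'.szE h10 he
    have hb : (Expr.lt (rg 1) szE).ival s' = if I.a < I.sz e then 1 else 0 := by simp [hszE, hC'.r1]
    have upd : ∀ {ℓ h} {s2 : Store} {x : ℕ}, ReadOK I ℓ h s2 → ReadOK I ℓ h (s2.setReg 10 x) := by
      intro ℓ h s2 x hR2; obtain ⟨σ, ctr, hT, hN, hc⟩ := hR2.trie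
      exact ⟨hR2.lists.congr rfl rfl rfl, ⟨hR2.src.len, hR2.src.ent⟩, σ, ctr,
        hT.congr (by simp) rfl rfl, ⟨hN.num, hN.le, hN.sum⟩, hc⟩
    refine Tri.ite (fun hc => ?_) (fun hc => ?_)
    · have hhi : I.a < I.sz e := by
        by_contra hn
        simp_all
      have nx := readList_next (col := col) he; have nh := readHi_next (I := I) e
      rw [if_pos hhi] at nx nh
      refine (for_ (I.sz e) (fun i => 17 * 2 ^ (I.hi (I.vt e i) e).length + 23)
        (fun i s2 => ReadOK I (readList I col e i) (readHi I e i) s2)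
        ((Hy.sz_le e).trans (by omega)) rfl ?_ ?_ ?_).conseq ?_ ?_
      · intro i s2 hf2 _; exact (hC'.fr hf2 (by decide)).szE ((hf2.reg 10 rfl).trans h10) he
      · obtain ⟨σ, ctr, hT, hN, hc⟩ := hR'.trie
        exact ⟨hR'.lists.congr rfl rfl rfl, ⟨hR'.src.len, hR'.src.ent⟩, σ, ctr,
          hT.congr (by simp) rfl rfl, ⟨hN.num, hN.le, hN.sum⟩, hc⟩
      · intro i hi s2 hf2 h11 hR2; have hrv : readHi I e i (I.vt e i) = I.hi (I.vt e i) e := by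
          simp [readHi, vt_notMem_take hi]
        have := trieVertexC_spec hB (hC'.fr hf2 (by decide)) hR2 ((hf2.reg 10 rfl).trans h10) h11 he hi
          (by simpa [readList] using vt_notMem_take hi)
          (by rw [hrv]; exact fun x hx => (Hy.mem_hi.1 hx).1)
          (fun v _ => (length_readHi_le e i v hhi).trans ((Hy.length_hi_le v he).trans (hB.deg v)))
        rw [hrv, readList_succ hi, ← hrv, readHi_succ hi, hrv] at this
        refine this.conseq le_rfl fun s3 hR3 => ?_; obtain ⟨σ, ctr, hT, hN, hc⟩ := hR3.trie
        exact ⟨hR3.lists.congr rfl rfl rfl, ⟨hR3.src.len, hR3.src.ent⟩, σ, ctr,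
          hT.congr (by simp) rfl rfl, ⟨hN.num, hN.le, hN.sum⟩, hc⟩
      · grind
      · simp_all
    · have hlo : ¬ I.a < I.sz e := by simp_all
      have nx := readList_next (col := col) he; have nh := readHi_next (I := I) e
      rw [if_neg hlo] at nx nh; rw [nx, nh] at hR'; simp only [t, if_neg hlo]
      exact Tri.skip (upd hR')
  -- A vertex with `h` earlier hyperedges costs `17 * 2 ^ h + 26 ≤ 43 * 2 ^ h` steps, and `2 ^ h` is
  -- what the sum over the vertices gains.
  · have key : ∀ e, ∑ j ∈ rng e, (t j + 1 + 3) ≤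
        43 * ∑ v ∈ rng I.n, 2 ^ (I.hi v e).length + 10 * e := by
      intro e
      induction e with
      | zero => simp
      | succ e ih =>
        rw [sum_range_succ]; by_cases hc : I.a < I.sz e
        · rw [sum_two_pow_hi e hc]
          have : t e ≤ 43 * ∑ i ∈ rng (I.sz e), 2 ^ (I.hi (I.vt e i) e).length + 3 := by
            simp only [t, if_pos hc]; rw [mul_sum]
            refine Nat.add_le_add_right (sum_le_sum fun i _ => ?_) 3; grind
          omega
        · have e1 : ∀ v, I.hi v (e + 1) = I.hi v e := fun v => by
            rw [Hy.hi_succ]; simp [hc]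
          grind
    grind

theorem sourceC_spec (hB : Big I β M) (hC : Consts I s)
    (h : SrcOK I (I.n + 1) (fun v => I.hi v I.m) s) :
    Tri M sourceC s (8 * I.n + 20) (SrcOK I (I.n + 1) I.src) := by
  have hidx := hB.idx; refine (for_const (I.n + 1) 5 (fun j s' => SrcOK I (I.n + 1)
    (fun v => if v < j then I.src v else I.hi v I.m) s') (by omega) rfl ?_ ?_ ?_).conseq (by omega) ?_
  · intro e s' hf _; rw [ival_reg, hf.reg 7 rfl, hC.r7]
  · exact ⟨fun v hv => by simpa using h.len v hv, fun v hv i hi => by simpa using h.ent v hv i hi⟩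
  · intro j hj s' hf h10 hS; have hC' := hC.fr hf (by decide); have hl := hS.len j hj
    simp only [lt_self_iff_false, if_false] at hl; have hd := hB.deg j
    refine stov (j := (I.hi j I.m).length * (I.n + 1) + j) (v := I.m + j) ?_ ?_ (by omega)
      (stov (j := j) (v := (I.hi j I.m).length + 1) ?_ ?_ (by omega) (nil ⟨?_, ?_⟩))
    · simp [h10, hl, hC'.r7]
    · simp [h10, hC'.r3]
    · simp [h10]
    · simp [setArr_arr, h10, hl]
    · intro v hv; simp only [setReg_arr, setArr_arr, if_true, Nat.reduceEqDiff, if_false]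
      by_cases hc : v = j
      · simp [hc, Hy.src]
      · rw [if_neg hc, hS.len v hv]; grind
    · intro v hv i hi; simp only [setReg_arr]
      rw [setArr_arr, if_neg (by simp), setArr_table _ _ _ _ _ _ hj hv]; by_cases hc : v = j
      · subst hc
        simp only [Nat.lt_succ_self, if_true, Hy.src, List.length_append, List.length_singleton] at hi
        simp only [Nat.lt_succ_self, if_true, Hy.src, and_true]; rw [getD_append_single hi]
        split_ifs with h1
        · rfl
        · have := hS.ent v hv i; grind
      · have e1 : (if v < j + 1 then I.src v else I.hi v I.m) =
            if v < j then I.src v else I.hi v I.m := by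
          grind
        simp only [e1] at hi ⊢; rw [if_neg (by tauto)]; exact hS.ent v hv i hi
  · rintro s' ⟨hS, -⟩; exact ⟨fun v hv => by simpa [hv] using hS.len v hv,
      fun v hv i hi => by simpa [hv] using hS.ent v hv i (by simpa [hv] using hi)⟩

/-- The index of the first list at a vertex with a given property. -/
theorem firstC_spec {u v N : ℕ} {h : ℕ → List ℕ} (hS : SrcOK I N h s) (hv : v < N)
    (hM : (h v).length ≤ M) (h20 : s.reg 20 = u) (h21 : s.reg 21 = v) (h7 : s.reg 7 = I.n + 1)
    (h8 : s.reg 8 = I.L) (p : ℕ → Bool)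
    (hp : ∀ id ∈ h v, 1 - s.arr 17 (u * I.L + id) = if p id then 0 else 1) :
    Tri M firstC s (2 * (h v).length + 5) (fun s' => s'.reg 22 = (h v).findIdx p) := by
  have hle := List.findIdx_le_length (p := p) (xs := h v)
  refine time (asgv (v := 0) rfl (by omega) (cons (loop ((h v).findIdx p) (fun _ => 1)
    (fun j s' => s'.reg 22 = j) (by simp) ?_ ?_) (T₂ := 1) fun s' hs' _ => nil hs'))
    (by simp; omega)
  all_goals
    have ev : ∀ s' j, Fr (Cmd.loop (.lt (rg 22) (ld 10 (rg 21)) *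
        (1 - ld 17 (rg 20 * rg 8 + ld 11 (rg 22 * rg 7 + rg 21)))) (.assign 22 (rg 22 + 1)))
        (s.setReg 22 0) s' → s'.reg 22 = j → (Expr.lt (rg 22) (ld 10 (rg 21)) *
        (1 - ld 17 (rg 20 * rg 8 + ld 11 (rg 22 * rg 7 + rg 21)))).ival s' =
        if hj : j < (h v).length then (if p ((h v)[j]) then 0 else 1) else 0 := by
      intro s' j hf hj; have e20 : s'.reg 20 = u := hf.rg h20; have e21 : s'.reg 21 = v := hf.rg h21
      have e7 : s'.reg 7 = I.n + 1 := hf.rg h7; have e8 : s'.reg 8 = I.L := hf.rg h8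
      have a10 := hf.arr 10 rfl; have a11 := hf.arr 11 rfl; have a17 := hf.arr 17 rfl
      simp only [ival_mul, ival_lt, ival_reg, ival_load, ival_sub, ival_one, ival_add, hj, e20, e21,
        e7, e8, a10, a11, a17, setReg_arr, hS.len v hv]
      split_ifs with h1 h2
      · rw [hS.ent v hv j h1, getD_eq_getElem _ _ h1, hp _ (getElem_mem h1), if_pos h2]
      · rw [hS.ent v hv j h1, getD_eq_getElem _ _ h1, hp _ (getElem_mem h1), if_neg h2]
      · simp
  · intro j hj s' hf hj'; have hjl : j < (h v).length := by omega
    refine ⟨?_, assign (by simp [hj']; omega) (by simp [hj'])⟩; grind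
  · grind

theorem Hy.length_src (v : ℕ) : (I.src v).length = (I.hi v I.m).length + 1 := by simp [Hy.src]

theorem Hy.src_lt {v id : ℕ} (hv : v ≤ I.n) (h : id ∈ I.src v) : id < I.L := by
  simp only [Hy.src, mem_append, Hy.mem_hi, List.mem_singleton] at h; simp only [Hy.L]; omega

/-- The lists when the first `e` small hyperedges and `t` pairs of the next one are read. -/
structure LowOK (I : Hy) (col : ℕ → ℕ) (e t : ℕ) (ℓ : ℕ → List ℕ) : Prop where
  hi : ∀ id < I.m, (ℓ id).toFinset = I.mem col id
  root : (ℓ (I.m + I.n)).toFinset = I.mem col (I.m + I.n)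
  low : ∀ v < I.n, ∀ u, u ∈ ℓ (I.m + v) ↔ (I.LowAdj e v u ∨
    ∃ t' < t, v = I.vt e (t' / I.sz e) ∧ u = I.vt e (t' % I.sz e)) ∧ ¬ I.HiAdj v u

theorem lowPairC_spec (hB : Big I β M) (hC : Consts I s) (hS : SrcOK I (I.n + 1) I.src s)
    {ℓ : ℕ → List ℕ} (hL : ListsOK I ℓ s) {e t : ℕ} (hO : LowOK I col e t ℓ) (he : e < I.m)
    (h10 : s.reg 10 = e) (h11 : s.reg 11 = t) (h13 : s.reg 13 = I.sz e)
    (ht : t < I.sz e * I.sz e) :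
    Tri M lowPairC s (2 * β + 25) (fun s' => ∃ ℓ', ListsOK I ℓ' s' ∧ LowOK I col e (t + 1) ℓ') := by
  have hidx := hB.idx; have hz : 0 < I.sz e := Nat.pos_of_ne_zero fun h => by simp [h] at ht
  have hi : t / I.sz e < I.sz e := Nat.div_lt_of_lt_mul ht
  have hj : t % I.sz e < I.sz e := mod_lt _ hz
  obtain ⟨v, hvd⟩ : ∃ v, v = I.vt e (t / I.sz e) := ⟨_, rfl⟩
  obtain ⟨u, hud⟩ : ∃ u, u = I.vt e (t % I.sz e) := ⟨_, rfl⟩; have hv : v < I.n := hvd ▸ Hy.vt_lt hi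
  have hu : u < I.n := hud ▸ Hy.vt_lt hj
  have hlen : (I.src v).length ≤ β + 1 := by rw [Hy.length_src]; have := hB.deg v; omega
  have hvL : I.m + v < I.L := by simp only [Hy.L]; omega
  have hstep : ∀ ℓ', (∀ id, id ≠ I.m + v → ℓ' id = ℓ id) →
      (∀ x, x ∈ ℓ' (I.m + v) ↔ x ∈ ℓ (I.m + v) ∨ x = u ∧ ¬ I.HiAdj v u) →
      LowOK I col e (t + 1) ℓ' := by
    intro ℓ' h1 h2; refine ⟨fun id hid => by rw [h1 id (by omega)]; exact hO.hi id hid,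
      by rw [h1 _ (by omega)]; exact hO.root, fun v' hv' x => ?_⟩
    have e1 : (∃ t' < t + 1, v' = I.vt e (t' / I.sz e) ∧ x = I.vt e (t' % I.sz e)) ↔
        (∃ t' < t, v' = I.vt e (t' / I.sz e) ∧ x = I.vt e (t' % I.sz e)) ∨ (v' = v ∧ x = u) := by
      grind
    rw [e1]; by_cases hc : v' = v
    · subst hc; rw [h2, hO.low v' hv', eq_self_iff_true, true_and]; grind
    · rw [h1 _ (by omega), hO.low v' hv']; simp_all
  refine time (asgv (v := v) ?_ (by omega) (asgv (v := u) ?_ (by omega)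
    (cons (firstC_spec (s := (s.setReg 21 v).setReg 20 u) (u := u) (v := v) (N := I.n + 1)
      (h := I.src) (p := fun id => decide (u ∈ ℓ id)) ⟨hS.len, hS.ent⟩ (by omega) (by omega)
      (by simp) (by simp) (by simp [hC.r7]) (by simp [hC.r8]) ?_)
      (T₂ := 10) ?_))) (by omega)
  · simp [h10, h11, h13, hC.a0 e he.le, hC.a1 e _ hi, hvd]
  · simp [h10, h11, h13, hC.a0 e he.le, hC.a1 e _ hj, hud]
  · intro id hid
    simp only [setReg_arr, hL.inc id (Hy.src_lt (by omega) hid) u hu, decide_eq_true_eq]; grind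
  intro s1 h22 hf; have e21 : s1.reg 21 = v := hf.rg rfl; have e20 : s1.reg 20 = u := hf.rg rfl
  have e3 : s1.reg 3 = I.m := hf.rg hC.r3; have e8 : s1.reg 8 = I.L := hf.rg hC.r8
  have hL1 : ListsOK I ℓ s1 := hL.congr (hf.arr 15 rfl) (hf.arr 16 rfl) (hf.arr 17 rfl)
  have hcond : (Expr.lt (rg 22) (ld 10 (rg 21))).ival s1 =
      if ∃ id ∈ I.src v, u ∈ ℓ id then 1 else 0 := by
    simp only [ival_lt, ival_reg, ival_load, h22, e21]; rw [hf.arr 10 rfl]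
    simp only [setReg_arr, hS.len v (by omega), List.findIdx_lt_length, decide_eq_true_eq]
  -- The lists at `v` are its large hyperedges and its own list of neighbours recorded so far, so
  -- the search fails exactly for a new vertex without a common large hyperedge.
  have hHi : (∃ id ∈ I.src v, u ∈ ℓ id) ↔ I.HiAdj v u ∨ u ∈ ℓ (I.m + v) := by
    simp only [Hy.src, mem_append, List.mem_singleton, Hy.mem_hi]; constructor
    · rintro ⟨id, ⟨h1, h2, h3⟩ | rfl, h⟩
      · have h4 := List.mem_toFinset.2 h
        rw [hO.hi id h1, Hy.mem, if_pos h1, if_pos h2, List.mem_toFinset] at h4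
        exact Or.inl ⟨id, h2, h3, h4⟩
      · simp_all
    · rintro (⟨id, h2, h3, h4⟩ | h)
      · have h1 : id < I.m := Hy.sz_lt (by omega); refine ⟨id, Or.inl ⟨h1, h2, h3⟩, ?_⟩
        rw [← List.mem_toFinset, hO.hi id h1, Hy.mem, if_pos h1, if_pos h2, List.mem_toFinset]
        exact h4
      · simp_all
  refine time (cons (Tri.ite (T := 7) (Q := fun s' => ∃ ℓ', ListsOK I ℓ' s' ∧
    LowOK I col e (t + 1) ℓ') (fun hc => ?_) (fun hc => ?_)) (T₂ := 1) fun s' hs' _ => nil hs')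
    (by omega)
  · have hc' : I.HiAdj v u ∨ u ∈ ℓ (I.m + v) := by
      by_contra hn
      simp_all
    refine (Tri.skip ⟨ℓ, hL1, hstep ℓ (fun _ _ => rfl) fun x => ?_⟩).time (by omega); simp_all
  · have hc' : ¬ (I.HiAdj v u ∨ u ∈ ℓ (I.m + v)) := by grind
    refine (appendC_spec (s := s1) (id := I.m + v) (u := u) hB e8 hL1 (fun s2 hs2 => ?_)
      (fun s2 hs2 => ?_) hvL hu (by tauto)).conseq le_rfl fun s2 hs2 => ⟨_, hs2, hstep _ ?_ ?_⟩
    · simp_all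
    · simp_all
    · simp_all
    · simp_all

theorem lowC_spec (hB : Big I β M) (hC : Consts I s) (hS : SrcOK I (I.n + 1) I.src s)
    {ℓ : ℕ → List ℕ} (hL : ListsOK I ℓ s) (hO : LowOK I col 0 0 ℓ) :
    Tri M lowC s (∑ e ∈ rng I.m, ((if I.a < I.sz e then 0 else
      I.sz e * I.sz e * (2 * β + 28)) + 15) + 3)
      (fun s' => ∃ ℓ', ListsOK I ℓ' s' ∧ ∀ id < I.L, (ℓ' id).toFinset = I.mem col id) := by
  have hidx := hB.idx; refine (for_ I.m (fun e => (if I.a < I.sz e then 0 else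
      I.sz e * I.sz e * (2 * β + 28)) + 12) (fun e s' => ∃ ℓ', ListsOK I ℓ' s' ∧ LowOK I col e 0 ℓ')
    (by omega) rfl ?_ ⟨ℓ, hL.congr rfl rfl rfl, hO⟩ ?_).conseq le_rfl ?_
  · intro e s' hf _; rw [ival_reg, hf.reg 3 rfl, hC.r3]
  · rintro e he s' hf h10 ⟨ℓ1, hL1, hO1⟩; have hC' := hC.fr hf (by decide)
    have hszE := hC'.szE h10 he; have hS' : SrcOK I (I.n + 1) I.src s' :=
      ⟨by rw [hf.arr 10 rfl]; exact hS.len, by rw [hf.arr 11 rfl]; exact hS.ent⟩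
    have hb : (Expr.lt (rg 1) szE).ival s' = if I.a < I.sz e then 1 else 0 := by simp [hszE, hC'.r1]
    refine Tri.ite (fun hc => ?_) (fun hc => ?_)
    · have hhi : I.a < I.sz e := by
        by_contra hn
        simp_all
      refine (Tri.skip ⟨ℓ1, hL1.congr rfl rfl rfl, hO1.hi, hO1.root, fun v hv u => ?_⟩).time (by omega)
      rw [hO1.low v hv]; have : I.LowAdj (e + 1) v u ↔ I.LowAdj e v u := by
        constructor
        · rintro ⟨x, hx, h1, h2⟩; refine ⟨x, ?_, h1, h2⟩; grind
        · rintro ⟨x, hx, h1⟩; exact ⟨x, by omega, h1⟩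
      simp_all
    · have hlo : ¬ I.a < I.sz e := by simp_all
      rw [if_neg hlo]; have hsz := Hy.sz_le (I := I) e
      refine time (asgv (v := I.sz e) hszE (by omega) (cons
        (for_const (I.sz e * I.sz e) (2 * β + 25) (fun t s2 => ∃ ℓ', ListsOK I ℓ' s2 ∧
          LowOK I col e t ℓ') ?_ rfl ?_ ⟨ℓ1, hL1.congr rfl rfl rfl, hO1⟩ ?_) (T₂ := 1) ?_)) ?_
      · exact (Nat.mul_le_mul (by omega) (by omega)).trans hB.sq
      · intro t s2 hf2 _; rw [ival_mul, ival_reg, hf2.reg 13 rfl]; simp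
      · rintro t ht s2 hf2 h11 ⟨ℓ2, hL2, hO2⟩
        have hC2 : Consts I s2 := (hC'.fr (P := .assign 13 szE) (s' := s'.setReg 13 (I.sz e))
          ⟨fun x hx => by simp [Cmd.modR] at hx; simp [Ne.symm hx], fun _ _ => rfl⟩ (by decide)).fr hf2
            (by decide)
        refine (lowPairC_spec hB hC2 ⟨by rw [hf2.arr 10 rfl]; exact hS'.len,
          by rw [hf2.arr 11 rfl]; exact hS'.ent⟩ hL2 hO2 he
          (hf2.rg h10) h11 (hf2.rg rfl) ht).conseq
          le_rfl ?_
        rintro s3 ⟨ℓ3, hL3, hO3⟩; exact ⟨ℓ3, hL3.congr rfl rfl rfl, hO3⟩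
      · rintro s2 ⟨⟨ℓ2, hL2, hO2⟩, -⟩ hf2
        refine nil ⟨ℓ2, hL2.congr rfl rfl rfl, hO2.hi, hO2.root, fun v hv u => ?_⟩
        rw [hO2.low v hv]; refine and_congr_left fun _ => ?_
        simp only [Nat.not_lt_zero, false_and, exists_const, or_false]; constructor
        · rintro (⟨x, hx, h1⟩ | ⟨t, ht, rfl, rfl⟩)
          · exact ⟨x, by omega, h1⟩
          · have hz : 0 < I.sz e := Nat.pos_of_ne_zero fun h => by simp [h] at ht
            exact ⟨e, by omega, hlo, Hy.vt_mem (Nat.div_lt_of_lt_mul ht),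
              Hy.vt_mem (mod_lt _ hz)⟩
        · rintro ⟨x, hx, h1, h2, h3⟩; rcases lt_succ_iff_lt_or_eq.1 hx with hx | rfl
          · exact Or.inl ⟨x, hx, h1, h2, h3⟩
          · obtain ⟨i, hi, rfl⟩ := Hy.mem_ed_iff.1 h2; obtain ⟨j, hj, rfl⟩ := Hy.mem_ed_iff.1 h3
            have hz : 0 < I.sz x := by omega
            refine Or.inr ⟨i * I.sz x + j, by nlinarith, ?_, ?_⟩
            · rw [mul_comm, Nat.mul_add_div hz, div_eq_of_lt hj, add_zero]
            · rw [mul_comm, Nat.mul_add_mod, mod_eq_of_lt hj]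
      · ring_nf; omega
  · rintro s' ⟨⟨ℓ', hL', hO'⟩, -⟩; refine ⟨ℓ', hL', fun id hid => ?_⟩; simp only [Hy.L] at hid
    rcases Nat.lt_or_ge id I.m with h | h
    · exact hO'.hi id h
    by_cases hc : id = I.m + I.n
    · rw [hc]; exact hO'.root
    · obtain ⟨v, rfl⟩ := Nat.exists_eq_add_of_le h; have hv : v < I.n := by omega
      ext u; rw [List.mem_toFinset, hO'.low v hv, Hy.mem, if_neg (by omega), if_neg (by omega)]
      simp only [Nat.not_lt_zero, false_and, exists_const, or_false, mem_filter,
        mem_rng, Nat.add_sub_cancel_left]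
      exact ⟨fun h => ⟨h.1.elim fun x hx => Hy.ed_lt hx.2.2.2, h⟩, fun h => h.2⟩
end

/-! ## The numbers of small hyperedges that contain a set -/

theorem sum_digits_lt {B : ℕ} {φ : ℕ → ℕ} : ∀ {k : ℕ}, (∀ x < k, φ x < B) →
    ∑ x ∈ rng k, φ x * B ^ x < B ^ k := by
  intro k
  induction k with
  | zero => simp
  | succ k ih =>
    intro h; rw [sum_range_succ, pow_succ]; have h1 := ih fun x hx => h x (by omega)
    have h2 : (φ k + 1) * B ^ k ≤ B * B ^ k := Nat.mul_le_mul_right _ (h k (by omega)); linarith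

theorem digit_sum {B : ℕ} {φ : ℕ → ℕ} : ∀ {k : ℕ}, (∀ x < k, φ x < B) → ∀ {x : ℕ}, x < k →
    (∑ i ∈ rng k, φ i * B ^ i) / B ^ x % B = φ x := by
  intro k
  induction k with
  | zero => intro _ x hx; omega
  | succ k ih =>
    intro h x hx; have hB : 0 < B := (Nat.zero_le _).trans_lt (h x hx); rw [sum_range_succ]
    rcases lt_succ_iff_lt_or_eq.1 hx with hx' | rfl
    · obtain ⟨d, rfl⟩ := Nat.exists_eq_add_of_lt hx'
      have e : φ (x + d + 1) * B ^ (x + d + 1) = B ^ x * (B * (φ (x + d + 1) * B ^ d)) := by ring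
      rw [e, Nat.add_mul_div_left _ _ (by positivity), Nat.add_mul_mod_self_left]; grind
    · rw [Nat.add_mul_div_right _ _ (by positivity),
        div_eq_of_lt (sum_digits_lt fun i hi => h i (by omega)), zero_add,
        mod_eq_of_lt (h x (by omega))]

theorem sum_digit (B t k : ℕ) : ∑ x ∈ rng k, t / B ^ x % B * B ^ x = t % B ^ k := by
  induction k with
  | zero => simp [Nat.mod_one]
  | succ k ih => rw [sum_range_succ, ih, Nat.mod_pow_succ, mul_comm]

section
variable {I : Hy} {col : ℕ → ℕ} {β M : ℕ} {s : Store}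

/-- The code of a set of vertices: `D x` is `0`, or exceeds the vertex of colour `x` by one. -/
def Hy.code (I : Hy) (D : ℕ → ℕ) : ℕ := ∑ x ∈ rng I.k, D x * (I.n + 1) ^ x

/-- The digits that belong to the number `t` of a subset of the hyperedge `e`. -/
def Hy.dig (I : Hy) (e t x : ℕ) : ℕ :=
  if t / (I.sz e + 1) ^ x % (I.sz e + 1) = 0 then 0
  else I.vt e (t / (I.sz e + 1) ^ x % (I.sz e + 1) - 1) + 1

/-- The digits below `j` have the right colours. -/
def Good (col : ℕ → ℕ) (j : ℕ) (D : ℕ → ℕ) : Prop := ∀ x < j, D x ≠ 0 → col (D x - 1) = x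

instance (j : ℕ) (D : ℕ → ℕ) : Decidable (Good col j D) :=
  inferInstanceAs (Decidable (∀ x < j, D x ≠ 0 → col (D x - 1) = x))

/-- The set with digits `D` is contained in the hyperedge `e`. -/
def Hy.Within (I : Hy) (D : ℕ → ℕ) (e : ℕ) : Prop := ∀ x < I.k, D x ≠ 0 → D x - 1 ∈ I.ed e

instance (D : ℕ → ℕ) (e : ℕ) : Decidable (I.Within D e) :=
  inferInstanceAs (Decidable (∀ x < I.k, D x ≠ 0 → D x - 1 ∈ I.ed e))

/-- The number of small hyperedges that contain the set with digits `D`. -/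
def Hy.lowDeg (I : Hy) (j : ℕ) (D : ℕ → ℕ) : ℕ :=
  ((rng j).filter fun e => ¬ I.a < I.sz e ∧ I.Within D e).card

theorem Hy.lowDeg_le (j : ℕ) (D : ℕ → ℕ) : I.lowDeg j D ≤ j := by
  have := card_filter_le (rng j) fun e => ¬ I.a < I.sz e ∧ I.Within D e; rwa [card_range] at this

theorem Hy.dig_pos {e t x : ℕ} (h : I.dig e t x ≠ 0) :
    t / (I.sz e + 1) ^ x % (I.sz e + 1) - 1 < I.sz e := by
  simp only [Hy.dig] at h; have := mod_lt (t / (I.sz e + 1) ^ x) (show 0 < I.sz e + 1 by omega)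
  grind

theorem Hy.dig_sub {e t x : ℕ} (h : I.dig e t x ≠ 0) :
    I.dig e t x - 1 = I.vt e (t / (I.sz e + 1) ^ x % (I.sz e + 1) - 1) := by
  simp only [Hy.dig] at h ⊢; simp_all

theorem Hy.dig_le (e t x : ℕ) : I.dig e t x ≤ I.n := by
  by_cases h : I.dig e t x = 0
  · omega
  · have h1 := Hy.dig_sub h; have h2 := Hy.vt_lt (Hy.dig_pos h); omega

theorem Hy.code_lt {D : ℕ → ℕ} (h : ∀ x < I.k, D x ≤ I.n) : I.code D < (I.n + 1) ^ I.k :=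
  sum_digits_lt fun x hx => Nat.lt_succ_of_le (h x hx)

theorem Hy.code_inj {D D' : ℕ → ℕ} (h : ∀ x < I.k, D x ≤ I.n) (h' : ∀ x < I.k, D' x ≤ I.n)
    (he : I.code D = I.code D') : ∀ x < I.k, D x = D' x := by
  intro x hx; rw [← digit_sum (fun x hx => Nat.lt_succ_of_le (h x hx)) hx,
    ← digit_sum (fun x hx => Nat.lt_succ_of_le (h' x hx)) hx]
  exact congrArg (fun z => z / (I.n + 1) ^ x % (I.n + 1)) he

/-- The code determines the selected vertices, and these determine the digits because a hyperedge
lists no vertex twice. -/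
theorem Hy.dig_inj {e t t' : ℕ} (ht : t < (I.sz e + 1) ^ I.k) (ht' : t' < (I.sz e + 1) ^ I.k)
    (h : I.code (I.dig e t) = I.code (I.dig e t')) : t = t' := by
  rw [← mod_eq_of_lt ht, ← mod_eq_of_lt ht', ← sum_digit, ← sum_digit]
  refine sum_congr rfl fun x hx => ?_
  have hd := Hy.code_inj (fun x _ => Hy.dig_le _ _ _) (fun x _ => Hy.dig_le _ _ _) h x
    (mem_rng.1 hx)
  congr 1; by_cases h0 : I.dig e t x = 0
  · have h0' := hd ▸ h0; simp only [Hy.dig] at h0 h0'; simp_all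
  · have h0' : I.dig e t' x ≠ 0 := hd ▸ h0; have := Hy.vt_inj (Hy.dig_pos h0) (Hy.dig_pos h0')
      (by rw [← Hy.dig_sub h0, ← Hy.dig_sub h0', hd])
    have n1 : t / (I.sz e + 1) ^ x % (I.sz e + 1) ≠ 0 := fun hz => h0 (by simp [Hy.dig, hz])
    have n2 : t' / (I.sz e + 1) ^ x % (I.sz e + 1) ≠ 0 := fun hz => h0' (by simp [Hy.dig, hz])
    omega

/-- Each colourful subset of `e` is counted once: injectivity gives at most one number, and the
positions of the vertices, shifted by one, are the digits of such a number. -/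
theorem card_dig (e : ℕ) {D : ℕ → ℕ} (hD : ∀ x < I.k, D x ≤ I.n) (hg : Good col I.k D) :
    ((rng ((I.sz e + 1) ^ I.k)).filter fun t =>
      Good col I.k (I.dig e t) ∧ I.code (I.dig e t) = I.code D).card =
      if I.Within D e then 1 else 0 := by
  split_ifs with hw
  · have h1 : ∀ x < I.k, ∃ φ, φ < I.sz e + 1 ∧ (D x = 0 → φ = 0) ∧
        (D x ≠ 0 → φ ≠ 0 ∧ I.vt e (φ - 1) = D x - 1) := by
      intro x hx; by_cases h0 : D x = 0
      · simp_all
      · obtain ⟨i, hi, hv⟩ := Hy.mem_ed_iff.1 (hw x hx h0)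
        exact ⟨i + 1, by omega, fun h => absurd h h0, fun _ => ⟨by omega, hv⟩⟩
    choose! φ hφ hφ0 hφ1 using h1
    have hd : ∀ x < I.k, I.dig e (∑ x ∈ rng I.k, φ x * (I.sz e + 1) ^ x) x = D x := by
      intro x hx; simp only [Hy.dig, digit_sum hφ hx]; grind
    refine le_antisymm (Finset.card_le_one.2 fun t ht t' ht' => ?_) (card_pos.2
      ⟨∑ x ∈ rng I.k, φ x * (I.sz e + 1) ^ x, ?_⟩)
    · simp only [mem_filter, mem_rng] at ht ht'
      exact Hy.dig_inj ht.1 ht'.1 (ht.2.2.trans ht'.2.2.symm)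
    · simp only [mem_filter, mem_rng]
      refine ⟨sum_digits_lt hφ, fun x hx h0 => ?_, sum_congr rfl fun x hx => ?_⟩
      · rw [hd x hx] at h0 ⊢; exact hg x hx h0
      · simp_all
  · rw [card_eq_zero, Finset.eq_empty_iff_forall_notMem]; intro t ht
    simp only [mem_filter, mem_rng] at ht; refine hw fun x hx h0 => ?_
    have := Hy.code_inj (fun x _ => Hy.dig_le _ _ _) hD ht.2.2 x hx; rw [← this] at h0 ⊢
    rw [Hy.dig_sub h0]; exact Hy.vt_mem (Hy.dig_pos h0)

theorem codeDigitC_spec (hB : Big I β M) (hC : Consts I s) (hc : ∀ v < I.n, s.arr 2 v = col v)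
    {e t j : ℕ} (he : e < I.m) (h10 : s.reg 10 = e) (h12 : s.reg 12 = j)
    (h13 : s.reg 13 = I.sz e + 1) (hj : j < I.k) (h15 : s.reg 15 = t / (I.sz e + 1) ^ j)
    (ht : t ≤ M) (h17 : s.reg 17 = if Good col j (I.dig e t) then 1 else 0)
    (h18 : s.reg 18 = ∑ x ∈ rng j, I.dig e t x * (I.n + 1) ^ x) :
    Tri M codeDigitC s 14 (fun s' => s'.reg 15 = t / (I.sz e + 1) ^ (j + 1) ∧
      s'.reg 17 = (if Good col (j + 1) (I.dig e t) then 1 else 0) ∧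
      s'.reg 18 = ∑ x ∈ rng (j + 1), I.dig e t x * (I.n + 1) ^ x) := by
  have hidx := hB.idx; have hsz := Hy.sz_le (I := I) e
  obtain ⟨φ, hφ⟩ : ∃ φ, φ = t / (I.sz e + 1) ^ j % (I.sz e + 1) := ⟨_, rfl⟩
  have hφlt : φ < I.sz e + 1 := hφ ▸ mod_lt _ (Nat.succ_pos _)
  have hGs : Good col (j + 1) (I.dig e t) ↔ Good col j (I.dig e t) ∧
      (I.dig e t j ≠ 0 → col (I.dig e t j - 1) = j) :=
    ⟨fun h => ⟨fun x hx => h x (by omega), h j (by omega)⟩, fun h x hx => by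
      rcases lt_succ_iff_lt_or_eq.1 hx with hx | rfl
      · exact h.1 x hx
      · omega⟩
  have hq : t / (I.sz e + 1) ^ j / (I.sz e + 1) = t / (I.sz e + 1) ^ (j + 1) := by
    rw [Nat.div_div_eq_div_mul, pow_succ]
  refine time (asgv (v := φ) (by simp [h15, h13, hφ]) (by omega)
    (asgv (v := t / (I.sz e + 1) ^ (j + 1)) (by simp [h15, h13, hq])
      ((Nat.div_le_self _ _).trans ht) (cons (Tri.ite (T := 7)
      (Q := fun s' => s'.reg 15 = t / (I.sz e + 1) ^ (j + 1) ∧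
      s'.reg 17 = (if Good col (j + 1) (I.dig e t) then 1 else 0) ∧
      s'.reg 18 = ∑ x ∈ rng (j + 1), I.dig e t x * (I.n + 1) ^ x)
      (fun hz => ?_) (fun hz => ?_)) (T₂ := 1) fun s' hs' _ => nil hs'))) le_rfl
  · have hz' : φ ≠ 0 := by simpa using hz
    obtain ⟨d, hd⟩ : ∃ d, d = I.vt e (φ - 1) := ⟨_, rfl⟩
    have hdig : I.dig e t j = d + 1 := by simp only [Hy.dig, ← hφ, if_neg hz', hd]
    have hdn : d < I.n := hd ▸ Hy.vt_lt (by omega)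
    have hsum : (∑ x ∈ rng j, I.dig e t x * (I.n + 1) ^ x) + (d + 1) * (I.n + 1) ^ j =
        ∑ x ∈ rng (j + 1), I.dig e t x * (I.n + 1) ^ x := by
      rw [sum_range_succ, hdig]
    have hlt : ∑ x ∈ rng (j + 1), I.dig e t x * (I.n + 1) ^ x < (I.n + 1) ^ (j + 1) :=
      sum_digits_lt fun x _ => Nat.lt_succ_of_le (Hy.dig_le _ _ _)
    have hpw := hB.pow_le (x := j + 1) (by omega)
    have e1 : I.off e + φ - 1 = I.off e + (φ - 1) := by omega
    refine asgv (v := d) ?_ (by omega) (asgv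
      (v := if Good col (j + 1) (I.dig e t) then 1 else 0) ?_ (by split_ifs <;> omega)
      (asgv (v := ∑ x ∈ rng (j + 1), I.dig e t x * (I.n + 1) ^ x) ?_ (by omega)
        (nil ?_)))
    · simp [h10, hC.a0 e he.le, e1, hC.a1 e (φ - 1) (by omega), hd]
    · simp only [ival_mul, ival_reg, ival_eqE, ival_load, setReg_reg, setReg_arr]; grind
    · simp [h18, h12, hC.a8 j hj, hsum]
    · simp
  · have hz' : φ = 0 := by simpa using hz
    have hdig : I.dig e t j = 0 := by simp only [Hy.dig, ← hφ, if_pos hz']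
    refine (Tri.skip ?_).time (by omega); simp [hGs, hdig, h17, h18, sum_range_succ]

/-- The invariant while the small hyperedges are counted. -/
def DegOK (I : Hy) (col : ℕ → ℕ) (e t : ℕ) (s : Store) : Prop :=
  ∀ D : ℕ → ℕ, (∀ x < I.k, D x ≤ I.n) → Good col I.k D → s.arr 18 (I.code D) = I.lowDeg e D +
    ((rng t).filter fun t' => Good col I.k (I.dig e t') ∧
      I.code (I.dig e t') = I.code D).card

theorem codeC_spec (hB : Big I β M) (hC : Consts I s) (hc : ∀ v < I.n, s.arr 2 v = col v)
    {e t : ℕ} (he : e < I.m) (h10 : s.reg 10 = e) (h11 : s.reg 11 = t)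
    (h13 : s.reg 13 = I.sz e + 1) (ht : t < (I.sz e + 1) ^ I.k) (hD : DegOK I col e t s) :
    Tri M codeC s (17 * I.k + 20) (DegOK I col e (t + 1)) := by
  have hidx := hB.idx; have hsz := Hy.sz_le (I := I) e
  have htM : t ≤ M := ht.le.trans ((pow_le_pow_left (by omega) _).trans hB.pow)
  refine time (asgv (v := t) (by simp [h11]) htM (asgv (v := 1) rfl (by omega)
    (asgv (v := 0) rfl (by omega) (cons (for_const I.k 14 (fun j s' =>
      s'.reg 15 = t / (I.sz e + 1) ^ j ∧
      s'.reg 17 = (if Good col j (I.dig e t) then 1 else 0) ∧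
      s'.reg 18 = ∑ x ∈ rng j, I.dig e t x * (I.n + 1) ^ x)
      hB.k_le rfl ?_ ?_ ?_) (T₂ := 5) ?_)))) (by omega)
  · intro j s' hf _; rw [ival_reg, hf.reg 0 rfl]; simp [hC.r0]
  · simp [Good]
  · rintro j hj s' hf h12 ⟨h15, h17, h18⟩; have hC1 : Consts I s' := by
      have hC0 : Consts I (((s.setReg 15 t).setReg 17 1).setReg 18 0) :=
        ⟨⟨by simp [hC.r0], by simp [hC.r1], by simp [hC.r2], by simp [hC.r3], hC.a0, hC.a1⟩,
          by simp [hC.r6], by simp [hC.r7], by simp [hC.r8], hC.a7, hC.a8⟩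
      exact hC0.fr hf (by decide)
    refine (codeDigitC_spec (e := e) (t := t) (j := j) (col := col) hB hC1
      (by rw [hf.arr 2 rfl]; exact hc) he (by rw [hf.reg 10 rfl]; simp [h10]) h12
      (hf.rg h13) hj h15 htM h17 h18).conseq le_rfl ?_
    simp
  · rintro s1 ⟨⟨-, h17, h18⟩, -⟩ hf; have e18 : s1.arr 18 = s.arr 18 := hf.arr 18 rfl
    have hstep : ∀ D : ℕ → ℕ, ((rng (t + 1)).filter fun t' => Good col I.k (I.dig e t') ∧
        I.code (I.dig e t') = I.code D).card = ((rng t).filter fun t' =>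
        Good col I.k (I.dig e t') ∧ I.code (I.dig e t') = I.code D).card +
        if Good col I.k (I.dig e t) ∧ I.code (I.dig e t) = I.code D then 1 else 0 := by
      intro D; rw [Finset.range_add_one, Finset.filter_insert]; grind
    refine time (cons (Tri.ite (T := 1) (Q := DegOK I col e (t + 1)) (fun hg => ?_)
      (fun hg => ?_)) (T₂ := 1) fun s' hs' _ => nil hs') (by omega)
    · have hg' : Good col I.k (I.dig e t) := by
        by_contra hn
        simp_all
      -- Needed to bound the new value: no smaller number for the same hyperedge has this code, so
      -- the cell counts only earlier hyperedges.
      have h0 : s.arr 18 (I.code (I.dig e t)) ≤ e := by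
        rw [hD _ (fun x _ => Hy.dig_le _ _ _) hg']; rw [card_eq_zero.2]
        · exact Hy.lowDeg_le _ _
        · rw [Finset.filter_eq_empty_iff]; rintro t' ht' ⟨-, h⟩; have ht'' := mem_rng.1 ht'
          exact absurd (Hy.dig_inj (ht''.trans ht) ht h) ht''.ne
      have h18' : s1.reg 18 = I.code (I.dig e t) := h18; refine store ?_ ?_
      · simp only [ival_add, ival_load, ival_reg, h18', e18, ival_one]; omega
      · intro D hDn hgD; rw [hstep, ← add_assoc, ← hD D hDn hgD]
        simp only [setArr_arr, if_true, ival_add, ival_load, ival_reg, h18', e18, ival_one, hg',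
          true_and]
        grind
    · have hg' : ¬ Good col I.k (I.dig e t) := by simp_all
      refine Tri.skip fun D hDn hgD => ?_; rw [hstep, ← add_assoc, ← hD D hDn hgD, e18]; simp [hg']

theorem degC_spec (hB : Big I β M) (hC : Consts I s) (hc : ∀ v < I.n, s.arr 2 v = col v)
    (h18 : s.arr 18 = 0) :
    Tri M degC s (∑ e ∈ rng I.m, ((if I.a < I.sz e then 0 else
      (I.sz e + 1) ^ I.k * (17 * I.k + 23)) + 5 * I.k + 20) + 3)
      (fun s' => ∀ D : ℕ → ℕ, (∀ x < I.k, D x ≤ I.n) → Good col I.k D →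
        s'.arr 18 (I.code D) = I.lowDeg I.m D) := by
  have hidx := hB.idx; refine (for_ I.m (fun e => (if I.a < I.sz e then 0 else
      (I.sz e + 1) ^ I.k * (17 * I.k + 23)) + 5 * I.k + 17) (fun e s' => DegOK I col e 0 s')
    (by omega) rfl ?_ ?_ ?_).conseq le_rfl ?_
  · intro e s' hf _; rw [ival_reg, hf.reg 3 rfl, hC.r3]
  · intro D _ _; simp [h18, Hy.lowDeg]
  · rintro e he s' hf h10 hD; have hC' := hC.fr hf (by decide); have hszE := hC'.szE h10 he
    have hb : (Expr.lt (rg 1) szE).ival s' = if I.a < I.sz e then 1 else 0 := by simp [hszE, hC'.r1]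
    have hsucc : ∀ D : ℕ → ℕ, I.lowDeg (e + 1) D = I.lowDeg e D +
        if ¬ I.a < I.sz e ∧ I.Within D e then 1 else 0 := by
      intro D; rw [Hy.lowDeg, Finset.range_add_one, Finset.filter_insert]; split_ifs
      · rw [Finset.card_insert_of_notMem (by simp)]; rfl
      · rfl
    refine Tri.ite (fun hc1 => ?_) (fun hc1 => ?_)
    · have hhi : I.a < I.sz e := by
        by_contra hn
        simp_all
      refine (Tri.skip fun D h1 h2 => ?_).time (by omega); rw [hsucc, setReg_arr, hD D h1 h2]
      simp [hhi]
    · have hlo : ¬ I.a < I.sz e := by simp_all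
      rw [if_neg hlo]; have hsz := Hy.sz_le (I := I) e
      have hpw : ∀ j ≤ I.k, (I.sz e + 1) ^ j ≤ M := fun j hj =>
        (pow_le_pow_left (by omega) _).trans (hB.pow_le hj)
      refine time (asgv (v := I.sz e + 1) (by simp [hszE]) (by omega)
        (asgv (v := 1) rfl (by omega) (cons
        (for_const I.k 1 (fun j s2 => s2.reg 14 = (I.sz e + 1) ^ j) hB.k_le rfl ?_ (by simp) ?_)
        (T₂ := (I.sz e + 1) ^ I.k * (17 * I.k + 20 + 3) + 5) ?_))) (by linarith)
      · intro j s2 hf2 _; rw [ival_reg, hf2.reg 0 rfl]; simp [hC'.r0]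
      · intro j hj s2 hf2 _ h14; have h13 : s2.reg 13 = I.sz e + 1 := hf2.rg rfl
        have := hpw (j + 1) (by omega)
        exact assign (by simpa [h14, h13, ← pow_succ] using this) (by simp [h14, h13, pow_succ])
      · rintro s2 ⟨h14, -⟩ hf2; have hC2 : Consts I s2 := by
          have hC0 : Consts I ((s'.setReg 13 (I.sz e + 1)).setReg 14 1) :=
            ⟨⟨by simp [hC'.r0], by simp [hC'.r1], by simp [hC'.r2], by simp [hC'.r3], hC'.a0,
              hC'.a1⟩, by simp [hC'.r6], by simp [hC'.r7], by simp [hC'.r8], hC'.a7, hC'.a8⟩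
          exact hC0.fr hf2 (by decide)
        have h13 : s2.reg 13 = I.sz e + 1 := hf2.rg rfl; have h10' : s2.reg 10 = e := hf2.rg h10
        have hc2 : ∀ v < I.n, s2.arr 2 v = col v := by
          rw [hf2.arr 2 rfl, setReg_arr, setReg_arr, hf.arr 2 rfl]; exact hc
        have hD2 : DegOK I col e 0 s2 := by intro D; rw [hf2.arr 18 rfl]; exact hD D
        refine time (cons (for_const ((I.sz e + 1) ^ I.k) (17 * I.k + 20)
          (fun t s3 => DegOK I col e t s3) (hpw _ le_rfl) rfl ?_ ?_ ?_) (T₂ := 1) ?_) (by omega)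
        · intro j s3 hf3 _; rw [ival_reg, hf3.reg 14 rfl, h14]
        · exact hD2
        · intro t ht s3 hf3 h11 hD3
          exact (codeC_spec hB (hC2.fr hf3 (by decide)) (by rw [hf3.arr 2 rfl]; exact hc2) he
            (hf3.rg h10') h11 (hf3.rg h13) ht hD3).conseq le_rfl
            fun s4 h4 => h4
        · rintro s3 ⟨hD3, -⟩ -
          refine nil fun D h1 h2 => ?_; rw [hsucc, setReg_arr, hD3 D h1 h2, card_dig e h1 h2]
          simp [hlo]
  · rintro s' ⟨hD, -⟩ D h1 h2; rw [hD D h1 h2]; simp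
end

/-! ## Counting -/

/-- What is known before the trees are counted. -/
structure Static (I : Hy) (col : ℕ → ℕ) (σ : ℕ → Finset ℕ) (ctr : ℕ) (ℓ : ℕ → List ℕ)
    (s : Store) : Prop extends Consts I s where
  c2 : ∀ v < I.n, s.arr 2 v = col v
  dis : ∀ X < 2 ^ I.k, ∀ Y < 2 ^ I.k, s.arr 6 (X * 2 ^ I.k + Y) = if X &&& Y = 0 then 1 else 0
  src : SrcOK I (I.n + 1) I.src s
  lists : ListsOK I ℓ s
  deg : ∀ D : ℕ → ℕ, (∀ x < I.k, D x ≤ I.n) → Good col I.k D →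
    s.arr 18 (I.code D) = I.lowDeg I.m D
  sg : ∀ a ≤ ctr, s.arr 14 a = (σ a).card % 2
  nodes : NodesOK I σ ctr (fun v => I.hi v I.m) s

/-- The data that do not depend on the store. -/
structure Trie (I : Hy) (β : ℕ) (col : ℕ → ℕ) (σ : ℕ → Finset ℕ) (ctr : ℕ) (ℓ : ℕ → List ℕ) : Prop where
  col_lt : ∀ v < I.n, col v < I.k
  root : σ 0 = ∅
  ctr_le : ctr ≤ I.n * 2 ^ β
  inj : ∀ a ≤ ctr, ∀ b ≤ ctr, σ a = σ b → a = b
  mem : ∀ id < I.L, (ℓ id).toFinset = I.mem col id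

section
variable {I : Hy} {col : ℕ → ℕ} {β M : ℕ} {s : Store} {σ : ℕ → Finset ℕ} {ctr : ℕ}
  {ℓ : ℕ → List ℕ}

theorem Static.fr {P : Cmd} {s' : Store} (h : Static I col σ ctr ℓ s) (hf : Fr P s s')
    (hk : keeps P [0, 1, 2, 3, 6, 7, 8]
      [0, 1, 7, 8, 2, 6, 9, 10, 11, 12, 14, 15, 16, 17, 18] = true) :
    Static I col σ ctr ℓ s' := by
  have ha := fun {x} hx => hf.arr_of hk (x := x) hx
  refine ⟨h.toConsts.fr hf ?_, ?_, ?_, ⟨?_, ?_⟩, h.lists.congr (ha (by simp)) (ha (by simp))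
    (ha (by simp)), ?_, ?_, ⟨?_, ?_, ?_⟩⟩
  · simp only [keeps, Bool.and_eq_true, List.all_cons] at hk ⊢; tauto
  · rw [ha (by simp)]; exact h.c2
  · rw [ha (by simp)]; exact h.dis
  · rw [ha (by simp)]; exact h.src.len
  · rw [ha (by simp)]; exact h.src.ent
  · rw [ha (by simp)]; exact h.deg
  · rw [ha (by simp)]; exact h.sg
  · rw [ha (by simp)]; exact h.nodes.num
  · rw [ha (by simp)]; exact h.nodes.le
  · rw [ha (by simp)]; exact h.nodes.sum

theorem Static.congr {s' : Store} (h : Static I col σ ctr ℓ s)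
    (hr : ∀ x ∈ [0, 1, 2, 3, 6, 7, 8], s'.reg x = s.reg x)
    (ha : ∀ x ∈ [0, 1, 7, 8, 2, 6, 9, 10, 11, 12, 14, 15, 16, 17, 18], s'.arr x = s.arr x) :
    Static I col σ ctr ℓ s' := by
  refine ⟨⟨⟨?_, ?_, ?_, ?_, ?_, ?_⟩, ?_, ?_, ?_, ?_, ?_⟩, ?_, ?_, ⟨?_, ?_⟩,
    h.lists.congr (ha _ (by simp)) (ha _ (by simp)) (ha _ (by simp)), ?_, ?_, ⟨?_, ?_, ?_⟩⟩
  · rw [hr _ (by simp)]; exact h.r0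
  · rw [hr _ (by simp)]; exact h.r1
  · rw [hr _ (by simp)]; exact h.r2
  · rw [hr _ (by simp)]; exact h.r3
  · rw [ha _ (by simp)]; exact h.a0
  · rw [ha _ (by simp)]; exact h.a1
  · rw [hr _ (by simp)]; exact h.r6
  · rw [hr _ (by simp)]; exact h.r7
  · rw [hr _ (by simp)]; exact h.r8
  · rw [ha _ (by simp)]; exact h.a7
  · rw [ha _ (by simp)]; exact h.a8
  · rw [ha _ (by simp)]; exact h.c2
  · rw [ha _ (by simp)]; exact h.dis
  · rw [ha _ (by simp)]; exact h.src.len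
  · rw [ha _ (by simp)]; exact h.src.ent
  · rw [ha _ (by simp)]; exact h.deg
  · rw [ha _ (by simp)]; exact h.sg
  · rw [ha _ (by simp)]; exact h.nodes.num
  · rw [ha _ (by simp)]; exact h.nodes.le
  · rw [ha _ (by simp)]; exact h.nodes.sum

variable (I col) in
/-- The number of trees of the instance with root `u` and colours `C`. -/
noncomputable def Hy.cnt (C u : ℕ) : ℕ := HyperMotivo.cnt I.n col (I.Nb col) C u

variable (I col) in
noncomputable def Hy.adjCnt (C v : ℕ) : ℕ := HyperMotivo.adjCnt I.n col (I.Nb col) C v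

theorem Hy.cnt_zero (u : ℕ) : I.cnt col 0 u = 0 := cnt_eq_zero (by simp)

theorem Hy.cnt_le {C : ℕ} (hC : C < 2 ^ I.k) (u : ℕ) : I.cnt col C u ≤ (I.n + 1) ^ (2 * I.k) :=
  HyperMotivo.cnt_le hC

theorem Big.cnt_le (hB : Big I β M) {C : ℕ} (hC : C < 2 ^ I.k) {t : ℕ} (ht : t ≤ 4 * (2 ^ β + β + 2) *
    (I.n + 1)) (u : ℕ) : t * I.cnt col C u ≤ M := by
  refine le_trans ?_ hB.val; rw [← mul_assoc]; exact Nat.mul_le_mul ht (Hy.cnt_le hC u)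

theorem Big.sum_cnt_le (hB : Big I β M) {C : ℕ} (hC : C < 2 ^ I.k) {t : ℕ}
    (ht : t ≤ 4 * (2 ^ β + β + 2)) {S : Finset ℕ} (hS : S.card ≤ I.n + 1) :
    t * ∑ u ∈ S, I.cnt col C u ≤ M := by
  refine le_trans ?_ hB.val; refine Nat.mul_le_mul ht ?_
  exact (sum_le_card_nsmul S _ _ fun u _ => Hy.cnt_le hC u).trans
    (Nat.mul_le_mul hS le_rfl)

theorem ival_splitE (hs : Static I col σ ctr ℓ s) {uE CE XE xE : Expr} {u C X x : ℕ}
    (hu : uE.ival s = u) (hC : CE.ival s = C) (hX : XE.ival s = X) (hx : xE.ival s = x)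
    (hxk : x < I.k) (hCk : C < 2 ^ I.k) (hXC : X < C)
    (h19 : s.arr 19 (u * 2 ^ I.k + X) = I.cnt col X u)
    (h20 : X ≠ 0 → s.arr 20 (u * 2 ^ I.k + (C - X)) = I.adjCnt col (C - X) u) :
    (splitE uE CE XE xE).ival s =
      if SplitOK x C X then I.cnt col X u * I.adjCnt col (C - X) u else 0 := by
  simp only [splitE, ival_mul, ival_load, ival_add, ival_sub, ival_lt, ival_reg, hu, hC, hX, hx,
    hs.r6, hs.a7 x hxk, hs.dis X (by omega) (C - X) (by omega), h19]
  -- For `X = 0` the entry for `C - X = C` is not known yet, but it is multiplied by the number of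
  -- trees without colours, which is `0`.
  rcases Nat.eq_zero_or_pos X with rfl | h0
  · simp [Hy.cnt_zero]
  · rw [h20 (by omega)]; simp only [SplitOK]; grind

variable (I col) in
/-- The number of trees with colours `C` whose root lies in the hyperedges of `S`. -/
noncomputable def Hy.nodeCnt (C : ℕ) (S : Finset ℕ) (j : ℕ) : ℕ :=
  ∑ u ∈ rng j, if S ⊆ (I.hi u I.m).toFinset then I.cnt col C u else 0

theorem Hy.nodeCnt_le (C : ℕ) (S : Finset ℕ) (j : ℕ) :
    I.nodeCnt col C S j ≤ ∑ u ∈ rng j, I.cnt col C u :=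
  sum_le_sum fun u _ => by split_ifs <;> simp

/-- The node `a` occurs once among the nodes at `u` if its hyperedges all contain `u`, and not at
all otherwise. -/
theorem count_node (hT : Trie I β col σ ctr ℓ) (hN : NodesOK I σ ctr (fun v => I.hi v I.m) s) {u a : ℕ}
    (hu : u < I.n) (ha : a ≤ ctr) (c : ℕ) :
    ∑ j ∈ rng (2 ^ (I.hi u I.m).length),
      (if s.arr 12 (j * (I.n + 1) + u) = a then c else 0) =
      if σ a ⊆ (I.hi u I.m).toFinset then c else 0 := by
  have h := hN.sum u hu fun S => if S = σ a then c else 0; rw [Finset.sum_ite_eq'] at h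
  simp only [Finset.mem_powerset] at h; rw [← h]; refine sum_congr rfl fun j hj => ?_
  refine if_congr ⟨fun h => by rw [h], fun h => ?_⟩ rfl rfl
  exact hT.inj _ (hN.le u hu j (mem_rng.1 hj)) a ha h

/-- As soon as the number of trees at a vertex is known, it is added to all trie nodes at that
vertex. In the end each node holds the sum over the vertices common to its hyperedges. -/
theorem countC_spec (hB : Big I β M) (hT : Trie I β col σ ctr ℓ) (hs : Static I col σ ctr ℓ s) {C : ℕ}
    (hC : C < 2 ^ I.k) (h10 : s.reg 10 = C)
    (h19 : ∀ v < I.n, ∀ X < C, s.arr 19 (v * 2 ^ I.k + X) = I.cnt col X v)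
    (h20 : ∀ v < I.n, ∀ X < C, s.arr 20 (v * 2 ^ I.k + X) = I.adjCnt col X v)
    (h21 : ∀ a ≤ ctr, s.arr 21 (a * 2 ^ I.k + C) = 0) :
    Tri M countC s (∑ v ∈ rng I.n, (8 * 2 ^ (I.hi v I.m).length + 4 * 2 ^ I.k + 20) + 3)
      (fun s' => (∀ v < I.n, s'.arr 19 (v * 2 ^ I.k + C) = I.cnt col C v) ∧
        (∀ v, ∀ X < 2 ^ I.k, X ≠ C → s'.arr 19 (v * 2 ^ I.k + X) = s.arr 19 (v * 2 ^ I.k + X)) ∧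
        (∀ a ≤ ctr, s'.arr 21 (a * 2 ^ I.k + C) = I.nodeCnt col C (σ a) I.n) ∧
        ∀ a, ∀ X < 2 ^ I.k, X ≠ C → s'.arr 21 (a * 2 ^ I.k + X) = s.arr 21 (a * 2 ^ I.k + X)) := by
  have hidx := hB.idx; have hK := hB.two_pow
  refine (for_ I.n (fun v => 8 * 2 ^ (I.hi v I.m).length + 4 * 2 ^ I.k + 17) (fun j s' =>
        (∀ v < j, s'.arr 19 (v * 2 ^ I.k + C) = I.cnt col C v) ∧
        (∀ v, ∀ X < 2 ^ I.k, X ≠ C → s'.arr 19 (v * 2 ^ I.k + X) = s.arr 19 (v * 2 ^ I.k + X)) ∧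
        (∀ a ≤ ctr, s'.arr 21 (a * 2 ^ I.k + C) = I.nodeCnt col C (σ a) j) ∧
        ∀ a, ∀ X < 2 ^ I.k, X ≠ C → s'.arr 21 (a * 2 ^ I.k + X) = s.arr 21 (a * 2 ^ I.k + X))
    (by omega) rfl ?_ ?_ ?_).conseq le_rfl fun s' hs' => hs'.1
  · intro j s' hf _; rw [ival_reg, hf.reg 2 rfl, hs.r2]
  · exact ⟨by simp, fun _ _ _ _ => rfl, fun a ha => by simp [h21 a ha, Hy.nodeCnt],
      fun _ _ _ _ => rfl⟩
  rintro u hu s1 hf1 h11 ⟨g19, g19', g21, g21'⟩; have hs1 := hs.fr hf1 (by decide)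
  have hcol := hT.col_lt u hu; have r10 : s1.reg 10 = C := hf1.rg h10
  have a20 : s1.arr 20 = s.arr 20 := hf1.arr 20 rfl
  have hrec := cnt_rec (n := I.n) (col := col) (Nb := I.Nb col) C u hu; let f : ℕ → ℕ := fun X =>
    if SplitOK (col u) C X then I.cnt col X u * I.adjCnt col (C - X) u else 0
  let b : ℕ := if C = 2 ^ col u then 1 else 0
  have hrec' : I.cnt col C u = b + ∑ X ∈ rng C, f X := hrec; have hcM : I.cnt col C u ≤ M := by
    have := hB.cnt_le (col := col) hC (t := 1) (by nlinarith [Nat.zero_le (2 ^ β)]) u; omega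
  refine time (asgv (v := col u) (by simp [h11, hs1.c2 u hu])
    ((hcol.le).trans hB.k_le) (asgv (v := b) ?_ (by simp only [b]; split_ifs <;> omega)
    (cons (for_const C 1 (fun X s' => s'.reg 13 = b + ∑ X ∈ rng X, f X)
      (by omega) rfl ?_ (by simp) ?_) (T₂ := 8 * 2 ^ (I.hi u I.m).length + 7) ?_))) (by omega)
  · simp only [ival_eqE, ival_reg, ival_load, setReg_reg, setReg_arr]; simp [r10, hs1.a7 _ hcol, b]
  · intro X s2 hf2 _; rw [ival_reg, hf2.reg 10 rfl]; simp [r10]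
  · intro X hX s2 hf2 h14 h13
    have hs2 : Static I col σ ctr ℓ s2 := (hs1.congr (s' := (s1.setReg 12 (col u)).setReg 13 b)
      (by simp) (by simp)).fr hf2 (by decide)
    have e19 : s2.arr 19 = s1.arr 19 := hf2.arr 19 rfl
    have e20 : s2.arr 20 = s.arr 20 := hf2.ar a20
    have hsp : (splitE (rg 11) (rg 10) (rg 14) (rg 12)).ival s2 = f X := by
      refine ival_splitE hs2 (u := u) (C := C) (X := X) (x := col u) ?_ ?_ h14 ?_ hcol hC hX ?_ ?_
      · rw [ival_reg, hf2.reg 11 rfl]; simp [h11]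
      · rw [ival_reg, hf2.reg 10 rfl]; simp [r10]
      · rw [ival_reg, hf2.reg 12 rfl]; simp
      · grind
      · grind
    have hle : b + ∑ X ∈ rng (X + 1), f X ≤ M := by
      refine le_trans (Nat.add_le_add_left (sum_le_sum_of_subset ?_) b) (hrec' ▸ hcM); simp_all
    rw [sum_range_succ] at hle; refine assign ?_ ?_
    · rw [ival_add, hsp, ival_reg, h13]; omega
    · rw [ival_add, hsp, ival_reg, h13, sum_range_succ]; simp; omega
  · rintro s2 ⟨h13, -⟩ hf2; rw [← hrec'] at h13
    have hs2 : Static I col σ ctr ℓ s2 := (hs1.congr (s' := (s1.setReg 12 (col u)).setReg 13 b)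
      (by simp) (by simp)).fr hf2 (by decide)
    have e11 : s2.reg 11 = u := hf2.rg h11; have e10 : s2.reg 10 = C := hf2.rg r10
    have e19 : s2.arr 19 = s1.arr 19 := hf2.arr 19 rfl
    have e21 : s2.arr 21 = s1.arr 21 := hf2.arr 21 rfl
    obtain ⟨s3, hs3d⟩ : ∃ s3, s3 = s2.setArr 19 (u * 2 ^ I.k + C) (I.cnt col C u) := ⟨_, rfl⟩
    have hs3 : Static I col σ ctr ℓ s3 := hs2.congr (by simp [hs3d]) (by simp [hs3d, setArr_arr'])
    have b21 : s3.arr 21 = s1.arr 21 := by simp [hs3d, setArr_arr', e21]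
    have d2 : 2 ^ (I.hi u I.m).length ≤ M := by
      have := hB.trie; have := pow_le_pow_right (show 0 < 2 by omega) (hB.deg u); omega
    let g : ℕ → ℕ → ℕ := fun a j => if s3.arr 12 (j * (I.n + 1) + u) = a then I.cnt col C u else 0
    have htot : ∀ a ≤ ctr, I.nodeCnt col C (σ a) u +
        ∑ j ∈ rng (2 ^ (I.hi u I.m).length), g a j = I.nodeCnt col C (σ a) (u + 1) := by
      intro a ha; rw [Hy.nodeCnt, Hy.nodeCnt, sum_range_succ, count_node hT hs3.nodes hu ha]
    refine time (stov (j := u * 2 ^ I.k + C) (v := I.cnt col C u) (by simp [e11, e10, hs2.r6])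
      (by simp [h13]) hcM ?_) (T₁ := 8 * 2 ^ (I.hi u I.m).length + 5 + 2) (by omega)
    rw [← hs3d]; refine time (cons (for_const (2 ^ (I.hi u I.m).length) 5
      (fun j s' => (∀ a ≤ ctr, s'.arr 21 (a * 2 ^ I.k + C) = I.nodeCnt col C (σ a) u +
          ∑ j ∈ rng j, g a j) ∧
        ∀ a, ∀ X < 2 ^ I.k, X ≠ C → s'.arr 21 (a * 2 ^ I.k + X) = s.arr 21 (a * 2 ^ I.k + X))
      d2 rfl ?_ ?_ ?_) (T₂ := 1) ?_) (T := 8 * 2 ^ (I.hi u I.m).length + 5) (by omega)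
    · intro j s4 hf4 _; have e11' : s4.reg 11 = u := by rw [hf4.reg 11 rfl, hs3d]; simpa using e11
      rw [ival_load, ival_reg, e11', hf4.arr 9 rfl, hs3.nodes.num u hu]
    · simp_all
    · rintro j hj s4 hf4 h14 ⟨k1, k2⟩; have hs4 := hs3.fr hf4 (by decide)
      obtain ⟨a, had⟩ : ∃ a, a = s3.arr 12 (j * (I.n + 1) + u) := ⟨_, rfl⟩
      have hac : a ≤ ctr := had ▸ hs3.nodes.le u hu j hj
      have e11' : s4.reg 11 = u := by rw [hf4.reg 11 rfl, hs3d]; simpa using e11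
      have e10' : s4.reg 10 = C := by rw [hf4.reg 10 rfl, hs3d]; simpa using e10
      have e13' : s4.reg 13 = I.cnt col C u := by rw [hf4.reg 13 rfl, hs3d]; simpa using h13
      have e12' : s4.arr 12 = s3.arr 12 := hf4.arr 12 rfl; have hctrM : a * 2 ^ I.k + C ≤ M := by
        have h1 := hT.ctr_le; have h2 := hB.node
        have h3 : (a + 1) * 2 ^ I.k ≤ (I.n * 2 ^ β + 1) * 2 ^ I.k := Nat.mul_le_mul_right _ (by omega)
        linarith
      have hv : I.nodeCnt col C (σ a) u + ∑ j ∈ rng (j + 1), g a j ≤ M := by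
        refine le_trans (Nat.add_le_add_left (sum_le_sum_of_subset
          (range_subset_range.2 hj)) _) ?_
        rw [htot a hac]; refine (Hy.nodeCnt_le _ _ _).trans ?_
        have := hB.sum_cnt_le (col := col) hC (t := 1) (S := rng (u + 1))
          (by nlinarith [Nat.zero_le (2 ^ β)]) (by simp; omega)
        omega
      rw [sum_range_succ] at hv
      have hgj : g a j = I.cnt col C u := by simp only [g, ← had, if_true]
      refine asgv (v := a * 2 ^ I.k + C) ?_ hctrM (stov (j := a * 2 ^ I.k + C)
        (v := I.nodeCnt col C (σ a) u + ∑ j ∈ rng j, g a j + g a j) ?_ ?_ (by omega)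
        (nil ⟨fun a' ha' => ?_, fun a' X hX hXC => ?_⟩))
      · simp [h14, hs4.r7, e11', e12', ← had, hs4.r6, e10']
      · simp
      · simp_all
      · rw [setReg_arr, setArr_table _ _ _ _ _ _ hC hC, setReg_arr, sum_range_succ]; grind
      · rw [setReg_arr, setArr_table _ _ _ _ _ _ hC hX, if_neg (by tauto), setReg_arr,
          k2 a' X hX hXC]
    · rintro s4 ⟨⟨k1, k2⟩, -⟩ hf4
      have e19' : ∀ v, ∀ X < 2 ^ I.k, s4.arr 19 (v * 2 ^ I.k + X) = if v = u ∧ X = C then I.cnt col C u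
          else s1.arr 19 (v * 2 ^ I.k + X) := by
        intro v X hX; rw [hf4.arr 19 rfl, hs3d, setArr_table _ _ _ _ _ _ hC hX, e19]
      refine nil ⟨fun v hv => ?_, fun v X hX hXC => ?_, fun a ha => ?_, k2⟩
      · rw [setReg_arr, e19' v C hC]; grind
      · simp_all
      · simp_all
end

/-- The number of slots for `x` units when a slot holds `q`. -/
def slots (q x : ℕ) : ℕ := (x + q - 1) / q

@[simp] theorem slots_zero (q : ℕ) : slots q 0 = 0 := by
  rcases Nat.eq_zero_or_pos q with rfl | hq
  · rfl
  · exact div_eq_of_lt (by omega)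

theorem lt_of_lt_slots {q x i : ℕ} (h : i < slots q x) : i * q < x := by
  have h1 : (i + 1) * q ≤ (x + q - 1) / q * q := Nat.mul_le_mul_right q h
  have h2 := Nat.div_mul_le_self (x + q - 1) q
  have hq : 0 < q := Nat.pos_of_ne_zero fun h0 => by subst h0; simp [slots] at h
  grind

theorem le_slots_mul {q x : ℕ} (hq : 0 < q) : x ≤ slots q x * q := by
  have h1 := Nat.div_add_mod (x + q - 1) q; have h2 := mod_lt (x + q - 1) hq; simp only [slots]
  grind

theorem slots_mul_lt {q x : ℕ} : slots q x * q ≤ if x = 0 then 0 else x + q := by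
  split_ifs with h
  · simp [h]
  · exact (Nat.div_mul_le_self _ _).trans (by omega)

/-! ### Sampling tables for the vertex lists -/

section
variable {I : Hy} {col : ℕ → ℕ} {β M : ℕ} {s : Store} {σ : ℕ → Finset ℕ} {ctr : ℕ}
  {ℓ : ℕ → List ℕ}

/-- The sampling table for the list `id` and the colours `C`. -/
structure SlotOK (I : Hy) (col : ℕ → ℕ) (id C : ℕ) (s : Store) (S q : ℕ) : Prop where
  sum : s.arr 22 (id * 2 ^ I.k + C) = ∑ u ∈ I.mem col id, I.cnt col C u
  a23 : s.arr 23 (id * 2 ^ I.k + C) = q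
  a24 : s.arr 24 (id * 2 ^ I.k + C) = S * q
  le : ∀ i < S, s.arr 26 ((i * I.L + id) * 2 ^ I.k + C) ≤ q
  -- With `g` an indicator, the slots of a vertex hold exactly its weight.
  fill : ∀ g : ℕ → ℕ, ∑ i ∈ rng S, s.arr 26 ((i * I.L + id) * 2 ^ I.k + C) *
    g (s.arr 25 ((i * I.L + id) * 2 ^ I.k + C)) = ∑ u ∈ I.mem col id, I.cnt col C u * g u
  mul_le : S * q ≤ 2 * ∑ u ∈ I.mem col id, I.cnt col C u
  S_le : S ≤ 4 * I.n

theorem slotSumC_spec (hB : Big I β M) (hT : Trie I β col σ ctr ℓ) (hs : Static I col σ ctr ℓ s)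
    {C id : ℕ} (hC : C < 2 ^ I.k) (hid : id < I.L) (h10 : s.reg 10 = C) (h11 : s.reg 11 = id)
    (h19 : ∀ v < I.n, s.arr 19 (v * 2 ^ I.k + C) = I.cnt col C v)
    (h12 : s.reg 12 = 0) (h13 : s.reg 13 = 0) :
    Tri M slotSumC s ((I.mem col id).card * 10 + 3) (fun s' =>
      s'.reg 12 = ∑ u ∈ I.mem col id, I.cnt col C u ∧
      s'.reg 13 = ((I.mem col id).filter fun u => I.cnt col C u ≠ 0).card) := by
  have hidx := hB.idx; have hK := hB.two_pow; have hnd := hs.lists.nodup id hid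
  have hlen : (ℓ id).length ≤ I.n := hs.lists.length_le hid
  have hcard : (I.mem col id).card = (ℓ id).length := by
    rw [← hT.mem id hid, toFinset_card_of_nodup hnd]
  let c : ℕ → ℕ := fun j => I.cnt col C ((ℓ id).getD j 0)
  have tot : ∑ j ∈ rng (ℓ id).length, c j = ∑ u ∈ I.mem col id, I.cnt col C u := by
    rw [← hT.mem id hid]; exact sum_getD (ℓ id) hnd fun u => I.cnt col C u
  have totM : ∑ u ∈ I.mem col id, I.cnt col C u ≤ M := by
    have := hB.sum_cnt_le (col := col) hC (t := 1) (S := I.mem col id)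
      (by nlinarith [Nat.zero_le (2 ^ β)]) (by omega)
    omega
  have part : ∀ j ≤ (ℓ id).length, ∑ i ∈ rng j, c i ≤ M := fun j hj => by
    rw [← tot] at totM; exact (sum_le_sum_of_subset (range_subset_range.2 hj)).trans totM
  refine (for_const (ℓ id).length 7 (fun j s' => s'.reg 12 = ∑ i ∈ rng j, c i ∧
    s'.reg 13 = ∑ i ∈ rng j, if c i ≠ 0 then 1 else 0) (by omega) rfl ?_ ?_ ?_).conseq
    (by omega) ?_
  · intro j s' hf _
    rw [ival_load, ival_reg, hf.arr 15 rfl, hf.reg 11 rfl, h11, hs.lists.len id hid]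
  · simp_all
  · rintro j hj s' hf h14 ⟨k12, k13⟩; have hs' := hs.fr hf (by decide)
    have e10 : s'.reg 10 = C := hf.rg h10; have e11 : s'.reg 11 = id := hf.rg h11
    have e19 : s'.arr 19 = s.arr 19 := hf.arr 19 rfl
    have hlt := hs.lists.lt_n id hid ((ℓ id).getD j 0)
      (by rw [getD_eq_getElem _ _ hj]; exact getElem_mem hj)
    have hp := part (j + 1) hj; rw [sum_range_succ] at hp
    have hz : ∑ i ∈ rng j, (if c i ≠ 0 then 1 else 0) ≤ j := by
      refine (sum_le_card_nsmul _ _ 1 fun i _ => by split_ifs <;> omega).trans (by simp)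
    refine asgv (v := c j) ?_ (by omega) (asgv (v := ∑ i ∈ rng j, c i + c j) ?_ hp
      (asgv (v := (∑ i ∈ rng j, if c i ≠ 0 then 1 else 0) + if c j ≠ 0 then 1 else 0)
      ?_ ?_ (nil ⟨?_, ?_⟩)))
    · simp only [ival_load, ival_add, ival_mul, ival_reg, h14, hs'.r8, e11, hs'.r6, e10,
        hs'.lists.ent id hid j hj, e19, h19 _ hlt, c]
    · simp [k12]
    · simp [k13, Nat.pos_iff_ne_zero]
    · grind
    · simp [sum_range_succ]
    · simp [sum_range_succ]
  · rintro s' ⟨⟨k12, k13⟩, -⟩; refine ⟨k12.trans tot, k13.trans ?_⟩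
    rw [sum_getD _ hnd (fun u => if I.cnt col C u ≠ 0 then 1 else 0), hT.mem id hid,
      card_filter]

theorem slotFillC_spec (hB : Big I β M) (hT : Trie I β col σ ctr ℓ) (hs : Static I col σ ctr ℓ s)
    {C id q : ℕ} (hC : C < 2 ^ I.k) (hid : id < I.L) (h10 : s.reg 10 = C) (h11 : s.reg 11 = id)
    (h19 : ∀ v < I.n, s.arr 19 (v * 2 ^ I.k + C) = I.cnt col C v)
    (h17 : s.reg 17 = q) (h18 : s.reg 18 = 0) (hq : ∀ u ∈ I.mem col id, I.cnt col C u ≠ 0 → 0 < q)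
    (hS : ∑ u ∈ I.mem col id, slots q (I.cnt col C u) ≤ 4 * I.n) :
    Tri M slotFillC s (∑ u ∈ I.mem col id, (10 * slots q (I.cnt col C u) + 10) + 3) (fun s' =>
      s'.reg 18 = ∑ u ∈ I.mem col id, slots q (I.cnt col C u) ∧
      (∀ i < ∑ u ∈ I.mem col id, slots q (I.cnt col C u),
        s'.arr 26 ((i * I.L + id) * 2 ^ I.k + C) ≤ q) ∧
      (∀ g : ℕ → ℕ, ∑ i ∈ rng (∑ u ∈ I.mem col id, slots q (I.cnt col C u)),
        s'.arr 26 ((i * I.L + id) * 2 ^ I.k + C) * g (s'.arr 25 ((i * I.L + id) * 2 ^ I.k + C)) =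
          ∑ u ∈ I.mem col id, I.cnt col C u * g u) ∧
      ∀ i, ∀ id' < I.L, ∀ X < 2 ^ I.k, (id' ≠ id ∨ X ≠ C) →
        s'.arr 25 ((i * I.L + id') * 2 ^ I.k + X) = s.arr 25 ((i * I.L + id') * 2 ^ I.k + X) ∧
        s'.arr 26 ((i * I.L + id') * 2 ^ I.k + X) = s.arr 26 ((i * I.L + id') * 2 ^ I.k + X)) := by
  have hidx := hB.idx; have hslots := hB.slots; have hnd := hs.lists.nodup id hid
  have hlen : (ℓ id).length ≤ I.n := hs.lists.length_le hid; have hmem := hT.mem id hid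
  simp only [← hmem, ← sum_getD (ℓ id) hnd] at hS ⊢
  obtain ⟨w, hw⟩ : ∃ w : ℕ → ℕ, w = fun j => (ℓ id).getD j 0 := ⟨_, rfl⟩
  simp only [show ∀ j, (ℓ id).getD j 0 = w j from fun j => by rw [hw]] at hS ⊢
  obtain ⟨N, hN⟩ : ∃ N, N = (ℓ id).length := ⟨_, rfl⟩; rw [← hN] at hS hlen ⊢
  have hwm : ∀ j < N, w j ∈ I.mem col id := fun j hj => by
    subst hN hw; rw [← hmem, List.mem_toFinset]; simp_all
  have hwn : ∀ j < N, w j < I.n := fun j hj => hs.lists.lt_n id hid _ (by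
    simp_all)
  let c : ℕ → ℕ := fun j => I.cnt col C (w j); let T : ℕ → ℕ := fun j => ∑ i ∈ rng j, slots q (c i)
  have hTS : T N ≤ 4 * I.n := hS; have hTmono : ∀ {j j'}, j ≤ j' → T j ≤ T j' := fun h =>
    sum_le_sum_of_subset (range_subset_range.2 h)
  have hcM : ∀ j, c j ≤ M := fun j => by
    have := hB.cnt_le (col := col) hC (t := 1) (by nlinarith [Nat.zero_le (2 ^ β)]) (w j); linarith
  let Rest : Store → Prop := fun s' => ∀ i, ∀ id' < I.L, ∀ X < 2 ^ I.k, (id' ≠ id ∨ X ≠ C) →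
        s'.arr 25 ((i * I.L + id') * 2 ^ I.k + X) = s.arr 25 ((i * I.L + id') * 2 ^ I.k + X) ∧
        s'.arr 26 ((i * I.L + id') * 2 ^ I.k + X) = s.arr 26 ((i * I.L + id') * 2 ^ I.k + X)
  let F : (ℕ → ℕ) → ℕ → Store → ℕ := fun g S s' => ∑ i ∈ rng S,
    s'.arr 26 ((i * I.L + id) * 2 ^ I.k + C) * g (s'.arr 25 ((i * I.L + id) * 2 ^ I.k + C))
  let Le : ℕ → Store → Prop := fun S s' => ∀ i < S, s'.arr 26 ((i * I.L + id) * 2 ^ I.k + C) ≤ q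
  refine (for_ N (fun j => 10 * slots q (c j) + 7) (fun j s' => s'.reg 18 = T j ∧
    Le (T j) s' ∧ (∀ g, F g (T j) s' = ∑ i ∈ rng j, c i * g (w i)) ∧ Rest s')
    (by omega) rfl ?_ ?_ ?_).conseq ?_ fun s' hs' => hs'.1
  · intro j s' hf _
    rw [ival_load, ival_reg, hf.arr 15 rfl, hf.reg 11 rfl, h11, hs.lists.len id hid, hN]
  · refine ⟨by simp [h18, T], fun i hi => by simp [T] at hi, by simp [F, T], fun _ _ _ _ _ _ =>
      ⟨rfl, rfl⟩⟩
  · rintro j hj s1 hf1 h14 ⟨k18, kle, kF, kR⟩; have hs1 := hs.fr hf1 (by decide)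
    have e10 : s1.reg 10 = C := hf1.rg h10; have e11 : s1.reg 11 = id := hf1.rg h11
    have e17 : s1.reg 17 = q := hf1.rg h17; have e19 : s1.arr 19 = s.arr 19 := hf1.arr 19 rfl
    have hwj := hwn j hj; have hTj : T (j + 1) = T j + slots q (c j) := sum_range_succ _ _
    have hTj' := hTmono (j := j + 1) (j' := N) hj; have hent := hs1.lists.ent id hid j (by omega)
    -- After `i` slots for the vertex `w j`, the truncated difference `c j - i * q` is still to be
    -- placed and `min (c j) (i * q)` units have been placed.
    refine time (asgv (v := w j) ?_ (by omega) (asgv (v := c j) ?_ (hcM j)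
      (cons (loop (slots q (c j)) (fun _ => 9) (fun i s' => s'.reg 15 = c j - i * q ∧
        s'.reg 18 = T j + i ∧ Le (T j + i) s' ∧ (∀ g, F g (T j + i) s' =
          ∑ i ∈ rng j, c i * g (w i) + min (c j) (i * q) * g (w j)) ∧ Rest s')
        ?_ ?_ ?_) (T₂ := 1) ?_))) ?_
    · simp only [ival_load, ival_add, ival_mul, ival_reg, h14, hs1.r8, e11, hent, hw]
    · simp [hs1.r6, e10, e19, h19 _ hwj, c]
    · simp only [setReg_reg, if_true]; refine ⟨by omega, by simp [k18], kle, fun g => ?_, kR⟩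
      refine (kF g).trans ?_; simp
    · rintro i hi s2 hf2 ⟨g15, g18, gle, gF, gR⟩; have f6 : s2.reg 6 = 2 ^ I.k := hf2.rg hs1.r6
      have f8 : s2.reg 8 = I.L := hf2.rg hs1.r8; have f10 : s2.reg 10 = C := hf2.rg e10
      have f11 : s2.reg 11 = id := hf2.rg e11; have f17 : s2.reg 17 = q := hf2.rg e17
      have f19 : s2.reg 19 = w j := hf2.rg rfl; have hlt := lt_of_lt_slots hi
      have hi1 : (i + 1) * q = i * q + q := by ring
      have hcj := hcM j; refine ⟨by rw [ival_reg, g15]; omega, ?_⟩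
      have hidx3 : ∀ x, ∀ id' < I.L, ∀ X < 2 ^ I.k, (x * I.L + id') * 2 ^ I.k + X =
          ((T j + i) * I.L + id) * 2 ^ I.k + C ↔ x = T j + i ∧ id' = id ∧ X = C := by
        intro x id' hid' X hX; constructor
        · intro h; obtain ⟨h1, h2⟩ := enc_inj hX hC h; obtain ⟨h3, h4⟩ := enc_inj hid' hid h1; omega
        · simp_all
      refine stov (j := ((T j + i) * I.L + id) * 2 ^ I.k + C) (v := w j) ?_ ?_ (by omega)
        (stov (j := ((T j + i) * I.L + id) * 2 ^ I.k + C) (v := min (c j - i * q) q) ?_ ?_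
        (by omega) (asgv (v := c j - (i + 1) * q) ?_ (by omega)
        (asgv (v := T j + (i + 1)) ?_ (by omega) (nil ⟨?_, ?_, ?_, fun g => ?_, ?_⟩))))
      · simp_all
      · simp_all
      · simp_all
      · simp only [ival_sub, ival_reg, setArr_reg, g15, f17]; omega
      · simp only [ival_sub, ival_reg, setArr_reg, g15, f17]; omega
      · simp [g18]; omega
      · simp
      · simp
      · intro x hx
        simp only [setReg_arr, setArr_arr, Nat.reduceEqDiff, if_true, if_false, hidx3 x id hid C hC,
          and_true]
        grind
      · simp only [F, setReg_arr, setArr_arr, Nat.reduceEqDiff, if_true, if_false,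
          hidx3 _ id hid C hC, and_true]
        rw [← add_assoc, sum_range_succ, if_pos rfl, if_pos rfl]
        have e1 : ∑ x ∈ rng (T j + i), (if x = T j + i then min (c j - i * q) q else
            s2.arr 26 ((x * I.L + id) * 2 ^ I.k + C)) * g (if x = T j + i then w j else
            s2.arr 25 ((x * I.L + id) * 2 ^ I.k + C)) = F g (T j + i) s2 := by
          refine sum_congr rfl fun x hx => ?_; grind
        rw [e1, gF g, add_assoc, ← Nat.add_mul]; congr 2; omega
      · intro x id' hid' X hX hne
        simp only [setReg_arr, setArr_arr, Nat.reduceEqDiff, if_true, if_false, hidx3 x id' hid' X hX]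
        grind
    · rintro s2 hf2 ⟨g15, -⟩; rw [ival_reg, g15]; rcases Nat.eq_zero_or_pos (c j) with h0 | h0
      · omega
      · have := le_slots_mul (x := c j) (hq _ (hwm j hj) (by simp only [c] at h0; omega)); omega
    · rintro s2 ⟨-, g18, gle, gF, gR⟩ -
      refine nil ⟨by simp [g18, hTj], by rw [hTj]; exact gle, fun g => ?_, gR⟩; rw [hTj]
      refine (gF g).trans ?_; rw [sum_range_succ]; congr 2
      rcases Nat.eq_zero_or_pos (c j) with h0 | h0
      · omega
      · have := le_slots_mul (x := c j) (hq _ (hwm j hj) (by simp only [c] at h0; omega)); omega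
    · simp; omega
  · grind

/-- The capacity `q` is the rounded average over the `z` vertices of nonzero weight. Rounding up
costs each of them at most `q`, in total at most `z * q`, which is at most the weight. Since `q` is
positive when `z` is, the weight is below `(q + 1) * z ≤ 2 * q * z`, which bounds the number of
slots by `4 * z`. -/
theorem slots_total {S : Finset ℕ} {c : ℕ → ℕ} {q n : ℕ}
    (hq : q = (∑ u ∈ S, c u) / (S.filter fun u => c u ≠ 0).card) (hn : S.card ≤ n) :
    (∀ u ∈ S, c u ≠ 0 → 0 < q) ∧ (∑ u ∈ S, slots q (c u)) * q ≤ 2 * ∑ u ∈ S, c u ∧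
      ∑ u ∈ S, slots q (c u) ≤ 4 * n := by
  obtain ⟨z, hz⟩ : ∃ z, z = (S.filter fun u => c u ≠ 0).card := ⟨_, rfl⟩
  obtain ⟨W, hW⟩ : ∃ W, W = ∑ u ∈ S, c u := ⟨_, rfl⟩; rw [← hz, ← hW] at hq; rw [← hW]
  have hzn : z ≤ n := hz ▸ (card_filter_le _ _).trans hn; have hzW : z ≤ W := by
    rw [hz, hW, card_filter]; exact sum_le_sum fun u _ => by split_ifs <;> omega
  have h1 : ∀ u ∈ S, c u ≠ 0 → 0 < q := by
    intro u hu hc; have : 0 < z := hz ▸ card_pos.2 ⟨u, mem_filter.2 ⟨hu, hc⟩⟩; simp_all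
  have hzq : z * q ≤ W := by rw [hq]; exact Nat.mul_div_le _ _
  have h2 : (∑ u ∈ S, slots q (c u)) * q ≤ W + z * q := by
    rw [sum_mul, hW, hz, card_filter, sum_mul, ← sum_add_distrib]
    refine sum_le_sum fun u _ => slots_mul_lt.trans ?_; grind
  refine ⟨h1, by omega, ?_⟩; rcases Nat.eq_zero_or_pos z with h0 | h0
  · refine le_trans (le_of_eq (sum_eq_zero fun u hu => ?_)) (Nat.zero_le _); have : c u = 0 := by
      by_contra hc
      grind
    rw [this, slots_zero]
  · have hqp : 0 < q := by rw [hq]; exact Nat.div_pos hzW h0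
    have h3 : W < (q + 1) * z := by have := Nat.lt_mul_div_succ W h0; grind
    have h4 : (∑ u ∈ S, slots q (c u)) * q ≤ 4 * z * q := by nlinarith
    exact (Nat.le_of_mul_le_mul_right h4 hqp).trans (by omega)

theorem slotC_spec (hB : Big I β M) (hT : Trie I β col σ ctr ℓ) (hs : Static I col σ ctr ℓ s)
    {C : ℕ} (hC : C < 2 ^ I.k) (h10 : s.reg 10 = C)
    (h19 : ∀ v < I.n, s.arr 19 (v * 2 ^ I.k + C) = I.cnt col C v)
    (hold : ∀ id < I.L, ∀ X < C, ∃ S q, SlotOK I col id X s S q) :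
    Tri M slotC s (∑ id ∈ rng I.L, (60 * (I.mem col id).card + 40) + 3)
      (fun s' => ∀ id < I.L, ∀ X < C + 1, ∃ S q, SlotOK I col id X s' S q) := by
  have hidx := hB.idx
  refine (for_ I.L (fun id => 60 * (I.mem col id).card + 37) (fun j s' => ∀ id < I.L, ∀ X < C + 1,
    (X < C ∨ id < j) → ∃ S q, SlotOK I col id X s' S q) (by simp only [Hy.L]; omega) rfl ?_ ?_ ?_).conseq
    le_rfl ?_
  · intro j s' hf _; rw [ival_reg, hf.reg 8 rfl, hs.r8]
  · intro id hid X hX h; obtain ⟨S, q, h⟩ := hold id hid X (by omega)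
    exact ⟨S, q, h.sum, h.a23, h.a24, h.le, h.fill, h.mul_le, h.S_le⟩
  · intro id hid s1 hf1 h11 hI; have hs1 := hs.fr hf1 (by decide)
    have e10 : s1.reg 10 = C := hf1.rg h10; have e19 : s1.arr 19 = s.arr 19 := hf1.arr 19 rfl
    have hcard : (I.mem col id).card ≤ I.n := by
      rw [← hT.mem id hid, toFinset_card_of_nodup (hs.lists.nodup id hid)]
      exact hs.lists.length_le hid
    obtain ⟨W, hW⟩ : ∃ W, W = ∑ u ∈ I.mem col id, I.cnt col C u := ⟨_, rfl⟩
    have hWM : 4 * W ≤ M := hW ▸ hB.sum_cnt_le (col := col) hC (t := 4) (S := I.mem col id)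
      (by nlinarith [Nat.zero_le (2 ^ β)]) (by omega)
    obtain ⟨q, hq⟩ : ∃ q, q = W / ((I.mem col id).filter fun u => I.cnt col C u ≠ 0).card := ⟨_, rfl⟩
    obtain ⟨t1, t2, t3⟩ := slots_total (q := q) (by rw [hq, hW]) (le_refl (I.mem col id).card)
    rw [← hW] at t2
    obtain ⟨S, hS⟩ : ∃ S, S = ∑ u ∈ I.mem col id, slots q (I.cnt col C u) := ⟨_, rfl⟩
    refine time (asgv (v := 0) rfl (by omega) (asgv (v := 0) rfl (by omega)
      (cons (slotSumC_spec (s := (s1.setReg 12 0).setReg 13 0) hB hT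
        (hs1.congr (by simp) (by simp)) hC hid (by simp [e10]) (by simp [h11])
        (by simp only [setReg_arr, e19]; exact h19) (by simp) (by simp))
      (T₂ := 50 * (I.mem col id).card + 18) ?_))) (by omega)
    rintro s2 ⟨k12, k13⟩ hf2
    have hs2 : Static I col σ ctr ℓ s2 := (hs1.congr (s' := (s1.setReg 12 0).setReg 13 0)
      (by simp) (by simp)).fr hf2 (by decide)
    have f10 : s2.reg 10 = C := hf2.rg e10; have f11 : s2.reg 11 = id := hf2.rg h11
    have f19 : s2.arr 19 = s.arr 19 := hf2.ar e19
    have hqM : q ≤ M := hq ▸ (Nat.div_le_self _ _).trans (by omega)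
    refine time (asgv (v := q) (by simp [k12, k13, hq, hW]) hqM
      (asgv (v := 0) rfl (by omega) (cons (slotFillC_spec
        (s := (s2.setReg 17 q).setReg 18 0) (q := q) hB hT
        (hs2.congr (by simp) (by simp)) hC hid (by simp [f10]) (by simp [f11])
        (by simp only [setReg_arr, f19]; exact h19) (by simp) (by simp) t1 (by omega))
      (T₂ := 7) ?_))) ?_
    · rintro s3 ⟨l18, lle, lfill, lrest⟩ hf3; rw [← hS] at l18 lle lfill
      have g10 : s3.reg 10 = C := hf3.rg f10; have g11 : s3.reg 11 = id := hf3.rg f11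
      have g6 : s3.reg 6 = 2 ^ I.k := hf3.rg hs2.r6
      have g12 : s3.reg 12 = W := by rw [hf3.reg 12 rfl]; simp [k12, hW]
      have g17 : s3.reg 17 = q := hf3.rg rfl
      refine stov (j := id * 2 ^ I.k + C) (v := W) (by simp [g10, g11, g6]) (by simp [g12])
        (by omega) (stov (j := id * 2 ^ I.k + C) (v := q) (by simp [g10, g11, g6])
        (by simp [g17]) hqM (stov (j := id * 2 ^ I.k + C) (v := S * q) (by simp [g10, g11, g6])
        (by simp [l18, g17]) (by rw [hS]; omega) (nil ?_)))
      intro id' hid' X hX hcase; have hXK : X < 2 ^ I.k := by omega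
      have e22 : ∀ a, a = 22 ∨ a = 23 ∨ a = 24 → s3.arr a = s1.arr a := by
        rintro a (rfl | rfl | rfl)
        · rw [hf3.arr 22 rfl, setReg_arr, setReg_arr, hf2.arr 22 rfl]; rfl
        · rw [hf3.arr 23 rfl, setReg_arr, setReg_arr, hf2.arr 23 rfl]; rfl
        · rw [hf3.arr 24 rfl, setReg_arr, setReg_arr, hf2.arr 24 rfl]; rfl
      have e25 : ∀ a, a = 25 ∨ a = 26 → s2.arr a = s1.arr a := by
        rintro a (rfl | rfl)
        · rw [hf2.arr 25 rfl]; rfl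
        · rw [hf2.arr 26 rfl]; rfl
      have hcell : ∀ x : ℕ, id' * 2 ^ I.k + X = id * 2 ^ I.k + C ↔ id' = id ∧ X = C := fun _ =>
        ⟨enc_inj hXK hC, fun h => by rw [h.1, h.2]⟩
      by_cases hc : id' = id ∧ X = C
      · obtain ⟨rfl, rfl⟩ := hc; refine ⟨S, q, ?_, ?_, ?_, ?_, ?_, ?_, ?_⟩
        · simp [setArr_arr, hW]
        · simp [setArr_arr]
        · simp [setArr_arr]
        · intro i hi; simpa [setArr_arr] using lle i hi
        · intro g; simpa [setArr_arr] using lfill g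
        · simp_all
        · omega
      · obtain ⟨S', q', h⟩ := hI id' hid' X hX (by omega)
        have h25 : ∀ i, s3.arr 25 ((i * I.L + id') * 2 ^ I.k + X) =
            s1.arr 25 ((i * I.L + id') * 2 ^ I.k + X) := fun i => by
          rw [(lrest i id' hid' X hXK (by omega)).1, setReg_arr, setReg_arr, e25 25 (by simp)]
        have h26 : ∀ i, s3.arr 26 ((i * I.L + id') * 2 ^ I.k + X) =
            s1.arr 26 ((i * I.L + id') * 2 ^ I.k + X) := fun i => by
          rw [(lrest i id' hid' X hXK (by omega)).2, setReg_arr, setReg_arr, e25 26 (by simp)]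
        have hcell' : ¬ (id' * 2 ^ I.k + X = id * 2 ^ I.k + C) := by rw [hcell 0]; exact hc
        refine ⟨S', q', ?_, ?_, ?_, ?_, ?_, h.mul_le, h.S_le⟩
        · simp [setArr_arr, hcell', e22, h.sum]
        · simp [setArr_arr, hcell', e22, h.a23]
        · simp [setArr_arr, hcell', e22, h.a24]
        · intro i hi; simpa [setArr_arr, h26] using h.le i hi
        · intro g; simpa [setArr_arr, h25, h26] using h.fill g
    · rw [sum_add_distrib, ← mul_sum, sum_const, smul_eq_mul, ← hS]; omega
  · simp_all

/-! ### Neighbour sums by inclusion and exclusion -/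

theorem mem_nb_iff {v u : ℕ} (hu : u < I.n) : u ∈ I.Nb col v ↔
    ¬ Disjoint (I.hi v I.m).toFinset (I.hi u I.m).toFinset ∨ u ∈ I.mem col (I.m + v) := by
  classical
  simp only [Hy.Nb, mem_filter, mem_rng, hu, true_and, Hy.src, mem_append,
    List.mem_singleton, Finset.not_disjoint_iff, List.mem_toFinset]
  constructor
  · rintro ⟨id, h | rfl, h'⟩
    · left; have h1 := Hy.mem_hi.1 h; refine ⟨id, h, Hy.mem_hi.2 ⟨h1.1, h1.2.1, ?_⟩⟩
      rw [Hy.mem, if_pos h1.1, if_pos h1.2.1, List.mem_toFinset] at h'; exact h'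
    · simp_all
  · rintro (⟨e, h, h'⟩ | h)
    · have h1 := Hy.mem_hi.1 h; refine ⟨e, Or.inl h, ?_⟩
      rw [Hy.mem, if_pos h1.1, if_pos h1.2.1, List.mem_toFinset]; exact (Hy.mem_hi.1 h').2.2
    · simp_all

theorem mem_low_disjoint {v u : ℕ} (hv : v < I.n) (h : u ∈ I.mem col (I.m + v)) :
    Disjoint (I.hi v I.m).toFinset (I.hi u I.m).toFinset := by
  classical
  rw [Hy.mem, if_neg (by omega), if_neg (by omega), mem_filter, Nat.add_sub_cancel_left] at h
  refine Finset.disjoint_left.2 fun e h1 h2 => h.2.2 ?_; rw [List.mem_toFinset, Hy.mem_hi] at h1 h2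
  exact ⟨e, h1.2.1, h1.2.2, h2.2.2⟩

/-- Inclusion and exclusion over the sets of large hyperedges at a vertex. -/
theorem adjCnt_eq {v : ℕ} (hv : v < I.n) (C : ℕ) :
    I.adjCnt col C v + ∑ S ∈ (I.hi v I.m).toFinset.powerset,
        (if S.card % 2 = 0 then I.nodeCnt col C S I.n else 0) =
      I.nodeCnt col C ∅ I.n + ∑ S ∈ (I.hi v I.m).toFinset.powerset,
        (if S.card % 2 = 0 then 0 else I.nodeCnt col C S I.n) +
        ∑ u ∈ I.mem col (I.m + v), I.cnt col C u := by
  classical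
  have hN : ∑ u ∈ I.mem col (I.m + v), I.cnt col C u =
      ∑ u ∈ rng I.n, if u ∈ I.mem col (I.m + v) then I.cnt col C u else 0 := by
    rw [← sum_filter]; refine sum_congr ?_ fun _ _ => rfl; ext u; simp only [mem_filter, mem_rng]
    refine ⟨fun h => ⟨?_, h⟩, fun h => h.2⟩
    rw [Hy.mem, if_neg (by omega), if_neg (by omega), mem_filter, mem_rng] at h; omega
  have hA : I.adjCnt col C v =
      ∑ u ∈ rng I.n, if u ∈ I.Nb col v then I.cnt col C u else 0 := by
    rw [Hy.adjCnt, HyperMotivo.adjCnt, ← sum_filter]; refine sum_congr ?_ fun _ _ => rfl; ext u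
    simp only [mem_filter, mem_rng]; refine ⟨fun h => ⟨?_, h⟩, fun h => h.2⟩
    rw [Hy.Nb, mem_filter, mem_rng] at h; omega
  -- Exchanging the sums, a vertex `u` is counted once for each set with the property `p` among the
  -- sets of large hyperedges common to `u` and `v`.
  have push : ∀ p : Finset ℕ → Prop, [DecidablePred p] →
      ∑ S ∈ (I.hi v I.m).toFinset.powerset, (if p S then I.nodeCnt col C S I.n else 0) =
      ∑ u ∈ rng I.n, I.cnt col C u *
        (((I.hi v I.m).toFinset ∩ (I.hi u I.m).toFinset).powerset.filter p).card := by
    intro p _; simp only [Hy.nodeCnt]; have e : ∀ S, (if p S then ∑ u ∈ rng I.n,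
        (if S ⊆ (I.hi u I.m).toFinset then I.cnt col C u else 0) else 0) = ∑ u ∈ rng I.n,
        if p S then (if S ⊆ (I.hi u I.m).toFinset then I.cnt col C u else 0) else 0 := fun S => by
      simp
    rw [sum_congr rfl fun S _ => e S, sum_comm]; refine sum_congr rfl fun u _ => ?_
    rw [card_filter, mul_sum, ← Finset.sum_subset (Finset.powerset_mono.2
      (Finset.inter_subset_left (s₁ := (I.hi v I.m).toFinset) (s₂ := (I.hi u I.m).toFinset)))]
    · refine sum_congr rfl fun S hS => ?_; grind
    · grind
  have flip : ∀ S : Finset ℕ, (if S.card % 2 = 0 then 0 else I.nodeCnt col C S I.n) =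
      if ¬ S.card % 2 = 0 then I.nodeCnt col C S I.n else 0 := fun S => by split_ifs <;> simp_all
  simp only [flip]
  rw [push (fun S => S.card % 2 = 0), push (fun S => ¬ S.card % 2 = 0), hN, hA, Hy.nodeCnt,
    ← sum_add_distrib, ← sum_add_distrib, ← sum_add_distrib]
  refine sum_congr rfl fun u hu => ?_; have hu := mem_rng.1 hu
  obtain ⟨D, hD⟩ : ∃ D, D = (I.hi v I.m).toFinset ∩ (I.hi u I.m).toFinset := ⟨_, rfl⟩
  -- Even and odd subsets of `D` balance unless `D` is empty, and then the vertex counts only if it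
  -- is on the list of neighbours through small hyperedges.
  have key : ((D.powerset.filter fun S => S.card % 2 = 0).card : ℤ) -
      (D.powerset.filter fun S => ¬ S.card % 2 = 0).card = if D = ∅ then 1 else 0 := by
    rw [← Finset.sum_powerset_neg_one_pow_card, card_filter, card_filter]; push_cast
    rw [← Finset.sum_sub_distrib]; refine sum_congr rfl fun S _ => ?_; by_cases h : S.card % 2 = 0
    · rw [if_pos h, if_neg (not_not.2 h), (Nat.even_iff.2 h).neg_one_pow]; simp
    · rw [if_neg h, if_pos h, (Nat.odd_iff.2 (by omega)).neg_one_pow]; simp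
  rw [← hD, if_pos (Finset.empty_subset _)]
  have hdisj : D = ∅ ↔ Disjoint (I.hi v I.m).toFinset (I.hi u I.m).toFinset := by
    rw [hD, Finset.disjoint_iff_inter_eq_empty]
  have hnb := mem_nb_iff (col := col) (v := v) hu; rw [← hdisj] at hnb
  by_cases h1 : u ∈ I.mem col (I.m + v)
  · have h2 : D = ∅ := hdisj.2 (mem_low_disjoint hv h1); rw [if_pos h2] at key
    rw [if_pos (hnb.2 (Or.inr h1)), if_pos h1]
    have : (D.powerset.filter fun S => S.card % 2 = 0).card =
      (D.powerset.filter fun S => ¬ S.card % 2 = 0).card + 1 := by omega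
    grind
  · by_cases h2 : D = ∅
    · rw [if_pos h2] at key; rw [if_neg (by tauto), if_neg h1]
      have : (D.powerset.filter fun S => S.card % 2 = 0).card =
        (D.powerset.filter fun S => ¬ S.card % 2 = 0).card + 1 := by omega
      grind
    · grind

theorem adjC_spec (hB : Big I β M) (hT : Trie I β col σ ctr ℓ) (hs : Static I col σ ctr ℓ s)
    {C : ℕ} (hC : C < 2 ^ I.k) (h10 : s.reg 10 = C)
    (h21 : ∀ a ≤ ctr, s.arr 21 (a * 2 ^ I.k + C) = I.nodeCnt col C (σ a) I.n)
    (h22 : ∀ id < I.L, s.arr 22 (id * 2 ^ I.k + C) = ∑ u ∈ I.mem col id, I.cnt col C u) :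
    Tri M adjC s (∑ v ∈ rng I.n, (10 * 2 ^ (I.hi v I.m).length + 20) + 3)
      (fun s' => (∀ v < I.n, s'.arr 20 (v * 2 ^ I.k + C) = I.adjCnt col C v) ∧
        ∀ v, ∀ X < 2 ^ I.k, X ≠ C → s'.arr 20 (v * 2 ^ I.k + X) = s.arr 20 (v * 2 ^ I.k + X)) := by
  have hidx := hB.idx; refine (for_ I.n (fun v => 10 * 2 ^ (I.hi v I.m).length + 17) (fun j s' =>
      (∀ v < j, s'.arr 20 (v * 2 ^ I.k + C) = I.adjCnt col C v) ∧
      ∀ v, ∀ X < 2 ^ I.k, X ≠ C → s'.arr 20 (v * 2 ^ I.k + X) = s.arr 20 (v * 2 ^ I.k + X))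
    (by omega) rfl ?_ ⟨by simp, fun _ _ _ _ => rfl⟩ ?_).conseq le_rfl fun s' hs' => hs'.1
  · intro j s' hf _; rw [ival_reg, hf.reg 2 rfl, hs.r2]
  rintro v hv s1 hf1 h11 ⟨g20, g20'⟩; have hs1 := hs.fr hf1 (by decide)
  have e10 : s1.reg 10 = C := hf1.rg h10; have e21 : s1.arr 21 = s.arr 21 := hf1.arr 21 rfl
  have e22 : s1.arr 22 = s.arr 22 := hf1.arr 22 rfl
  obtain ⟨d, hd⟩ : ∃ d, d = 2 ^ (I.hi v I.m).length := ⟨_, rfl⟩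
  have hdβ : d ≤ 2 ^ β := hd ▸ pow_le_pow_right (by omega) (hB.deg v)
  have hdM : d ≤ M := by have := hB.trie; omega
  obtain ⟨B, hBd⟩ : ∃ B, B = ∑ u ∈ rng I.n, I.cnt col C u := ⟨_, rfl⟩
  have hBM : 4 * (2 ^ β + β + 2) * B ≤ M := by
    have := hB.sum_cnt_le (col := col) hC (S := rng I.n) le_rfl (by simp); simp_all
  have hF : ∀ S, I.nodeCnt col C S I.n ≤ B := fun S => hBd ▸ Hy.nodeCnt_le _ _ _
  let node : ℕ → ℕ := fun j => s1.arr 12 (j * (I.n + 1) + v)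
  have hnode : ∀ j < d, node j ≤ ctr := fun j hj => hs1.nodes.le v hv j (hd ▸ hj)
  let ev : ℕ → ℕ := fun j => if (σ (node j)).card % 2 = 0 then I.nodeCnt col C (σ (node j)) I.n else 0
  let od : ℕ → ℕ := fun j => if (σ (node j)).card % 2 = 0 then 0 else I.nodeCnt col C (σ (node j)) I.n
  have hev : ∀ j ≤ d, ∑ i ∈ rng j, ev i ≤ 2 ^ β * B := fun j hj => by
    refine (sum_le_card_nsmul _ _ B fun i _ => ?_).trans ?_
    · grind
    · simp only [card_range, smul_eq_mul]; exact Nat.mul_le_mul_right _ (hj.trans hdβ)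
  have hod : ∀ j ≤ d, ∑ i ∈ rng j, od i ≤ 2 ^ β * B := fun j hj => by
    refine (sum_le_card_nsmul _ _ B fun i _ => ?_).trans ?_
    · grind
    · simp only [card_range, smul_eq_mul]; exact Nat.mul_le_mul_right _ (hj.trans hdβ)
  have hM2 : 2 ^ β * B + 2 * B ≤ M := by nlinarith [Nat.zero_le (2 ^ β * B), Nat.zero_le (β * B)]
  have hadj := adjCnt_eq (col := col) hv C
  rw [← hs1.nodes.sum v hv (fun S => if S.card % 2 = 0 then I.nodeCnt col C S I.n else 0),
    ← hs1.nodes.sum v hv (fun S => if S.card % 2 = 0 then 0 else I.nodeCnt col C S I.n), ← hd] at hadj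
  have hadjB : I.adjCnt col C v ≤ B := by
    rw [hBd, Hy.adjCnt, HyperMotivo.adjCnt]
    refine sum_le_sum_of_subset (f := fun u => I.cnt col C u) fun u hu => ?_
    simp only [Hy.Nb, mem_filter] at hu; exact hu.1
  have hr0 : s1.arr 21 C = I.nodeCnt col C ∅ I.n := by
    have := h21 0 (Nat.zero_le _); rw [hT.root] at this; simp_all
  have hF0 := hF ∅; refine time (asgv (v := I.nodeCnt col C ∅ I.n) (by simp [e10, hr0]) (by omega)
    (asgv (v := 0) rfl (by omega) (cons (for_const d 7 (fun j s' =>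
      s'.reg 12 = I.nodeCnt col C ∅ I.n + ∑ i ∈ rng j, od i ∧
      s'.reg 13 = ∑ i ∈ rng j, ev i) hdM rfl ?_ (by simp) ?_) (T₂ := 3) ?_))) (by omega)
  · intro j s' hf _; rw [ival_load, ival_reg, hf.reg 11 rfl, hf.arr 9 rfl]
    simp [h11, hs1.nodes.num v hv, hd]
  · rintro j hj s2 hf2 h14 ⟨k12, k13⟩
    have hs2 : Static I col σ ctr ℓ s2 := (hs1.congr (s' := (s1.setReg 12
      (I.nodeCnt col C ∅ I.n)).setReg 13 0) (by simp) (by simp)).fr hf2 (by decide)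
    have f11 : s2.reg 11 = v := hf2.rg h11; have f10 : s2.reg 10 = C := hf2.rg e10
    have f12 : s2.arr 12 = s1.arr 12 := hf2.arr 12 rfl
    have f21 : s2.arr 21 = s.arr 21 := hf2.ar e21; have h1 := hev (j + 1) hj
    have h2 := hod (j + 1) hj; have hc := hnode j hj; have hsg := hs2.sg (node j) hc
    have hctrM : node j ≤ M := by have := hT.ctr_le; have := hB.trie; omega
    have hFj := h21 (node j) hc; rw [sum_range_succ] at h1 h2
    refine time (asgv (v := node j) (by simp [h14, hs2.r7, f11, f12, node]) hctrM
      (cons (Tri.ite (T := 1) (Q := fun s' =>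
        s'.reg 12 = I.nodeCnt col C ∅ I.n + ∑ i ∈ rng (j + 1), od i ∧
        s'.reg 13 = ∑ i ∈ rng (j + 1), ev i) (fun hb => ?_) (fun hb => ?_)) (T₂ := 1)
        fun s' hs' _ => nil (by simpa using hs'))) (by omega)
    · have hb' : ¬ (σ (node j)).card % 2 = 0 := by simpa [hsg] using hb
      have o1 : od j = I.nodeCnt col C (σ (node j)) I.n := if_neg hb'
      have v1 : ev j = 0 := if_neg hb'; refine assign ?_ ⟨?_, ?_⟩
      · simp [k12, hs2.r6, f10, f21, hFj]; omega
      · simp [k12, hs2.r6, f10, f21, hFj, sum_range_succ, o1]; omega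
      · simp [k13, sum_range_succ, v1]
    · have hb' : (σ (node j)).card % 2 = 0 := by simpa [hsg] using hb
      have o1 : od j = 0 := if_pos hb'
      have v1 : ev j = I.nodeCnt col C (σ (node j)) I.n := if_pos hb'; refine assign ?_ ⟨?_, ?_⟩
      · simp [k13, hs2.r6, f10, f21, hFj]; omega
      · simp [k12, sum_range_succ, o1]
      · simp [k13, hs2.r6, f10, f21, hFj, sum_range_succ, v1]
  · rintro s2 ⟨⟨k12, k13⟩, -⟩ hf2
    have hs2 : Static I col σ ctr ℓ s2 := (hs1.congr (s' := (s1.setReg 12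
      (I.nodeCnt col C ∅ I.n)).setReg 13 0) (by simp) (by simp)).fr hf2 (by decide)
    have f11 : s2.reg 11 = v := hf2.rg h11; have f10 : s2.reg 10 = C := hf2.rg e10
    have f22 : s2.arr 22 = s.arr 22 := hf2.ar e22
    have f20 : s2.arr 20 = s1.arr 20 := hf2.arr 20 rfl
    have hW := h22 (I.m + v) (by simp only [Hy.L]; omega)
    refine stov (j := v * 2 ^ I.k + C) (v := I.adjCnt col C v) (by simp [f11, hs2.r6, f10]) ?_
      (by omega) (nil ⟨fun v' hv' => ?_, fun v' X hX hXC => ?_⟩)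
    · simp only [ival_sub, ival_add, ival_load, ival_mul, ival_reg, k12, k13, hs2.r3, f11, hs2.r6,
        f10, f22, hW]
      grind
    · rw [setReg_arr, setArr_table _ _ _ _ _ _ hC hC, f20]; grind
    · rw [setReg_arr, setArr_table _ _ _ _ _ _ hC hX, if_neg (by tauto), f20, g20' v' X hX hXC]

/-- The tables of the sampler. -/
structure Built (I : Hy) (col : ℕ → ℕ) (σ : ℕ → Finset ℕ) (ctr : ℕ) (ℓ : ℕ → List ℕ)
    (s : Store) : Prop extends Static I col σ ctr ℓ s where
  cnt : ∀ v < I.n, ∀ C < 2 ^ I.k, s.arr 19 (v * 2 ^ I.k + C) = I.cnt col C v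
  adj : ∀ v < I.n, ∀ C < 2 ^ I.k, s.arr 20 (v * 2 ^ I.k + C) = I.adjCnt col C v
  slot : ∀ id < I.L, ∀ C < 2 ^ I.k, ∃ S q, SlotOK I col id C s S q

theorem dpC_spec (hB : Big I β M) (hT : Trie I β col σ ctr ℓ) (hs : Static I col σ ctr ℓ s)
    (h21 : s.arr 21 = 0) :
    Tri M dpC s (2 ^ I.k * (18 * ∑ v ∈ rng I.n, 2 ^ (I.hi v I.m).length +
        I.n * (4 * 2 ^ I.k + 40) + 60 * ∑ id ∈ rng I.L, (I.mem col id).card +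
        40 * I.L + 20) + 3) (Built I col σ ctr ℓ) := by
  refine (for_const (2 ^ I.k) (18 * ∑ v ∈ rng I.n, 2 ^ (I.hi v I.m).length +
        I.n * (4 * 2 ^ I.k + 40) + 60 * ∑ id ∈ rng I.L, (I.mem col id).card +
        40 * I.L + 17)
    (fun C s' => (∀ v < I.n, ∀ X < C, s'.arr 19 (v * 2 ^ I.k + X) = I.cnt col X v) ∧
      (∀ v < I.n, ∀ X < C, s'.arr 20 (v * 2 ^ I.k + X) = I.adjCnt col X v) ∧
      (∀ id < I.L, ∀ X < C, ∃ S q, SlotOK I col id X s' S q) ∧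
      ∀ a ≤ ctr, ∀ X < 2 ^ I.k, C ≤ X → s'.arr 21 (a * 2 ^ I.k + X) = 0)
    hB.two_pow rfl ?_ ?_ ?_).fr.conseq le_rfl ?_
  · intro j s' hf _; rw [ival_reg, hf.reg 6 rfl, hs.r6]
  · simp_all
  · rintro C hC s1 hf1 h10 ⟨g19, g20, gS, g21⟩; have hs1 := hs.fr hf1 (by decide)
    refine time (cons (countC_spec hB hT hs1 hC h10 g19 g20 fun a ha => g21 a ha C hC le_rfl)
      (T₂ := (∑ id ∈ rng I.L, (60 * (I.mem col id).card + 40) + 3) +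
        ((∑ v ∈ rng I.n, (10 * 2 ^ (I.hi v I.m).length + 20) + 3) + 1 + 1) + 1) ?_) ?_
    · rintro s2 ⟨k19, k19', k21, k21'⟩ hf2; have hs2 := hs1.fr hf2 (by decide)
      have f10 : s2.reg 10 = C := hf2.rg h10
      have gS2 : ∀ id < I.L, ∀ X < C, ∃ S q, SlotOK I col id X s2 S q := by
        intro id hid X hX; obtain ⟨S, q, h⟩ := gS id hid X hX; have e22 := hf2.arr 22 rfl
        have e23 := hf2.arr 23 rfl; have e24 := hf2.arr 24 rfl; have e25 := hf2.arr 25 rfl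
        have e26 := hf2.arr 26 rfl
        exact ⟨S, q, e22 ▸ h.sum, e23 ▸ h.a23, e24 ▸ h.a24, e26 ▸ h.le, by
          rw [e25, e26]; exact h.fill, h.mul_le, h.S_le⟩
      refine cons (slotC_spec hB hT hs2 hC f10 k19 gS2) ?_; intro s3 l hf3
      have hs3 := hs2.fr hf3 (by decide); have l10 : s3.reg 10 = C := hf3.rg f10
      have l19 : s3.arr 19 = s2.arr 19 := hf3.arr 19 rfl
      have l21 : s3.arr 21 = s2.arr 21 := hf3.arr 21 rfl
      have l20 : s3.arr 20 = s1.arr 20 := by rw [hf3.arr 20 rfl, hf2.arr 20 rfl]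
      refine time (cons (adjC_spec hB hT hs3 hC l10 (by rw [l21]; exact k21) fun id hid => ?_)
        (T₂ := 1) ?_) le_rfl
      · obtain ⟨S, q, h⟩ := l id hid C (by omega); exact h.sum
      rintro s4 ⟨m20, m20'⟩ hf4; have m19 : s4.arr 19 = s2.arr 19 := hf4.ar l19
      have m21 : s4.arr 21 = s2.arr 21 := hf4.ar l21
      refine nil ⟨fun v hv X hX => ?_, fun v hv X hX => ?_, fun id hid X hX => ?_,
        fun a ha X hX hCX => ?_⟩
      · rw [setReg_arr, m19]; grind
      · rw [setReg_arr]; grind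
      · obtain ⟨S, q, h⟩ := l id hid X hX; have e22 := hf4.arr 22 rfl; have e23 := hf4.arr 23 rfl
        have e24 := hf4.arr 24 rfl; have e25 := hf4.arr 25 rfl; have e26 := hf4.arr 26 rfl
        exact ⟨S, q, by rw [setReg_arr, e22]; exact h.sum, by rw [setReg_arr, e23]; exact h.a23,
          by rw [setReg_arr, e24]; exact h.a24, by rw [setReg_arr, e26]; exact h.le, by
          rw [setReg_arr, e25, e26]; exact h.fill, h.mul_le, h.S_le⟩
      · rw [setReg_arr, m21, k21' a X hX (by omega), g21 a ha X hX (by omega)]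
    · simp only [sum_add_distrib, ← mul_sum, sum_const, card_range,
        smul_eq_mul]
      ring_nf
      omega
  · rintro s' ⟨⟨⟨h1, h2, h3, -⟩, -⟩, hf⟩; exact ⟨hs.fr hf (by decide), h1, h2, h3⟩
end

/-! ### The build-up phase and the law of the colouring -/

section
variable {I : Hy} {col : ℕ → ℕ} {β M : ℕ} {s : Store}

variable (I) in
/-- The time to prepare the tables after the colouring is drawn, with `W` for the total length of
the vertex lists. -/
def prepTime (β W : ℕ) : ℕ :=
  4 * (2 ^ I.k * 2 ^ I.k) + 200 + 28 * I.n + 10 * I.m +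
  43 * ∑ v ∈ rng I.n, 2 ^ (I.hi v I.m).length +
  ∑ e ∈ rng I.m, ((if I.a < I.sz e then 0 else I.sz e * I.sz e * (2 * β + 28)) + 15) +
  ∑ e ∈ rng I.m, ((if I.a < I.sz e then 0 else
      (I.sz e + 1) ^ I.k * (17 * I.k + 23)) + 5 * I.k + 20) +
  2 ^ I.k * (18 * ∑ v ∈ rng I.n, 2 ^ (I.hi v I.m).length +
        I.n * (4 * 2 ^ I.k + 40) + 60 * W + 40 * I.L + 20)

theorem readOK_init (h9 : ∀ v < I.n, s.arr 9 v = 1) (hL : ListsOK I (rootList I col I.n) s)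
    (hz : ∀ a, 10 ≤ a → a ≤ 14 → s.arr a = 0) (h16 : s.reg 16 = 0) :
    ReadOK I (readList I col 0 0) (readHi I 0 0) s := by
  have hn := I.n_pos; have hh : ∀ v, readHi I 0 0 v = [] := fun v => by simp [readHi, Hy.hi]
  refine ⟨hL.lists fun id _ => ?_, ⟨fun v _ => ?_, fun v _ i hi => ?_⟩, fun _ => ∅, 0,
    ⟨h16, rfl, fun a ha b hb _ => by omega, fun a _ => ?_, fun a _ e _ h => ?_, fun b hb hb0 => ?_,
      fun a _ e _ => ?_⟩, ⟨fun v hv => ?_, fun v _ j _ => ?_, fun v _ g => ?_⟩, Nat.zero_le _⟩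
  · by_cases h : id = 0
    · subst h; have : ¬ (0 = I.m + I.n) := by omega
      simp [readList, rootList, this]
    · simp [readList, h]
  · simp_all
  · simp_all
  · simp_all
  · simp_all
  · omega
  · simp_all
  · simp_all
  · simp_all
  · simp [hh]

theorem lowOK_init : LowOK I col 0 0 (readList I col I.m 0) := by
  classical
  have hn := I.n_pos; refine ⟨fun id hid => ?_, ?_, fun v hv u => ?_⟩
  · by_cases h : I.a < I.sz id <;> simp [readList, Hy.mem, hid, h]
  · ext u; have h1 : ¬ (I.n = 0) := by omega
    simp [readList, rootList, Hy.mem, h1]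
  · have h1 : readList I col I.m 0 (I.m + v) = [] := by
      by_cases h : v = 0
      · simp [readList, h]
      · have : ¬ (I.m + v = I.m + I.n) := by omega
        simp [readList, rootList, h]; omega
    simp [h1, Hy.LowAdj]

theorem prepC_spec (hB : Big I β M) (hC : Consts I s) (hc : ∀ v < I.n, s.arr 2 v = col v)
    (hk : ∀ v < I.n, col v < I.k) (hz : ∀ a, 9 ≤ a → a ≤ 26 → s.arr a = 0) (h16 : s.reg 16 = 0) :
    Tri M prepC s (prepTime I β (∑ id ∈ rng I.L, (I.mem col id).card)) (fun s' =>
      ∃ σ ctr ℓ, Trie I β col σ ctr ℓ ∧ Built I col σ ctr ℓ s') := by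
  refine time (cons (disC_spec hB hC) fun s1 dis hf1 => ?_) ?_
    (T₁ := (4 * (2 ^ I.k * 2 ^ I.k) + 10) + ((20 * I.n + 20) + ((43 * ∑ v ∈ rng I.n,
      2 ^ (I.hi v I.m).length + 10 * I.m + 10) + ((8 * I.n + 20) +
      ((∑ e ∈ rng I.m, ((if I.a < I.sz e then 0 else
        I.sz e * I.sz e * (2 * β + 28)) + 15) + 3) +
      ((∑ e ∈ rng I.m, ((if I.a < I.sz e then 0 else
        (I.sz e + 1) ^ I.k * (17 * I.k + 23)) + 5 * I.k + 20) + 3) +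
      ((2 ^ I.k * (18 * ∑ v ∈ rng I.n, 2 ^ (I.hi v I.m).length +
        I.n * (4 * 2 ^ I.k + 40) + 60 * (∑ id ∈ rng I.L, (I.mem col id).card) +
        40 * I.L + 20) + 3) + 1 + 1) + 1) + 1) + 1) + 1) + 1) + 1)
  · have hC1 := hC.fr hf1 (by decide)
    have c1 : ∀ v < I.n, s1.arr 2 v = col v := by rw [hf1.arr 2 rfl]; exact hc
    refine cons (rootC_spec hB hC1 c1 ⟨by rw [hf1.arr 15 rfl, hz 15 (by omega) (by omega)],
      by rw [hf1.arr 17 rfl, hz 17 (by omega) (by omega)]⟩) ?_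
    rintro s2 ⟨h9, hL2⟩ hf2; have hC2 := hC1.fr hf2 (by decide)
    have hR2 : ReadOK I (readList I col 0 0) (readHi I 0 0) s2 := by
      refine readOK_init h9 hL2 (fun a ha1 ha2 => ?_) (hf2.rg (hf1.rg h16))
      obtain rfl | rfl | rfl | rfl | rfl : a = 10 ∨ a = 11 ∨ a = 12 ∨ a = 13 ∨ a = 14 := by omega
      · rw [hf2.arr 10 rfl, hf1.arr 10 rfl, hz _ (by omega) (by omega)]
      · rw [hf2.arr 11 rfl, hf1.arr 11 rfl, hz _ (by omega) (by omega)]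
      · rw [hf2.arr 12 rfl, hf1.arr 12 rfl, hz _ (by omega) (by omega)]
      · rw [hf2.arr 13 rfl, hf1.arr 13 rfl, hz _ (by omega) (by omega)]
      · rw [hf2.arr 14 rfl, hf1.arr 14 rfl, hz _ (by omega) (by omega)]
    refine cons (trieC_spec hB hC2 hR2) ?_; intro s3 hR3 hf3; have hC3 := hC2.fr hf3 (by decide)
    have hh : readHi I I.m 0 = fun v => I.hi v I.m := by funext v; simp [readHi]
    rw [hh] at hR3; obtain ⟨σ, ctr, hT, hN, hctr⟩ := hR3.trie
    refine cons (sourceC_spec hB hC3 hR3.src) ?_; intro s4 hS4 hf4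
    have hC4 := hC3.fr hf4 (by decide); have hL4 : ListsOK I (readList I col I.m 0) s4 :=
      hR3.lists.congr (hf4.arr 15 rfl) (hf4.arr 16 rfl) (hf4.arr 17 rfl)
    refine cons (lowC_spec hB hC4 hS4 hL4 lowOK_init) ?_; rintro s5 ⟨ℓ, hL5, hmem⟩ hf5
    have hC5 := hC4.fr hf5 (by decide); have c5 : ∀ v < I.n, s5.arr 2 v = col v := by
      rw [hf5.arr 2 rfl, hf4.arr 2 rfl, hf3.arr 2 rfl, hf2.arr 2 rfl]; exact c1
    have z5 : s5.arr 18 = 0 := by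
      rw [hf5.arr 18 rfl, hf4.arr 18 rfl, hf3.arr 18 rfl, hf2.arr 18 rfl, hf1.arr 18 rfl,
        hz _ (by omega) (by omega)]
    refine cons (degC_spec hB hC5 c5 z5) ?_; intro s6 hD6 hf6; have hC6 := hC5.fr hf6 (by decide)
    have z6 : s6.arr 21 = 0 := by
      rw [hf6.arr 21 rfl, hf5.arr 21 rfl, hf4.arr 21 rfl, hf3.arr 21 rfl, hf2.arr 21 rfl,
        hf1.arr 21 rfl, hz _ (by omega) (by omega)]
    have hTr : Trie I β col σ ctr ℓ := by
      refine ⟨hk, hT.root, hctr.trans ?_, hT.inj, hmem⟩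
      refine (sum_le_card_nsmul _ _ (2 ^ β) fun v _ =>
        pow_le_pow_right (by omega) (hB.deg v)).trans (by simp)
    have hSt : Static I col σ ctr ℓ s6 := by
      refine ⟨hC6, ?_, ?_, ⟨?_, ?_⟩, hL5.congr (hf6.arr 15 rfl) (hf6.arr 16 rfl) (hf6.arr 17 rfl),
        hD6, ?_, ⟨?_, ?_, ?_⟩⟩
      · rw [hf6.arr 2 rfl]; exact c5
      · rw [hf6.arr 6 rfl, hf5.arr 6 rfl, hf4.arr 6 rfl, hf3.arr 6 rfl, hf2.arr 6 rfl]; exact dis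
      · rw [hf6.arr 10 rfl, hf5.arr 10 rfl]; exact hS4.len
      · rw [hf6.arr 11 rfl, hf5.arr 11 rfl]; exact hS4.ent
      · rw [hf6.arr 14 rfl, hf5.arr 14 rfl, hf4.arr 14 rfl]; exact hT.sg
      · rw [hf6.arr 9 rfl, hf5.arr 9 rfl, hf4.arr 9 rfl]; exact hN.num
      · rw [hf6.arr 12 rfl, hf5.arr 12 rfl, hf4.arr 12 rfl]; exact hN.le
      · rw [hf6.arr 12 rfl, hf5.arr 12 rfl, hf4.arr 12 rfl]; exact hN.sum
    exact time (cons (dpC_spec hB hTr hSt z6) (T₂ := 1) fun s7 h7 _ =>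
      nil ⟨σ, ctr, ℓ, hTr, h7⟩) le_rfl
  · simp only [prepTime]; omega

/-- The start of a computation. -/
structure Start (I : Hy) (s : Store) : Prop extends Input I s where
  arr0 : ∀ a, 2 ≤ a → s.arr a = 0
  reg0 : s.reg 16 = 0

/-- The tables are prepared for the stored colouring. -/
def Prepared (I : Hy) (β : ℕ) (s : Store) : Prop :=
  ∃ σ ctr ℓ, Trie I β (s.arr 2) σ ctr ℓ ∧ Built I (s.arr 2) σ ctr ℓ s

theorem prepC_prepared (hB : Big I β M) (h : Start I s) {s1 s2 : Store} (hC1 : Consts I s1)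
    (hf1 : Fr initC s s1) (hf2 : Fr colorC s1 s2) (hcol : ∀ v < I.n, s2.arr 2 v < I.k) {W : ℕ}
    (hW : ∀ col, ∑ id ∈ rng I.L, (I.mem col id).card ≤ W) :
    Tri M prepC s2 (prepTime I β W) (fun s' => Prepared I β s' ∧ s'.arr 2 = s2.arr 2) := by
  have hp := prepC_spec (col := s2.arr 2) hB (hC1.fr hf2 (by decide)) (fun _ _ => rfl) hcol
    (fun a h1 h2 => ?_) ?_
  · refine hp.fr.conseq ?_ ?_
    · simp only [prepTime]; simp_all
    · rintro s' ⟨⟨σ, ctr, ℓ, h1, h2⟩, hf⟩; have e : s'.arr 2 = s2.arr 2 := hf.arr 2 rfl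
      exact ⟨⟨σ, ctr, ℓ, e ▸ h1, e ▸ h2⟩, e⟩
  · have k1 : colorC.modA a = false := by
      have : (2 : ℕ) ≠ a := by omega
      simp [colorC, forC, blk, Cmd.modA, this]
    have k2 : initC.modA a = false := by
      have h7 : (7 : ℕ) ≠ a := by omega
      have h8 : (8 : ℕ) ≠ a := by omega
      simp [initC, forC, blk, Cmd.modA, h7, h8]
    rw [hf2.arr a k1, hf1.arr a k2, h.arr0 a (by omega)]
  · rw [hf2.reg 16 rfl, hf1.reg 16 rfl, h.reg0]

theorem buildC_spec (hB : Big I β M) (h : Start I s) {W : ℕ}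
    (hW : ∀ col, ∑ id ∈ rng I.L, (I.mem col id).card ≤ W) :
    Tri M buildC s (20 * I.k + 8 * I.n + prepTime I β W + 30) (Prepared I β) := by
  have hk := I.two_le_k; have hidx := hB.idx
  refine time (cons (initC_spec hB h.toInput) fun s1 hC1 hf1 => cons
    (for_const I.n 5 (fun j s' => ∀ v < j, s'.arr 2 v < I.k) (by omega) rfl ?_ (by simp) ?_)
    fun s2 hs2 hf2 => ?_) ?_ (T₁ := (20 * I.k + 20) + ((I.n * (5 + 3) + 3) +
      (prepTime I β W + 1 + 1) + 1) + 1)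
  · intro j s' hf _; rw [ival_reg, hf.reg 2 rfl, hC1.r2]
  · intro j hj s' hf h10 hI; have h0 : s'.reg 0 = I.k := hf.rg hC1.r0
    refine time (cons (Q₁ := fun s'' => s''.reg 11 < I.k) (Tri.rand (by
      rw [ival_reg, h0]; exact hB.k_le) fun x hx => ?_) (T₂ := 3) fun s'' hs'' hf'' => ?_) le_rfl
    · rw [ival_reg, h0] at hx; simp; omega
    · have e10 : s''.reg 10 = j := hf''.rg h10; have e2 : s''.arr 2 = s'.arr 2 := hf''.arr 2 rfl
      have hkM := hB.k_le
      refine stov (j := j) (v := s''.reg 11) (by simp [e10]) rfl (by omega) (nil fun v hv => ?_)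
      simp only [setReg_arr, setArr_arr, if_true]; split_ifs with hc
      · omega
      · rw [e2]; exact hI v (by omega)
  · exact time (cons (prepC_prepared hB h hC1 hf1 hf2 hs2.1 hW) (T₂ := 1) fun s3 h3 _ =>
      nil h3.1) le_rfl
  · omega

/-- The value of a colouring of which the first `j` colours are known, when the colouring `c` has
value `x` and the others have value `y`. -/
noncomputable def colorVal (k n : ℕ) (c : ℕ → ℕ) (x y : ℝ≥0∞) (j : ℕ) (a : ℕ → ℕ) : ℝ≥0∞ :=
  if ∀ v < j, a v = c v then
    x * ((k : ℝ≥0∞) ^ (n - j))⁻¹ + y * (((k ^ (n - j) - 1 : ℕ) : ℝ≥0∞) / (k : ℝ≥0∞) ^ (n - j))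
  else y

/-- The next colour agrees with `c` with probability `1 / k`; after a disagreement the value is `y`
for good. So the value is the average of its successors. -/
theorem colorVal_step {k n : ℕ} (hk : 0 < k) {c : ℕ → ℕ} {x y : ℝ≥0∞} {j : ℕ} (hj : j < n)
    (hc : c j < k) (a : ℕ → ℕ) :
    (∑ i ∈ rng k, colorVal k n c x y (j + 1) (update a j i)) / k ≤
      colorVal k n c x y j a := by
  have hk0 : (k : ℝ≥0∞) ≠ 0 := by exact_mod_cast hk.ne'
  have hkt : (k : ℝ≥0∞) ≠ ⊤ := natCast_ne_top k
  have hagree : ∀ i, (∀ v < j + 1, update a j i v = c v) ↔ (∀ v < j, a v = c v) ∧ i = c j := by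
    grind
  by_cases h : ∀ v < j, a v = c v
  · obtain ⟨d, hd⟩ : ∃ d, n - j = d + 1 := ⟨n - j - 1, by omega⟩
    have hd' : n - (j + 1) = d := by omega
    obtain ⟨N, hN⟩ : ∃ N, N = k ^ d := ⟨_, rfl⟩; have hNpos : 0 < N := hN ▸ Nat.pow_pos hk
    have hN0 : (N : ℝ≥0∞) ≠ 0 := by exact_mod_cast hNpos.ne'
    have hNt : (N : ℝ≥0∞) ≠ ⊤ := natCast_ne_top N
    have hNc : (k : ℝ≥0∞) ^ d = N := by rw [hN]; push_cast; rfl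
    simp only [colorVal, hagree, hd, hd', eq_true h, true_and, if_true, pow_succ, hNc, ← hN]
    obtain ⟨A, hA⟩ : ∃ A, A = x * (N : ℝ≥0∞)⁻¹ + y * (((N - 1 : ℕ) : ℝ≥0∞) / N) := ⟨_, rfl⟩
    have hsum : ∑ i ∈ rng k, (if i = c j then A else y) = A + ((k - 1 : ℕ) : ℝ≥0∞) * y := by
      rw [sum_ite, sum_const, sum_const, Finset.filter_eq' (rng k) (c j),
        if_pos (mem_rng.2 hc), Finset.filter_ne', Finset.card_erase_of_mem
        (mem_rng.2 hc)]
      simp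
    rw [← hA, hsum, hA]; have e1 : x * ((N : ℝ≥0∞) * k)⁻¹ = x * (N : ℝ≥0∞)⁻¹ / k := by
      rw [ENNReal.mul_inv (Or.inl hN0) (Or.inl hNt), div_eq_mul_inv, mul_assoc]
    have e2 : ((N * k - 1 : ℕ) : ℝ≥0∞) / (N * k) =
        (((N - 1 : ℕ) : ℝ≥0∞) / N + ((k - 1 : ℕ) : ℝ≥0∞)) / k := by
      have e3 : N * k - 1 = (N - 1) + (k - 1) * N := by
        obtain ⟨N', rfl⟩ := Nat.exists_eq_add_of_lt hNpos
        obtain ⟨k', rfl⟩ := Nat.exists_eq_add_of_lt hk; grind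
      rw [e3, Nat.cast_add, Nat.cast_mul, ENNReal.add_div, ENNReal.add_div]; congr 1
      · rw [div_eq_mul_inv, div_eq_mul_inv, div_eq_mul_inv,
          ENNReal.mul_inv (Or.inl hN0) (Or.inl hNt), mul_assoc]
      · rw [mul_comm (N : ℝ≥0∞) k, ENNReal.mul_div_mul_right _ _ hN0 hNt]
    refine le_of_eq ?_; rw [e1, e2]; simp only [div_eq_mul_inv, mul_add, add_mul]; ring
  · have : ∀ i, colorVal k n c x y (j + 1) (update a j i) = y := fun i => by
      rw [colorVal, if_neg]; rw [hagree]; tauto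
    simp only [this, sum_const, card_range, nsmul_eq_mul]
    rw [colorVal, if_neg h, mul_comm, ENNReal.mul_div_cancel_right hk0 hkt]

/-- The conditional value, as a function of the number of colours drawn, is a supersolution of the
drawing loop; at stores that cannot occur it is set to `⊤`. -/
theorem ic_colorC {k n : ℕ} (hk : 0 < k) (hkM : k ≤ M) (hnM : n ≤ M) (h0 : s.reg 0 = k)
    (h2 : s.reg 2 = n) {c : ℕ → ℕ} (hc : ∀ v < n, c v < k) {f : Store → ℝ≥0∞} {x y : ℝ≥0∞}
    (hf : ∀ s', Fr colorC s s' → (∀ v < n, s'.arr 2 v < k) →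
      f s' ≤ if ∀ v < n, s'.arr 2 v = c v then x else y) :
    ic M true 0 colorC f s ≤
      x * ((k : ℝ≥0∞) ^ n)⁻¹ + y * (((k ^ n - 1 : ℕ) : ℝ≥0∞) / (k : ℝ≥0∞) ^ n) := by
  classical
  let G : Store → Prop := fun s' => Fr colorC s s' ∧ s'.reg 10 ≤ n ∧
    ∀ v < s'.reg 10, s'.arr 2 v < k
  let X : Store → ℝ≥0∞ := fun s' =>
    if G s' then colorVal k n c x y (s'.reg 10) (s'.arr 2) else ⊤
  have hG0 : G (s.setReg 10 0) := by
    refine ⟨⟨fun z hz => ?_, fun _ _ => rfl⟩, by simp, by simp⟩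
    have : z ≠ 10 := fun h => by subst h; exact absurd hz (by decide)
    simp [this]
  have key := ic_loop_le (M := M) (b := true) (τ := 0) (e := .lt (.reg 10) (rg 2))
    (p := .seq (blk [.rand 11 (rg 0), .store 2 (rg 10) (rg 11)]) (.assign 10 (.reg 10 + 1)))
    (f := f) (X := X) (fun s' => ?_) (s.setReg 10 0)
  · have e : ic M true 0 colorC f s = ic M true 0 (.loop (.lt (.reg 10) (rg 2))
        (.seq (blk [.rand 11 (rg 0), .store 2 (rg 10) (rg 11)]) (.assign 10 (.reg 10 + 1)))) f
        (s.setReg 10 0) := by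
      simp [colorC, forC, ic]
    rw [e]; refine key.trans (le_of_eq ?_); simp only [X, if_pos hG0]; simp [colorVal]
  · by_cases hG : G s'
    · obtain ⟨hfr, hle, hlt⟩ := hG; obtain ⟨j, hj⟩ : ∃ j, j = s'.reg 10 := ⟨_, rfl⟩
      rw [← hj] at hle hlt; have r0 : s'.reg 0 = k := hfr.rg h0; have r2 : s'.reg 2 = n := hfr.rg h2
      have hX : X s' = colorVal k n c x y j (s'.arr 2) := by grind
      rw [hX]; rcases Nat.lt_or_ge j n with hjn | hjn
      · have hcond : (Expr.lt (.reg 10) (rg 2)).ival s' ≠ 0 := by simp [← hj, r2, hjn]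
        rw [if_pos hcond]
        have hX2 : ∀ i < k, X (((s'.setReg 11 i).setArr 2 j i).setReg 10 (j + 1)) =
            colorVal k n c x y (j + 1) (update (s'.arr 2) j i) := by
          intro i hi; have hG' : G (((s'.setReg 11 i).setArr 2 j i).setReg 10 (j + 1)) := by
            refine ⟨⟨fun z hz => ?_, fun z hz => ?_⟩, by simp; omega, fun v hv => ?_⟩
            · have h10 : z ≠ 10 := fun h => by subst h; exact absurd hz (by decide)
              have h11 : z ≠ 11 := fun h => by subst h; exact absurd hz (by decide)
              simp [h10, h11, hfr.reg z hz]
            · have h10 : z ≠ 2 := fun h => by subst h; exact absurd hz (by decide)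
              simp [setArr_arr', h10, hfr.arr z hz]
            · simp only [setReg_reg, if_true] at hv; simp only [setReg_arr, setArr_arr, if_true]
              grind
          simp only [X]; rw [if_pos hG']; simp [setArr_arr']
        have e2 : ic M true 0 (.seq (blk [.rand 11 (rg 0), .store 2 (rg 10) (rg 11)])
            (.assign 10 (.reg 10 + 1))) X s' = (∑ i ∈ rng k,
            X (((s'.setReg 11 i).setArr 2 j i).setReg 10 (j + 1))) / k := by
          simp only [blk, ic, ival_reg, r0, hkM, if_true, zero_add, agg, hk.ne', if_false]; congr 1
          refine sum_congr rfl fun i hi => ?_; have := mem_rng.1 hi; rw [if_pos (by simp; omega)]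
          simp only [setReg_reg, setArr_reg, ival_add, ival_reg, ival_one]; grind
        rw [e2, sum_congr rfl fun i hi => hX2 i (mem_rng.1 hi), zero_add]
        exact colorVal_step hk hjn (hc j hjn) _
      · have hjn' : j = n := by omega
        subst hjn'; have hcond : ¬ (Expr.lt (.reg 10) (rg 2)).ival s' ≠ 0 := by simp [← hj, r2]
        rw [if_neg hcond, zero_add]; refine (hf s' hfr hlt).trans (le_of_eq ?_); simp [colorVal]
    · simp only [X, if_neg hG, le_top]

/-- Drawing the colours is the only random part, and the preparation of the tables does not change
them, so the value is decided once the colouring is drawn. -/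
theorem ic_buildC (hB : Big I β M) (h : Start I s) {c : ℕ → ℕ} (hc : ∀ v < I.n, c v < I.k)
    {f : Store → ℝ≥0∞} {x y : ℝ≥0∞}
    (hf : ∀ s', f s' ≤ if ∀ v < I.n, s'.arr 2 v = c v then x else y) :
    ic M true 0 buildC f s ≤
      x * ((I.k : ℝ≥0∞) ^ I.n)⁻¹ + y * (((I.k ^ I.n - 1 : ℕ) : ℝ≥0∞) / (I.k : ℝ≥0∞) ^ I.n) := by
  have hk := I.two_le_k; have hidx := hB.idx
  have e : ic M true 0 buildC f s = ic M true 0 initC (ic M true 0 colorC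
      (ic M true 0 prepC (ic M true 0 .skip f))) s := by
    simp [buildC, blk, ic]
  rw [e]; have := (initC_spec hB h.toInput).fr true 0 (ic M true 0 colorC
      (ic M true 0 prepC (ic M true 0 .skip f))) (x * ((I.k : ℝ≥0∞) ^ I.n)⁻¹ +
        y * (((I.k ^ I.n - 1 : ℕ) : ℝ≥0∞) / (I.k : ℝ≥0∞) ^ I.n)) ?_
  · simp_all
  rintro s1 ⟨hC1, hf1⟩; refine ic_colorC (by omega) hB.k_le (by omega) hC1.r0 hC1.r2 hc ?_
  -- A crude bound will do, because time has weight `0` here.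
  intro s2 hf2 hlt; have hW : ∀ col, ∑ id ∈ rng I.L, (I.mem col id).card ≤ I.L * (I.n + I.n) := by
    intro col; refine (sum_le_card_nsmul _ _ (I.n + I.n) fun id _ => ?_).trans (by simp)
    classical
    rw [Hy.mem]; split_ifs
    · exact ((List.toFinset_card_le _).trans (Hy.sz_le id)).trans (by omega)
    · simp
    · grind
    · grind
  have := prepC_prepared hB h hC1 hf1 hf2 hlt hW true 0 (ic M true 0 .skip f)
    (if ∀ v < I.n, s2.arr 2 v = c v then x else y) ?_
  · simp_all
  rintro s3 ⟨-, h3⟩; simp only [ic, zero_add]; grind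
end

/-! ## Choosing a neighbour -/

section
variable {M : ℕ} {b : Bool} {τ : ℝ≥0∞} {s : Store}

/-- The unrolled functional is itself a supersolution and hence lies above the least one. -/
theorem ic_loop_fold (e : Expr) (p : Cmd) (f : Store → ℝ≥0∞) (s : Store) :
    ic M b τ (.loop e p) f s ≤
      τ + (if e.ival s ≠ 0 then ic M b τ p (ic M b τ (.loop e p) f) s else f s) := by
  refine ic_loop_le (X := fun s' => τ + (if e.ival s' ≠ 0 then
    ic M b τ p (ic M b τ (.loop e p) f) s' else f s')) (fun s'' => ?_) s
  refine add_le_add_right ?_ τ; split_ifs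
  · exact ic_mono p s'' fun s3 => ic_loop_unfold e p f s3
  · simp

theorem ic_seq (p q : Cmd) (f : Store → ℝ≥0∞) (s : Store) :
    ic M b τ (.seq p q) f s = τ + ic M b τ p (ic M b τ q f) s := rfl

theorem ic_assign {x v : ℕ} {e : Expr} (he : e.ival s = v) (hv : v ≤ M) (f : Store → ℝ≥0∞) :
    ic M b τ (.assign x e) f s = τ + f (s.setReg x v) := by
  subst he; simp [ic, hv]

theorem ic_rand {x Q : ℕ} {e : Expr} (he : e.ival s = Q) (hQ : Q ≤ M) (hQ0 : Q ≠ 0)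
    (f : Store → ℝ≥0∞) : ic M true τ (.rand x e) f s =
      τ + (∑ r ∈ rng Q, f (s.setReg x r)) / Q := by
  subst he; simp [ic, hQ, agg, hQ0]

/-- A loop that is repeated until it succeeds, where the value of the loop is at most `V` whenever
its body is executed. -/
theorem ic_loop_retry {e : Expr} {p : Cmd} {f : Store → ℝ≥0∞} (P : Store → Prop) (V : ℝ≥0∞)
    (h : ∀ s', P s' → e.ival s' ≠ 0 → ∀ g : Store → ℝ≥0∞,
      (∀ s'', P s'' → e.ival s'' ≠ 0 → g s'' ≤ V) →
      (∀ s'', P s'' → e.ival s'' = 0 → g s'' ≤ τ + f s'') → τ + ic M b τ p g s' ≤ V)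
    (hs : P s) (he : e.ival s ≠ 0) : ic M b τ (.loop e p) f s ≤ V := by
  classical
  have := ic_loop_le (M := M) (b := b) (τ := τ) (e := e) (p := p) (f := f)
    (X := fun s' => if P s' then (if e.ival s' ≠ 0 then V else τ + f s') else ⊤) (fun s' => ?_) s
  · simp_all
  · by_cases hP : P s'
    · grind
    · simp [hP]

/-- The value of a loop that succeeds `A` times in `Q` tries. -/
theorem retry_value {c B : ℝ≥0∞} {A Q : ℕ} (hA : A ≠ 0) (hAQ : A ≤ Q) :
    c + (B + ((Q - A : ℕ) : ℝ≥0∞) * ((c * Q + B) / A)) / Q ≤ (c * Q + B) / A := by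
  have hA0 : (A : ℝ≥0∞) ≠ 0 := by exact_mod_cast hA
  have hAt : (A : ℝ≥0∞) ≠ ⊤ := natCast_ne_top A
  have hQ0 : (Q : ℝ≥0∞) ≠ 0 := by exact_mod_cast (show Q ≠ 0 by omega)
  have hQt : (Q : ℝ≥0∞) ≠ ⊤ := natCast_ne_top Q
  -- `V` is the fixed point of one try: `A * V = c * Q + B`, to which `(Q - A) * V` is added before
  -- dividing by `Q`.
  obtain ⟨V, hV⟩ : ∃ V, V = (c * Q + B) / A := ⟨_, rfl⟩; rw [← hV]
  have h1 : A * V = c * Q + B := by rw [hV, ENNReal.mul_div_cancel hA0 hAt]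
  have h2 : V = (A * V + ((Q - A : ℕ) : ℝ≥0∞) * V) / Q := by
    rw [← add_mul, ← Nat.cast_add, Nat.add_sub_cancel' hAQ, mul_comm,
      ENNReal.mul_div_cancel_right hQ0 hQt]
  conv_rhs => rw [h2, h1]
  rw [add_assoc, ENNReal.add_div (c := (Q : ℝ≥0∞)) (a := c * Q),
    ENNReal.mul_div_cancel_right hQ0 hQt]

/-- A number drawn below a total weight is a block together with an offset; this is how weighted
choices are averaged. -/
theorem sum_blocks {A : Type*} [AddCommMonoid A] (w : ℕ → ℕ) (h : ℕ → A) (N : ℕ) :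
    ∑ r ∈ rng (∑ i ∈ rng N, w i), h r =
      ∑ i ∈ rng N, ∑ r ∈ rng (w i), h (∑ j ∈ rng i, w j + r) := by
  induction N with
  | zero => simp
  | succ N ih =>
    rw [sum_range_succ w, Finset.sum_range_add, ih,
      sum_range_succ (fun i => ∑ r ∈ rng (w i), h (∑ j ∈ rng i, w j + r))]

/-- The search for the block of a number. -/
theorem scan_spec {W : Expr} {w : ℕ → ℕ} {X r : ℕ} (hX : X ≤ M)
    (hW : ∀ s', Fr (.loop (1 - .lt (rg 29) W) (blk [.assign 29 (rg 29 - W),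
      .assign 30 (rg 30 + 1)])) s s' → ∀ j ≤ X, s'.reg 30 = j → W.ival s' = w j)
    (hr : r < w X) (h29 : s.reg 29 = ∑ x ∈ rng X, w x + r)
    (hM : ∑ x ∈ rng X, w x + r ≤ M) (h30 : s.reg 30 = 0) :
    Tri M (.loop (1 - .lt (rg 29) W) (blk [.assign 29 (rg 29 - W), .assign 30 (rg 30 + 1)])) s
      (X * 6 + 1) (fun s' => s'.reg 30 = X ∧ s'.reg 29 = r) := by
  have hmono : ∀ j < X, w j + ∑ x ∈ rng j, w x ≤ ∑ x ∈ rng X, w x := by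
    intro j hj; rw [add_comm, ← sum_range_succ]
    exact sum_le_sum_of_subset (range_subset_range.2 hj)
  refine (loop X (fun _ => 5) (fun j s' => s'.reg 30 = j ∧
    s'.reg 29 = ∑ x ∈ rng X, w x + r - ∑ x ∈ rng j, w x) ⟨h30, by simpa using h29⟩
    ?_ ?_).conseq (by simp) ?_
  · rintro j hj s' hf ⟨h1, h2⟩; have := hmono j hj; have hWj := hW s' hf j hj.le h1; refine ⟨?_, ?_⟩
    · simp only [ival_sub, ival_one, ival_lt, ival_reg, h2, hWj]; grind
    refine asgv (v := ∑ x ∈ rng X, w x + r - ∑ x ∈ rng (j + 1), w x) ?_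
      (by omega) (asgv (v := j + 1) (by simp [h1]) (by omega) (nil ⟨by simp, by simp⟩))
    simp only [ival_sub, ival_reg, h2, hWj, sum_range_succ]; omega
  · rintro s' hf ⟨h1, h2⟩; have hWj := hW s' hf X le_rfl h1; simp_all
  · omega

end

section
variable {I : Hy} {col : ℕ → ℕ} {β M : ℕ} {s : Store} {σ : ℕ → Finset ℕ} {ctr : ℕ}
  {ℓ : ℕ → List ℕ}

theorem Built.fr {P : Cmd} {s' : Store} (h : Built I col σ ctr ℓ s) (hf : Fr P s s')
    (hk : keeps P [0, 1, 2, 3, 6, 7, 8]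
      [0, 1, 7, 8, 2, 6, 9, 10, 11, 12, 14, 15, 16, 17, 18, 19, 20, 22, 23, 24, 25, 26] = true) :
    Built I col σ ctr ℓ s' := by
  have hr := fun {x} hx => hf.reg_of hk (x := x) hx
  have ha := fun {x} hx => hf.arr_of hk (x := x) hx
  refine ⟨h.toStatic.congr (fun x hx => hr hx) fun x hx => ha ?_, ?_, ?_, ?_⟩
  · simp only [mem_cons, List.not_mem_nil, or_false] at hx ⊢; omega
  · rw [ha (by simp)]; exact h.cnt
  · rw [ha (by simp)]; exact h.adj
  · intro id hid C hC; obtain ⟨S, q, hS⟩ := h.slot id hid C hC; have e22 := ha (x := 22) (by simp)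
    have e23 := ha (x := 23) (by simp); have e24 := ha (x := 24) (by simp)
    have e25 := ha (x := 25) (by simp); have e26 := ha (x := 26) (by simp)
    exact ⟨S, q, e22 ▸ hS.sum, e23 ▸ hS.a23, e24 ▸ hS.a24, e26 ▸ hS.le, by
      rw [e25, e26]; exact hS.fill, hS.mul_le, hS.S_le⟩

/-- The sampler can be called. -/
structure Ready (I : Hy) (M : ℕ) (col : ℕ → ℕ) (σ : ℕ → Finset ℕ) (ctr : ℕ) (ℓ : ℕ → List ℕ)
    (s : Store) : Prop extends Built I col σ ctr ℓ s where
  -- `SlotOK` controls an entry of array `25` only where the filled part is positive, and the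
  -- colouring is not specified at the artificial vertex `n`. As the sampler copies such cells too,
  -- all of them must be bounded.
  b25 : ∀ i, s.arr 25 i ≤ M
  c2' : s.arr 2 = col
  b2 : ∀ i, col i ≤ M

theorem Ready.fr {P : Cmd} {s' : Store} (h : Ready I M col σ ctr ℓ s) (hf : Fr P s s')
    (hk : keeps P [0, 1, 2, 3, 6, 7, 8]
      [0, 1, 7, 8, 2, 6, 9, 10, 11, 12, 14, 15, 16, 17, 18, 19, 20, 22, 23, 24, 25, 26] = true) :
    Ready I M col σ ctr ℓ s' :=
  ⟨h.toBuilt.fr hf hk, fun i => by rw [hf.arr_of hk (x := 25) (by simp)]; exact h.b25 i,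
    by rw [hf.arr_of hk (x := 2) (by simp)]; exact h.c2', h.b2⟩

theorem Hy.mem_lt {id u : ℕ} (h : u ∈ I.mem col id) : u < I.n := by
  classical
  rw [Hy.mem] at h; split_ifs at h
  · exact Hy.ed_lt (List.mem_toFinset.1 h)
  · simp at h
  · simp_all
  · simp_all

theorem Hy.nb_iff {v u : ℕ} : u ∈ I.Nb col v ↔ ∃ id ∈ I.src v, u ∈ I.mem col id := by
  classical
  simp only [Hy.Nb, mem_filter, mem_rng]
  exact ⟨fun h => h.2, fun ⟨id, h1, h2⟩ => ⟨Hy.mem_lt h2, id, h1, h2⟩⟩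

theorem Hy.length_src_le (hB : Big I β M) (v : ℕ) : (I.src v).length ≤ β + 1 := by
  rw [Hy.length_src]; have := hB.deg v; omega

/-- The list with index `i` at `v`. -/
def Hy.sid (I : Hy) (v i : ℕ) : ℕ := (I.src v).getD i 0

theorem Hy.sid_mem {v i : ℕ} (h : i < (I.src v).length) : I.sid v i ∈ I.src v := by
  rw [Hy.sid, getD_eq_getElem _ _ h]; exact getElem_mem h

open Classical in
/-- The index of the first list at `v` that contains `u`. -/
noncomputable def Hy.fst (I : Hy) (col : ℕ → ℕ) (v u : ℕ) : ℕ :=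
  (I.src v).findIdx fun id => u ∈ I.mem col id

theorem Hy.fst_lt {v u : ℕ} : I.fst col v u < (I.src v).length ↔ u ∈ I.Nb col v := by
  rw [Hy.fst, List.findIdx_lt_length, Hy.nb_iff]; simp

/-- The index of the first list at `v` that contains `u`. -/
theorem first_spec (hB : Big I β M) (hT : Trie I β col σ ctr ℓ) (hs : Static I col σ ctr ℓ s)
    {u v : ℕ} (hv : v ≤ I.n) (h20 : s.reg 20 = u) (h21 : s.reg 21 = v) :
    Tri M firstC s (2 * β + 7) (fun s' => u < I.n → s'.reg 22 = I.fst col v u) := by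
  classical
  have hlen := Hy.length_src_le hB v; have hidx := hB.idx; by_cases hu : u < I.n
  · refine (firstC_spec (p := fun id => u ∈ I.mem col id) hs.src (by omega) (by omega) h20 h21 hs.r7
      hs.r8 fun id hid => ?_).conseq (by omega) fun s' hs' _ => hs'
    have hid' := Hy.src_lt hv hid
    simp only [hs.lists.inc id hid' u hu, ← hT.mem id hid', List.mem_toFinset, decide_eq_true_eq]
    grind
  · refine (firstC_spec (p := fun id => decide (s.arr 17 (u * I.L + id) ≠ 0)) hs.src (by omega)
      (by omega) h20 h21 hs.r7 hs.r8 fun id _ => ?_).conseq (by omega) fun s' hs' h => absurd h hu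
    grind

end

/-- An identity for all natural weights `g` passes to weights in any semiring, since these are
combinations of indicators. -/
theorem sum_transfer {R ι : Type*} [CommSemiring R] {A : Finset ι} {B : Finset ℕ} {a : ι → ℕ}
    {x : ι → ℕ} {c : ℕ → ℕ}
    (h : ∀ g : ℕ → ℕ, ∑ i ∈ A, a i * g (x i) = ∑ u ∈ B, c u * g u) (Y : ℕ → R) :
    ∑ i ∈ A, (a i : R) * Y (x i) = ∑ u ∈ B, (c u : R) * Y u := by
  classical
  have e1 : ∀ t ∈ A.image x ∪ B, Y t = ∑ y ∈ A.image x ∪ B, ((if t = y then 1 else 0 : ℕ) : R) * Y y := by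
    simp_all
  have e2 : ∑ i ∈ A, (a i : R) * Y (x i) = ∑ i ∈ A, (a i : R) *
      ∑ y ∈ A.image x ∪ B, ((if x i = y then 1 else 0 : ℕ) : R) * Y y :=
    sum_congr rfl fun i hi => by grind
  have e3 : ∑ u ∈ B, (c u : R) * Y u = ∑ u ∈ B, (c u : R) *
      ∑ y ∈ A.image x ∪ B, ((if u = y then 1 else 0 : ℕ) : R) * Y y :=
    sum_congr rfl fun u hu => by rw [← e1 u (Finset.mem_union_right _ hu)]
  rw [e2, e3]; simp only [mul_sum]; rw [sum_comm, sum_comm (s := B)]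
  refine sum_congr rfl fun y _ => ?_
  have := congrArg (fun z : ℕ => (z : R) * Y y) (h fun t => if t = y then 1 else 0)
  simp only [Nat.cast_sum, sum_mul] at this; simp_all

/-- A number below `S * q` is a slot with an offset, and slot `i` accepts `fill i` of its offsets.
-/
theorem sum_slots {R : Type*} [CommSemiring R] {S q : ℕ} {fill : ℕ → ℕ} (h : ∀ i < S, fill i ≤ q)
    (P : ℕ → Prop) [DecidablePred P] (y : ℕ → R) :
    ∑ r ∈ rng (S * q), (if r % q < fill (r / q) ∧ P (r / q) then y (r / q) else 0) =
      ∑ i ∈ rng S, (fill i : R) * if P i then y i else 0 := by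
  have := sum_blocks (fun _ => q)
    (fun r => if r % q < fill (r / q) ∧ P (r / q) then y (r / q) else 0) S
  simp only [sum_const, card_range, smul_eq_mul] at this; rw [this]
  refine sum_congr rfl fun i hi => ?_; have hi' := h i (mem_rng.1 hi)
  have e : ∀ r ∈ rng q, (if (i * q + r) % q < fill ((i * q + r) / q) ∧ P ((i * q + r) / q)
      then y ((i * q + r) / q) else 0) = if r < fill i then (if P i then y i else 0) else 0 := by
    intro r hr; have hr' := mem_rng.1 hr; have h1 : (i * q + r) / q = i := by
      rw [mul_comm, Nat.mul_add_div (by omega), div_eq_of_lt hr', add_zero]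
    have h2 : (i * q + r) % q = r := by rw [mul_comm, Nat.mul_add_mod, mod_eq_of_lt hr']
    grind
  rw [sum_congr rfl e, ← sum_filter, sum_const, nsmul_eq_mul]; congr 2
  have : (rng q).filter (· < fill i) = rng (fill i) := by grind
  simp_all

section
variable {I : Hy} {col : ℕ → ℕ} {β M : ℕ} {s : Store} {σ : ℕ → Finset ℕ} {ctr : ℕ}
  {ℓ : ℕ → List ℕ} {v C : ℕ}

theorem Hy.adjCnt_def : I.adjCnt col C v = ∑ u ∈ I.Nb col v, I.cnt col C u := rfl

/-- Assigning each neighbour to the first list that contains it removes the multiplicity of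
neighbours that share several large hyperedges with `v`. -/
theorem sum_first {R : Type*} [AddCommMonoid R] (F : ℕ → R) :
    ∑ i ∈ rng (I.src v).length, ∑ u ∈ I.mem col (I.sid v i),
      (if I.fst col v u = i then F u else 0) = ∑ u ∈ I.Nb col v, F u := by
  classical
  have e : ∀ i ∈ rng (I.src v).length, ∑ u ∈ I.mem col (I.sid v i),
      (if I.fst col v u = i then F u else 0) =
      ∑ u ∈ I.Nb col v, if I.fst col v u = i then F u else 0 := by
    intro i hi; rw [← sum_filter, ← sum_filter]; refine sum_congr ?_ fun _ _ => rfl; ext u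
    simp only [mem_filter, and_congr_left_iff]; rintro rfl; have hi := mem_rng.1 hi
    refine ⟨fun h => Hy.nb_iff.2 ⟨_, Hy.sid_mem hi, h⟩, fun _ => ?_⟩
    have h1 := List.findIdx_getElem (w := hi); rw [Hy.sid, getD_eq_getElem _ _ hi]
    exact of_decide_eq_true h1
  rw [sum_congr rfl e, sum_comm]; refine sum_congr rfl fun u hu => ?_
  rw [Finset.sum_ite_eq, if_pos (mem_rng.2 (Hy.fst_lt.2 hu))]

/-- The cell of a slot. -/
def Hy.cell (I : Hy) (C id i : ℕ) : ℕ := (i * I.L + id) * 2 ^ I.k + C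

/-- The weight of a list. -/
def wt (I : Hy) (v C : ℕ) (s : Store) (i : ℕ) : ℕ := s.arr 24 (I.sid v i * 2 ^ I.k + C)

/-- The capacity of the slots of a list. -/
def cap (I : Hy) (v C : ℕ) (s : Store) (i : ℕ) : ℕ := s.arr 23 (I.sid v i * 2 ^ I.k + C)

/-- The vertex that a number below the weight of a list stands for. -/
def pick (I : Hy) (v C : ℕ) (s : Store) (i r : ℕ) : ℕ :=
  s.arr 25 (I.cell C (I.sid v i) (r / cap I v C s i))

/-- Whether the number is accepted. -/
def Acc (I : Hy) (col : ℕ → ℕ) (v C : ℕ) (s : Store) (i r : ℕ) : Prop :=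
  r % cap I v C s i < s.arr 26 (I.cell C (I.sid v i) (r / cap I v C s i)) ∧
    I.fst col v (pick I v C s i r) = i

theorem Built.slot_src (hR : Built I col σ ctr ℓ s) (hv : v ≤ I.n) (hC : C < 2 ^ I.k) {i : ℕ}
    (hi : i < (I.src v).length) : ∃ S, wt I v C s i = S * cap I v C s i ∧
      SlotOK I col (I.sid v i) C s S (cap I v C s i) := by
  obtain ⟨S, q, h⟩ := hR.slot _ (Hy.src_lt hv (Hy.sid_mem hi)) C hC
  obtain rfl : cap I v C s i = q := h.a23; exact ⟨S, h.a24, h⟩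

open Classical in
-- Among the accepted pairs of a list and a number, each neighbour occurs exactly as often as it has
-- trees, so the accepted choice has the desired law.
theorem sum_acc {R : Type*} [CommSemiring R] (hR : Built I col σ ctr ℓ s) (hv : v ≤ I.n)
    (hC : C < 2 ^ I.k) (Y : ℕ → R) :
    ∑ i ∈ rng (I.src v).length, ∑ r ∈ rng (wt I v C s i),
      (if Acc I col v C s i r then Y (pick I v C s i r) else 0) =
      ∑ u ∈ I.Nb col v, (I.cnt col C u : R) * Y u := by
  rw [← sum_first]; refine sum_congr rfl fun i hi => ?_
  obtain ⟨S, h1, h2⟩ := hR.slot_src hv hC (mem_rng.1 hi); rw [h1]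
  refine Eq.trans (sum_congr rfl fun r _ => ?_) <| (sum_slots h2.le (fun j => I.fst col v (s.arr 25 (I.cell C (I.sid v i) j)) = i)
    fun j => Y (s.arr 25 (I.cell C (I.sid v i) j))).trans ?_
  · exact if_congr Iff.rfl rfl rfl
  · refine (sum_transfer h2.fill fun u => if I.fst col v u = i then Y u else 0).trans ?_; simp

theorem wt_le (hR : Built I col σ ctr ℓ s) (hv : v ≤ I.n) (hC : C < 2 ^ I.k) {i : ℕ}
    (hi : i < (I.src v).length) : wt I v C s i ≤ 2 * I.adjCnt col C v := by
  obtain ⟨S, h1, h2⟩ := hR.slot_src hv hC hi; rw [h1, Hy.adjCnt_def]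
  refine h2.mul_le.trans (Nat.mul_le_mul_left 2 (sum_le_sum_of_subset fun u hu => ?_))
  exact Hy.nb_iff.2 ⟨_, Hy.sid_mem hi, hu⟩

/-- The capacity of a list is at most twice its weight, the weight of a list is at most the
neighbour sum, and there are at most `β + 1` lists. So a try succeeds with probability at least `1 /
(2 * (β + 1))` when there is a tree to choose. -/
theorem sum_wt_le (hB : Big I β M) (hR : Built I col σ ctr ℓ s) (hv : v ≤ I.n) (hC : C < 2 ^ I.k) :
    ∑ i ∈ rng (I.src v).length, wt I v C s i ≤ 2 * (β + 1) * I.adjCnt col C v := by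
  refine (sum_le_card_nsmul _ _ _ fun i hi => wt_le hR hv hC (mem_rng.1 hi)).trans ?_
  rw [card_range, smul_eq_mul, mul_comm 2 (β + 1), mul_assoc]
  exact Nat.mul_le_mul_right _ (Hy.length_src_le hB v)

theorem adjCnt_big (hB : Big I β M) (hC : C < 2 ^ I.k) : 2 * (β + 1) * I.adjCnt col C v ≤ M := by
  classical
  rw [Hy.adjCnt_def]; have := Nat.one_le_two_pow (n := β)
  refine hB.sum_cnt_le (col := col) hC ?_ ((Finset.card_le_card (t := rng I.n) fun u hu => ?_).trans ?_)
  · omega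
  · exact (mem_filter.1 hu).1
  · simp

theorem chooseTailC_spec (hB : Big I β M) (hT : Trie I β col σ ctr ℓ) (hR : Ready I M col σ ctr ℓ s)
    (hv : v ≤ I.n) (hC : C < 2 ^ I.k) (h21 : s.reg 21 = v) (h25 : s.reg 25 = C) {i r : ℕ}
    (hi : i < (I.src v).length) (hr : r < wt I v C s i)
    (h29 : s.reg 29 = ∑ j ∈ rng i, wt I v C s j + r) :
    Tri M chooseTailC s (8 * β + 30) (fun s' => s'.reg 20 = pick I v C s i r ∧
      (s'.reg 28 = 0 ∧ Acc I col v C s i r ∨ s'.reg 28 = 1 ∧ ¬ Acc I col v C s i r)) := by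
  have hidx := hB.idx; have hlen := Hy.length_src_le hB v
  obtain ⟨S, hS1, hS⟩ := hR.slot_src hv hC hi; have hid := Hy.src_lt hv (Hy.sid_mem hi)
  have hadj := adjCnt_big (col := col) (v := v) hB hC; have hL : I.L = I.m + I.n + 1 := rfl
  have hQ : ∑ j ∈ rng i, wt I v C s j + r ≤ M := by
    refine le_trans ?_ ((sum_wt_le hB hR.toBuilt hv hC).trans hadj)
    refine le_trans (Nat.add_le_add_left hr.le _) ?_; rw [← sum_range_succ]
    exact sum_le_sum_of_subset (range_subset_range.2 hi)
  have hlist : ∀ j < (I.src v).length, s.arr 11 (j * (I.n + 1) + v) = I.sid v j := fun j hj =>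
    hR.src.ent v (by omega) j hj
  obtain ⟨q, hq⟩ : ∃ q, q = cap I v C s i := ⟨_, rfl⟩; rw [← hq] at hS1 hS
  have hq0 : 0 < q := by grind
  have hsl : r / q < S := by rw [hS1] at hr; exact Nat.div_lt_of_lt_mul (by rwa [mul_comm])
  have hqM : q ≤ M := by
    have h1 : q ≤ S * q := Nat.le_mul_of_pos_left q ((Nat.zero_le _).trans_lt hsl)
    have h2 := wt_le hR.toBuilt hv hC hi; grind
  have hcell : (r / q * I.L + I.sid v i) * 2 ^ I.k + C ≤ M := by
    refine le_trans ?_ hB.slot; have h1 : r / q * I.L + I.sid v i + 1 ≤ (4 * I.n + 1) * I.L := by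
      have h2 : r / q * I.L ≤ 4 * I.n * I.L := Nat.mul_le_mul_right _ (by have := hS.S_le; omega)
      linarith
    calc _ ≤ (r / q * I.L + I.sid v i) * 2 ^ I.k + 2 ^ I.k := by omega
      _ = (r / q * I.L + I.sid v i + 1) * 2 ^ I.k := by ring
      _ ≤ _ := Nat.mul_le_mul_right _ h1
  have h25M := hR.b25 (I.cell C (I.sid v i) (r / q))
  refine time (asgv (v := 0) rfl (by omega) (cons (scan_spec (w := wt I v C s) (X := i)
    (r := r) (by omega) ?_ hr (by simpa using h29) hQ (by simp)) (T₂ := (2 * β + 7) + 3 + 1 + 2 + 2 + 2 + 2)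
    ?_)) (by omega)
  · intro s' hf j hj h30; have f21 : s'.reg 21 = v := hf.rg h21
    have f25 : s'.reg 25 = C := hf.rg h25; have f7 : s'.reg 7 = I.n + 1 := hf.rg hR.r7
    have f6 : s'.reg 6 = 2 ^ I.k := hf.rg hR.r6; have f11 : s'.arr 11 = s.arr 11 := hf.arr 11 rfl
    have f24 : s'.arr 24 = s.arr 24 := hf.arr 24 rfl
    simp only [weightE, ival_load, ival_add, ival_mul, ival_reg, h30, f21, f25, f7, f6, f11, f24,
      hlist j (by omega), wt]
  · rintro s1 ⟨h30, h29'⟩ hf; have f21 : s1.reg 21 = v := hf.rg h21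
    have f25 : s1.reg 25 = C := hf.rg h25; have f7 : s1.reg 7 = I.n + 1 := hf.rg hR.r7
    have f6 : s1.reg 6 = 2 ^ I.k := hf.rg hR.r6; have f8 : s1.reg 8 = I.L := hf.rg hR.r8
    have f11 : s1.arr 11 = s.arr 11 := hf.arr 11 rfl
    have f23 : s1.arr 23 = s.arr 23 := hf.arr 23 rfl
    have f25' : s1.arr 25 = s.arr 25 := hf.arr 25 rfl
    refine asgv (v := I.sid v i) (by simp [h30, f7, f21, f11, hlist i hi]) (by omega)
      (asgv (v := q) (by simp [f6, f25, f23, hq, cap]) hqM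
      (asgv (v := (r / q * I.L + I.sid v i) * 2 ^ I.k + C) (by simp [h29', f6, f8, f25]) hcell
      (asgv (v := pick I v C s i r) (by simp [f25', pick, Hy.cell, hq]) (by
        rw [pick, ← hq]; exact h25M) ?_)))
    have hR1 : Static I col σ ctr ℓ s1 := (hR.toStatic.congr (s' := s.setReg 30 0) (by simp)
      (by simp)).fr hf (by decide)
    refine time (cons (T₁ := 2 * β + 7) (T₂ := 3) (first_spec hB hT (u := pick I v C s i r) (v := v) (s := (((s1.setReg 31 (I.sid v i)).setReg 32 q).setReg 33
      ((r / q * I.L + I.sid v i) * 2 ^ I.k + C)).setReg 20 (pick I v C s i r)) (hR1.congr (by simp)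
      (by simp)) hv (by simp) (by simp [f21])) fun s2 h22 hf2 => ?_) (by omega)
    have g20 : s2.reg 20 = pick I v C s i r := hf2.rg rfl; have g29 : s2.reg 29 = r := hf2.rg h29'
    have g30 : s2.reg 30 = i := hf2.rg h30; have g32 : s2.reg 32 = q := hf2.rg rfl
    have g33 : s2.reg 33 = I.cell C (I.sid v i) (r / q) := by rw [hf2.reg 33 rfl]; simp [Hy.cell]
    have g26 : s2.arr 26 = s.arr 26 := by rw [hf2.arr 26 rfl]; simp [hf.arr 26 rfl]
    -- A slot that is not empty holds a genuine vertex: the sum identity for slots is applied to the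
    -- indicator of the numbers that are not vertices.
    have hlt : s.arr 26 (I.cell C (I.sid v i) (r / q)) ≠ 0 → pick I v C s i r < I.n := by
      intro h0
      by_contra hc
      have h1 := hS.fill fun u => if u < I.n then 0 else 1
      rw [sum_eq_zero (s := I.mem col (I.sid v i)) fun u hu => by simp [Hy.mem_lt hu],
        Finset.sum_eq_zero_iff] at h1
      have h2 := h1 (r / q) (mem_rng.2 hsl); simp only [pick, ← hq, Hy.cell] at hc h0; simp_all
    have hval : (1 - .lt (rg 29 % rg 32) (ld 26 (rg 33)) * eqE (rg 22) (rg 30) : Expr).ival s2 =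
        1 - (if r % q < s.arr 26 (I.cell C (I.sid v i) (r / q)) then 1 else 0) *
          (if s2.reg 22 = i then 1 else 0) := by
      simp_all
    by_cases hacc : Acc I col v C s i r
    · have h1 := hacc.1; rw [← hq] at h1
      refine asgv (v := 0) ?_ (by omega) (nil ⟨by simpa using g20, Or.inl ⟨by simp, hacc⟩⟩)
      rw [hval, if_pos h1, h22 (hlt (by omega)), if_pos hacc.2]
    · refine asgv (v := 1) ?_ (by omega) (nil ⟨by simpa using g20, Or.inr ⟨by simp, hacc⟩⟩)
      rw [hval]; split_ifs with h1 h2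
      · refine absurd ⟨by rw [← hq]; exact h1, ?_⟩ hacc; omega
      all_goals rfl

end

theorem Fr.setReg {P : Cmd} {x : ℕ} (h : P.modR x = true) (s : Store) (v : ℕ) :
    Fr P s (s.setReg x v) := ⟨fun y hy => by
  have : y ≠ x := fun e => by rw [e, h] at hy; exact absurd hy (by simp)
  simp [this], fun _ _ => rfl⟩

theorem Fr.loop {p : Cmd} {e : Expr} {s s' : Store} (h : Fr p s s') : Fr (.loop e p) s s' :=
  h.of_le (fun _ h => h) fun _ h => h

section
variable {I : Hy} {col : ℕ → ℕ} {β M : ℕ} {s : Store} {σ : ℕ → Finset ℕ} {ctr : ℕ}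
  {ℓ : ℕ → List ℕ} {v C : ℕ} {τ : ℝ≥0∞}

open Classical in
-- The sum over all outcomes of one try: the accepted ones end with the value of the chosen
-- neighbour, the others start again with value `V`.
theorem sum_try (hR : Built I col σ ctr ℓ s) (hv : v ≤ I.n)
    (hC : C < 2 ^ I.k) (Y : ℕ → ℝ≥0∞) (c V : ℝ≥0∞) :
    ∑ i ∈ rng (I.src v).length, ∑ r ∈ rng (wt I v C s i),
      (c + if Acc I col v C s i r then Y (pick I v C s i r) else V) =
      ((∑ i ∈ rng (I.src v).length, wt I v C s i : ℕ) : ℝ≥0∞) * c +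
        (∑ u ∈ I.Nb col v, (I.cnt col C u : ℝ≥0∞) * Y u +
        ((∑ i ∈ rng (I.src v).length, wt I v C s i - I.adjCnt col C v : ℕ) : ℝ≥0∞) * V) := by
  have h1 := sum_acc hR hv hC (fun _ => 1)
  have h2 : ∑ i ∈ rng (I.src v).length, ∑ r ∈ rng (wt I v C s i),
      (if Acc I col v C s i r then 0 else 1) =
      ∑ i ∈ rng (I.src v).length, wt I v C s i - I.adjCnt col C v := by
    simp only [Nat.cast_id, mul_one] at h1; rw [Hy.adjCnt_def, ← h1]; refine Nat.eq_sub_of_add_eq ?_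
    simp only [← sum_add_distrib]; refine sum_congr rfl fun i _ => ?_
    rw [sum_congr rfl (g := fun _ => 1) fun r _ => by split_ifs <;> rfl]
    simp
  rw [← h2, ← sum_acc hR hv hC Y]; push_cast; simp only [sum_mul, ← sum_add_distrib]
  refine sum_congr rfl fun i _ => ?_
  rw [← nsmul_eq_mul, ← card_range (wt I v C s i), ← sum_const, card_range,
    ← sum_add_distrib]
  refine sum_congr rfl fun r _ => ?_; split_ifs <;> simp

theorem adjCnt_le_sum_wt (hR : Built I col σ ctr ℓ s) (hv : v ≤ I.n) (hC : C < 2 ^ I.k) :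
    I.adjCnt col C v ≤ ∑ i ∈ rng (I.src v).length, wt I v C s i := by
  classical
  have h1 := sum_acc hR hv hC (fun _ => 1); simp only [Nat.cast_id, mul_one] at h1
  rw [Hy.adjCnt_def, ← h1]; refine sum_le_sum fun i _ => ?_
  refine (sum_le_card_nsmul _ _ 1 fun r _ => by split_ifs <;> simp).trans (by simp)

/-- A bound for the expected time of the choice of a neighbour. -/
def chooseTime (β : ℕ) : ℕ := 2 * (β + 1) * (8 * β + 35) + 4 * β + 20

/-- With `Q` outcomes of which `A` are accepted, the retry loop has value `(c * Q + B) / A`; the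
second part is the desired average, and `Q ≤ 2 * (β + 1) * A` bounds the time. -/
theorem chooseC_le (hB : Big I β M) (hT : Trie I β col σ ctr ℓ) (hR : Ready I M col σ ctr ℓ s)
    (hv : v ≤ I.n) (hC : C < 2 ^ I.k) (h21 : s.reg 21 = v) (h25 : s.reg 25 = C)
    (h0 : I.adjCnt col C v ≠ 0) {f : Store → ℝ≥0∞} {Y : ℕ → ℝ≥0∞}
    (hf : ∀ s', ∀ u ∈ I.Nb col v, Fr chooseC s s' → s'.reg 20 = u → f s' ≤ Y u) :
    ic M true τ chooseC f s ≤ τ * chooseTime β +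
      (∑ u ∈ I.Nb col v, (I.cnt col C u : ℝ≥0∞) * Y u) / I.adjCnt col C v := by
  classical
  have hidx := hB.idx; have hlen := Hy.length_src_le hB v
  have hadj := adjCnt_big (col := col) (v := v) hB hC; have hQA := sum_wt_le hB hR.toBuilt hv hC
  have hAQ := adjCnt_le_sum_wt hR.toBuilt hv hC
  obtain ⟨Q, hQ⟩ : ∃ Q, Q = ∑ i ∈ rng (I.src v).length, wt I v C s i := ⟨_, rfl⟩
  rw [← hQ] at hQA hAQ
  obtain ⟨B, hBB⟩ : ∃ B, B = ∑ u ∈ I.Nb col v, (I.cnt col C u : ℝ≥0∞) * Y u := ⟨_, rfl⟩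
  have hA0 : (I.adjCnt col C v : ℝ≥0∞) ≠ 0 := by exact_mod_cast h0
  have hAt := natCast_ne_top (I.adjCnt col C v)
  have hQ0 : (Q : ℝ≥0∞) ≠ 0 := by exact_mod_cast (show Q ≠ 0 by omega)
  have hQt := natCast_ne_top Q; obtain ⟨c, hc⟩ : ∃ c, c = τ * ((8 * β + 35 : ℕ) : ℝ≥0∞) := ⟨_, rfl⟩
  obtain ⟨V, hV⟩ : ∃ V, V = (c * Q + B) / I.adjCnt col C v := ⟨_, rfl⟩
  have hVle : V ≤ τ * ((2 * (β + 1) * (8 * β + 35) : ℕ) : ℝ≥0∞) + B / I.adjCnt col C v := by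
    rw [hV, ENNReal.add_div]; refine add_le_add_left (ENNReal.div_le_of_le_mul ?_) _
    have : (Q : ℝ≥0∞) ≤ ((2 * (β + 1) : ℕ) : ℝ≥0∞) * I.adjCnt col C v := by exact_mod_cast hQA
    refine (mul_le_mul_right this c).trans (le_of_eq ?_); rw [hc]; push_cast; ring
  have hfor : Tri M (forC 27 (ld 10 (rg 21)) (.assign 26 (rg 26 + weightE (rg 27)))) (s.setReg 26 0)
      ((I.src v).length * (1 + 3) + 3) (fun s' => s'.reg 26 = Q) := by
    refine (for_const (I.src v).length 1 (fun j s' => s'.reg 26 = ∑ i ∈ rng j,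
      wt I v C s i) (by omega) rfl ?_ (by simp) ?_).conseq le_rfl fun s' hs' => hs'.1.trans hQ.symm
    · intro j s' hfr _; have f21 : s'.reg 21 = v := hfr.rg h21
      have f10 : s'.arr 10 = s.arr 10 := hfr.arr 10 rfl; simp [f21, f10, hR.src.len v (by omega)]
    · intro j hj s' hfr h27 h26; have f21 : s'.reg 21 = v := hfr.rg h21
      have f25 : s'.reg 25 = C := hfr.rg h25; have f7 : s'.reg 7 = I.n + 1 := hfr.rg hR.r7
      have f6 : s'.reg 6 = 2 ^ I.k := hfr.rg hR.r6
      have f11 : s'.arr 11 = s.arr 11 := hfr.arr 11 rfl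
      have f24 : s'.arr 24 = s.arr 24 := hfr.arr 24 rfl
      have hval : (rg 26 + weightE (rg 27) : Expr).ival s' =
          ∑ i ∈ rng (j + 1), wt I v C s i := by
        simp only [weightE, ival_load, ival_add, ival_mul, ival_reg, h27, f21, f25, f7, f6, f11, f24,
          hR.src.ent v (by omega) j hj, h26, sum_range_succ, wt, Hy.sid]
      have hle : ∑ i ∈ rng (j + 1), wt I v C s i ≤ Q := by
        rw [hQ]; exact sum_le_sum_of_subset (range_subset_range.2 hj)
      refine assign (by omega) ?_; simp_all
  have hloop : ∀ s1, Fr chooseC s s1 → s1.reg 26 = Q → s1.reg 28 = 1 →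
      ic M true τ (.loop (rg 28) (.seq (.rand 29 (rg 26)) chooseTailC)) (fun s' => τ + f s') s1 ≤ V := by
    intro s1 hf1 h26 h28
    refine ic_loop_retry (fun s' => Fr chooseC s s' ∧ s'.reg 26 = Q) V ?_ ⟨hf1, h26⟩ (by simp [h28])
    rintro s2 ⟨hf2, g26⟩ - g hg1 hg0; have hQM : Q ≤ M := by omega
    rw [ic_seq, ic_rand (by rw [ival_reg, g26]) hQM (by omega)]
    have hr : ∀ i ∈ rng (I.src v).length, ∀ r ∈ rng (wt I v C s i),
        ic M true τ chooseTailC g (s2.setReg 29 (∑ j ∈ rng i, wt I v C s j + r)) ≤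
        τ * ((8 * β + 32 : ℕ) : ℝ≥0∞) + if Acc I col v C s i r then Y (pick I v C s i r) else V := by
      intro i hi r hr; rw [mem_rng] at hi hr
      have hf3 : Fr chooseC s (s2.setReg 29 (∑ j ∈ rng i, wt I v C s j + r)) :=
        hf2.trans (Fr.setReg rfl _ _)
      have e21 := hf3.reg 21 rfl; have e25 := hf3.reg 25 rfl; have e24 := hf3.arr 24 rfl
      have e23 := hf3.arr 23 rfl; have e25' := hf3.arr 25 rfl; have e26' := hf3.arr 26 rfl
      have hsp := chooseTailC_spec (i := i) (r := r) hB hT (hR.fr hf3 (by decide)) hv hC (by rw [e21, h21])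
        (by rw [e25, h25]) hi (by rw [wt, e24]; exact hr) (by simp [wt, hf2.arr 24 rfl])
      have hpick : pick I v C (s2.setReg 29 (∑ j ∈ rng i, wt I v C s j + r)) i r =
          pick I v C s i r := by
        simp only [pick, cap, e25', e23]
      have hacc : Acc I col v C (s2.setReg 29 (∑ j ∈ rng i, wt I v C s j + r)) i r ↔
          Acc I col v C s i r := by
        simp only [Acc, hpick, cap, e26', e23]
      rw [hpick, hacc] at hsp
      refine (hsp.fr true τ g (τ + τ + if Acc I col v C s i r then Y (pick I v C s i r) else V)
        ?_).trans (le_of_eq (by push_cast; ring))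
      rintro s3 ⟨⟨h20, h28⟩, hf4⟩
      have hfr : Fr chooseC s s3 := hf3.trans hf4.right.loop.left.right.right.right
      have h26 : s3.reg 26 = Q := hf4.rg g26; rcases h28 with ⟨h28, ha⟩ | ⟨h28, ha⟩
      · refine (hg0 s3 ⟨hfr, h26⟩ (by simp [h28])).trans ?_; rw [if_pos ha, add_assoc]
        refine add_le_add_right (add_le_add_right (hf s3 _ (Hy.fst_lt.1 ?_) hfr h20) τ) τ
        rw [ha.2]; exact hi
      · rw [if_neg ha]; exact (hg1 s3 ⟨hfr, h26⟩ (by simp [h28])).trans le_add_self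
    have hsum : ∑ r ∈ rng Q, ic M true τ chooseTailC g (s2.setReg 29 r) ≤
        Q * (τ * ((8 * β + 32 : ℕ) : ℝ≥0∞)) + (B + ((Q - I.adjCnt col C v : ℕ) : ℝ≥0∞) * V) := by
      have := sum_try hR.toBuilt hv hC Y (τ * ((8 * β + 32 : ℕ) : ℝ≥0∞)) V; rw [← hQ, ← hBB] at this
      rw [← this]
      nth_rw 1 [hQ]
      rw [sum_blocks]; exact sum_le_sum fun i hi => sum_le_sum fun r hr' => hr i hi r hr'
    have hret := retry_value (c := c) (B := B) h0 hAQ; rw [← hV] at hret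
    refine le_trans (add_le_add_right (add_le_add_right (add_le_add_right
      (div_le_div_right hsum _) τ) τ) τ) (le_trans (le_of_eq ?_) hret)
    rw [ENNReal.add_div, mul_comm (Q : ℝ≥0∞), ENNReal.mul_div_cancel_right hQ0 hQt, hc]; grind
  have hstart : Fr chooseC s (s.setReg 26 0) := Fr.setReg rfl _ _
  rw [chooseC, blk, ic_seq, ic_assign (v := 0) rfl (Nat.zero_le _), blk, ic_seq]
  have hmain := hfor.fr true τ (ic M true τ (blk [.assign 28 1,
      .loop (rg 28) (.seq (.rand 29 (rg 26)) chooseTailC)]) f) (τ * 3 + V) ?_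
  · refine (add_le_add_right (add_le_add_right (add_le_add_right hmain τ) τ) τ).trans ?_
    have hl : τ * (((I.src v).length * (1 + 3) + 3 : ℕ) : ℝ≥0∞) ≤ τ * ((4 * β + 7 : ℕ) : ℝ≥0∞) :=
      mul_le_mul_right (by exact_mod_cast (by omega)) τ
    refine (add_le_add_right (add_le_add_right (add_le_add_right (add_le_add hl
      (add_le_add_right hVle _)) τ) τ) τ).trans ?_
    rw [← hBB, chooseTime]; have : τ + (τ + (τ + (τ * ((4 * β + 7 : ℕ) : ℝ≥0∞) + (τ * 3 +
        (τ * ((2 * (β + 1) * (8 * β + 35) : ℕ) : ℝ≥0∞) + B / I.adjCnt col C v))))) =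
        τ * ((2 * (β + 1) * (8 * β + 35) + 4 * β + 13 : ℕ) : ℝ≥0∞) + B / I.adjCnt col C v := by
      grind
    rw [this]; exact add_le_add_left (mul_le_mul_right (by exact_mod_cast (by omega)) τ) _
  · rintro s1 ⟨h26, hf1⟩; rw [blk, ic_seq, ic_assign (v := 1) rfl (by omega), blk, ic_seq]
    refine (add_le_add_right (add_le_add_right (add_le_add_right (hloop _ ((hstart.trans
      hf1.left.right).trans (Fr.setReg rfl _ _)) (by simpa using h26) (by simp)) τ) τ) τ).trans
      (le_of_eq ?_)
    ring

end

/-! ## The sampled trees -/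

/-- A record for each colour: a vertex, two colour sets and a colour. -/
abbrev Rec : Type := ℕ → ℕ × ℕ × ℕ × ℕ

/-- The records of a tree without that of its root. -/
def rest (col : ℕ → ℕ) : BT → Rec → Rec
  | .leaf _, ρ => ρ
  | .node a b, ρ => rest col b (update (rest col a ρ) (col b.root)
      (b.root, a.mask col, b.mask col, col a.root))

/-- The records of a tree that is attached to `v`. -/
def place (col : ℕ → ℕ) (v X C : ℕ) (t : BT) (ρ : Rec) : Rec :=
  rest col t (update ρ (col t.root) (t.root, X, C, col v))

variable (I : Hy) (col : ℕ → ℕ) in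
noncomputable def Hy.TS (C u : ℕ) : Finset BT := HyperMotivo.TS I.n col (I.Nb col) C u

variable (I : Hy) (col : ℕ → ℕ) in
/-- The average over the trees with root `u`. -/
noncomputable def exT (C u : ℕ) (K : Rec → ℝ≥0∞) (ρ : Rec) : ℝ≥0∞ :=
  (∑ t ∈ I.TS col C u, K (rest col t ρ)) / I.cnt col C u

variable (I : Hy) (col : ℕ → ℕ) in
/-- The average over the trees attached to `v`. -/
noncomputable def exA (v X C : ℕ) (K : Rec → ℝ≥0∞) (ρ : Rec) : ℝ≥0∞ :=
  (∑ u ∈ I.Nb col v, ∑ t ∈ I.TS col C u, K (place col v X C t ρ)) / I.adjCnt col C v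

variable (I : Hy) (col : ℕ → ℕ) in
/-- The average over the trees for the items of a stack. -/
noncomputable def exL (F : Rec → ℝ≥0∞) : List (ℕ × ℕ × ℕ) → Rec → ℝ≥0∞
  | [], ρ => F ρ
  | (v, X, C) :: L, ρ => exA I col v X C (exL F L) ρ

section
variable {I : Hy} {col : ℕ → ℕ} {u v C X : ℕ} {K : Rec → ℝ≥0∞} {ρ : Rec}

theorem cnt_mul_exT : (I.cnt col C u : ℝ≥0∞) * exT I col C u K ρ =
    ∑ t ∈ I.TS col C u, K (rest col t ρ) := by
  by_cases h : I.cnt col C u = 0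
  · have h1 : I.TS col C u = ∅ := card_eq_zero.1 h; simp_all
  · exact ENNReal.mul_div_cancel (by exact_mod_cast h) (natCast_ne_top _)

theorem adjCnt_mul_exA : (I.adjCnt col C v : ℝ≥0∞) * exA I col v X C K ρ =
    ∑ u ∈ I.Nb col v, ∑ t ∈ I.TS col C u, K (place col v X C t ρ) := by
  by_cases h : I.adjCnt col C v = 0
  · rw [h, Nat.cast_zero, zero_mul]; refine (sum_eq_zero fun u hu => ?_).symm
    have h1 : I.TS col C u = ∅ := card_eq_zero.1 (Finset.sum_eq_zero_iff.1 (Hy.adjCnt_def ▸ h) u hu)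
    simp [h1]
  · exact ENNReal.mul_div_cancel (by exact_mod_cast h) (natCast_ne_top _)

/-- A uniform attached tree arises by choosing its root in proportion to the number of trees there,
and then a uniform tree with this root. -/
theorem exA_eq : (∑ u ∈ I.Nb col v, (I.cnt col C u : ℝ≥0∞) *
    exT I col C u K (update ρ (col u) (u, X, C, col v))) / I.adjCnt col C v =
    exA I col v X C K ρ := by
  rw [exA]; congr 1; refine sum_congr rfl fun u _ => ?_; rw [cnt_mul_exT]
  refine sum_congr rfl fun t ht => ?_; rw [place, (mem_TS.1 ht).2.2]

theorem exT_leaf (hu : u < I.n) : exT I col (2 ^ col u) u K ρ = K ρ := by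
  have h : I.TS col (2 ^ col u) u = {.leaf u} := by
    ext t; rw [Finset.mem_singleton]; refine ⟨fun ht => ?_, fun ht => ht ▸ mem_TS.2 ⟨hu, rfl, rfl⟩⟩
    obtain ⟨h1, h2, h3⟩ := mem_TS.1 ht
    cases t with
    | leaf u' => rw [show u' = u from h3]
    | node a b =>
      have h4 := Nat.ge_two_pow_of_testBit h1.1.col_root; have h5 := mask_pos (col := col) b
      rw [show a.root = u from h3] at h4; simp only [BT.mask] at h2; omega
  have h' : I.cnt col (2 ^ col u) u = 1 := by change (I.TS col (2 ^ col u) u).card = 1; simp_all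
  rw [exT, h, h', Finset.sum_singleton, rest, Nat.cast_one, div_one]

variable (I col) in
/-- The number of trees with root `u` and colours `C` that split into `X` and `C - X`. -/
noncomputable def Hy.spl (C u X : ℕ) : ℕ :=
  if SplitOK (col u) C X then I.cnt col X u * I.adjCnt col (C - X) u else 0

theorem cnt_eq_sum_spl (hu : u < I.n) (hC : C ≠ 2 ^ col u) :
    I.cnt col C u = ∑ X ∈ rng C, I.spl col C u X := by
  have := cnt_rec (col := col) (Nb := I.Nb col) C u hu; rw [if_neg hC, zero_add] at this; exact this

/-- A uniform tree arises by choosing the split in proportion to the number of trees it allows, and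
then independent uniform trees for the two parts. -/
theorem exT_split (hu : u < I.n) (hC : C ≠ 2 ^ col u) :
    (∑ X ∈ rng C, (I.spl col C u X : ℝ≥0∞) * exT I col X u (exA I col u X (C - X) K) ρ) /
      I.cnt col C u = exT I col C u K ρ := by
  rw [exT, Hy.TS, sum_TS C u hu, if_neg hC, zero_add]; congr 1; refine sum_congr rfl fun X _ => ?_
  simp only [Hy.spl]; split_ifs with h
  · rw [Nat.cast_mul, mul_right_comm, cnt_mul_exT, mul_comm, mul_sum]
    refine sum_congr rfl fun a ha => ?_; rw [adjCnt_mul_exA]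
    refine sum_congr rfl fun v _ => sum_congr rfl fun b hb => ?_
    rw [rest, place, (mem_TS.1 ha).2.1, (mem_TS.1 ha).2.2, (mem_TS.1 hb).2.1]
  · simp

end

/-! ## Splitting a tree -/

/-- The lowest `j` items of the stack. -/
def stk (s : Store) : ℕ → List (ℕ × ℕ × ℕ)
  | 0 => []
  | j + 1 => (s.arr 31 j, s.arr 32 j, s.arr 33 j) :: stk s j

theorem length_stk (s : Store) (j : ℕ) : (stk s j).length = j := by
  induction j with
  | zero => rfl
  | succ j ih => simp [stk, ih]

theorem stk_congr {s s' : Store} : ∀ {j : ℕ}, (∀ a, 31 ≤ a → a ≤ 33 → ∀ i < j, s'.arr a i = s.arr a i) →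
    stk s' j = stk s j
  | 0, _ => rfl
  | j + 1, h => by
    rw [stk, stk, stk_congr fun a h1 h2 i hi => h a h1 h2 i (by omega),
      h 31 (by omega) (by omega) j (by omega), h 32 (by omega) (by omega) j (by omega),
      h 33 (by omega) (by omega) j (by omega)]

/-- The stack. -/
def stack (s : Store) : List (ℕ × ℕ × ℕ) := stk s (s.reg 24)

/-- The records. -/
def recs (s : Store) : Rec := fun x => (s.arr 27 x, s.arr 28 x, s.arr 29 x, s.arr 30 x)

/-- The total of the colour sets of the items. -/
def total (L : List (ℕ × ℕ × ℕ)) : ℕ := (L.map fun it => it.2.2).sum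

/-- A time bound for the items of a stack. -/
def cost (A D : ℕ) (L : List (ℕ × ℕ × ℕ)) : ℕ := (L.map fun it => D * (it.2.2 - 1) + A).sum + 1

/-- The items have trees. -/
def Items (I : Hy) (col : ℕ → ℕ) (L : List (ℕ × ℕ × ℕ)) : Prop :=
  ∀ it ∈ L, it.1 ≤ I.n ∧ it.2.1 < 2 ^ I.k ∧ it.2.2 < 2 ^ I.k ∧ I.adjCnt col it.2.2 it.1 ≠ 0

section
variable {I : Hy} {col : ℕ → ℕ} {β M : ℕ} {s : Store} {σ : ℕ → Finset ℕ} {ctr : ℕ}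
  {ℓ : ℕ → List ℕ} {u C X : ℕ} {τ : ℝ≥0∞}

theorem Hy.adjCnt_zero (v : ℕ) : I.adjCnt col 0 v = 0 := by
  rw [Hy.adjCnt_def]; exact sum_eq_zero fun u _ => Hy.cnt_zero u

/-- Every item has a nonempty colour set. This keeps the stack pointer below `2 ^ k`. -/
theorem Items.length_le {L : List (ℕ × ℕ × ℕ)} (h : Items I col L) : L.length ≤ total L := by
  induction L with
  | nil => simp
  | cons it L ih =>
    have h1 := ih fun it' h' => h it' (List.mem_cons_of_mem _ h')
    have h2 : it.2.2 ≠ 0 := fun h0 => (h it (by simp)).2.2.2 (by rw [h0, Hy.adjCnt_zero])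
    simp only [List.length_cons, total, List.map_cons, List.sum_cons] at h1 ⊢; omega

theorem splitTailC_spec (hB : Big I β M) (hR : Ready I M col σ ctr ℓ s) (hu : u < I.n)
    (hC : C < 2 ^ I.k) (hk : col u < I.k) (hX : X < C) {r : ℕ} (hr : r < I.spl col C u X)
    (h20 : s.reg 20 = u) (h25 : s.reg 25 = C) (h34 : s.reg 34 = col u)
    (h24 : s.reg 24 < 2 ^ I.k) (hM : I.cnt col C u = ∑ X ∈ rng C, I.spl col C u X)
    (h29 : s.reg 29 = ∑ x ∈ rng X, I.spl col C u x + r) :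
    Tri M splitTailC s (6 * 2 ^ I.k + 20) (fun s' => stack s' = (u, X, C - X) :: stack s ∧
      s'.reg 25 = X) := by
  have hidx := hB.idx; have hK := hB.two_pow
  have hcM := hB.cnt_le (col := col) hC (t := 1) (by grind) u
  have hle : ∑ x ∈ rng X, I.spl col C u x + r ≤ M := by
    have : ∑ x ∈ rng (X + 1), I.spl col C u x ≤ I.cnt col C u := by
      rw [hM]; exact sum_le_sum_of_subset (range_subset_range.2 hX)
    rw [sum_range_succ] at this; omega
  refine time (asgv (v := 0) rfl (by omega) (cons (scan_spec (w := I.spl col C u) (X := X)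
    (r := r) (by omega) ?_ hr (by simpa using h29) hle (by simp)) (T₂ := 11) ?_)) (by omega)
  · intro s' hf j hj h30
    have hR' := (hR.toStatic.congr (s' := s.setReg 30 0) (by simp) (by simp)).fr hf (by decide)
    refine ival_splitE hR' (by rw [ival_reg, hf.reg 20 rfl]; simpa using h20)
      (by rw [ival_reg, hf.reg 25 rfl]; simpa using h25) h30
      (by rw [ival_reg, hf.reg 34 rfl]; simpa using h34) hk hC (by omega) ?_ fun h0 => ?_
    · rw [hf.arr 19 rfl]; exact hR.cnt u hu j (by omega)
    · rw [hf.arr 20 rfl]; exact hR.adj u hu _ (by omega)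
  · rintro s1 ⟨h30, -⟩ hf; have f20 : s1.reg 20 = u := hf.rg h20
    have f25 : s1.reg 25 = C := hf.rg h25; have f24 : s1.reg 24 = s.reg 24 := hf.rg rfl
    refine stov (j := s.reg 24) (v := u) (by simp [f24]) (by simp [f20]) (by omega)
      (stov (j := s.reg 24) (v := X) (by simp [f24]) (by simp [h30]) (by omega)
      (stov (j := s.reg 24) (v := C - X) (by simp [f24]) (by simp [f25, h30]) (by omega)
      (asgv (v := s.reg 24 + 1) (by simp [f24]) (by omega) (asgv (v := X) (by simp [h30])
      (by omega) (nil ⟨?_, by simp⟩)))))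
    simp only [stack, setReg_reg, Nat.reduceEqDiff, if_true, if_false, stk, setReg_arr, setArr_arr]
    congr 1; refine stk_congr fun a h1 h2 i hi => ?_; have e : s1.arr a = s.arr a := by
      have : a = 31 ∨ a = 32 ∨ a = 33 := by omega
      rcases this with rfl | rfl | rfl
      · rw [hf.arr 31 rfl]; rfl
      · rw [hf.arr 32 rfl]; rfl
      · rw [hf.arr 33 rfl]; rfl
    simp only [setReg_arr, setArr_arr, if_neg (show i ≠ s.reg 24 by omega), ite_self, e]

/-- The masks themselves, as numbers, serve as a potential: splitting `C` into `X` and `C - X`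
lowers the sum of the masks minus one by `1`. This releases `D`, which pays for the split and for
the amount `A` of the new item. -/
theorem expandC_le (hB : Big I β M) (hT : Trie I β col σ ctr ℓ) {A D : ℕ} (hD : 6 * 2 ^ I.k + 23 + A ≤ D)
    (hu : u < I.n) {F : Rec → ℝ≥0∞} {f : Store → ℝ≥0∞} {ρ : Rec} {N : ℕ} (hN : N < 2 ^ I.k)
    (hf : ∀ s', Ready I M col σ ctr ℓ s' → recs s' = ρ → Items I col (stack s') →
      total (stack s') + 2 ^ col u = N →
      f s' ≤ τ * cost A D (stack s') + exL I col F (stack s') ρ) (C : ℕ) :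
    ∀ {s : Store}, Ready I M col σ ctr ℓ s → recs s = ρ → Items I col (stack s) →
      total (stack s) + C = N → I.cnt col C u ≠ 0 →
      s.reg 20 = u → s.reg 25 = C → s.reg 34 = col u →
      ic M true τ expandC f s ≤ τ * ((cost A D (stack s) + D * (C - 1) + 1 : ℕ) : ℝ≥0∞) +
        exT I col C u (exL I col F (stack s)) ρ := by
  have hk := hT.col_lt u hu
  induction C using Nat.strong_induction_on with
  | _ C ih =>
    intro s hR hρ hI htot hc h20 h25 h34; have hbit : C.testBit (col u) := by
      by_contra h
      exact hc (cnt_eq_zero (by simpa using h))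
    have hge := Nat.ge_two_pow_of_testBit hbit; have hpos := two_pow_pos (col u)
    have hcond : (rg 25 - ld 7 (rg 34) : Expr).ival s = C - 2 ^ col u := by
      simp [h25, h34, hR.a7 _ hk]
    refine (ic_loop_fold _ _ f s).trans ?_; rw [hcond]; by_cases hC : C = 2 ^ col u
    · rw [if_neg (by omega)]; refine (add_le_add_right (hf s hR hρ hI (by omega)) τ).trans ?_
      rw [hC, exT_leaf hu, ← add_assoc]; refine add_le_add_left ?_ _; rw [← mul_one_add]
      exact mul_le_mul_right (by exact_mod_cast (by omega)) τ
    · rw [if_pos (by omega)]; have hsum := cnt_eq_sum_spl (col := col) hu hC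
      have hcM := hB.cnt_le (col := col) (show C < 2 ^ I.k by omega) (t := 1) (by grind) u
      rw [one_mul] at hcM; obtain ⟨Q, hQ⟩ : ∃ Q, Q = I.cnt col C u := ⟨_, rfl⟩
      have hQ0 : (Q : ℝ≥0∞) ≠ 0 := by exact_mod_cast hQ ▸ hc
      have hQt := natCast_ne_top Q; rw [← hQ] at hcM
      rw [ic_seq, ic_rand (Q := Q) (by simp [h20, h25, hR.r6, hR.cnt u hu C (by omega), hQ]) hcM
        (hQ ▸ hc)]
      obtain ⟨c, hcc⟩ : ∃ c, c = τ * ((6 * 2 ^ I.k + 20 + (cost A D (stack s) + D * (C - 2) + A + 1) : ℕ) : ℝ≥0∞) :=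
        ⟨_, rfl⟩
      have hr : ∀ X ∈ rng C, ∀ r ∈ rng (I.spl col C u X),
          ic M true τ splitTailC (ic M true τ expandC f)
            (s.setReg 29 (∑ x ∈ rng X, I.spl col C u x + r)) ≤
          c + exT I col X u (exA I col u X (C - X) (exL I col F (stack s))) ρ := by
        intro X hX r hr; rw [mem_rng] at hX hr; have hw0 : I.spl col C u X ≠ 0 := by omega
        rw [Hy.spl] at hw0; have hw : I.cnt col X u ≠ 0 ∧ I.adjCnt col (C - X) u ≠ 0 := by simp_all
        have hX0 : X ≠ 0 := fun h => hw.1 (by rw [h, Hy.cnt_zero]); have hlen := hI.length_le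
        rw [stack, length_stk] at hlen
        have hRs := hR.fr (Fr.setReg (P := .rand 29 0) (x := 29) rfl s
          (∑ x ∈ rng X, I.spl col C u x + r)) (by decide)
        have hst : stack (s.setReg 29 (∑ x ∈ rng X, I.spl col C u x + r)) = stack s := by
          simp only [stack, setReg_reg, Nat.reduceEqDiff, if_false]
          exact stk_congr fun _ _ _ _ _ => rfl
        refine ((splitTailC_spec hB hRs hu (show C < 2 ^ I.k by omega) hk hX hr (by simpa using h20)
          (by simpa using h25) (by simpa using h34) (by simp; rw [stack] at htot; omega) hsum
          (by simp)).fr true τ _ (τ * ((cost A D (stack s) + D * (C - 2) + A + 1 : ℕ) : ℝ≥0∞) +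
            exT I col X u (exA I col u X (C - X) (exL I col F (stack s))) ρ) ?_).trans (le_of_eq ?_)
        · rintro s1 ⟨⟨h1, h2⟩, hf1⟩; rw [hst] at h1; have e : recs s1 = ρ := by
            rw [← hρ]; funext x
            simp only [recs, hf1.arr 27 rfl, hf1.arr 28 rfl, hf1.arr 29 rfl, hf1.arr 30 rfl, setReg_arr]
          refine (ih X hX (hRs.fr hf1 (by decide)) e ?_ ?_ hw.1 ?_ h2 ?_).trans ?_
          · rw [h1]; intro it hit; rcases mem_cons.1 hit with rfl | hit
            · grind
            · exact hI it hit
          · rw [h1]; simp only [total, List.map_cons, List.sum_cons] at htot ⊢; omega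
          · rw [hf1.reg 20 rfl]; simpa using h20
          · rw [hf1.reg 34 rfl]; simpa using h34
          · rw [h1]; refine add_le_add_left (mul_le_mul_right (Nat.cast_le.2 ?_) τ) _
            simp only [cost, List.map_cons, List.sum_cons]
            obtain ⟨X', rfl⟩ := Nat.exists_eq_succ_of_ne_zero hX0
            obtain ⟨Y, hY⟩ : ∃ Y, C = X' + Y + 2 := ⟨C - X' - 2, by omega⟩; subst hY; grind
        · rw [hcc]; push_cast; ring
      have hsum2 : ∑ r ∈ rng Q, ic M true τ splitTailC (ic M true τ expandC f) (s.setReg 29 r) ≤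
          Q * c + Q * exT I col C u (exL I col F (stack s)) ρ := by
        nth_rw 1 [hQ]
        rw [hsum, sum_blocks]
        refine (sum_le_sum fun X hX => sum_le_sum fun r hr' => hr X hX r hr').trans ?_
        simp only [sum_const, card_range, nsmul_eq_mul, mul_add, sum_add_distrib]
        refine add_le_add (le_of_eq ?_) (le_of_eq ?_)
        · rw [← sum_mul, ← Nat.cast_sum, ← hsum, hQ]
        · rw [← exT_split hu hC, ← hQ, ENNReal.mul_div_cancel hQ0 hQt]
      refine (add_le_add_right (add_le_add_right (add_le_add_right
        (div_le_div_right hsum2 _) τ) τ) τ).trans ?_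
      rw [← mul_add, mul_comm, ENNReal.mul_div_cancel_right hQ0 hQt, hcc]; simp only [← add_assoc]
      refine add_le_add_left ?_ _; have : C - 1 = C - 2 + 1 := by omega
      rw [this]
      calc _ = τ * ((6 * 2 ^ I.k + 23 + A + cost A D (stack s) + D * (C - 2) + 1 : ℕ) : ℝ≥0∞) := by
            grind
        _ ≤ _ := mul_le_mul_right (Nat.cast_le.2 (by rw [Nat.mul_add]; omega)) τ

end

/-! ## Growing a tree -/

section
variable {I : Hy} {col : ℕ → ℕ} {β M : ℕ} {s : Store} {σ : ℕ → Finset ℕ} {ctr : ℕ}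
  {ℓ : ℕ → List ℕ} {u v C X : ℕ} {τ : ℝ≥0∞}

theorem recs_congr {s s' : Store} (h : ∀ a, 27 ≤ a → a ≤ 30 → s'.arr a = s.arr a) :
    recs s' = recs s := by
  funext x
  simp only [recs, h 27 (by omega) (by omega), h 28 (by omega) (by omega), h 29 (by omega) (by omega),
    h 30 (by omega) (by omega)]

theorem popC_spec {h : ℕ} (h24 : s.reg 24 = h + 1) (hh : h ≤ M)
    (h31 : s.arr 31 h ≤ M) (h32 : s.arr 32 h ≤ M) (h33 : s.arr 33 h ≤ M) :
    Tri M popC s 9 (fun s' => stack s' = stk s h ∧ s'.reg 21 = s.arr 31 h ∧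
      s'.reg 35 = s.arr 32 h ∧ s'.reg 25 = s.arr 33 h) := by
  refine asgv (v := h) (by simp [h24]) hh (asgv (v := s.arr 31 h) (by simp) h31
    (asgv (v := s.arr 32 h) (by simp) h32 (asgv (v := s.arr 33 h) (by simp) h33
    (nil ⟨?_, by simp, by simp, by simp⟩))))
  simp only [stack, setReg_reg, Nat.reduceEqDiff, if_true, if_false]
  exact stk_congr fun _ _ _ _ _ => rfl

theorem recordC_spec (hB : Big I β M) (hR : Ready I M col σ ctr ℓ s)
    (hu : u < I.n) (h20 : s.reg 20 = u) (h21 : s.reg 21 = v) (h25 : s.reg 25 = C)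
    (h35 : s.reg 35 = X) (hX : X ≤ M) (hC : C ≤ M) :
    Tri M recordC s 11 (fun s' => recs s' = update (recs s) (col u) (u, X, C, col v) ∧
      s'.reg 34 = col u) := by
  have hidx := hB.idx; have h2 := hR.c2'
  refine asgv (v := col u) (by simp [h20, h2]) (hR.b2 u) (stov (j := col u) (v := u) (by simp)
    (by simp [h20]) (by omega) (stov (j := col u) (v := X) (by simp) (by simp [h35]) hX
    (stov (j := col u) (v := C) (by simp) (by simp [h25]) hC (stov (j := col u) (v := col v)
    (by simp) (by simp [h21, h2, setArr_arr']) (hR.b2 v) (nil ⟨?_, by simp⟩)))))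
  funext x; by_cases hx : x = col u
  · subst hx; simp [recs, setArr_arr]
  · simp [recs, setArr_arr, hx]

/-- Induction on the sum of the masks on the stack: an item is replaced by the parts below its root
`u`, whose masks add up to `2 ^ col u` less. The remaining items stand for independent uniform
trees, and `exL` averages over them one after the other. -/
theorem growLoop_le (hB : Big I β M) (hT : Trie I β col σ ctr ℓ) {A D : ℕ}
    (hA : chooseTime β + 26 ≤ A) (hD : 6 * 2 ^ I.k + 23 + A ≤ D) {F : Rec → ℝ≥0∞}
    {f : Store → ℝ≥0∞} (hf : ∀ s', Ready I M col σ ctr ℓ s' → f s' ≤ F (recs s')) (N : ℕ) :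
    ∀ {s : Store}, Ready I M col σ ctr ℓ s → Items I col (stack s) → total (stack s) = N →
      N < 2 ^ I.k →
      ic M true τ (.loop (rg 24) (.seq popC (.seq chooseC (.seq recordC expandC)))) f s ≤
        τ * cost A D (stack s) + exL I col F (stack s) (recs s) := by
  have hidx := hB.idx; have hK := hB.two_pow
  induction N using Nat.strong_induction_on with
  | _ N ih =>
    intro s hR hI hN hNk; refine (ic_loop_fold _ _ f s).trans ?_; rw [ival_reg]
    obtain h0 | ⟨h, h24⟩ : s.reg 24 = 0 ∨ ∃ h, s.reg 24 = h + 1 := by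
      cases s.reg 24 <;> simp
    · rw [if_neg (by omega)]; have hst : stack s = [] := by rw [stack, h0]; rfl
      rw [hst]; simpa [cost, exL] using add_le_add_right (hf s hR) τ
    · rw [if_pos (by omega)]; obtain ⟨v, hv⟩ : ∃ v, v = s.arr 31 h := ⟨_, rfl⟩
      obtain ⟨X, hX⟩ : ∃ X, X = s.arr 32 h := ⟨_, rfl⟩
      obtain ⟨C, hC⟩ : ∃ C, C = s.arr 33 h := ⟨_, rfl⟩
      obtain ⟨L, hL⟩ : ∃ L, L = stk s h := ⟨_, rfl⟩
      have hst : stack s = (v, X, C) :: L := by rw [stack, h24, hv, hX, hC, hL]; rfl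
      have hlen := hI.length_le; rw [stack, length_stk] at hlen; rw [stack] at hN
      obtain ⟨hvn, hXk, hCk, hadj⟩ := hI (v, X, C) (by simp [hst]); dsimp only at hvn hXk hCk hadj
      have hIL : Items I col L := fun it hit => hI it (by simp [hst, hit])
      have htot : C + total L = N := by rw [← hN, ← stack, hst]; simp [total]
      have hA0 : (I.adjCnt col C v : ℝ≥0∞) ≠ 0 := by exact_mod_cast hadj
      have hAt := natCast_ne_top (I.adjCnt col C v); rw [ic_seq]
      obtain ⟨E, hE⟩ : ∃ E, E = cost A D L + D * (C - 1) + 14 := ⟨_, rfl⟩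
      have hpop := (popC_spec (M := M) h24 (by omega) (hv ▸ by omega) (hX ▸ by omega)
        (hC ▸ by omega)).fr true τ (ic M true τ (.seq chooseC (.seq recordC expandC))
          (ic M true τ (.loop (rg 24) (.seq popC (.seq chooseC (.seq recordC expandC)))) f))
        (τ * ((chooseTime β + E + 1 : ℕ) : ℝ≥0∞) + exA I col v X C (exL I col F L) (recs s)) ?_
      · refine (add_le_add_right (add_le_add_right hpop τ) τ).trans ?_
        rw [hst, exL, ← add_assoc, ← add_assoc, ← add_assoc]; refine add_le_add_left ?_ _
        calc _ = τ * ((chooseTime β + E + 12 : ℕ) : ℝ≥0∞) := by push_cast; ring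
          _ ≤ _ := mul_le_mul_right (Nat.cast_le.2 ?_) τ
        simp only [hE, cost, List.map_cons, List.sum_cons]; omega
      rintro s1 ⟨⟨g1, g21, g35, g25⟩, hf1⟩; rw [← hL] at g1; rw [← hv] at g21; rw [← hX] at g35
      rw [← hC] at g25; have hR1 := hR.fr hf1 (by decide)
      have hrec1 : recs s1 = recs s := recs_congr fun a h1 h2 => hf1.arr a (by
        interval_cases a <;> rfl)
      rw [ic_seq]; have hch := chooseC_le (τ := τ) (v := v) (C := C) hB hT hR1 hvn hCk g21 g25 hadj
        (f := ic M true τ (.seq recordC expandC) (ic M true τ (.loop (rg 24)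
          (.seq popC (.seq chooseC (.seq recordC expandC)))) f))
        -- A neighbour without trees has weight `0`, so the value `⊤` there does no harm and frees
        -- the case from proof.
        (Y := fun u => if I.cnt col C u = 0 then ⊤ else τ * (E : ℝ≥0∞) +
          exT I col C u (exL I col F L) (update (recs s) (col u) (u, X, C, col v))) ?_
      · refine (add_le_add_right hch τ).trans (le_of_eq ?_)
        have : ∀ u ∈ I.Nb col v, (I.cnt col C u : ℝ≥0∞) * (if I.cnt col C u = 0 then ⊤ else
            τ * (E : ℝ≥0∞) + exT I col C u (exL I col F L)
              (update (recs s) (col u) (u, X, C, col v))) =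
            (I.cnt col C u : ℝ≥0∞) * (τ * E) + (I.cnt col C u : ℝ≥0∞) *
              exT I col C u (exL I col F L) (update (recs s) (col u) (u, X, C, col v)) := by
          intro u _; split_ifs with h0
          · simp [h0]
          · grind
        rw [sum_congr rfl this, sum_add_distrib, ← sum_mul, ← Nat.cast_sum,
          ← Hy.adjCnt_def, ENNReal.add_div, exA_eq, mul_comm (I.adjCnt col C v : ℝ≥0∞),
          ENNReal.mul_div_cancel_right hA0 hAt]
        grind
      intro s2 u hu hf2 h20; have hun : u < I.n := by
        obtain ⟨id, -, h⟩ := Hy.nb_iff.1 hu; exact Hy.mem_lt h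
      have hR2 := hR1.fr hf2 (by decide); split_ifs with hcu
      · simp
      rw [ic_seq]; have hrec2 : recs s2 = recs s := by
        rw [← hrec1]; exact recs_congr fun a h1 h2 => hf2.arr a (by interval_cases a <;> rfl)
      have hst2 : stack s2 = L := by
        rw [← g1, stack, stack, hf2.reg 24 rfl]
        exact stk_congr fun a h1 h2 i _ => by rw [hf2.arr a (by interval_cases a <;> rfl)]
      have hrcd := (recordC_spec (u := u) (v := v) (X := X) (C := C) hB hR2 hun h20
        (hf2.rg g21) (hf2.rg g25) (hf2.rg g35)
        (by omega) (by omega)).fr true τ (ic M true τ expandC (ic M true τ (.loop (rg 24)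
          (.seq popC (.seq chooseC (.seq recordC expandC)))) f))
        (τ * ((cost A D L + D * (C - 1) + 1 : ℕ) : ℝ≥0∞) + exT I col C u (exL I col F L)
          (update (recs s) (col u) (u, X, C, col v))) ?_
      · refine (add_le_add_right hrcd τ).trans ?_; rw [← add_assoc, ← add_assoc]
        refine add_le_add_left ?_ _
        calc _ = τ * ((cost A D L + D * (C - 1) + 13 : ℕ) : ℝ≥0∞) := by push_cast; ring
          _ ≤ _ := mul_le_mul_right (Nat.cast_le.2 (by omega)) τ
      rintro s3 ⟨⟨k1, k34⟩, hf3⟩; have hst3 : stack s3 = L := by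
        rw [← hst2, stack, stack, hf3.reg 24 rfl]
        exact stk_congr fun a h1 h2 i _ => by rw [hf3.arr a (by interval_cases a <;> rfl)]
      rw [hrec2] at k1
      have := expandC_le (τ := τ) (A := A) (D := D) (N := N) (F := F) hB hT hD hun hNk
        (f := ic M true τ (.loop (rg 24) (.seq popC (.seq chooseC (.seq recordC expandC)))) f)
        (fun s' h1 h2 h3 h4 => ?_) C (hR2.fr hf3 (by decide)) k1 (by rw [hst3]; exact hIL)
        (by rw [hst3]; omega) hcu (hf3.rg h20)
        (hf3.rg (hf2.rg g25)) k34
      · simp_all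
      · grind

/-- A bound for the expected time for growing a tree. -/
def growTime (k β : ℕ) : ℕ := (chooseTime β + 6 * 2 ^ k + 60) * 2 ^ k

/-- The whole tree is an item like any other: a tree with all colours, attached to the artificial
vertex `n`. -/
theorem growC_le (hB : Big I β M) (hT : Trie I β col σ ctr ℓ) (hR : Ready I M col σ ctr ℓ s)
    (h0 : I.adjCnt col (2 ^ I.k - 1) I.n ≠ 0) {F : Rec → ℝ≥0∞} {f : Store → ℝ≥0∞}
    (hf : ∀ s', Ready I M col σ ctr ℓ s' → f s' ≤ F (recs s')) :
    ic M true τ growC f s ≤ τ * growTime I.k β +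
      exA I col I.n 0 (2 ^ I.k - 1) F (recs s) := by
  have hidx := hB.idx; have hK := hB.two_pow; have hk := I.two_le_k; have h4 : 4 ≤ 2 ^ I.k := by
    calc 4 = 2 ^ 2 := rfl
      _ ≤ _ := pow_le_pow_right (by omega) hk
  have hst : Tri M startC s 9 (fun s' => stack s' = [(I.n, 0, 2 ^ I.k - 1)]) := by
    refine asgv (v := 1) rfl (by omega) (stov (j := 0) (v := I.n) rfl (by simp [hR.r2]) (by omega)
      (stov (j := 0) (v := 0) rfl rfl (by omega) (stov (j := 0) (v := 2 ^ I.k - 1) rfl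
      (by simp [hR.r6]) (by omega) (nil ?_))))
    simp [stack, stk, setArr_arr]
  rw [growC, ic_seq]
  refine (add_le_add_right (hst.fr true τ _ (τ * ((cost (chooseTime β + 26) (chooseTime β + 26 +
    6 * 2 ^ I.k + 23) [(I.n, 0, 2 ^ I.k - 1)] : ℕ) : ℝ≥0∞) + exA I col I.n 0 (2 ^ I.k - 1) F (recs s))
    ?_) τ).trans ?_
  · rintro s1 ⟨h1, hf1⟩
    have := growLoop_le (τ := τ) hB hT le_rfl (by omega) hf (total (stack s1)) (A := chooseTime β + 26)
      (D := chooseTime β + 26 + 6 * 2 ^ I.k + 23) (hR.fr hf1 (by decide)) ?_ rfl ?_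
    · rwa [h1, recs_congr fun a h1 h2 => hf1.arr a (by interval_cases a <;> rfl)] at this
    · rw [h1]; intro it hit; simp_all
    · rw [h1]; simp [total]
  · rw [← add_assoc, ← add_assoc]; refine add_le_add_left ?_ _
    refine le_trans (le_of_eq (b := τ * ((10 + cost (chooseTime β + 26) (chooseTime β + 26 +
      6 * 2 ^ I.k + 23) [(I.n, 0, 2 ^ I.k - 1)] : ℕ) : ℝ≥0∞)) (by push_cast; ring))
      (mul_le_mul_right (Nat.cast_le.2 ?_) τ)
    simp only [cost, growTime, List.map_cons, List.map_nil, List.sum_cons, List.sum_nil]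
    obtain ⟨K, hKK⟩ : ∃ K, 2 ^ I.k = K + 4 := ⟨2 ^ I.k - 4, by omega⟩; rw [hKK]; grind
end

/-! ## Testing whether a tree is canonical -/

section
variable {n : ℕ} {col : ℕ → ℕ} {Nb : ℕ → Finset ℕ} {ρ ρ' : Rec}

/-- The records describe the attached trees. -/
def Recorded (col : ℕ → ℕ) (ρ : Rec) : BT → Prop
  | .leaf _ => True
  | .node a b => Recorded col ρ a ∧ Recorded col ρ b ∧
      ρ (col b.root) = (b.root, a.mask col, b.mask col, col a.root)

theorem Recorded.congr {t : BT} (h : Recorded col ρ t) (he : ∀ u ∈ t.leaves, ρ' (col u) = ρ (col u)) :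
    Recorded col ρ' t := by
  induction t with
  | leaf u => trivial
  | node a b iha ihb =>
    simp only [BT.leaves, mem_append] at he
    refine ⟨iha h.1 fun u hu => he u (Or.inl hu), ihb h.2.1 fun u hu => he u (Or.inr hu), ?_⟩
    rw [he _ (Or.inr b.root_mem), h.2.2]

theorem Valid.col_ne {a b : BT} (h : Valid n col Nb (.node a b)) {u v : ℕ} (hu : u ∈ a.leaves)
    (hv : v ∈ b.leaves) : col u ≠ col v := fun e =>
  land_eq_zero_iff.1 h.2.2.2.1 (col u) ((h.1.testBit _).2 ⟨u, hu, rfl⟩)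
    ((h.2.1.testBit _).2 ⟨v, hv, e.symm⟩)

theorem rest_of_notMem {t : BT} (h : Valid n col Nb t) : ∀ {ρ : Rec} {x : ℕ},
    (x = col t.root ∨ ∀ u ∈ t.leaves, col u ≠ x) → rest col t ρ x = ρ x := by
  induction t with
  | leaf u => intros; rfl
  | node a b iha ihb =>
    intro ρ x hx; have hb : ∀ u ∈ b.leaves, col u ≠ x := by
      rcases hx with rfl | hx
      · exact fun u hu e => h.col_ne a.root_mem hu e.symm
      · exact fun u hu => hx u (by simp [BT.leaves, hu])
    rw [rest, ihb h.2.1 (Or.inr hb), update_of_ne (hb _ b.root_mem).symm]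
    refine iha h.1 (hx.imp_right fun hx u hu => hx u (by simp [BT.leaves, hu]))

/-- The two parts have disjoint colours, so the records of one are not overwritten by those of the
other. -/
theorem rest_spec {t : BT} (h : Valid n col Nb t) : ∀ {ρ : Rec}, Recorded col (rest col t ρ) t ∧
    ∀ u ∈ t.leaves, u ≠ t.root → (rest col t ρ (col u)).1 = u := by
  induction t with
  | leaf u => exact ⟨trivial, fun v hv hne => absurd (by simpa [BT.leaves, BT.root] using hv) hne⟩
  | node a b iha ihb =>
    intro ρ
    have ha : ∀ u ∈ a.leaves, rest col (.node a b) ρ (col u) = rest col a ρ (col u) := fun u hu => by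
      rw [rest, rest_of_notMem h.2.1 (Or.inr fun v hv => (h.col_ne hu hv).symm),
        update_of_ne (h.col_ne hu b.root_mem)]
    have hr : rest col (.node a b) ρ (col b.root) = (b.root, a.mask col, b.mask col, col a.root) := by
      rw [rest, rest_of_notMem h.2.1 (Or.inl rfl), update_self]
    refine ⟨⟨(iha h.1).1.congr ha, (ihb h.2.1).1, hr⟩, fun u hu hne => ?_⟩
    rcases mem_append.1 hu with hu | hu
    · rw [ha u hu]; exact (iha h.1).2 u hu hne
    · by_cases hub : u = b.root
      · simp_all
      · exact (ihb h.2.1).2 u hu hub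

theorem place_spec {t : BT} (h : Valid n col Nb t) {v X C : ℕ} :
    Recorded col (place col v X C t ρ) t ∧ (∀ u ∈ t.leaves, (place col v X C t ρ (col u)).1 = u) ∧
      place col v X C t ρ (col t.root) = (t.root, X, C, col v) := by
  have h1 : place col v X C t ρ (col t.root) = (t.root, X, C, col v) := by
    rw [place, rest_of_notMem h (Or.inl rfl), update_self]
  refine ⟨(rest_spec h).1, fun u hu => ?_, h1⟩; by_cases hr : u = t.root
  · rw [hr, h1]
  · exact (rest_spec h).2 u hu hr

/-- The test that belongs to the colour `z`. -/
def Pass (Nb : ℕ → Finset ℕ) (ρ : Rec) (z : ℕ) : Prop :=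
  ∀ x y, (ρ z).2.1.testBit x → (ρ z).2.2.1.testBit y → (ρ x).1 ∈ Nb (ρ y).1 →
    x = (ρ z).2.2.2 ∧ z ≤ y

/-- Each vertex other than the root is the root of exactly one attached part, so the conditions at
the inner nodes are indexed by the colours of these vertices. -/
theorem canon_iff {t : BT} (h : Valid n col Nb t) (hr : Recorded col ρ t)
    (hg : ∀ u ∈ t.leaves, (ρ (col u)).1 = u) :
    Canon col Nb t ↔ ∀ u ∈ t.leaves, u ≠ t.root → Pass Nb ρ (col u) := by
  induction t with
  | leaf u => exact ⟨fun _ v hv hne => absurd (by simpa [BT.leaves, BT.root] using hv) hne, fun _ => trivial⟩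
  | node a b iha ihb =>
    have hga : ∀ u ∈ a.leaves, (ρ (col u)).1 = u := fun u hu => hg u (by simp [BT.leaves, hu])
    have hgb : ∀ u ∈ b.leaves, (ρ (col u)).1 = u := fun u hu => hg u (by simp [BT.leaves, hu])
    have hp : Pass Nb ρ (col b.root) ↔ ∀ x ∈ a.verts, ∀ y ∈ b.verts, x ∈ Nb y →
        x = a.root ∧ col b.root ≤ col y := by
      simp only [Pass, hr.2.2, mem_verts]; constructor
      · intro H x hx y hy hxy
        have := H (col x) (col y) ((h.1.testBit _).2 ⟨x, hx, rfl⟩) ((h.2.1.testBit _).2 ⟨y, hy, rfl⟩)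
          (by rwa [hga x hx, hgb y hy])
        exact ⟨h.1.inj hx a.root_mem this.1, this.2⟩
      · intro H x y hx hy hxy; obtain ⟨u, hu, rfl⟩ := (h.1.testBit _).1 hx
        obtain ⟨v, hv, rfl⟩ := (h.2.1.testBit _).1 hy; grind
    rw [Canon, ← hp, iha h.1 hr.1 hga, ihb h.2.1 hr.2.1 hgb]
    have hab : ∀ u ∈ b.leaves, u ≠ a.root := fun u hu e => h.col_ne a.root_mem hu (e ▸ rfl)
    constructor
    · rintro ⟨h1, h2, h3⟩ u hu hne; rcases mem_append.1 hu with hu | hu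
      · exact h1 u hu hne
      · grind
    · intro H; exact ⟨fun u hu => H u (List.mem_append_left _ hu),
        fun u hu _ => H u (List.mem_append_right _ hu) (hab u hu),
        H _ (List.mem_append_right _ b.root_mem) (hab _ b.root_mem)⟩

end

section
variable {I : Hy} {col : ℕ → ℕ} {β M : ℕ} {s : Store} {σ : ℕ → Finset ℕ} {ctr : ℕ}
  {ℓ : ℕ → List ℕ} {u v C X : ℕ} {τ : ℝ≥0∞}

/-- The colours `z`, `x`, `y` violate the test. -/
def Bad (I : Hy) (col : ℕ → ℕ) (ρ : Rec) (z x y : ℕ) : Prop :=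
  (ρ z).2.1.testBit x ∧ (ρ z).2.2.1.testBit y ∧ (ρ x).1 ∈ I.Nb col (ρ y).1 ∧
    ¬ (x = (ρ z).2.2.2 ∧ z ≤ y)

theorem div_mod_two (X i : ℕ) : X / 2 ^ i % 2 = if X.testBit i then 1 else 0 := by grind

theorem checkC_spec (hB : Big I β M) (hT : Trie I β col σ ctr ℓ) (hR : Ready I M col σ ctr ℓ s)
    (hg : ∀ x < I.k, (recs s x).1 < I.n) :
    Tri M checkC s (I.k * I.k * I.k * (2 * β + 26) + 8) (fun s' => s'.reg 36 ≤ 1 ∧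
      (s'.reg 36 = 1 ↔ ∃ z < I.k, ∃ x < I.k, ∃ y < I.k, Bad I col (recs s) z x y)) := by
  classical
  have hidx := hB.idx; have hk := I.two_le_k; have hk3 := hB.k3
  let B : ℕ → Prop := fun t => Bad I col (recs s) (t / (I.k * I.k)) (t / I.k % I.k) (t % I.k)
  have hBB : (∃ t < I.k * I.k * I.k, B t) ↔
      ∃ z < I.k, ∃ x < I.k, ∃ y < I.k, Bad I col (recs s) z x y := by
    constructor
    · rintro ⟨t, ht, hb⟩
      exact ⟨_, Nat.div_lt_of_lt_mul ht, _, mod_lt _ (by omega), _, mod_lt _ (by omega), hb⟩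
    · rintro ⟨z, hz, x, hx, y, hy, hb⟩
      have e1 : (z * I.k + x) * I.k + y = (I.k * I.k) * z + (x * I.k + y) := by ring
      have h1 : x * I.k + y < I.k * I.k := by
        have : (x + 1) * I.k ≤ I.k * I.k := Nat.mul_le_mul_right _ hx; linarith
      have d1 : ((z * I.k + x) * I.k + y) / (I.k * I.k) = z := by
        rw [e1, Nat.mul_add_div (by positivity), div_eq_of_lt h1, add_zero]
      have d2 : ((z * I.k + x) * I.k + y) / I.k = z * I.k + x := by
        rw [mul_comm _ I.k, Nat.mul_add_div (by omega), div_eq_of_lt hy, add_zero]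
      have d3 : (z * I.k + x) % I.k = x := by rw [mul_comm, Nat.mul_add_mod, mod_eq_of_lt hx]
      have d4 : ((z * I.k + x) * I.k + y) % I.k = y := by
        rw [mul_comm _ I.k, Nat.mul_add_mod, mod_eq_of_lt hy]
      refine ⟨(z * I.k + x) * I.k + y, ?_, ?_⟩
      · rw [e1]; have : I.k * I.k * (z + 1) ≤ I.k * I.k * I.k := Nat.mul_le_mul_left _ hz; linarith
      · grind
  refine (asgv (v := 0) rfl (by omega) (cons (for_const (I.k * I.k * I.k) (2 * β + 23)
    (fun j s' => s'.reg 36 ≤ 1 ∧ (s'.reg 36 = 1 ↔ ∃ t < j, B t)) hk3 rfl ?_ (by simp) ?_) (T₂ := 1)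
    fun s' hs' _ => nil hs'.1)).conseq
    (by simp only [Nat.add_assoc, Nat.reduceAdd]; omega) fun s' hs' => ⟨hs'.1, hs'.2.trans hBB⟩
  · intro j s' hf _; have f0 : s'.reg 0 = I.k := hf.rg hR.r0; simp [f0]
  · rintro j hj s1 hf1 h37 ⟨h36, hiff⟩
    have hR0 : Static I col σ ctr ℓ (s.setReg 36 0) := hR.toStatic.congr (by simp) (by simp)
    have hR1 := hR0.fr hf1 (by decide); obtain ⟨z, hz⟩ : ∃ z, z = j / (I.k * I.k) := ⟨_, rfl⟩
    obtain ⟨x, hx⟩ : ∃ x, x = j / I.k % I.k := ⟨_, rfl⟩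
    obtain ⟨y, hy⟩ : ∃ y, y = j % I.k := ⟨_, rfl⟩
    have hzk : z < I.k := hz ▸ Nat.div_lt_of_lt_mul hj
    have hxk : x < I.k := hx ▸ mod_lt _ (by omega); have hyk : y < I.k := hy ▸ mod_lt _ (by omega)
    have hkM := hB.k_le; have hgx : s.arr 27 x < I.n := hg x hxk
    have hgy : s.arr 27 y < I.n := hg y hyk; have g27 : s1.arr 27 = s.arr 27 := hf1.arr 27 rfl
    refine time (asgv (v := z) (by simp [h37, hR1.r0, hz]) (by omega) (asgv (v := x)
      (by simp [h37, hR1.r0, hx]) (by omega) (asgv (v := y) (by simp [h37, hR1.r0, hy]) (by omega)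
      (asgv (v := s.arr 27 x) (by simp [g27]) (by omega) (asgv (v := s.arr 27 y)
      (by simp [g27]) (by omega) ?_)))))
      (T₁ := (2 * β + 7) + 4 + 1 + 2 + 2 + 2 + 2 + 2) (by omega)
    refine time (cons (T₁ := 2 * β + 7) (T₂ := 4) (first_spec hB hT (u := s.arr 27 x)
      (v := s.arr 27 y) (s := ((((s1.setReg 38 z).setReg 39 x).setReg 40 y).setReg 20
      (s.arr 27 x)).setReg 21 (s.arr 27 y)) (hR1.congr (by simp) (by simp)) hgy.le (by simp) (by simp))
      fun s2 h22 hf2 => ?_) (by omega)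
    have hR2 := (hR1.congr (s' := ((((s1.setReg 38 z).setReg 39 x).setReg 40 y).setReg 20
      (s.arr 27 x)).setReg 21 (s.arr 27 y)) (by simp) (by simp)).fr hf2 (by decide)
    have k38 : s2.reg 38 = z := hf2.rg rfl; have k39 : s2.reg 39 = x := hf2.rg rfl
    have k40 : s2.reg 40 = y := hf2.rg rfl; have k21 : s2.reg 21 = s.arr 27 y := hf2.rg rfl
    have k36 : s2.reg 36 = s1.reg 36 := hf2.rg rfl
    have k28 : s2.arr 28 = s.arr 28 := hf2.ar (hf1.arr 28 rfl)
    have k29 : s2.arr 29 = s.arr 29 := hf2.ar (hf1.arr 29 rfl)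
    have k30 : s2.arr 30 = s.arr 30 := hf2.ar (hf1.arr 30 rfl)
    have hval : ((ld 28 (rg 38) / ld 7 (rg 39) % 2) * (ld 29 (rg 38) / ld 7 (rg 40) % 2) *
        .lt (rg 22) (ld 10 (rg 21)) *
        (1 - eqE (rg 39) (ld 30 (rg 38)) * .lt (rg 38) (rg 40 + 1)) : Expr).ival s2 =
        if B j then 1 else 0 := by
      simp only [ival_mul, ival_mod, ival_div, ival_load, ival_reg, ival_lt, ival_sub, ival_one,
        ival_eqE, ival_add, k38, k39, k40, k21, k28, k29, k30, hR2.a7 x hxk, hR2.a7 y hyk,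
        h22 hgx, hR2.src.len _ (show s.arr 27 y < I.n + 1 by omega), Hy.fst_lt]
      simp only [show (2 : Expr).ival s2 = 2 from rfl, div_mod_two, B, Bad, ← hz, ← hx, ← hy, recs]
      grind
    have hstep : (∃ t < j + 1, B t) ↔ (∃ t < j, B t) ∨ B j := by grind
    rw [hstep]
    refine time (cons (Tri.ite (T := 1) (fun hc => assign (Q := fun s' => s'.reg 36 ≤ 1 ∧
      (s'.reg 36 = 1 ↔ (∃ t < j, B t) ∨ B j)) (by simp; omega) ?_) fun hc => Tri.skip ?_) (T₂ := 1)
      fun s3 hs3 _ => nil (by simpa using hs3)) le_rfl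
    · simp_all
    · simp_all

/-- The test of the records of a tree. -/
theorem checkC_tree (hB : Big I β M) (hT : Trie I β col σ ctr ℓ) (hR : Ready I M col σ ctr ℓ s)
    {t : BT} (ht : Valid I.n col (I.Nb col) t) (hm : t.mask col = 2 ^ I.k - 1) {ρ : Rec}
    (hr : recs s = place col v 0 C t ρ) :
    Tri M checkC s (I.k * I.k * I.k * (2 * β + 26) + 8) (fun s' =>
      (s'.reg 36 = 0 ↔ Canon col (I.Nb col) t) ∧ recs s' = recs s) := by
  obtain ⟨h1, h2, h3⟩ := place_spec (v := v) (X := 0) (C := C) (ρ := ρ) ht; rw [← hr] at h1 h2 h3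
  have hbit : ∀ x, (∃ u ∈ t.leaves, col u = x) ↔ x < I.k := fun x => by
    rw [← ht.testBit, hm, Nat.testBit_two_pow_sub_one]; simp
  refine (checkC_spec hB hT hR fun x hx => ?_).fr.conseq le_rfl ?_
  · obtain ⟨u, hu, rfl⟩ := (hbit x).2 hx; rw [h2 u hu]; exact ht.leaves_lt u hu
  · rintro s' ⟨⟨h4, h5⟩, hf⟩
    refine ⟨?_, recs_congr fun a h1 h2 => hf.arr a (by interval_cases a <;> rfl)⟩
    have h6 : s'.reg 36 = 0 ↔ ¬ s'.reg 36 = 1 := by omega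
    rw [h6, h5, canon_iff ht h1 h2]
    -- The recorded masks have no bits from `k` on, so the `k * k * k` triples examined by the
    -- program are all that matter.
    have hmask : ∀ u ∈ t.leaves, u ≠ t.root → (recs s (col u)).2.1 < 2 ^ I.k ∧
        (recs s (col u)).2.2.1 < 2 ^ I.k := by
      have : ∀ t' : BT, Recorded col (recs s) t' → t'.mask col < 2 ^ I.k →
          ∀ u ∈ t'.leaves, u ≠ t'.root → (recs s (col u)).2.1 < 2 ^ I.k ∧
            (recs s (col u)).2.2.1 < 2 ^ I.k := by
        intro t'
        induction t' with
        | leaf u => intro _ _ v hv hne; exact absurd (by simpa [BT.leaves, BT.root] using hv) hne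
        | node a b iha ihb =>
          intro hr hm u hu hne; simp only [BT.mask] at hm; rcases mem_append.1 hu with hu | hu
          · exact iha hr.1 (by omega) u hu hne
          · by_cases hub : u = b.root
            · rw [hub, hr.2.2]; exact ⟨by dsimp only; omega, by dsimp only; omega⟩
            · exact ihb hr.2.1 (by omega) u hu hub
      grind
    have hlt : ∀ {X x : ℕ}, X < 2 ^ I.k → X.testBit x = true → x < I.k := fun hX hx =>
      (Nat.pow_lt_pow_iff_right (by omega)).1 ((Nat.ge_two_pow_of_testBit hx).trans_lt hX)
    constructor
    · intro H u hu hne x y hx hy hxy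
      by_contra hc
      obtain ⟨m1, m2⟩ := hmask u hu hne
      exact H ⟨col u, (hbit _).1 ⟨u, hu, rfl⟩, x, hlt m1 hx, y, hlt m2 hy, hx, hy, hxy, hc⟩
    · rintro H ⟨z, hz, x, hx, y, hy, b1, b2, b3, b4⟩; obtain ⟨u, hu, rfl⟩ := (hbit z).2 hz
      -- The root was recorded with the empty mask as the tree it is attached to, so its test is
      -- vacuous.
      by_cases hur : u = t.root
      · simp_all
      · exact b4 (H u hu hur x y b1 b2 b3)

end

/-! ## Sampling a connected set -/

section
variable {I : Hy} {col : ℕ → ℕ} {β M : ℕ} {s : Store} {σ : ℕ → Finset ℕ} {ctr : ℕ}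
  {ℓ : ℕ → List ℕ} {τ : ℝ≥0∞}

/-- The division into large and small hyperedges is bookkeeping only. A vertex may count as its own
neighbour, which is harmless because the parts of a tree have disjoint colours. -/
theorem Hy.nb_iff_adj {u v : ℕ} (hv : v < I.n) :
    u ∈ I.Nb col v ↔ ∃ e, v ∈ I.ed e ∧ u ∈ I.ed e := by
  classical
  by_cases hu : u < I.n
  · have hlt : ∀ {e w}, w ∈ I.ed e → e < I.m := fun h => Hy.sz_lt (List.length_pos_of_mem h)
    have hm : I.m + v ≠ I.m + I.n := by omega
    rw [mem_nb_iff hu, Finset.not_disjoint_iff]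
    simp only [List.mem_toFinset, Hy.mem_hi, Hy.mem, if_neg (show ¬ I.m + v < I.m by omega), if_neg hm,
      Nat.add_sub_cancel_left, mem_filter, mem_rng, hu, true_and]
    constructor
    · rintro (⟨e, ⟨-, -, h1⟩, -, -, h2⟩ | ⟨⟨e, -, -, h1, h2⟩, -⟩) <;> exact ⟨e, h1, h2⟩
    · rintro ⟨e, h1, h2⟩; by_cases hh : I.HiAdj v u
      · obtain ⟨e, h0, h1, h2⟩ := hh; grind
      · exact Or.inr ⟨⟨e, hlt h1, fun h0 => hh ⟨e, h0, h1, h2⟩, h1, h2⟩, hh⟩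
  · refine ⟨fun h => ?_, fun ⟨e, _, h⟩ => absurd (Hy.ed_lt h) hu⟩
    obtain ⟨id, -, h⟩ := Hy.nb_iff.1 h; exact absurd (Hy.mem_lt h) hu

theorem Hy.nb_root {u : ℕ} : u ∈ I.Nb col I.n ↔ u < I.n ∧ col u = 0 := by
  classical
  have h : I.hi I.n I.m = [] := List.filter_eq_nil_iff.2 fun e _ => by
    simpa using fun _ h => absurd (Hy.ed_lt h) (lt_irrefl _)
  rw [Hy.nb_iff, Hy.src, h]; simp [Hy.mem]

theorem symNb : SymNb I.n (I.Nb col) := fun _ hu _ hv h =>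
  (Hy.nb_iff_adj hu).2 ((Hy.nb_iff_adj hv).1 h |>.imp fun _ h => h.symm)

open Classical in
variable (I col) in
/-- The connected sets with all the colours. -/
noncomputable def Hy.sets : Finset (Finset ℕ) :=
  (rng I.n).powerset.filter fun W => Set.InjOn col W ∧ W.card = I.k ∧ Conn (I.Nb col) W

open Classical in
variable (I col) in
/-- The trees with all the colours. -/
noncomputable def Hy.trees : Finset BT := (I.Nb col I.n).biUnion (I.TS col (2 ^ I.k - 1))

theorem Hy.mem_trees {t : BT} : t ∈ I.trees col ↔
    Valid I.n col (I.Nb col) t ∧ t.mask col = 2 ^ I.k - 1 ∧ col t.root = 0 := by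
  classical
  rw [Hy.trees, Finset.mem_biUnion]; constructor
  · rintro ⟨u, hu, ht⟩; obtain ⟨h1, h2, rfl⟩ := mem_TS.1 ht; exact ⟨h1, h2, (Hy.nb_root.1 hu).2⟩
  · rintro ⟨h1, h2, h3⟩
    exact ⟨t.root, Hy.nb_root.2 ⟨h1.leaves_lt _ t.root_mem, h3⟩, mem_TS.2 ⟨h1, h2, rfl⟩⟩

theorem sum_trees {A : Type*} [AddCommMonoid A] (h : BT → A) :
    ∑ u ∈ I.Nb col I.n, ∑ t ∈ I.TS col (2 ^ I.k - 1) u, h t = ∑ t ∈ I.trees col, h t := by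
  classical
  rw [Hy.trees, Finset.sum_biUnion]; intro u _ v _ huv
  refine Finset.disjoint_left.2 fun t ht ht' => huv ?_
  rw [← (mem_TS.1 ht).2.2, ← (mem_TS.1 ht').2.2]

theorem card_trees : (I.trees col).card = I.adjCnt col (2 ^ I.k - 1) I.n := by
  have := sum_trees (I := I) (col := col) fun _ => 1; rw [card_eq_sum_ones, ← this]
  simp only [← card_eq_sum_ones]
  rfl

theorem Hy.colors {t : BT} (ht : t ∈ I.trees col) (x : ℕ) :
    (∃ u ∈ t.leaves, col u = x) ↔ x < I.k := by
  obtain ⟨h1, h2, -⟩ := Hy.mem_trees.1 ht; rw [← h1.testBit, h2, Nat.testBit_two_pow_sub_one]; simp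

theorem Hy.verts_mem {t : BT} (ht : t ∈ I.trees col) : t.verts ∈ I.sets col := by
  classical
  have h1 := (Hy.mem_trees.1 ht).1; have hinj : Set.InjOn col t.verts := fun u hu v hv h =>
    h1.inj (mem_verts.1 hu) (mem_verts.1 hv) h
  refine mem_filter.2 ⟨Finset.mem_powerset.2 fun u hu => mem_rng.2
    (h1.leaves_lt u (mem_verts.1 hu)), hinj, ?_, h1.conn symNb⟩
  rw [← Finset.card_image_of_injOn hinj, ← card_range I.k]; congr 1; ext x
  simp only [Finset.mem_image, mem_verts, mem_rng, Hy.colors ht]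

theorem image_canon (hcol : ∀ v < I.n, col v < I.k) {W : Finset ℕ} (hW : W ∈ I.sets col) :
    ∃ t ∈ I.trees col, Canon col (I.Nb col) t ∧ t.verts = W := by
  classical
  obtain ⟨h1, h2, h3, h4⟩ := mem_filter.1 hW
  have hlt : ∀ v ∈ W, v < I.n := fun v hv => mem_rng.1 (Finset.mem_powerset.1 h1 hv)
  have himg : W.image col = rng I.k := by
    refine Finset.eq_of_subset_of_card_le (fun x hx => ?_) ?_
    · grind
    · grind
  have hk := I.two_le_k; have h0 : 0 ∈ W.image col := by rw [himg, mem_rng]; omega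
  obtain ⟨u, hu, hu0⟩ := Finset.mem_image.1 h0
  obtain ⟨t, t1, t2, t3, t4⟩ := canon_exists symNb W.card W u rfl hlt h2 hu h4
  refine ⟨t, Hy.mem_trees.2 ⟨t1, Nat.eq_of_testBit_eq fun i => ?_, by rw [t3, hu0]⟩, t2, t4⟩
  rw [Bool.eq_iff_iff, t1.testBit, Nat.testBit_two_pow_sub_one, decide_eq_true_eq, ← mem_rng,
    ← himg, Finset.mem_image, ← t4]
  simp only [mem_verts]

/-- Canonical trees with all colours correspond to the sampled sets: the vertex of colour `0` fixes
the root, and a set has one canonical tree for a given root. -/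
theorem sum_canon {A : Type*} [AddCommMonoid A] (hcol : ∀ v < I.n, col v < I.k) (b : Finset ℕ → A) :
    open Classical in
    ∑ t ∈ (I.trees col).filter (Canon col (I.Nb col)), b t.verts = ∑ W ∈ I.sets col, b W := by
  classical
  refine Finset.sum_bij (fun t _ => t.verts) (fun t ht => Hy.verts_mem (mem_filter.1 ht).1)
    ?_ ?_ fun _ _ => rfl
  · intro t ht t' ht' he; obtain ⟨h1, h2⟩ := mem_filter.1 ht; obtain ⟨h1', h2'⟩ := mem_filter.1 ht'
    obtain ⟨v1, -, c1⟩ := Hy.mem_trees.1 h1; obtain ⟨v1', -, c1'⟩ := Hy.mem_trees.1 h1'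
    refine canon_unique symNb t t' v1 h2 v1' h2' (v1.inj t.root_mem ?_ (c1.trans c1'.symm)) he
    have : t'.root ∈ t'.verts := mem_verts.2 t'.root_mem; rw [← he] at this; exact mem_verts.1 this
  · intro W hW; obtain ⟨t, t1, t2, t3⟩ := image_canon hcol hW; grind

/-- Within one set, a vertex is known by its colour, so its trees are coded by words of length `2 *
k` over `k + 1` letters. This bounds the expected number of attempts. -/
theorem card_trees_le (hcol : ∀ v < I.n, col v < I.k) :
    (I.trees col).card ≤ (I.k + 1) ^ (2 * I.k) * (I.sets col).card := by
  classical
  refine Finset.card_le_mul_card_image_of_maps_to (f := BT.verts) (fun t ht => Hy.verts_mem ht) _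
    fun W hW => ?_
  refine BT.card_le_of_code _ col I.k I.k ?_ ?_ ?_
  · intro t ht u hu; exact hcol u ((Hy.mem_trees.1 (mem_filter.1 ht).1).1.leaves_lt u hu)
  · intro t ht t' ht' u hu u' hu' he; have h1 := mem_verts.2 hu; have h2 := mem_verts.2 hu'
    rw [(mem_filter.1 ht).2] at h1; rw [(mem_filter.1 ht').2] at h2
    exact (mem_filter.1 hW).2.1 h1 h2 he
  · intro t ht; obtain ⟨h1, h2, -⟩ := Hy.mem_trees.1 (mem_filter.1 ht).1
    exact h1.length_le (by rw [h2]; have := two_pow_pos I.k; omega)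

/-- A bound for the expected time of one attempt. -/
def tryTime (k β : ℕ) : ℕ := growTime k β + k * k * k * (2 * β + 26) + 11

/-- Of the `A` equally likely trees exactly `N` are canonical, one for each set. Retrying until a
canonical tree appears therefore averages uniformly over the sets, with `A / N` attempts on average.
-/
theorem attemptC_le (hB : Big I β M) (hT : Trie I β col σ ctr ℓ) (hR : Ready I M col σ ctr ℓ s)
    (hne : (I.sets col).Nonempty) {f : Store → ℝ≥0∞} {b : Finset ℕ → ℝ≥0∞}
    (hf : ∀ s', Ready I M col σ ctr ℓ s' → ∀ W ∈ I.sets col, (∀ u ∈ W, s'.arr 27 (col u) = u) →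
      f s' ≤ b W) :
    ic M true τ attemptC f s ≤
      τ * (((I.k + 1) ^ (2 * I.k) * tryTime I.k β + 2 : ℕ) : ℝ≥0∞) +
        (∑ W ∈ I.sets col, b W) / (I.sets col).card := by
  classical
  have hidx := hB.idx; obtain ⟨N, hN⟩ : ∃ N, N = (I.sets col).card := ⟨_, rfl⟩
  obtain ⟨A, hA⟩ : ∃ A, A = I.adjCnt col (2 ^ I.k - 1) I.n := ⟨_, rfl⟩
  have hN0 : N ≠ 0 := by rw [hN]; exact hne.card_pos.ne'
  have hNc : ((I.trees col).filter (Canon col (I.Nb col))).card = N := by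
    have := sum_canon (I := I) hT.col_lt (fun _ => 1); simp_all
  have hNA : N ≤ A := by rw [← hNc, hA, ← card_trees]; exact card_filter_le _ _
  have hAN := card_trees_le (I := I) hT.col_lt; rw [card_trees, ← hA, ← hN] at hAN
  obtain ⟨B, hBB⟩ : ∃ B, B = ∑ W ∈ I.sets col, b W := ⟨_, rfl⟩
  obtain ⟨c, hc⟩ : ∃ c, c = τ * (tryTime I.k β : ℝ≥0∞) := ⟨_, rfl⟩
  obtain ⟨V, hV⟩ : ∃ V, V = (c * A + B) / N := ⟨_, rfl⟩
  have hA0 : (A : ℝ≥0∞) ≠ 0 := by exact_mod_cast (by omega : A ≠ 0)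
  have hAt := natCast_ne_top A
  have hVle : V ≤ τ * (((I.k + 1) ^ (2 * I.k) * tryTime I.k β : ℕ) : ℝ≥0∞) + B / N := by
    rw [hV, ENNReal.add_div]; refine add_le_add_left (ENNReal.div_le_of_le_mul ?_) _
    have : (A : ℝ≥0∞) ≤ (((I.k + 1) ^ (2 * I.k) : ℕ) : ℝ≥0∞) * N := by exact_mod_cast hAN
    refine (mul_le_mul_right this c).trans (le_of_eq ?_); rw [hc]; push_cast; ring
  have key : ic M true τ (.loop (rg 36) (.seq growC checkC)) f (s.setReg 36 1) ≤ V := by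
    refine ic_loop_retry (Ready I M col σ ctr ℓ) V ?_ (hR.fr (Fr.setReg (P := .assign 36 1) rfl s 1)
      (by decide)) (by simp)
    intro s1 hR1 _ g hg1 hg0; rw [ic_seq]
    -- The law of the grown tree is known for functions of the records only, so the test is replaced
    -- by its supremum over the stores with given records.
    have hgrow := growC_le (τ := τ) hB hT hR1 (by omega) (F := fun r => ⨆ (s' : Store)
      (_ : Ready I M col σ ctr ℓ s' ∧ recs s' = r), ic M true τ checkC g s')
      (f := ic M true τ checkC g) (fun s' hs' => le_iSup₂_of_le s' ⟨hs', rfl⟩ le_rfl)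
    obtain ⟨c', hc'⟩ : ∃ c', c' = τ * ((I.k * I.k * I.k * (2 * β + 26) + 9 : ℕ) : ℝ≥0∞) := ⟨_, rfl⟩
    have ht : ∀ t ∈ I.trees col, (⨆ (s' : Store) (_ : Ready I M col σ ctr ℓ s' ∧
        recs s' = place col I.n 0 (2 ^ I.k - 1) t (recs s1)), ic M true τ checkC g s') ≤
        c' + if Canon col (I.Nb col) t then b t.verts else V := by
      intro t ht; refine iSup₂_le fun s2 ⟨hR2, hr⟩ => ?_; obtain ⟨t1, t2, -⟩ := Hy.mem_trees.1 ht
      refine ((checkC_tree hB hT hR2 t1 t2 hr).fr true τ g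
        (τ + if Canon col (I.Nb col) t then b t.verts else V) ?_).trans (le_of_eq ?_)
      · rintro s3 ⟨⟨h1, h2⟩, hf3⟩; have hR3 := hR2.fr hf3 (by decide)
        by_cases hcan : Canon col (I.Nb col) t
        · rw [if_pos hcan]
          refine (hg0 s3 hR3 (h1.2 hcan)).trans (add_le_add_right (hf s3 hR3 _ (Hy.verts_mem ht) ?_) τ)
          intro u hu
          have := (place_spec (v := I.n) (X := 0) (C := 2 ^ I.k - 1) (ρ := recs s1) t1).2.1 u
            (mem_verts.1 hu)
          rw [← hr, ← h2] at this; exact this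
        · rw [if_neg hcan]; exact (hg1 s3 hR3 fun h => hcan (h1.1 h)).trans le_add_self
      · rw [hc']; push_cast; ring
    have hsum : ∑ t ∈ I.trees col, (c' + if Canon col (I.Nb col) t then b t.verts else V) =
        A * c' + (B + ((A - N : ℕ) : ℝ≥0∞) * V) := by
      rw [sum_add_distrib, sum_const, card_trees, ← hA, nsmul_eq_mul, sum_ite,
        sum_canon hT.col_lt, ← hBB, sum_const, nsmul_eq_mul]
      congr 4
      have := Finset.card_filter_add_card_filter_not (s := I.trees col) (Canon col (I.Nb col))
      rw [hNc, card_trees, ← hA] at this; omega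
    have hret := retry_value (c := c) (B := B) hN0 hNA; rw [← hV] at hret
    have h2 : ic M true τ growC (ic M true τ checkC g) s1 ≤ τ * growTime I.k β +
        (A * c' + (B + ((A - N : ℕ) : ℝ≥0∞) * V)) / A := by
      refine hgrow.trans (add_le_add_right ?_ _)
      rw [exA, sum_trees (fun t => ⨆ (s' : Store) (_ : Ready I M col σ ctr ℓ s' ∧
        recs s' = place col I.n 0 (2 ^ I.k - 1) t (recs s1)), ic M true τ checkC g s'), ← hsum, ← hA]
      exact div_le_div_right (sum_le_sum ht) _
    refine le_trans (add_le_add_right (add_le_add_right h2 τ) τ) (le_trans (le_of_eq ?_) hret)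
    rw [ENNReal.add_div, mul_comm (A : ℝ≥0∞), ENNReal.mul_div_cancel_right hA0 hAt, hc, hc', tryTime]
    grind
  rw [attemptC, ic_seq, ic_assign (v := 1) rfl (by omega)]
  refine (add_le_add_right (add_le_add_right (key.trans hVle) τ) τ).trans (le_of_eq ?_)
  rw [← hBB, ← hN]; grind

end

/-- The mask of a set of colours. -/
def maskOf (k : ℕ) (p : ℕ → Prop) [DecidablePred p] : ℕ :=
  ∑ x ∈ rng k, (if p x then 1 else 0) * 2 ^ x

theorem maskOf_lt {k : ℕ} {p : ℕ → Prop} [DecidablePred p] : maskOf k p < 2 ^ k :=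
  sum_digits_lt fun x _ => by split_ifs <;> omega

theorem testBit_maskOf {k : ℕ} {p : ℕ → Prop} [DecidablePred p] {x : ℕ} (hx : x < k) :
    (maskOf k p).testBit x = true ↔ p x := by
  have := digit_sum (B := 2) (φ := fun x => if p x then 1 else 0) (k := k)
    (fun x _ => by split_ifs <;> omega) hx
  rw [← maskOf, div_mod_two] at this; grind

theorem eq_of_testBit {k X Y : ℕ} (hX : X < 2 ^ k) (hY : Y < 2 ^ k)
    (h : ∀ x < k, X.testBit x = true ↔ Y.testBit x = true) : X = Y :=
  Nat.eq_of_testBit_eq fun x => by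
    by_cases hx : x < k
    · simp_all
    · have := pow_le_pow_right (show 0 < 2 by omega) (not_lt.1 hx)
      rw [Nat.testBit_lt_two_pow (hX.trans_le this), Nat.testBit_lt_two_pow (hY.trans_le this)]

theorem land_compl {k Y Z : ℕ} (hZ : Z < 2 ^ k) :
    Y &&& (2 ^ k - 1 - Z) = 0 ↔ ∀ x < k, Y.testBit x = true → Z.testBit x = true := by
  rw [land_eq_zero_iff, show 2 ^ k - 1 - Z = 2 ^ k - (Z + 1) by omega]; grind

/-! ### Writing out the induced hypergraph -/

section
variable {I : Hy} {col : ℕ → ℕ} {β M : ℕ} {s : Store} {σ : ℕ → Finset ℕ} {ctr : ℕ}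
  {ℓ : ℕ → List ℕ} {g : ℕ → ℕ}

/-- The colours of the vertices in the hyperedge `e`, when `g x` is the vertex of colour `x`. -/
def Hy.tr (I : Hy) (g : ℕ → ℕ) (e : ℕ) : ℕ := maskOf I.k fun x => g x ∈ I.ed e

/-- The number of small hyperedges with the trace `Y`. -/
def Hy.small (I : Hy) (g : ℕ → ℕ) (Y : ℕ) : ℕ :=
  ((rng I.m).filter fun e => ¬ I.a < I.sz e ∧ I.tr g e = Y).card

-- The small hyperedges that contain the set with mask `Y` are sorted by their trace `Z`, a superset
-- of `Y`. A proper superset is a larger number that contains `Y`, which is what the program tests.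
variable (I g) in
theorem Hy.lowDeg_eq {Y : ℕ} (hY : Y < 2 ^ I.k) :
    I.lowDeg I.m (fun x => if Y.testBit x then g x + 1 else 0) = I.small g Y +
      ∑ Z ∈ rng (2 ^ I.k), (if Y < Z then 1 else 0) *
        (if Y &&& (2 ^ I.k - 1 - Z) = 0 then 1 else 0) * I.small g Z := by
  have hw : ∀ e, I.Within (fun x => if Y.testBit x then g x + 1 else 0) e ↔
      Y &&& (2 ^ I.k - 1 - I.tr g e) = 0 := by
    intro e; rw [Hy.tr, land_compl maskOf_lt]; refine forall₂_congr fun x hx => ?_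
    rw [testBit_maskOf hx]; simp_all
  have h1 : I.small g Y = ∑ Z ∈ rng (2 ^ I.k), if Z = Y then I.small g Y else 0 := by simp_all
  rw [Hy.lowDeg, Finset.card_eq_sum_card_fiberwise (f := I.tr g) (t := rng (2 ^ I.k))
    (fun e _ => mem_coe.2 (mem_rng.2 maskOf_lt)), h1, ← sum_add_distrib]
  refine sum_congr rfl fun Z hZ => ?_; have hZ := mem_rng.1 hZ; rw [Finset.filter_filter]
  have h2 : ((rng I.m).filter fun e => (¬ I.a < I.sz e ∧ I.Within (fun x =>
      if Y.testBit x then g x + 1 else 0) e) ∧ I.tr g e = Z).card =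
      if Y &&& (2 ^ I.k - 1 - Z) = 0 then I.small g Z else 0 := by
    split_ifs with h
    · rw [Hy.small]; congr 1; grind
    · refine card_eq_zero.2 (Finset.filter_eq_empty_iff.2 fun e _ h' => h ?_); grind
  rw [h2]; rcases lt_trichotomy Y Z with h | rfl | h
  · grind
  · have : Y &&& (2 ^ I.k - 1 - Y) = 0 := (land_compl hY).2 fun _ _ h => h; simp [this]
  -- A set `Y` inside `Z` would be disjoint from the complement of `Z`; both together would stay
  -- below `2 ^ k`, which fails for `Z < Y`.
  · have : ¬ Y &&& (2 ^ I.k - 1 - Z) = 0 := fun h0 => by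
      have h3 := Nat.or_lt_two_pow hY (show 2 ^ I.k - 1 - Z < 2 ^ I.k by omega)
      rw [← add_eq_lor _ _ h0] at h3; omega
    grind

theorem zetaC_spec (hB : Big I β M) (hs : Static I col σ ctr ℓ s)
    (hg : ∀ x < I.k, s.arr 27 x = g x) (hgn : ∀ x < I.k, g x < I.n)
    (hgc : ∀ x < I.k, col (g x) = x) :
    Tri M zetaC s (2 ^ I.k * (4 * I.k + 4 * 2 ^ I.k + 20) + 3)
      (fun s' => ∀ Y < 2 ^ I.k, s'.arr 34 Y = I.small g Y) := by
  have hidx := hB.idx; have hK := hB.two_pow; have hKp := two_pow_pos I.k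
  refine (for_const (2 ^ I.k) (4 * I.k + 4 * 2 ^ I.k + 17) (fun j s' => ∀ Y < 2 ^ I.k,
    2 ^ I.k - 1 - Y < j → s'.arr 34 Y = I.small g Y) hK rfl ?_ (by simp) ?_).conseq le_rfl
    fun s' hs' Y hY => hs'.1 Y hY (by omega)
  · intro j s' hf _; rw [ival_reg, hf.reg 6 rfl, hs.r6]
  rintro j hj s1 hf1 h41 h34; have hs1 := hs.fr hf1 (by decide)
  have a27 : s1.arr 27 = s.arr 27 := hf1.arr 27 rfl
  obtain ⟨Y, hYd⟩ : ∃ Y, Y = 2 ^ I.k - 1 - j := ⟨_, rfl⟩; have hY : Y < 2 ^ I.k := by omega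
  let D : ℕ → ℕ := fun x => if Y.testBit x then g x + 1 else 0
  have hDn : ∀ x < I.k, D x ≤ I.n := fun x hx => by
    grind
  have hDg : Good col I.k D := fun x hx h0 => by
    grind
  have hDp : ∀ j ≤ I.k, ∑ x ∈ rng j, D x * (I.n + 1) ^ x ≤ M := fun j hj =>
    (sum_le_sum_of_subset (range_subset_range.2 hj)).trans
      ((Hy.code_lt hDn).le.trans hB.pow)
  let S : ℕ → ℕ := fun Z => (if Y < Z then 1 else 0) *
        (if Y &&& (2 ^ I.k - 1 - Z) = 0 then 1 else 0) * I.small g Z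
  have hlow : I.lowDeg I.m D = I.small g Y + ∑ Z ∈ rng (2 ^ I.k), S Z := I.lowDeg_eq g hY
  have hlm := Hy.lowDeg_le (I := I) I.m D
  have hSp : ∀ j ≤ 2 ^ I.k, ∑ Z ∈ rng j, S Z ≤ M := fun j hj => by
    have : ∑ Z ∈ rng j, S Z ≤ ∑ Z ∈ rng (2 ^ I.k), S Z :=
      sum_le_sum_of_subset (range_subset_range.2 hj)
    omega
  refine time (asgv (v := Y) (by simp [hs1.r6, h41, hYd]) (by omega)
    (asgv (v := 0) rfl (by omega) (cons (T₂ := 4 * 2 ^ I.k + 9) (for_const I.k 1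
      (fun j s' => s'.reg 43 = ∑ x ∈ rng j, D x * (I.n + 1) ^ x) hB.k_le rfl ?_ (by simp) ?_)
      ?_))) (T₁ := I.k * (1 + 3) + 3 + (4 * 2 ^ I.k + 9) + 1 + 2 + 2) (by omega)
  · intro j s2 hf2 _; rw [ival_reg, hf2.reg 0 rfl]; simp [hs1.r0]
  · intro x hx s2 hf2 h44 h43
    have hs2 : Static I col σ ctr ℓ s2 := (hs1.congr (s' := (s1.setReg 42 Y).setReg 43 0)
      (by simp) (by simp)).fr hf2 (by decide)
    have e42 : s2.reg 42 = Y := hf2.rg rfl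
    have e27 : s2.arr 27 x = g x := by rw [hf2.arr 27 rfl]; simp [a27, hg x hx]
    have hv : (rg 43 + rg 42 / ld 7 (rg 44) % 2 * ((ld 27 (rg 44) + 1) * ld 8 (rg 44))).ival s2 =
        ∑ x ∈ rng (x + 1), D x * (I.n + 1) ^ x := by
      simp only [ival_add, ival_mul, ival_mod, ival_div, ival_load, ival_reg, h44, h43, e42, e27,
        hs2.a7 x hx, hs2.a8 x hx, sum_range_succ, show (2 : Expr).ival s2 = 2 from rfl,
        ival_one, div_mod_two, D]
      simp
    refine assign (by rw [hv]; exact hDp _ hx) ?_; simp_all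
  rintro s2 ⟨h43, -⟩ hf2
  have hs2 : Static I col σ ctr ℓ s2 := (hs1.congr (s' := (s1.setReg 42 Y).setReg 43 0)
    (by simp) (by simp)).fr hf2 (by decide)
  have e42 : s2.reg 42 = Y := hf2.rg rfl; have e34 : s2.arr 34 = s1.arr 34 := hf2.ar rfl
  have e41 : s2.reg 41 = j := hf2.rg h41
  refine time (asgv (v := 0) rfl (by omega) (cons (T₂ := 3) (for_const (2 ^ I.k) 1
      (fun j s' => s'.reg 45 = ∑ Z ∈ rng j, S Z) hK rfl ?_ (by simp) ?_)
      ?_)) (T₁ := 2 ^ I.k * (1 + 3) + 3 + 3 + 1 + 2) (by omega)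
  · intro j s3 hf3 _; rw [ival_reg, hf3.reg 6 rfl]; simp [hs2.r6]
  · intro Z hZ s3 hf3 h44 h45
    have hs3 : Static I col σ ctr ℓ s3 := (hs2.congr (s' := s2.setReg 45 0)
      (by simp) (by simp)).fr hf3 (by decide)
    have f42 : s3.reg 42 = Y := hf3.rg e42; have f34 : s3.arr 34 = s1.arr 34 := hf3.ar e34
    have hv : (rg 45 + .lt (rg 42) (rg 44) * ld 6 (rg 42 * rg 6 + (rg 6 - 1 - rg 44)) *
        ld 34 (rg 44)).ival s3 = ∑ Z ∈ rng (Z + 1), S Z := by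
      simp only [ival_add, ival_mul, ival_sub, ival_lt, ival_load, ival_reg, h44, h45, f42, f34,
        hs3.r6, sum_range_succ, ival_one, hs3.dis Y hY (2 ^ I.k - 1 - Z) (by omega), S]
      grind
    refine assign (by rw [hv]; exact hSp _ hZ) ?_; rw [hv]; simp
  · rintro s3 ⟨h45, -⟩ hf3; have hs3 : Static I col σ ctr ℓ s3 := (hs2.congr (s' := s2.setReg 45 0)
      (by simp) (by simp)).fr hf3 (by decide)
    have f42 : s3.reg 42 = Y := hf3.rg e42
    have f43 : s3.reg 43 = I.code D := by rw [hf3.reg 43 rfl, Hy.code]; simpa using h43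
    have f34 : s3.arr 34 = s1.arr 34 := hf3.ar e34
    refine stov (j := Y) (v := I.small g Y) (by simp [f42]) ?_ (by omega) (nil ?_)
    · simp [f43, h45, hs3.deg D hDn hDg, hlow]
    · intro Y' hY' hj'; simp only [setReg_arr, setArr_arr, f34, if_true]; grind

end

theorem Holds.left {f : ℕ → ℕ} {L L' : List ℕ} (h : Holds f (L ++ L')) : Holds f L := fun i hi => by
  rw [h i (by simp; omega), List.getElem_append_left hi]

theorem Holds.snoc {f : ℕ → ℕ} {L : List ℕ} (h : Holds f L) (v : ℕ) :
    Holds (update f L.length v) (L ++ [v]) := fun i hi => by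
  rcases lt_succ_iff_lt_or_eq.1 (by simpa using hi) with h1 | rfl
  · rw [update_of_ne h1.ne, h i h1, List.getElem_append_left h1]
  · simp

theorem setArr_same (s : Store) (a i v : ℕ) :
    (s.setArr a i v).arr a = update (s.arr a) i v := by
  simp [Store.setArr]

theorem length_offsets {V : Type*} (es : List (List V)) : (offsets es).length = es.length + 1 := by
  simp [offsets]

theorem offsets_getElem {V : Type*} {es : List (List V)} {i : ℕ} (h : i < (offsets es).length) :
    (offsets es)[i] = ((es.take i).map List.length).sum := by
  simp [offsets]

theorem offsets_snoc {V : Type*} (es : List (List V)) (l : List V) :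
    offsets (es ++ [l]) = offsets es ++ [es.flatten.length + l.length] := by
  refine List.ext_getElem (by simp [length_offsets]) fun i h1 h2 => ?_; rw [offsets_getElem]
  rcases lt_or_ge i (es.length + 1) with h | h
  · rw [List.getElem_append_left (by rw [length_offsets]; exact h), offsets_getElem,
      List.take_append_of_le_length (by omega)]
  · rw [List.getElem_append_right (by rw [length_offsets]; exact h), List.take_of_length_le (by simpa)]
    simp

/-- The colours in a mask. -/
def bits (k Y : ℕ) : List ℕ := (List.range k).filter fun x => Y.testBit x

theorem mem_bits {k Y x : ℕ} : x ∈ bits k Y ↔ x < k ∧ Y.testBit x = true := by simp [bits]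

theorem bits_succ (k Y : ℕ) : bits (k + 1) Y = bits k Y ++ if Y.testBit k then [k] else [] := by
  rw [bits, List.range_succ, List.filter_append, bits]; grind

theorem length_bits_le (k Y : ℕ) : (bits k Y).length ≤ k :=
  (List.length_filter_le _ _).trans (by simp)

section
variable {n : ℕ} (k : ℕ) (G : ℕ → Fin n) (T : ℕ → Prop) [DecidablePred T]

/-- The hyperedges whose masks are marked. -/
def marked (j : ℕ) : List (List (Fin n)) :=
  ((List.range j).filter fun Y => T Y ∧ 2 ≤ (bits k Y).length).map fun Y => (bits k Y).map G

theorem marked_succ (j : ℕ) : marked k G T (j + 1) =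
    marked k G T j ++ if T j ∧ 2 ≤ (bits k j).length then [(bits k j).map G] else [] := by
  rw [marked, List.range_succ, List.filter_append, List.map_append, marked]; grind

theorem length_marked_le (j : ℕ) : (marked k G T j).length ≤ j := by
  rw [marked, List.length_map]; grind

theorem length_flatten_marked_le (j : ℕ) : (marked k G T j).flatten.length ≤ j * k := by
  induction j with
  | zero => simp [marked]
  | succ j ih =>
    rw [marked_succ, Nat.succ_mul, List.flatten_append, List.length_append]
    refine Nat.add_le_add ih ?_; split_ifs
    · simpa using length_bits_le k j
    · simp

end

section
variable {I : Hy} {col : ℕ → ℕ} {β M : ℕ} {s : Store} {σ : ℕ → Finset ℕ} {ctr : ℕ}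
  {ℓ : ℕ → List ℕ}

/-- A large hyperedge is reached through one of its vertices in the sampled set. This misses those
with empty trace, hence the restriction to `Y ≠ 0`; they are not part of the output. -/
theorem markC_spec {g : ℕ → ℕ} (hB : Big I β M) (hT : Trie I β col σ ctr ℓ)
    (hs : Static I col σ ctr ℓ s) (hg : ∀ x < I.k, s.arr 27 x = g x) (hgn : ∀ x < I.k, g x < I.n)
    (h34 : ∀ Y < 2 ^ I.k, s.arr 34 Y = I.small g Y) :
    Tri M markC s (I.k * (β * (4 * I.k + 14) + 10) + 3)
      (fun s' => ∀ Y < 2 ^ I.k, Y ≠ 0 → (s'.arr 34 Y ≠ 0 ↔ ∃ e < I.m, I.tr g e = Y)) := by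
  have hidx := hB.idx; refine (for_const I.k (β * (4 * I.k + 14) + 7) (fun j s' => ∀ Y < 2 ^ I.k,
    s'.arr 34 Y ≠ 0 ↔ I.small g Y ≠ 0 ∨ ∃ x < j, ∃ e ∈ I.hi (g x) I.m, I.tr g e = Y)
    hB.k_le rfl ?_ (fun Y hY => by simp [h34 Y hY]) ?_).conseq le_rfl fun s' hs' Y hY h0 => ?_
  · intro j s' hf _; rw [ival_reg, hf.reg 0 rfl, hs.r0]
  · rintro x hx s1 hf1 h41 k34; have hs1 := hs.fr hf1 (by decide)
    have a27 : s1.arr 27 = s.arr 27 := hf1.arr 27 rfl; have hgx := hgn x hx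
    have hdeg := hB.deg (g x)
    have hlen : (I.src (g x)).length = (I.hi (g x) I.m).length + 1 := Hy.length_src _
    refine time (asgv (v := g x) (by simp [h41, a27, hg x hx]) (by omega)
      (cons (for_const (I.hi (g x) I.m).length (4 * I.k + 11) (fun i s' => ∀ Y < 2 ^ I.k,
        s'.arr 34 Y ≠ 0 ↔ (I.small g Y ≠ 0 ∨ ∃ x' < x, ∃ e ∈ I.hi (g x') I.m, I.tr g e = Y) ∨
          ∃ e ∈ (I.hi (g x) I.m).take i, I.tr g e = Y) (by omega) rfl ?_ ?_ ?_) (T₂ := 1) ?_))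
      (T₁ := (I.hi (g x) I.m).length * (4 * I.k + 11 + 3) + 3 + 1 + 1 + 2)
      (by have := Nat.mul_le_mul_right (4 * I.k + 14) hdeg; simp only [Nat.add_assoc, Nat.reduceAdd]; omega)
    · intro i s2 hf2 _; rw [ival_sub, ival_load, ival_reg, hf2.reg 42 rfl, hf2.arr 10 rfl]
      simp [hs1.src.len (g x) (by omega), hlen]
    · simp_all
    · intro i hi s2 hf2 h43 j34; have hs2 : Static I col σ ctr ℓ s2 :=
        (hs1.congr (s' := s1.setReg 42 (g x)) (by simp) (by simp)).fr hf2 (by decide)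
      have e42 : s2.reg 42 = g x := hf2.rg rfl; have e27 : s2.arr 27 = s.arr 27 := hf2.ar a27
      obtain ⟨e, hed⟩ : ∃ e, e = (I.hi (g x) I.m)[i] := ⟨_, rfl⟩
      have heh : e ∈ I.hi (g x) I.m := hed ▸ getElem_mem hi; obtain ⟨hem, hea, -⟩ := Hy.mem_hi.1 heh
      have heL : e < I.L := by simp only [Hy.L]; omega
      have hent := hs2.src.ent (g x) (by omega) i (by omega)
      rw [Hy.src, List.getD_append _ _ _ _ hi, getD_eq_getElem _ _ hi, ← hed] at hent
      have hmemE : ∀ u, u ∈ ℓ e ↔ u ∈ I.ed e := fun u => by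
        rw [← List.mem_toFinset, hT.mem e heL, Hy.mem, if_pos hem, if_pos hea, List.mem_toFinset]
      have htM : I.tr g e ≤ M := maskOf_lt.le.trans hB.two_pow
      refine time (asgv (v := e) (by simp [h43, e42, hs2.r7, hent]) (by omega)
        (asgv (v := 0) rfl (by omega) (cons (T₂ := 3) (for_const I.k 1 (fun j s' =>
          s'.reg 45 = maskOf j fun x => g x ∈ I.ed e) hB.k_le rfl ?_ (by simp [maskOf]) ?_) ?_)))
        (T₁ := I.k * (1 + 3) + 3 + 3 + 1 + 2 + 2) (by omega)
      · intro j s3 hf3 _; rw [ival_reg, hf3.reg 0 rfl]; simp [hs2.r0]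
      · intro y hy s3 hf3 h46 h45
        have hs3 : Static I col σ ctr ℓ s3 := (hs2.congr (s' := (s2.setReg 44 e).setReg 45 0)
          (by simp) (by simp)).fr hf3 (by decide)
        have f44 : s3.reg 44 = e := hf3.rg rfl
        have f27 : s3.arr 27 y = g y := by rw [hf3.arr 27 rfl]; simp [e27, hg y hy]
        have hv : (rg 45 + ld 17 (ld 27 (rg 46) * rg 8 + rg 44) * ld 7 (rg 46)).ival s3 =
            maskOf (y + 1) fun x => g x ∈ I.ed e := by
          simp only [ival_add, ival_mul, ival_load, ival_reg, h46, h45, f44, f27, hs3.r8,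
            hs3.a7 y hy, hs3.lists.inc e heL (g y) (hgn y hy), hmemE, maskOf, sum_range_succ]
        refine assign ?_ (by rw [hv]; simp); rw [hv]; exact maskOf_lt.le.trans (hB.two_pow_le hy)
      · rintro s3 ⟨h45, -⟩ hf3; have f34 : s3.arr 34 = s2.arr 34 := hf3.ar rfl
        refine stov (j := I.tr g e) (v := 1) (by simp [h45, Hy.tr]) rfl (by omega)
          (nil fun Y hY => ?_)
        rw [List.take_add_one, List.getElem?_eq_getElem hi, ← hed]
        simp only [setReg_arr, setArr_same, f34, Option.toList_some, mem_append,
          List.mem_singleton, or_and_right, exists_or, exists_eq_left]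
        grind
    · rintro s2 ⟨j34, -⟩ hf2; refine nil fun Y hY => ?_
      rw [setReg_arr, j34 Y hY, List.take_length, or_assoc]; grind
  · rw [hs'.1 Y hY]; constructor
    · rintro (h | ⟨x, -, e, he, h⟩)
      · obtain ⟨e, he⟩ := Finset.card_ne_zero.1 h; grind
      · exact ⟨e, (Hy.mem_hi.1 he).1, h⟩
    · rintro ⟨e, he, h⟩; by_cases ha : I.a < I.sz e
      · obtain ⟨x, hx⟩ := Nat.exists_testBit_of_ne_zero h0; have hxk : x < I.k := by
          by_contra hc
          have := pow_le_pow_right (show 0 < 2 by omega) (not_lt.1 hc)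
          rw [Nat.testBit_lt_two_pow (hY.trans_le this)] at hx; simp at hx
        rw [← h, Hy.tr, testBit_maskOf hxk] at hx
        exact Or.inr ⟨x, hxk, e, Hy.mem_hi.2 ⟨he, ha, hx⟩, h⟩
      · exact Or.inl (Finset.card_ne_zero.2 ⟨e, mem_filter.2 ⟨mem_rng.2 he, ha, h⟩⟩)

variable {G : ℕ → Fin I.n}

theorem emitC_spec (hB : Big I β M) (hs : Static I col σ ctr ℓ s)
    (hg : ∀ x < I.k, s.arr 27 x = G x) :
    Tri M emitC s (2 ^ I.k * (9 * I.k + 18) + 9) (fun s' =>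
      s'.reg 5 = (marked I.k G (fun Y => s.arr 34 Y ≠ 0) (2 ^ I.k)).length ∧
      Holds (s'.arr 4) (offsets (marked I.k G (fun Y => s.arr 34 Y ≠ 0) (2 ^ I.k))) ∧
      Holds (s'.arr 5)
        ((marked I.k G (fun Y => s.arr 34 Y ≠ 0) (2 ^ I.k)).flatten.map fun v : Fin I.n => (v : ℕ))) := by
  have hidx := hB.idx; have hK := hB.two_pow
  obtain ⟨L, hL⟩ : ∃ L, L = marked I.k G (fun Y => s.arr 34 Y ≠ 0) := ⟨_, rfl⟩; rw [← hL]
  let val : Fin I.n → ℕ := fun v => v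
  refine time (asgv (v := 0) rfl (by omega) (stov (j := 0) (v := 0) rfl rfl (by omega)
    (cons (T₂ := 1) (for_const (2 ^ I.k) (9 * I.k + 15) (fun j s' => s'.reg 5 = (L j).length ∧
      Holds (s'.arr 4) (offsets (L j)) ∧ Holds (s'.arr 5) ((L j).flatten.map val))
      hK rfl ?_ ?_ ?_) fun s' hs' _ => nil hs'.1)))
    (T₁ := 2 ^ I.k * (9 * I.k + 15 + 3) + 3 + 1 + 1 + 2 + 2)
    (by simp only [Nat.add_assoc, Nat.reduceAdd]; omega)
  · intro j s' hf _; rw [ival_reg, hf.reg 6 rfl]; simp [hs.r6]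
  · subst hL; refine ⟨by simp [marked], fun i hi => ?_, fun i hi => ?_⟩
    · have : i = 0 := by simpa [length_offsets, marked] using hi
      subst this; rw [offsets_getElem]; simp [setArr_arr]
    · simp [marked] at hi
  rintro j hj s1 hf1 h41 ⟨h5, h4, hF⟩
  have hs1 : Static I col σ ctr ℓ s1 := (hs.congr (s' := (s.setReg 5 0).setArr 4 0 0)
    (by simp) (by simp [setArr_arr'])).fr hf1 (by decide)
  have a27 : s1.arr 27 = s.arr 27 := by rw [hf1.arr 27 rfl]; simp [setArr_arr']
  have a34 : s1.arr 34 = s.arr 34 := by rw [hf1.arr 34 rfl]; simp [setArr_arr']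
  have h4l : s1.arr 4 (L j).length = (L j).flatten.length := by
    rw [h4 _ (by simp [length_offsets]), offsets_getElem, List.take_length, List.length_flatten]
  have hFl : (L j).flatten.length + I.k ≤ M := by
    refine le_trans ?_ hB.k4; have h1 := length_flatten_marked_le I.k G (fun Y => s.arr 34 Y ≠ 0) j
    have h2 : (j + 1) * I.k ≤ 2 ^ I.k * 2 ^ I.k := Nat.mul_le_mul hj lt_two_pow_self.le
    rw [← hL] at h1; linarith
  have hLl : (L j).length ≤ j := hL ▸ length_marked_le I.k G _ j
  have hLs : L (j + 1) = L j ++ if s1.arr 34 j ≠ 0 ∧ 2 ≤ (bits I.k j).length then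
      [(bits I.k j).map G] else [] := by rw [hL, a34]; exact marked_succ _ _ _ _
  refine Tri.ite (fun hc => ?_) fun hc => ?_
  · replace hc : s1.arr 34 j ≠ 0 := by simpa [h41] using hc
    refine time (asgv (v := (L j).flatten.length) (by simp [h5, h4l]) (by omega)
      (cons (T₂ := 8) (for_const I.k 6 (fun i s' =>
        s'.reg 42 = (L j).flatten.length + (bits i j).length ∧
        Holds (s'.arr 5) ((L j).flatten.map val ++ ((bits i j).map G).map val))
        hB.k_le rfl ?_ ?_ ?_) ?_)) (T₁ := I.k * (6 + 3) + 3 + 8 + 1 + 2) (by omega)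
    · intro i s2 hf2 _; rw [ival_reg, hf2.reg 0 rfl]; simp [hs1.r0]
    · simpa [bits] using hF
    · rintro x hx s2 hf2 h43 ⟨h42, k5⟩
      have hs2 : Static I col σ ctr ℓ s2 := (hs1.congr (s' := s1.setReg 42 (L j).flatten.length)
        (by simp) (by simp)).fr hf2 (by decide)
      have e41 : s2.reg 41 = j := hf2.rg h41
      have e27 : s2.arr 27 x = G x := by rw [hf2.arr 27 rfl]; simp [a27, hg x hx]
      have hcond : (rg 41 / ld 7 (rg 43) % 2).ival s2 = if j.testBit x then 1 else 0 := by
        simp only [ival_mod, ival_div, ival_load, ival_reg, e41, h43, hs2.a7 x hx,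
          show (2 : Expr).ival s2 = 2 from rfl, div_mod_two]
      have hbl := length_bits_le x j; refine Tri.ite (fun hb => ?_) fun hb => ?_
      · have hb : j.testBit x = true := by simp_all
        have hlt := (G x).2
        refine stov (j := s2.reg 42) (v := G x) rfl (by simp [h43, e27]) (by omega)
          (asgv (v := s2.reg 42 + 1) (by simp) (by omega) (nil ⟨?_, ?_⟩))
        · simp [bits_succ, hb, h42]; omega
        · have := k5.snoc (G x)
          simp only [setReg_arr, setArr_same, h42, bits_succ, hb, if_true, List.map_append,
            ← List.append_assoc]
          grind
      · have hb : ¬ j.testBit x = true := by simp_all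
        refine conseq (Tri.skip ⟨?_, ?_⟩ : Tri M .skip s2 1 _) (by omega) fun _ h => h
        · simp [bits_succ, hb, h42]
        · simpa [bits_succ, hb] using k5
    · rintro s2 ⟨⟨h42, k5⟩, -⟩ hf2; have e5 : s2.reg 5 = (L j).length := hf2.rg h5
      have e4 : s2.arr 4 = s1.arr 4 := hf2.ar rfl; have hbl := length_bits_le I.k j
      have hcond : (Expr.lt (ld 4 (rg 5) + 1) (rg 42)).ival s2 =
          if 2 ≤ (bits I.k j).length then 1 else 0 := by
        simp only [ival_lt, ival_add, ival_load, ival_reg, ival_one, e5, e4, h4l, h42]; grind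
      refine cons (T₁ := 6) (T₂ := 1) (Q₁ := fun s' => s'.reg 5 = (L (j + 1)).length ∧
        Holds (s'.arr 4) (offsets (L (j + 1))) ∧ Holds (s'.arr 5) ((L (j + 1)).flatten.map val))
        (Tri.ite (fun hb => ?_) fun hb => ?_) fun s' hs' _ => nil (by simpa using hs')
      · have hb : 2 ≤ (bits I.k j).length := by grind
        rw [if_pos ⟨hc, hb⟩] at hLs; refine asgv (v := (L j).length + 1) (by simp [e5]) (by omega)
          (stov (j := (L j).length + 1) (v := s2.reg 42) (by simp) (by simp) (by omega)
          (nil ⟨by simp [hLs], ?_, ?_⟩))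
        · rw [setArr_same, setReg_arr, e4, hLs, offsets_snoc, h42]
          have := h4.snoc ((L j).flatten.length + (bits I.k j).length)
          simpa [length_offsets] using this
        · rw [hLs]; simpa [setArr_arr'] using k5
      · have hb : ¬ 2 ≤ (bits I.k j).length := by simp_all
        rw [if_neg (fun h => hb h.2), List.append_nil] at hLs
        refine conseq (Tri.skip ?_ : Tri M .skip s2 1 _) (by omega) fun _ h => h; rw [hLs, e4]
        exact ⟨e5, h4, k5.left⟩
  · have hc : ¬ s1.arr 34 j ≠ 0 := by simpa [h41] using hc
    rw [if_neg (fun h => hc h.1), List.append_nil] at hLs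
    refine conseq (Tri.skip ?_ : Tri M .skip s1 1 _) (by omega) fun _ h => h; simp_all

end

/-- In the input and output formats the coercion of a list of vertices unfolds to a monadic bind;
this restores the plain map. -/
theorem coe_list {n : ℕ} (l : List (Fin n)) :
    (List.map (fun v => v) do let a ← l; pure (a : ℕ)) = l.map fun v : Fin n => (v : ℕ) := by
  simp [List.map_eq_flatMap]

section
variable {n k m : ℕ} {G : ℕ → Fin n} {T : ℕ → Prop} [DecidablePred T] {F : ℕ → Set (Fin n)}
  {t : ℕ → ℕ}

theorem mem_map_bits (hF : ∀ e, ∀ x < k, (t e).testBit x = true ↔ G x ∈ F e) (e : ℕ) :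
    {v | v ∈ (bits k (t e)).map G} = F e ∩ {v | ∃ x < k, G x = v} := by
  ext v; simp only [Set.mem_ofPred_eq, List.mem_map, mem_bits, Set.mem_inter_iff]; grind

theorem lists_marked (hG : ∀ x < k, ∀ y < k, G x = G y → x = y) (ht : ∀ e, t e < 2 ^ k)
    (hF : ∀ e, ∀ x < k, (t e).testBit x = true ↔ G x ∈ F e)
    (hT : ∀ Y < 2 ^ k, Y ≠ 0 → (T Y ↔ ∃ e < m, t e = Y)) :
    Lists (marked k G T (2 ^ k))
      {X | 2 ≤ X.ncard ∧ ∃ e < m, X = F e ∩ {v | ∃ x < k, G x = v}} := by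
  classical
  have hnd : ∀ Y, ((bits k Y).map G).Nodup := fun Y =>
    List.Nodup.map_on (fun x hx y hy h => hG x (mem_bits.1 hx).1 y (mem_bits.1 hy).1 h)
      (List.nodup_range.filter _)
  have hcard : ∀ Y, {v | v ∈ (bits k Y).map G}.ncard = (bits k Y).length := fun Y => by
    rw [← List.coe_toFinset, Set.ncard_coe_finset, toFinset_card_of_nodup (hnd Y),
      List.length_map]
  refine ⟨fun l hl => ?_, ?_, fun X => ?_⟩
  · obtain ⟨Y, -, rfl⟩ := List.mem_map.1 hl; exact hnd Y
  · rw [marked, List.map_map]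
    refine List.Nodup.map_on (fun Y hY Z hZ h => ?_) (List.nodup_range.filter _)
    refine eq_of_testBit (List.mem_range.1 (List.mem_filter.1 hY).1)
      (List.mem_range.1 (List.mem_filter.1 hZ).1) fun x hx => ?_
    have h1 : ∀ Y, G x ∈ {v | v ∈ (bits k Y).map G} ↔ Y.testBit x = true := fun Y => by
      simp only [Set.mem_ofPred_eq, List.mem_map, mem_bits]; grind
    grind
  · have hm : X ∈ (marked k G T (2 ^ k)).map (fun l => {v | v ∈ l}) ↔ ∃ Y,
        (Y < 2 ^ k ∧ T Y ∧ 2 ≤ (bits k Y).length) ∧ {v | v ∈ (bits k Y).map G} = X := by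
      rw [marked, List.map_map, List.mem_map]; simp
    rw [hm]; constructor
    · rintro ⟨h2, e, he, rfl⟩; rw [← mem_map_bits hF, hcard] at h2
      refine ⟨t e, ⟨ht e, (hT _ (ht e) ?_).2 ⟨e, he, rfl⟩, h2⟩, mem_map_bits hF e⟩; intro h0
      simp [h0, bits] at h2
    · rintro ⟨Y, ⟨hY, h1, h2⟩, rfl⟩; refine ⟨(hcard Y).ge.trans' h2, ?_⟩
      obtain ⟨e, he, rfl⟩ := (hT Y hY (fun h0 => by simp [h0, bits] at h2)).1 h1
      exact ⟨e, he, mem_map_bits hF e⟩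

end

/-- A bound for the time to write the output. -/
def outTime (k β : ℕ) : ℕ := 4 * k + 2 ^ k * (4 * k + 4 * 2 ^ k + 20) +
  k * (β * (4 * k + 14) + 10) + 2 ^ k * (9 * k + 18) + 30

section
variable {I : Hy} {col : ℕ → ℕ} {β M : ℕ} {s : Store} {σ : ℕ → Finset ℕ} {ctr : ℕ}
  {ℓ : ℕ → List ℕ} {τ : ℝ≥0∞}

theorem outputC_spec {G : ℕ → Fin I.n} {H : Hypergraph (Fin I.n)} (hB : Big I β M)
    (hT : Trie I β col σ ctr ℓ) (hs : Static I col σ ctr ℓ s)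
    (hg : ∀ x < I.k, s.arr 27 x = G x) (hgc : ∀ x < I.k, col (G x) = x)
    (hV : H.vertexSet = {v | ∃ x < I.k, G x = v})
    (hE : H.edgeSet = {X | 2 ≤ X.ncard ∧ ∃ e < I.m, X = {v : Fin I.n | (v : ℕ) ∈ I.ed e} ∩ H.vertexSet}) :
    Tri M outputC s (outTime I.k β) fun s' => Outputs s' H := by
  have hidx := hB.idx; have hk := hB.k_le
  have hgn : ∀ x < I.k, (G x : ℕ) < I.n := fun x _ => (G x).2
  have hinj : ∀ x < I.k, ∀ y < I.k, G x = G y → x = y := fun x hx y hy h => by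
    grind
  obtain ⟨s1, hs1d⟩ : ∃ s1, s1 = s.setReg 4 I.k := ⟨_, rfl⟩
  have hs1 : Static I col σ ctr ℓ s1 := hs.congr (by simp [hs1d]) (by simp [hs1d])
  have a27 : s1.arr 27 = s.arr 27 := by simp [hs1d]
  refine time (asgv (v := I.k) (by simp [hs.r0]) hk ?_)
    (T₁ := I.k * (1 + 3) + 3 + (2 ^ I.k * (4 * I.k + 4 * 2 ^ I.k + 20) + 3 +
      (I.k * (β * (4 * I.k + 14) + 10) + 3 + (2 ^ I.k * (9 * I.k + 18) + 9 + 1 + 1) + 1) + 1)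
      + 1 + 2) (by simp only [outTime]; omega)
  rw [← hs1d]
  refine cons (for_const I.k 1 (fun j s' => ∀ x < j, s'.arr 3 x = G x) hk rfl ?_ (by simp) ?_) ?_
  · intro j s' hf _; rw [ival_reg, hf.reg 0 rfl, hs1.r0]
  · intro x hx s2 hf2 h41 h3; have e27 : s2.arr 27 x = G x := by rw [hf2.arr 27 rfl, a27, hg x hx]
    have hlt := hgn x hx; have hv : (ld 27 (rg 41)).ival s2 = G x := by simp [h41, e27]
    refine store (by rw [hv]; omega) ?_; rw [hv, setReg_arr, setArr_same, ival_reg, h41]; grind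
  rintro s2 ⟨h3, -⟩ hf2; have hs2 := hs1.fr hf2 (by decide)
  have b27 : s2.arr 27 = s.arr 27 := hf2.ar a27
  refine cons (zetaC_spec hB hs2 (g := fun x => G x) (by simpa [b27] using hg) hgn hgc) ?_
  intro s3 h34 hf3; have hs3 := hs2.fr hf3 (by decide)
  have c27 : s3.arr 27 = s.arr 27 := hf3.ar b27
  refine cons (markC_spec hB hT hs3 (g := fun x => G x) (by simpa [c27] using hg) hgn h34) ?_
  intro s4 h34' hf4; have hs4 := hs3.fr hf4 (by decide)
  have d27 : s4.arr 27 = s.arr 27 := hf4.ar c27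
  refine cons (T₁ := 2 ^ I.k * (9 * I.k + 18) + 9) (T₂ := 1)
    (emitC_spec hB hs4 (G := G) (by simpa [d27] using hg)) ?_
  rintro s5 ⟨e5, e4, e5'⟩ hf5
  refine nil ⟨(List.range I.k).map G, marked I.k G (fun Y => s4.arr 34 Y ≠ 0) (2 ^ I.k),
    List.Nodup.map_on (fun x hx y hy h => hinj x (by simpa using hx) y (by simpa using hy) h)
      List.nodup_range, ?_, ?_, ?_, e5, ?_, e4, ?_⟩
  · simp_all
  · rw [hE, hV]; exact lists_marked hinj (t := I.tr fun x => G x) (fun e => maskOf_lt)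
      (fun e x hx => testBit_maskOf hx) h34'
  · rw [hf5.reg 4 rfl, hf4.reg 4 rfl, hf3.reg 4 rfl, hf2.reg 4 rfl]; simp [hs1d]
  · rw [coe_list, hf5.arr 3 rfl, hf4.arr 3 rfl, hf3.arr 3 rfl]; intro i hi; grind
  · rw [coe_list]; exact e5'

theorem sampleC_le (hB : Big I β M) (hT : Trie I β col σ ctr ℓ) (hR : Ready I M col σ ctr ℓ s)
    (hne : (I.sets col).Nonempty) {f : Store → ℝ≥0∞} {b : Finset ℕ → ℝ≥0∞}
    {H : Finset ℕ → Hypergraph (Fin I.n)}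
    (hV : ∀ W ∈ I.sets col, (H W).vertexSet = {v : Fin I.n | (v : ℕ) ∈ W})
    (hE : ∀ W ∈ I.sets col, (H W).edgeSet =
      {X | 2 ≤ X.ncard ∧ ∃ e < I.m, X = {v : Fin I.n | (v : ℕ) ∈ I.ed e} ∩ (H W).vertexSet})
    (hf : ∀ s', Ready I M col σ ctr ℓ s' → ∀ W ∈ I.sets col, Outputs s' (H W) → f s' ≤ b W) :
    ic M true τ sampleC f s ≤
      τ * (((I.k + 1) ^ (2 * I.k) * tryTime I.k β + outTime I.k β + 3 : ℕ) : ℝ≥0∞) +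
        (∑ W ∈ I.sets col, b W) / (I.sets col).card := by
  classical
  have hc : ((I.sets col).card : ℝ≥0∞) ≠ 0 := by exact_mod_cast hne.card_pos.ne'
  obtain ⟨c, hcd⟩ : ∃ c, c = τ * (outTime I.k β : ℝ≥0∞) := ⟨_, rfl⟩; rw [sampleC, ic_seq]
  refine (add_le_add_right (attemptC_le hB hT hR hne (f := ic M true τ outputC f)
    (b := fun W => c + b W) ?_) τ).trans (le_of_eq ?_)
  · intro s1 hR1 W hW h27; obtain ⟨hWn, hWi, hWk, -⟩ := mem_filter.1 hW
    rw [Finset.mem_powerset] at hWn; have hex : ∀ x < I.k, ∃ v ∈ W, col v = x := fun x hx => by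
      have : W.image col = rng I.k := by
        refine Finset.eq_of_subset_of_card_le (fun x hx => ?_) ?_
        · obtain ⟨v, hv, rfl⟩ := Finset.mem_image.1 hx
          exact mem_rng.2 (hT.col_lt v (mem_rng.1 (hWn hv)))
        · grind
      exact Finset.mem_image.1 (this ▸ mem_rng.2 hx)
    choose! g hg1 hg2 using hex
    -- The default is never used for a colour below `k`.
    let G : ℕ → Fin I.n := fun x => if h : g x < I.n then ⟨g x, h⟩ else ⟨0, I.n_pos⟩
    have hG : ∀ x < I.k, (G x : ℕ) = g x := fun x hx => by
      grind
    refine ((outputC_spec hB hT hR1.toStatic (G := G) (H := H W) ?_ ?_ ?_ (hE W hW)).fr true τ f (b W)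
      ?_).trans (le_of_eq (by rw [hcd]))
    · grind
    · simp_all
    · rw [hV W hW]; ext v; simp only [Set.mem_ofPred_eq]; constructor
      · intro hv; have hk := hT.col_lt v v.2; grind
      · grind
    · rintro s2 ⟨h1, h2⟩; exact hf s2 (hR1.fr h2 (by decide)) W hW h1
  · rw [sum_add_distrib, sum_const, nsmul_eq_mul, ENNReal.add_div, mul_comm ((I.sets col).card : ℝ≥0∞),
      ENNReal.mul_div_cancel_right hc (natCast_ne_top _), hcd]
    grind

end

/-! ## The hypergraph of an instance -/

/-- The hyperedge with index `e`. -/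
def Hy.set (I : Hy) (e : ℕ) : Set (Fin I.n) := {v | (v : ℕ) ∈ I.ed e}

/-- The instance `I` represents `H`. -/
structure Rep (I : Hy) (H : Hypergraph (Fin I.n)) : Prop where
  edges : H.edgeSet = I.set '' (rng I.m : Set ℕ)
  inj : Set.InjOn I.set (rng I.m : Set ℕ)
  verts : H.vertexSet = Set.univ

section
variable {I : Hy} {H : Hypergraph (Fin I.n)} {col : ℕ → ℕ} {β : ℕ}

theorem Hy.ncard_set (e : ℕ) : (I.set e).ncard = I.sz e := by
  have h : Fin.val '' I.set e = ((I.ed e).toFinset : Set ℕ) := by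
    ext v; simp only [Set.mem_image, List.coe_toFinset, Set.mem_ofPred_eq]
    exact ⟨fun ⟨v, h, e⟩ => e ▸ h, fun h => ⟨⟨v, Hy.ed_lt h⟩, h, rfl⟩⟩
  rw [← Set.ncard_image_of_injective _ Fin.val_injective, h, Set.ncard_coe_finset,
    toFinset_card_of_nodup (Hy.ed_nodup e), Hy.sz]

theorem Rep.of_lists {es : List (List (Fin I.n))} (hE : I.E = es.map (List.map Fin.val))
    (hl : Lists es H.edgeSet) (hv : H.vertexSet = Set.univ) : Rep I H := by
  have hm : I.m = (es.map fun l => {v | v ∈ l}).length := by simp [Hy.m, hE]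
  have hs : ∀ e (h : e < (es.map fun l => {v | v ∈ l}).length),
      I.set e = (es.map fun l => {v | v ∈ l})[e] := fun e h => by
    rw [List.length_map] at h; ext v; simp [Hy.set, Hy.ed, hE, h, Fin.val_inj]
  refine ⟨Set.ext fun X => ?_, fun e he e' he' h => ?_, hv⟩
  · rw [hl.2.2, List.mem_iff_getElem]; grind
  · simp only [Finset.coe_range, Set.mem_Iio, hm] at he he'; rw [hs e he, hs e' he'] at h
    exact hl.2.1.getElem_inj_iff.1 h

theorem Rep.ncard (hr : Rep I H) : H.edgeSet.ncard = I.m := by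
  rw [hr.edges, hr.inj.ncard_image, Set.ncard_coe_finset, card_range]

theorem Rep.size_eq (hr : Rep I H) : size H = ∑ e ∈ rng I.m, I.sz e := by
  rw [size, hr.edges, finsum_mem_image hr.inj, finsum_mem_coe_finset]
  exact sum_congr rfl fun e _ => Hy.ncard_set e

theorem Rep.deg (hr : Rep I H) (hN : IsNice H I.a β) (v : ℕ) : (I.hi v I.m).length ≤ β := by
  by_cases hv : v < I.n
  · have hmem : degree (upperPart H I.a) ⟨v, hv⟩ ∈ degree (upperPart H I.a) '' H.vertexSet :=
      ⟨_, hr.verts ▸ Set.mem_univ _, rfl⟩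
    refine le_trans ?_ ((le_csSup (Set.toFinite _).bddAbove hmem).trans hN)
    · have hnd : (I.hi v I.m).Nodup := List.nodup_range.filter _
      rw [← toFinset_card_of_nodup hnd, ← Set.ncard_coe_finset, degree]
      refine Set.ncard_le_ncard_of_injOn I.set (fun e he => ?_) (fun e he e' he' h => ?_)
      · obtain ⟨h1, h2, h3⟩ := Hy.mem_hi.1 (List.mem_toFinset.1 he)
        refine ⟨⟨?_, by rw [Hy.ncard_set]; exact h2⟩, h3⟩; rw [hr.edges]; grind
      · have h1 := (Hy.mem_hi.1 (List.mem_toFinset.1 he)).1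
        have h2 := (Hy.mem_hi.1 (List.mem_toFinset.1 he')).1
        exact hr.inj (by simpa using h1) (by simpa using h2) h
  · have : I.hi v I.m = [] := List.filter_eq_nil_iff.2 fun e _ => by
      simpa using fun _ h => hv (Hy.ed_lt h)
    simp [this]

/-- The set of vertices with the given numbers. -/
def Hy.fin (I : Hy) (W : Finset ℕ) : Set (Fin I.n) := {v | (v : ℕ) ∈ W}

theorem Rep.edgeSet_induced (hr : Rep I H) (U : Set (Fin I.n)) : (induced H U).edgeSet =
    {X | 2 ≤ X.ncard ∧ ∃ e < I.m, X = {v : Fin I.n | (v : ℕ) ∈ I.ed e} ∩ U} := by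
  ext X; simp only [induced, hr.edges, Set.exists_mem_image, Finset.coe_range, Set.mem_Iio]
  rfl

theorem Rep.adj_iff (hr : Rep I H) {U : Set (Fin I.n)} {u v : Fin I.n} (hu : u ∈ U) (hv : v ∈ U) :
    (gaifman (induced H U)).Adj u v ↔ u ≠ v ∧ (u : ℕ) ∈ I.Nb col v := by
  rw [Hy.nb_iff_adj v.2]; refine and_congr_right fun hne => ?_
  rw [Hypergraph.Adj, hr.edgeSet_induced]; constructor
  · grind
  · rintro ⟨e, h1, h2⟩; have he : e < I.m := Hy.sz_lt (List.length_pos_of_mem h1)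
    refine ⟨_, ⟨?_, e, he, rfl⟩, ⟨h2, hu⟩, h1, hv⟩
    exact (Set.one_lt_ncard_iff (Set.toFinite _)).2 ⟨u, v, ⟨h2, hu⟩, ⟨h1, hv⟩, hne⟩

/-- A closed set is stable along paths, and conversely the vertices reachable from a given one form
a closed set. -/
theorem Rep.conn_iff (hr : Rep I H) {W : Finset ℕ} (hW : W ⊆ rng I.n) (hne : W.Nonempty) :
    IsConnectedHypergraph (induced H (I.fin W)) ↔ Conn (I.Nb col) W := by
  classical
  have hn : ∀ v ∈ W, v < I.n := fun v hv => mem_rng.1 (hW hv)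
  have hadj : ∀ u v : I.fin W, ((gaifman (induced H (I.fin W))).induce (I.fin W)).Adj u v ↔
      (u : Fin I.n) ≠ v ∧ ((u : Fin I.n) : ℕ) ∈ I.Nb col v := fun u v => by
    rw [SimpleGraph.comap_adj]; exact hr.adj_iff u.2 v.2
  change ((gaifman (induced H (I.fin W))).induce (I.fin W)).Connected ↔ _; constructor
  · rintro hc S hS ⟨a, ha⟩ hcl; refine Finset.Subset.antisymm hS fun b hb => ?_
    have hab := hc.preconnected ⟨⟨a, hn a (hS ha)⟩, hS ha⟩ ⟨⟨b, hn b hb⟩, hb⟩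
    rw [SimpleGraph.reachable_iff_reflTransGen] at hab
    have key : ∀ y : I.fin W, Relation.ReflTransGen
        ((gaifman (induced H (I.fin W))).induce (I.fin W)).Adj ⟨⟨a, hn a (hS ha)⟩, hS ha⟩ y →
        ((y : Fin I.n) : ℕ) ∈ S := fun y hy => by
      induction hy with
      | refl => exact ha
      | @tail y z _ h ih => exact hcl _ ih _ z.2 ((hadj y z).1 h).2
    grind
  · intro hc; obtain ⟨a, ha⟩ := hne
    have hS := hc (W.filter fun b => ∃ h : b ∈ W, ((gaifman (induced H (I.fin W))).induce
      (I.fin W)).Reachable ⟨⟨a, hn a ha⟩, ha⟩ ⟨⟨b, hn b h⟩, h⟩) (Finset.filter_subset _ _)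
      ⟨a, mem_filter.2 ⟨ha, ha, SimpleGraph.Reachable.refl _⟩⟩ ?_
    · rw [SimpleGraph.connected_iff_exists_forall_reachable]
      refine ⟨⟨⟨a, hn a ha⟩, ha⟩, fun ⟨b, hb⟩ => ?_⟩; have hb' : (b : ℕ) ∈ W := hb; simp_all
    · intro x hx y hy hxy; obtain ⟨hx, hx', h⟩ := mem_filter.1 hx; refine mem_filter.2 ⟨hy, hy, ?_⟩
      by_cases hne : x = y
      · simp_all
      · refine h.trans (SimpleGraph.Adj.reachable ((hadj _ _).2 ⟨fun h => hne (Fin.ext_iff.1 h), hxy⟩))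

theorem Hy.fin_injOn : Set.InjOn I.fin {W | W ⊆ rng I.n} := fun W hW W' hW' h => by
  ext v; constructor
  · intro hv; exact (Set.ext_iff.1 h ⟨v, mem_rng.1 (hW hv)⟩).1 hv
  · intro hv; exact (Set.ext_iff.1 h ⟨v, mem_rng.1 (hW' hv)⟩).2 hv

theorem Hy.sets_subset {W : Finset ℕ} (hW : W ∈ I.sets col) : W ⊆ rng I.n := by
  classical
  exact Finset.mem_powerset.1 (mem_filter.1 hW).1

theorem Rep.colorfulSets_eq (hr : Rep I H) {c : Fin I.n → Fin I.k} (hc : ∀ v : Fin I.n, col v = c v) :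
    colorfulSets H I.k c = I.fin '' (I.sets col : Set (Finset ℕ)) := by
  classical
  have hk := I.two_le_k
  have key : ∀ W ⊆ rng I.n, I.fin W ∈ colorfulSets H I.k c ↔ W ∈ I.sets col := by
    intro W hW; have hcard : (I.fin W).ncard = W.card := by
      rw [← Set.ncard_image_of_injective _ Fin.val_injective, ← Set.ncard_coe_finset]; congr 1
      ext v; exact ⟨fun ⟨v, h, e⟩ => e ▸ h, fun h => ⟨⟨v, mem_rng.1 (hW h)⟩, h, rfl⟩⟩
    have hinj : InjOn c (I.fin W) ↔ InjOn col W := by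
      constructor
      · intro h u hu v hv huv; have hu' := mem_rng.1 (hW hu); have hv' := mem_rng.1 (hW hv)
        refine Fin.ext_iff.1 (@h ⟨u, hu'⟩ hu ⟨v, hv'⟩ hv (Fin.ext ?_)); grind
      · exact fun h u hu v hv huv => Fin.ext (h hu hv (by rw [hc, hc, huv]))
    rw [Hy.sets, mem_filter, Finset.mem_powerset, ← hinj, ← hcard]
    refine ⟨fun ⟨_, h1, h2, h3⟩ => ⟨hW, h3, h1, (hr.conn_iff hW (card_pos.1 (by omega))).1 h2⟩,
      fun ⟨_, h3, h1, h2⟩ => ⟨hr.verts ▸ Set.subset_univ _, h1,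
        (hr.conn_iff hW (card_pos.1 (by omega))).2 h2, h3⟩⟩
  refine Set.Subset.antisymm (fun U hU => ?_) fun U ⟨W, hW, e⟩ => e ▸ (key W (Hy.sets_subset hW)).2 hW
  have hU' : I.fin (U.toFinset.image Fin.val) = U := by ext v; simp [Hy.fin, Fin.val_inj]
  grind

/-- A store shows the vertex set of what it outputs, so the outputs for different sets are disjoint
events. -/
theorem Outputs.vertexSet_eq {n : ℕ} {s : Store} {G G' : Hypergraph (Fin n)} (h : Outputs s G)
    (h' : Outputs s G') : G.vertexSet = G'.vertexSet := by
  obtain ⟨us, -, -, h1, -, h2, -, h3, -⟩ := h; obtain ⟨us', -, -, h1', -, h2', -, h3', -⟩ := h'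
  rw [coe_list] at h3 h3'; rw [← h1, ← h1']; have : us = us' := by
    refine List.map_injective_iff.2 Fin.val_injective (List.ext_getElem ?_ fun i hi hi' => ?_)
    · simp_all
    · exact (h3 i hi).symm.trans (h3' i hi')
  rw [this]

theorem flatten_getD (E : List (List ℕ)) : ∀ e i, i < (E.getD e []).length →
    E.flatten.getD (∑ j ∈ rng e, (E.getD j []).length + i) 0 = (E.getD e []).getD i 0 := by
  induction E with
  | nil => simp
  | cons l E ih =>
    rintro (_ | e) i hi
    · simp only [List.getD_cons_zero, Finset.range_zero, Finset.sum_empty, zero_add] at hi ⊢; grind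
    · simp only [List.getD_cons_succ] at hi ⊢
      rw [Finset.sum_range_succ', List.flatten_cons, List.getD_append_right _ _ _ _ (by simp; omega),
        ← ih e i hi]
      congr 1; simp; omega

theorem offsets_getD {V : Type*} (es : List (List V)) (e : ℕ) (h : e ≤ es.length) :
    (offsets es).getD e 0 = ∑ j ∈ rng e, (es.getD j []).length := by
  rw [getD_eq_getElem _ _ (by rw [length_offsets]; omega), offsets_getElem]
  induction e with
  | zero => simp
  | succ e ih =>
    rw [sum_range_succ, ← ih (by omega), List.take_add_one, List.getElem?_eq_getElem h,
      getD_eq_getElem _ _ h, List.map_append, List.sum_append]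
    simp

end

/-! ## Bounds -/

section
variable {I : Hy} {col : ℕ → ℕ} {β : ℕ}

theorem sum_le_of_pow {k N : ℕ} (hk : 2 ≤ k) : N * N ≤ N ^ k := by
  rcases Nat.eq_zero_or_pos N with rfl | h
  · simp
  · rw [← sq]; exact pow_le_pow_right h hk

/-- A power of this number bounds the numbers that occur. -/
def Hy.base (I : Hy) (β : ℕ) : ℕ := 2 ^ β * (I.a + I.n + I.m + 2) ^ I.k

theorem Hy.base_facts (I : Hy) (β : ℕ) : 9 * 2 ^ β ≤ I.base β ∧ 2 ^ I.k ≤ I.base β ∧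
    (I.n + 1) ^ I.k ≤ I.base β ∧ 2 ^ β * (I.a + I.n + I.m + 2) ≤ I.base β ∧
    (I.a + I.n + I.m + 2) * (I.a + I.n + I.m + 2) ≤ I.base β := by
  have hn := I.n_pos; obtain ⟨N, hN⟩ : ∃ N, N = I.a + I.n + I.m + 2 := ⟨_, rfl⟩
  have h1 : N * N ≤ N ^ I.k := sum_le_of_pow I.two_le_k
  have h2 : 3 * 3 ≤ N * N := Nat.mul_le_mul (by omega) (by omega)
  have h3 : N ^ I.k ≤ I.base β := hN ▸ Nat.le_mul_of_pos_left _ (by positivity)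
  have h4 : ∀ x ≤ N ^ I.k, 2 ^ β * x ≤ I.base β := fun x hx => by
    rw [Hy.base, ← hN]; exact Nat.mul_le_mul le_rfl hx
  rw [← hN]; refine ⟨?_, (pow_le_pow_left (by omega) _).trans h3,
    (pow_le_pow_left (by omega) _).trans h3, h4 _ ((Nat.le_mul_self N).trans h1), h1.trans h3⟩
  rw [mul_comm]; exact h4 9 (by omega)

/-- Every number to be bounded is at most a product of at most five factors `base`; the sixth power
leaves room. -/
theorem Hy.big (hdeg : ∀ v, (I.hi v I.m).length ≤ β) : Big I β (I.base β ^ 6) := by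
  have hn := I.n_pos; obtain ⟨h1, h2, h3, h4, h5⟩ := I.base_facts β
  obtain ⟨B, hB⟩ : ∃ B, B = I.base β := ⟨_, rfl⟩; obtain ⟨P, hP⟩ : ∃ P, P = 2 ^ β := ⟨_, rfl⟩
  have hPβ : β + 1 ≤ P := hP ▸ lt_two_pow_self
  obtain ⟨N, hN⟩ : ∃ N, N = I.a + I.n + I.m + 2 := ⟨_, rfl⟩; rw [← hB] at h1 h2 h3 h4 h5
  rw [← hP] at h1; rw [← hP, ← hN] at h4; rw [← hN] at h5
  have hNB : N ≤ B := (Nat.le_mul_self N).trans h5; have hk : I.k ≤ B := lt_two_pow_self.le.trans h2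
  have up : ∀ {x} j, x ≤ B ^ j → j ≤ 6 → x ≤ I.base β ^ 6 := fun j h hj =>
    hB ▸ h.trans (pow_le_pow_right (by omega) hj)
  have up1 : ∀ {x}, x ≤ B → x ≤ I.base β ^ 6 := fun h => up 1 (by rwa [pow_one]) (by omega)
  have m2 : ∀ {x y}, x ≤ B → y ≤ B → x * y ≤ B ^ 2 := fun hx hy =>
    (Nat.mul_le_mul hx hy).trans (sq B).ge
  have m3 : ∀ {x y} j, x ≤ B ^ j → y ≤ B → x * y ≤ B ^ (j + 1) := fun j hx hy =>
    (Nat.mul_le_mul hx hy).trans (pow_succ B j).ge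
  have hPN : I.n * P + P * 2 ≤ B := by
    refine le_trans (le_of_eq (by ring)) ((Nat.mul_le_mul (le_refl P) (show I.n + 2 ≤ N by omega)).trans h4)
  have h12 : 12 * P ≤ B ^ 2 := by
    rw [sq]; exact (Nat.mul_le_mul (by omega : 12 ≤ 2 * 9) (by omega)).trans
      (Nat.mul_le_mul (by omega : 2 * 9 ≤ B * 2) (le_refl P) |>.trans (by nlinarith))
  refine ⟨hdeg, up1 (by omega), up1 (by nlinarith),
    up 2 (m2 (by omega) (by omega)) (by omega), up 2 (m2 (by omega) (by omega)) (by omega),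
    up 3 (m3 2 (m2 hk hk) hk) (by omega), up 2 (m2 h2 h2) (by omega), up1 (by omega),
    up1 (by rw [← hP]; omega), up 2 (m2 (by rw [← hP]; omega) h2) (by omega),
    up 4 (m3 3 (m3 2 ((show 4 * I.n + 1 ≤ 4 * N by omega).trans (m2 (by omega) hNB))
      (by rw [Hy.L]; omega)) h2) (by omega), ?_⟩
  rw [mul_comm 2, pow_mul, sq, ← mul_assoc, ← mul_assoc, ← hP]
  exact up 5 (m3 4 (m3 3 (m3 2 ((show _ ≤ 12 * P by omega).trans h12) (by omega)) h3) h3) (by omega)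

theorem Hy.input {es : List (List (Fin I.n))} (hE : I.E = es.map (List.map Fin.val)) :
    Start I (inputStore I.k I.a I.n es) ∧ Bounded (I.base β ^ 6) (inputStore I.k I.a I.n es) := by
  have hsz : ∀ e, (es.getD e []).length = I.sz e := fun e => by
    rw [Hy.sz, Hy.ed, hE]; grind
  have hm : es.length = I.m := by rw [Hy.m, hE, List.length_map]
  have hoff : ∀ e ≤ I.m, (offsets es).getD e 0 = I.off e := fun e he => by
    rw [offsets_getD _ _ (by omega), Hy.off, sum_congr rfl fun e _ => hsz e]
  have hfl : (List.map (fun v => v) do let a ← es.flatten; pure (a : ℕ)) = I.E.flatten := by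
    rw [coe_list, hE, List.map_flatten]
  obtain ⟨h1, h2, h3, h4, h5⟩ := I.base_facts β; have hN := Nat.le_mul_self (I.a + I.n + I.m + 2)
  have hk := (lt_two_pow_self (n := I.k)).le
  have hup : ∀ {x}, x ≤ I.base β → x ≤ I.base β ^ 6 := fun h => h.trans (Nat.le_self_pow (by omega) _)
  refine ⟨⟨⟨by simp [inputStore], by simp [inputStore], by simp [inputStore], by simp [inputStore, hm],
    by simpa [inputStore] using hoff, fun e i hi => ?_⟩, fun a ha => ?_, by simp [inputStore]⟩,
    fun x => hup ?_, fun b i => hup ?_⟩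
  · have := flatten_getD I.E e i hi; simp only [inputStore, hfl]; exact this
  · funext i; simp [inputStore, show a ≠ 0 by omega, show a ≠ 1 by omega]
  · simp only [inputStore, hm]; grind
  · simp only [inputStore, hfl]; split_ifs
    · rcases le_or_gt i I.m with h | h
      · rw [hoff i h]
        refine le_trans (sum_le_card_nsmul _ _ I.n fun e _ => Hy.sz_le e) (le_trans ?_ h5)
        rw [card_range]; exact Nat.mul_le_mul (by omega) (by omega)
      · rw [List.getD_eq_default _ _ (by rw [length_offsets]; omega)]; omega
    · grind
    · omega

theorem Hy.sum_ed (p : ℕ → Prop) [DecidablePred p] (c : ℕ → ℕ) :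
    ∑ v ∈ rng I.n, ∑ e ∈ rng I.m, (if p e ∧ v ∈ I.ed e then c e else 0) =
      ∑ e ∈ rng I.m, if p e then I.sz e * c e else 0 := by
  rw [sum_comm]; refine sum_congr rfl fun e _ => ?_
  have h : (rng I.n).filter (fun v => v ∈ I.ed e) = (I.ed e).toFinset := by
    ext v; simpa using fun h => Hy.ed_lt h
  split_ifs with hp
  · simp only [hp, true_and]
    rw [← sum_filter, h, sum_const, toFinset_card_of_nodup (Hy.ed_nodup e)]
    rfl
  · simp [hp]

theorem Hy.length_hi (v : ℕ) : (I.hi v I.m).length =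
    ∑ e ∈ rng I.m, if I.a < I.sz e ∧ v ∈ I.ed e then 1 else 0 := by
  rw [← card_filter, Hy.hi, ← toFinset_card_of_nodup (List.nodup_range.filter _)]; congr 1; ext e
  simp

theorem Hy.sum_mem_le : ∑ id ∈ rng I.L, (I.mem col id).card ≤
    ∑ v ∈ rng I.n, (I.hi v I.m).length +
      ∑ e ∈ rng I.m, (if I.a < I.sz e then 0 else I.sz e * I.sz e) + I.n := by
  classical
  rw [Hy.L, sum_range_succ, Finset.sum_range_add]; refine Nat.add_le_add (Nat.add_le_add ?_ ?_) ?_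
  · simp only [Hy.length_hi]; rw [Hy.sum_ed (fun e => I.a < I.sz e) fun _ => 1]
    refine sum_le_sum fun e he => ?_; rw [Hy.mem, if_pos (mem_rng.1 he)]; split_ifs
    · rw [mul_one]; exact List.toFinset_card_le _
    · simp
  · have := Hy.sum_ed (I := I) (fun e => ¬ I.a < I.sz e) I.sz; simp only [ite_not] at this
    rw [← this]; refine sum_le_sum fun v hv => ?_; have hv := mem_rng.1 hv
    rw [Hy.mem, if_neg (by omega), if_neg (by omega), ← sum_filter]
    refine (Finset.card_le_card (t := ((rng I.m).filter fun e => ¬ I.a < I.sz e ∧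
      v ∈ I.ed e).biUnion fun e => (I.ed e).toFinset) fun u hu => ?_).trans
      (Finset.card_biUnion_le.trans (sum_le_sum fun e _ => List.toFinset_card_le _))
    obtain ⟨e, he, h1, h2, h3⟩ := (mem_filter.1 hu).2.1; rw [Nat.add_sub_cancel_left] at h2
    exact Finset.mem_biUnion.2 ⟨e, mem_filter.2 ⟨mem_rng.2 he, h1, h2⟩,
      List.mem_toFinset.2 h3⟩
  · rw [Hy.mem, if_neg (by omega), if_pos rfl]; grind

/-- All terms are compared with the claimed bound `R`: the trie and the counting with `2 ^ β * n`,
the subsets of small hyperedges with `α ^ k * |E|` since `(α + 1) ^ k ≤ 2 ^ k * α ^ k` for `α > 0`,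
and the pairs in small hyperedges with the last term. -/
theorem Hy.build_time (hdeg : ∀ v, (I.hi v I.m).length ≤ β)
    (h0 : ∀ e < I.m, ∀ e' < I.m, I.sz e = 0 → I.sz e' = 0 → e = e') :
    ∃ W, (∀ col, ∑ id ∈ rng I.L, (I.mem col id).card ≤ W) ∧
      20 * I.k + 8 * I.n + prepTime I β W + 30 ≤ 2 ^ (7 * I.k) *
        (2 ^ β * I.n + I.a ^ I.k * I.m + I.a ^ 2 * β * ∑ e ∈ rng I.m, I.sz e) := by
  have hn := I.n_pos; have hk := I.two_le_k; obtain ⟨K, hK⟩ : ∃ K, K = 2 ^ I.k := ⟨_, rfl⟩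
  have hkK : I.k ≤ K := hK ▸ lt_two_pow_self.le; have hβ : β + 1 ≤ 2 ^ β := lt_two_pow_self
  obtain ⟨R, hR⟩ : ∃ R, R = 2 ^ β * I.n + I.a ^ I.k * I.m +
    I.a ^ 2 * β * ∑ e ∈ rng I.m, I.sz e := ⟨_, rfl⟩
  have hnR : 2 ^ β * I.n ≤ R := by omega
  -- `A` is `α ^ k`, except for `α = 0`: then the second term of `R` vanishes and the number of
  -- hyperedges must be paid for by `2 ^ β * n`.
  obtain ⟨A, hA1, hAR, hA⟩ : ∃ A, 1 ≤ A ∧ I.m * A ≤ R ∧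
      ∀ e, ¬ I.a < I.sz e → I.sz e * I.sz e ≤ A ∧ (I.sz e + 1) ^ I.k ≤ K * A := by
    rcases Nat.eq_zero_or_pos I.a with ha | ha
    · refine ⟨1, le_rfl, ?_, fun e he => ?_⟩
      · have h1 : ∑ v ∈ rng I.n, (I.hi v I.m).length ≤ I.n * β :=
          (sum_le_card_nsmul _ _ _ fun v _ => hdeg v).trans (by simp)
        simp only [Hy.length_hi] at h1; rw [Hy.sum_ed (fun e => I.a < I.sz e) fun _ => 1, ha] at h1
        have h2 : ((rng I.m).filter fun e => I.sz e = 0).card ≤ 1 :=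
          Finset.card_le_one.2 fun e he e' he' => by grind
        -- Every nonempty hyperedge is large, so incidences bound their number by `n * β`; one empty
        -- hyperedge may be added.
        rw [card_filter] at h2; have h3 : I.m ≤ I.n * β + 1 := by
          refine le_trans ?_ (Nat.add_le_add h1 h2); rw [← sum_add_distrib]
          refine (card_range I.m).symm.trans_le ?_; rw [card_eq_sum_ones]
          refine sum_le_sum fun e _ => ?_; grind
        have h4 : I.n * (β + 1) ≤ 2 ^ β * I.n := by rw [mul_comm]; exact Nat.mul_le_mul hβ le_rfl
        linarith
      · have : I.sz e = 0 := by omega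
        simp only [this, zero_add, one_pow]; omega
    · refine ⟨I.a ^ I.k, Nat.one_le_pow _ _ ha, by rw [mul_comm]; omega, fun e he => ⟨?_, ?_⟩⟩
      · exact (Nat.mul_le_mul (by omega) (by omega)).trans (sum_le_of_pow hk)
      · rw [hK, ← mul_pow]; exact pow_le_pow_left (by omega) _
  have hn1 : I.n ≤ R := (Nat.le_mul_of_pos_left _ (by omega)).trans hnR
  have hm1 : I.m ≤ R := (Nat.le_mul_of_pos_right _ hA1).trans hAR
  have hlow : ∀ f : ℕ → ℕ, ∀ c, (∀ e, ¬ I.a < I.sz e → f e ≤ c * A) →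
      ∑ e ∈ rng I.m, (if I.a < I.sz e then 0 else f e) ≤ c * R := fun f c hf => by
    refine (sum_le_card_nsmul _ _ (c * A) fun e _ => ?_).trans ?_
    · grind
    · rw [card_range, smul_eq_mul, mul_left_comm]; exact Nat.mul_le_mul le_rfl hAR
  have hD : ∀ f : ℕ → ℕ, (∀ v, f v ≤ 2 ^ β) → ∑ v ∈ rng I.n, f v ≤ R := fun f hf => by
    refine (sum_le_card_nsmul _ _ _ fun v _ => hf v).trans ?_; grind
  have hD1 := hD _ fun v => pow_le_pow_right (show 0 < 2 by omega) (hdeg v)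
  have hD2 := hD _ fun v => (hdeg v).trans (by omega)
  have hS0 := hlow (fun e => I.sz e * I.sz e) 1 fun e h => by rw [one_mul]; exact (hA e h).1
  have hS1 : ∑ e ∈ rng I.m,
      (if I.a < I.sz e then 0 else I.sz e * I.sz e * (2 * β + 28)) ≤ 30 * R := by
    have h1 : ∑ e ∈ rng I.m, (if I.a < I.sz e then 0 else I.sz e * I.sz e * β) ≤ R := by
      refine le_trans (sum_le_sum fun e _ => ?_) (le_trans (mul_sum _ _ _).ge
        (show I.a ^ 2 * β * ∑ e ∈ rng I.m, I.sz e ≤ R by omega))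
      split_ifs with h
      · omega
      -- A nonempty small hyperedge satisfies `|e| ^ 2 ≤ α ^ 2 ≤ α ^ 2 * |e|`.
      · rw [mul_right_comm (I.a ^ 2)]; refine Nat.mul_le_mul ?_ le_rfl
        have h1 : I.sz e * I.sz e ≤ I.a * I.a := Nat.mul_le_mul (by omega) (by omega)
        rcases Nat.eq_zero_or_pos (I.sz e) with h0 | h0
        · grind
        · rw [sq]; exact h1.trans (Nat.le_mul_of_pos_right _ h0)
    have h2 : ∑ e ∈ rng I.m, (if I.a < I.sz e then 0 else I.sz e * I.sz e * (2 * β + 28)) =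
        2 * ∑ e ∈ rng I.m, (if I.a < I.sz e then 0 else I.sz e * I.sz e * β) +
        28 * ∑ e ∈ rng I.m, (if I.a < I.sz e then 0 else I.sz e * I.sz e) := by
      rw [mul_sum, mul_sum, ← sum_add_distrib]; refine sum_congr rfl fun e _ => ?_; grind
    omega
  have hS2 := hlow (fun e => (I.sz e + 1) ^ I.k * (17 * I.k + 23)) (K * (17 * K + 23)) fun e h => by
    rw [mul_right_comm]; exact Nat.mul_le_mul (hA e h).2 (by omega)
  refine ⟨3 * R, fun col => Hy.sum_mem_le.trans (by omega), ?_⟩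
  rw [← hR, prepTime, sum_add_distrib, sum_add_distrib, sum_add_distrib, ← hK]
  simp only [sum_const, card_range, smul_eq_mul, Hy.L]
  have hK4 : 4 ≤ K := hK ▸ pow_le_pow_right (show 0 < 2 by omega) hk
  -- Two of the seven factors `2 ^ k` are `K * K`; the other five are at least `2 ^ 10` because `k ≥
  -- 2`.
  have hKK : 1024 * (K * K * R) ≤ 2 ^ (7 * I.k) * R := by
    rw [show 7 * I.k = 5 * I.k + (I.k + I.k) by ring, pow_add, pow_add, ← hK, mul_assoc, mul_assoc, mul_assoc]
    exact Nat.mul_le_mul (pow_le_pow_right (show 0 < 2 by omega) (show 10 ≤ 5 * I.k by omega)) le_rfl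
  refine le_trans ?_ hKK; generalize 2 ^ (7 * I.k) = z
  calc _ ≤ 20 * K + 8 * R + (4 * (K * K) + 200 + 28 * R + 10 * R + 43 * R + (30 * R + R * 15) +
        (K * (17 * K + 23) * R + R * (5 * K) + R * 20) + K * (18 * R + R * (4 * K + 40) +
        60 * (3 * R) + 40 * (R + R + 1) + 20)) + 30 := by gcongr
    _ ≤ _ := by
      have h1 : 1 ≤ R := by omega
      have h2 : K * R ≤ K * K * R := Nat.mul_le_mul (Nat.le_mul_self K) le_rfl
      have h3 : K * K ≤ K * K * R := Nat.le_mul_of_pos_right _ h1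
      have h4 : K ≤ K * K := Nat.le_mul_self K
      have h5 : R ≤ K * R := Nat.le_mul_of_pos_left _ (by omega); linarith

/-- A bound for the expected time of a call. -/
theorem sample_time {k β n : ℕ} (hk : 2 ≤ k) (hn : 2 ≤ n) :
    ((((k + 1) ^ (2 * k) * tryTime k β + outTime k β + 3 : ℕ)) : ℝ) ≤
      (k : ℝ) ^ (13 * k) * ((β : ℝ) ^ 2 + Real.log n) := by
  obtain ⟨K, hK⟩ : ∃ K, K = 2 ^ k := ⟨_, rfl⟩; obtain ⟨b, hb⟩ : ∃ b, b = β + 1 := ⟨_, rfl⟩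
  have hkK : k ≤ K := hK ▸ lt_two_pow_self.le; have hb1 : 1 ≤ b := by omega
  have hK1 : 1 ≤ K := by omega
  have hbb : b ≤ b * b := Nat.le_mul_self b
  have y1 : K * K ≤ K * K * K := Nat.le_mul_of_pos_right _ hK1
  have y2 : K ≤ K * K := Nat.le_mul_self K
  have y3 : K * K * K ≤ K * K * K * (b * b) := Nat.le_mul_of_pos_right _ (Nat.mul_pos hb1 hb1)
  have y4 : K * (b * b) ≤ K * K * K * (b * b) := Nat.mul_le_mul (y2.trans y1) le_rfl
  have y5 : K * K * b ≤ K * K * K * (b * b) := Nat.mul_le_mul y1 hbb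
  have y6 : K * b ≤ K * (b * b) := Nat.mul_le_mul le_rfl hbb
  have h1 : tryTime k β ≤ 193 * (K * K * K * (b * b)) := by
    have e1 : chooseTime β ≤ 90 * (b * b) := by simp only [chooseTime, hb]; nlinarith
    have e2 : growTime k β ≤ (90 * (b * b) + 6 * K + 60) * K := by
      rw [growTime, ← hK]; exact Nat.mul_le_mul (by omega) le_rfl
    have e3 : k * k * k * (2 * β + 26) ≤ K * K * K * (26 * (b * b)) := by gcongr; omega
    rw [tryTime]; linarith
  have h2 : outTime k β ≤ 117 * (K * K * K * (b * b)) := by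
    have : outTime k β ≤ 4 * K + K * (4 * K + 4 * K + 20) + K * (b * (4 * K + 14) + 10) +
        K * (9 * K + 18) + 30 := by rw [outTime, ← hK]; gcongr; omega
    linarith
  -- The exponent is `4 + 3 + 6`: for the number of attempts, for `2 ^ (3 * k)`, and for the
  -- numerical constant. The factor `4` anticipates `(β + 1) ^ 2 ≤ 4 * (β ^ 2 + ln n)`.
  have h3 : ((k + 1) ^ (2 * k) * tryTime k β + outTime k β + 3) * 4 ≤ k ^ (13 * k) * (b * b) := by
    obtain ⟨P, hP⟩ : ∃ P, P = (k + 1) ^ (2 * k) := ⟨_, rfl⟩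
    have p1 : 1 ≤ P := hP ▸ Nat.one_le_pow _ _ (by omega); have p2 : P ≤ k ^ (4 * k) := by
      rw [hP, show 4 * k = 2 * (2 * k) by ring, pow_mul k]; exact pow_le_pow_left (by nlinarith) _
    have p3 : K * K * K ≤ k ^ (3 * k) := by
      have : K ≤ k ^ k := hK ▸ pow_le_pow_left hk _
      rw [show 3 * k = k + k + k by ring, pow_add, pow_add]; gcongr
    have p4 : 2 ^ 11 ≤ k ^ (6 * k) := (pow_le_pow_left hk 11).trans
      (pow_le_pow_right (by omega) (by omega))
    have p5 : P * tryTime k β ≤ P * (193 * (K * K * K * (b * b))) := Nat.mul_le_mul le_rfl h1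
    have p6 : K * K * K * (b * b) ≤ P * (K * K * K * (b * b)) := Nat.le_mul_of_pos_left _ p1
    rw [← hP]
    calc _ ≤ 2 ^ 11 * P * (K * K * K) * (b * b) := by linarith
      _ ≤ k ^ (6 * k) * k ^ (4 * k) * k ^ (3 * k) * (b * b) := by gcongr
      _ = _ := by rw [← pow_add, ← pow_add]; ring_nf
  have h4 : (((k + 1) ^ (2 * k) * tryTime k β + outTime k β + 3 : ℕ) : ℝ) * 4 ≤
      (k : ℝ) ^ (13 * k) * ((β + 1) * (β + 1)) := by
    rw [hb] at h3; exact_mod_cast h3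
  -- With `n ≥ 2` the logarithm absorbs what remains of the cost for `β = 0`.
  have h5 : (1 / 2 : ℝ) ≤ Real.log n :=
    (by linarith [Real.log_two_gt_d9] : (1 / 2 : ℝ) ≤ Real.log 2).trans
      (Real.log_le_log (by norm_num) (by exact_mod_cast hn))
  have h6 : (0 : ℝ) ≤ (k : ℝ) ^ (13 * k) := by positivity
  nlinarith [mul_le_mul_of_nonneg_left (show ((β : ℝ) + 1) * (β + 1) ≤ 4 * ((β : ℝ) ^ 2 + Real.log n)
    by nlinarith [sq_nonneg ((β : ℝ) - 1)]) h6]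

end

/-- The two upper bounds add up to `1`, so neither can be strict. -/
theorem eq_inv_of_le {N : ℕ} (hN : N ≠ 0) {x y : ℝ≥0∞} (hx : x ≤ 1 / N)
    (hy : y ≤ ((N - 1 : ℕ) : ℝ≥0∞) / N) (h : 1 ≤ x + y) : x = (N : ℝ≥0∞)⁻¹ := by
  have h0 : (N : ℝ≥0∞) ≠ 0 := by exact_mod_cast hN
  have ht := natCast_ne_top N; rw [one_div] at hx; refine le_antisymm hx ?_
  have h1 : (1 : ℝ≥0∞) = (N : ℝ≥0∞)⁻¹ + ((N - 1 : ℕ) : ℝ≥0∞) / N := by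
    rw [← one_div, ENNReal.div_add_div_same, ← Nat.cast_one, ← Nat.cast_add,
      show 1 + (N - 1) = N by omega, Nat.cast_one, ENNReal.div_self h0 ht]
  have h2 : ((N - 1 : ℕ) : ℝ≥0∞) / N ≠ ⊤ := ENNReal.div_ne_top (natCast_ne_top _) h0
  refine (ENNReal.add_le_add_iff_right h2).1 ?_; rw [← h1]; exact h.trans (add_le_add_right hy x)

/-! ### The two phases on the machine -/

section
variable {I : Hy} {β w : ℕ} {H : Hypergraph (Fin I.n)} {es : List (List (Fin I.n))} {s : Store}

theorem Tri.ic_zero {M T : ℕ} {P : Cmd} {Q : Store → Prop} (h : Tri M P s T Q) (b : Bool) :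
    ic M b 1 P 0 s ≤ T := by
  simpa using h b 1 0 0 fun _ _ => le_rfl

/-- Stored numbers are at most `base ^ 6` and expressions have size at most `40`, so all values are
at most `base ^ 240`, strictly below `base ^ 241`. -/
theorem Hy.size_lt (hw : I.base β ^ 241 ≤ 2 ^ w) {P : Cmd} (hP : P.size ≤ 40) :
    (I.base β ^ 6) ^ P.size < 2 ^ w := by
  have h := (I.base_facts β).1; have h2 := two_pow_pos β; rw [← pow_mul]
  exact (Nat.pow_lt_pow_right (by omega) (by omega)).trans_le hw

/-- The values `1` and `0` on and off the colouring bound its probability, the values `0` and `1`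
that of the complement. -/
theorem Hy.coloring (hdeg : ∀ v, (I.hi v I.m).length ≤ β) (hE : I.E = es.map (List.map Fin.val))
    (hw : I.base β ^ 241 ≤ 2 ^ w) {W : ℕ}
    (hW : ∀ col, ∑ id ∈ rng I.L, (I.mem col id).card ≤ W) (c : Fin I.n → Fin I.k) :
    haltProb w buildC (inputStore I.k I.a I.n es) {s | HasColoring s c} =
      ((I.k : ℝ≥0∞) ^ I.n)⁻¹ := by
  classical
  have hk := I.two_le_k; obtain ⟨hS, hb⟩ := Hy.input (β := β) hE; have hB := Hy.big hdeg
  have hP := Hy.size_lt hw size_buildC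
  obtain ⟨cN, hcN⟩ : ∃ cN : ℕ → ℕ, ∀ v : Fin I.n, cN v = c v :=
    ⟨fun v => if h : v < I.n then c ⟨v, h⟩ else 0, fun v => by simp⟩
  have hcol : ∀ s : Store, HasColoring s c ↔ ∀ v < I.n, s.arr 2 v = cN v := fun s =>
    ⟨fun h v hv => (h ⟨v, hv⟩).trans (hcN ⟨v, hv⟩).symm, fun h v => (h v v.2).trans (hcN v)⟩
  have hlt : ∀ v < I.n, cN v < I.k := fun v hv => by rw [hcN ⟨v, hv⟩]; exact (c _).2
  have := eq_inv_of_le (N := I.k ^ I.n) (by positivity)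
    ((haltProb_le hB.two hP hb {s | HasColoring s c}).trans
      ((ic_buildC hB hS hlt (x := 1) (y := 0) fun s' => ?_).trans (le_of_eq (by simp))))
    ((haltProb_le hB.two hP hb {s | HasColoring s c}ᶜ).trans
      ((ic_buildC hB hS hlt (x := 0) (y := 1) fun s' => ?_).trans (le_of_eq (by simp))))
    (one_le_haltProb_add _ _ (((expectedTime_le hB.two hP hb).trans
      ((buildC_spec hB hS hW).ic_zero true)).trans_lt (ENNReal.natCast_lt_top _)) _)
  · simp_all
  · exact Set.indicator_apply_le' (fun h => by rw [if_pos ((hcol s').1 h)]; rfl) fun _ => zero_le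
  · exact Set.indicator_apply_le' (fun h => by rw [if_neg fun e => h ((hcol s').2 e)]; rfl)
      fun _ => zero_le

/-- One bound for the sampler is used four times: for the time, for the preservation of the tables
by a call, with the value `⊤` where they are damaged, and for the event and its complement. -/
theorem Hy.sampling (hr : Rep I H) (hdeg : ∀ v, (I.hi v I.m).length ≤ β)
    (hw : I.base β ^ 241 ≤ 2 ^ w) {col : ℕ → ℕ} {σ ctr ℓ} (hT : Trie I β col σ ctr ℓ)
    (hR : Ready I (I.base β ^ 6) col σ ctr ℓ s) (hb : Bounded (I.base β ^ 6) s)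
    (hne : (I.sets col).Nonempty) :
    expectedTime w sampleC s ≤
        (((I.k + 1) ^ (2 * I.k) * tryTime I.k β + outTime I.k β + 3 : ℕ) : ℝ≥0∞) ∧
      (∀ s' ∈ finalStores w sampleC s, Bounded (I.base β ^ 6) s' ∧
        Ready I (I.base β ^ 6) col σ ctr ℓ s') ∧
      ∀ W ∈ I.sets col, haltProb w sampleC s {s' | Outputs s' (induced H (I.fin W))} =
        ((I.sets col).card : ℝ≥0∞)⁻¹ := by
  classical
  have hB := Hy.big hdeg; have hP := Hy.size_lt hw size_sampleC
  have key := fun τ (f : Store → ℝ≥0∞) b => sampleC_le (τ := τ) (f := f) (b := b)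
    (H := fun W => induced H (I.fin W)) hB hT hR hne (fun _ _ => rfl)
    fun W _ => hr.edgeSet_induced _
  have hE : expectedTime w sampleC s ≤
      (((I.k + 1) ^ (2 * I.k) * tryTime I.k β + outTime I.k β + 3 : ℕ) : ℝ≥0∞) :=
    (expectedTime_le hB.two hP hb).trans ((key 1 0 (fun _ => 0) fun _ _ _ _ _ => le_rfl).trans
      (le_of_eq (by simp)))
  refine ⟨hE, fun s' hs' => ?_, fun W hW => ?_⟩
  · have := finalStores_lt_top hB.two hP hb (f := fun s' => if Ready I (I.base β ^ 6) col σ ctr ℓ s'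
      then 0 else ⊤) (((key 0 _ (fun _ => 0) fun s' h _ _ _ => by simp [h]).trans
      (le_of_eq (by simp))).trans_lt ENNReal.zero_lt_top) hs'
    grind
  · have huniq : ∀ s', ∀ W' ∈ I.sets col, Outputs s' (induced H (I.fin W')) →
        Outputs s' (induced H (I.fin W)) → W' = W := fun s' W' hW' h h' =>
      Hy.fin_injOn (Hy.sets_subset hW') (Hy.sets_subset hW) (h.vertexSet_eq h')
    refine eq_inv_of_le hne.card_pos.ne'
      ((haltProb_le hB.two hP hb _).trans ((key 0 _ (fun W' => if W' = W then 1 else 0)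
        fun s' _ W' hW' h => ?_).trans (le_of_eq ?_)))
      ((haltProb_le hB.two hP hb _).trans ((key 0 _ (fun W' => if W' = W then 0 else 1)
        fun s' _ W' hW' h => ?_).trans (le_of_eq ?_)))
      (one_le_haltProb_add _ _ (hE.trans_lt (ENNReal.natCast_lt_top _)) _)
    · refine Set.indicator_apply_le' (fun h' => ?_) fun _ => zero_le
      rw [if_pos (huniq s' W' hW' h h')]; rfl
    · simp [hW]
    · refine Set.indicator_apply_le' (fun h' => ?_) fun _ => zero_le
      rw [if_neg fun e => h' (by subst e; exact h)]; rfl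
    · simp [sum_ite, Finset.filter_ne', Finset.card_erase_of_mem hW]

theorem Hy.main (hr : Rep I H) (hN : IsNice H I.a β) (hE : I.E = es.map (List.map Fin.val))
    (hw : (2 ^ β * (I.a + I.n + H.edgeSet.ncard + 2) ^ I.k) ^ 241 ≤ 2 ^ w) :
    HaltsWithin w buildC (inputStore I.k I.a I.n es) (2 ^ (241 * I.k) *
      (2 ^ β * I.n + I.a ^ I.k * H.edgeSet.ncard + I.a ^ 2 * β * size H)) ∧
    (∀ c : Fin I.n → Fin I.k, haltProb w buildC (inputStore I.k I.a I.n es)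
      {s | HasColoring s c} = ((I.k : ℝ≥0∞) ^ I.n)⁻¹) ∧
    ∀ c : Fin I.n → Fin I.k, (colorfulSets H I.k c).Nonempty →
      ∀ s₁ ∈ finalStores w buildC (inputStore I.k I.a I.n es), HasColoring s₁ c →
        ∀ s, AfterCalls w sampleC s₁ s →
          expectedTime w sampleC s ≤
            ENNReal.ofReal ((I.k : ℝ) ^ (241 * I.k) * ((β : ℝ) ^ 2 + Real.log I.n)) ∧
          ∀ U ∈ colorfulSets H I.k c, haltProb w sampleC s {s' | Outputs s' (induced H U)} =
            ((colorfulSets H I.k c).ncard : ℝ≥0∞)⁻¹ := by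
  classical
  have hk := I.two_le_k; have hdeg := hr.deg hN; have hB := Hy.big hdeg; rw [hr.ncard] at hw ⊢
  rw [hr.size_eq]; have hw : I.base β ^ 241 ≤ 2 ^ w := hw; obtain ⟨hS, hb⟩ := Hy.input (β := β) hE
  have hP := Hy.size_lt hw size_buildC
  -- The hyperedges are listed without repetition, so at most one of them is empty.
  obtain ⟨W, hW, hT⟩ := Hy.build_time hdeg fun e he e' he' h h' =>
    hr.inj (by simpa using he) (by simpa using he') (by
      rw [← Hy.ncard_set, Set.ncard_eq_zero] at h h'; rw [h, h'])
  have hbuild := buildC_spec hB hS hW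
  refine ⟨haltsWithin_of_le hB.two hP hb ((hbuild.ic_zero false).trans (Nat.cast_le.2 (hT.trans
    (Nat.mul_le_mul (pow_le_pow_right (by omega) (by omega)) le_rfl)))),
    Hy.coloring hdeg hE hw hW,
    fun c hc s₁ hs₁ hsc s hs => ?_⟩
  have hpre := finalStores_lt_top hB.two hP hb (f := fun s' => if Prepared I β s' then 0 else ⊤)
    ((hbuild true 0 _ 0 fun s' h => by simp [h]).trans_lt (by simp)) hs₁
  have hprep : Prepared I β s₁ := by_contra fun h => by simp [h] at hpre
  obtain ⟨σ, ctr, ℓ, hTr, hBu⟩ := hprep; have hsets := hr.colorfulSets_eq hsc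
  have hne : (I.sets (s₁.arr 2)).Nonempty := by simp_all
  -- Induction over the earlier calls; the coloring stays that of the store after the build-up
  -- phase.
  have hinv : Bounded (I.base β ^ 6) s ∧ Ready I (I.base β ^ 6) (s₁.arr 2) σ ctr ℓ s := by
    induction hs with
    | refl => exact ⟨hpre.1, hBu, hpre.1.2 25, rfl, hpre.1.2 2⟩
    | tail _ h ih => exact (Hy.sampling hr hdeg hw hTr ih.2 ih.1 hne).2.1 _ h
  obtain ⟨h1, -, h3⟩ := Hy.sampling hr hdeg hw hTr hinv.2 hinv.1 hne
  have hinj : Set.InjOn I.fin (I.sets (s₁.arr 2) : Set (Finset ℕ)) :=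
    Hy.fin_injOn.mono fun _ => Hy.sets_subset
  -- A colourful set with `k ≥ 2` vertices exists.
  have hn : 2 ≤ I.n := by
    obtain ⟨U, -, hU, -⟩ := hc; have := Set.ncard_le_card U
    rw [Nat.card_eq_fintype_card, Fintype.card_fin] at this; omega
  refine ⟨h1.trans ?_, fun U hU => ?_⟩
  · rw [← ENNReal.ofReal_natCast]; refine ENNReal.ofReal_le_ofReal ((sample_time hk hn).trans ?_)
    have : 0 ≤ Real.log I.n := Real.log_natCast_nonneg _
    refine mul_le_mul_of_nonneg_right (pow_le_pow_right₀ ?_ (by omega)) (by positivity)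
    exact_mod_cast (by omega : 1 ≤ I.k)
  · rw [hsets] at hU ⊢; obtain ⟨W, hW, rfl⟩ := hU; rw [hinj.ncard_image, Set.ncard_coe_finset]
    simp_all

end

end HyperMotivo

/-- There are two fixed programs `build` and `sample` and a constant `C` such that the following
holds for all `k ≥ 2`, `α`, `β`, every `(α, β)`-nice hypergraph `H` on the nonempty vertex set
`{0, …, n - 1}`, every listing `es` of its hyperedges, and every word length `w` for which a word
can hold a fixed power of `2 ^ β * (α + |V| + |E| + 2) ^ k`. -/
theorem mainTheorem1 :
    ∃ (build sample : Cmd) (C : ℕ),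
      ∀ (k α β n : ℕ) (H : Hypergraph (Fin n)) (es : List (List (Fin n))) (w : ℕ),
        2 ≤ k → 0 < n → H.vertexSet = Set.univ → IsNice H α β → Lists es H.edgeSet →
        (2 ^ β * (α + n + H.edgeSet.ncard + 2) ^ k) ^ C ≤ 2 ^ w →
        -- running time of the build-up phase
        HaltsWithin w build (inputStore k α n es)
          (2 ^ (C * k) * (2 ^ β * n + α ^ k * H.edgeSet.ncard + α ^ 2 * β * size H)) ∧
        -- the build-up phase chooses a uniformly random coloring with `k` colors
        (∀ c : Fin n → Fin k,
          haltProb w build (inputStore k α n es) {s | HasColoring s c} = ((k : ℝ≥0∞) ^ n)⁻¹) ∧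
        -- each call of the sampling phase, after the build-up phase and any number of earlier calls
        ∀ c : Fin n → Fin k, (colorfulSets H k c).Nonempty →
          ∀ s₁ ∈ finalStores w build (inputStore k α n es), HasColoring s₁ c →
            ∀ s, AfterCalls w sample s₁ s →
              expectedTime w sample s ≤
                ENNReal.ofReal ((k : ℝ) ^ (C * k) * ((β : ℝ) ^ 2 + Real.log n)) ∧
              ∀ U ∈ colorfulSets H k c,
                haltProb w sample s {s' | Outputs s' (induced H U)} =
                  ((colorfulSets H k c).ncard : ℝ≥0∞)⁻¹ := by
  -- The constant is dictated by the word length; the running times would do with the exponents `7 *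
  -- k` and `13 * k`.
  refine ⟨buildC, sampleC, 241, fun k α β n H es w hk hn hv hN hl hw => ?_⟩
  refine Hy.main (I := ⟨k, α, n, es.map (List.map Fin.val), hk, hn, fun l hl' => ?_,
    fun l hl' v hv => ?_⟩) (Rep.of_lists rfl hl hv) hN rfl hw
  · obtain ⟨l, h, rfl⟩ := List.mem_map.1 hl'
    exact (hl.1 l h).map Fin.val_injective
  · obtain ⟨l, h, rfl⟩ := List.mem_map.1 hl'
    obtain ⟨v, -, rfl⟩ := List.mem_map.1 hv
    exact v.2
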